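/- **Toda vertex algebra.** *The algebra $K$.* Let $K=M^{-1}\mathbb C[\tau]$, where $M$ is the multiplicative set generated by the $\tau-n$, $n\in\mathbb Z$. Put $(T^nF)(\tau)=F(\tau+n)$ and $(SF)(\tau)=F(-\tau)$, let $\operatorname{Tr}F$ be the sum of the residues of $F\,d\tau$ at the integers, put $u_{n,j}=(\tau-n)^{-j-1}$ ($n\in\mathbb Z$, $j\ge 0$), and let $K_{\mathrm{Sing}}=\operatorname{Span}\{u_{n,j}\}$, so that $K=\mathbb C[\tau]\oplus K_{\mathrm{Sing}}$. A $W$-valued distribution is a linear map $\mathcal D\colon K\to W$, thought of as $F\mapsto \operatorname{Tr}(\mathcal D(\tau)F(\tau))$. It has rational singular part $\sum s_{n,j}\,u_{n,j}$ (finite sum, $s_{n,j}\in W$) if $\mathcal D(G)=\sum \operatorname{Tr}(u_{n,j}G)\,s_{n,j}$ for all $G\in\mathbb C[\tau]$; it is holomorphic if it vanishes on $\mathbb C[\tau]$. The value $\mathcal D(u_{n,j})$ is the $j$-th Taylor coefficient at $n$ of its holomorphic part. The antipodal distribution $\mathcal D^S$ is the one with kernel $\mathcal D(-\tau)$, i.e.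 $\mathcal D^S(F)=-\mathcal D(SF)$. *$H_T$-vertex algebras.* Let $H_T=\mathbb C[T,T^{-1}]$. An $H_T$-vertex algebra is a complex vector space $V$ with a vector $1_V$ and a linear map $f\mapsto Y(f,\tau)$ from $V$ to $\operatorname{End}(V)$-valued distributions (write $f_{\{F\}}=Y(f)(F)$ for $F\in K$) such that: 1. every $Y(f,\tau)g$ has rational singular part; 2. $Y(1_V)(F)=\operatorname{Tr}(F)\,\mathrm{id}$, $Y(f,\tau)1_V$ is holomorphic, and $f_{\{1/\tau\}}1_V=f$; 3. $f_{\{T^{-n}F\}}=(T^n_Vf)_{\{F\}}$ for $n\in\mathbb Z$, where $T^n_Vf:=f_{\{1/(\tau-n)\}}1_V$; 4. $Y(f,\tau)g=\mathcal R_V(\tau)\,Y^S(g,\tau)f$, where $\mathcal R_V(\tau)v=Y(v,\tau)1_V$ and the product is the Leibniz product on the holomorphic part plus multiplication of the singular part by $\mathcal R_V(\tau)$; 5. for all $f,g$ there is $F\in M$ with $F(\tau_1-\tau_2)\,[Y(f,\tau_1),Y(g,\tau_2)]=0$ as a distribution on $K\otimes K$. *Toda conformal algebra.* An $H_T$-conformal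 algebra is an $H_T$-module with bilinear products $f_ng$ ($n\in\mathbb Z$), finitely many nonzero for given $f,g$, such that $(T^pf)_n=f_{n+p}$, $f_ng=-T^n(g_{-n}f)$ and $[f_m,g_n]=(f_{m-n}g)_n$. Let $\mathrm{CToda}$ be the free $H_T$-module on $B,C$ with $B_0C=-C$, $B_{-1}C=C$, $C_0B=C$, $C_1B=-TC$, all other products of the generators being zero. Let $\mathcal L\mathrm{Toda}=(\mathrm{CToda}\otimes K)/(T\otimes T-1)(\mathrm{CToda}\otimes K)$, let $f_{\{p\}}$ be the class of $f\otimes p$, and let $[f_{\{p\}},g_{\{q\}}]=\sum_n(f_ng)_{\{(T^np)q\}}$. Let $\mathcal L\mathrm{Toda}_{\mathrm{cr}}$ and $\mathcal L\mathrm{Toda}_{\mathrm{ann}}$ be the Lie subalgebras spanned by the $f_{\{p\}}$ with $p\in K_{\mathrm{Sing}}$, respectively $p\in\mathbb C[\tau]$. Let $\mathrm{VToda}$ be the $\mathcal L\mathrm{Toda}$-module induced from the trivial one-dimensional $\mathcal L\mathrm{Toda}_{\mathrm{ann}}$-module, with generator $v_0$. *Toda vertex Poisson algebra.* This is $P=\mathbb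 C[T^nB,T^nC;\,n\in\mathbb Z]$ with the automorphism $T$ and the products $f_ng$ that extend those of $\mathrm{CToda}$, where each $f_n$ is a derivation. **Theorem.** $\mathcal L\mathrm{Toda}=\mathcal L\mathrm{Toda}_{\mathrm{cr}}\oplus\mathcal L\mathrm{Toda}_{\mathrm{ann}}$, the map $\mathcal U(\mathcal L\mathrm{Toda}_{\mathrm{cr}})\to\mathrm{VToda}$, $u\mapsto uv_0$, is bijective, and $P$ is an $H_T$-vertex Poisson algebra (an $H_T$-conformal algebra and commutative algebra on which $T$ is an algebra automorphism and the $f_n$ are derivations). There is a state-field correspondence $Y$ that makes $\mathrm{VToda}$ an $H_T$-vertex algebra with vacuum $v_0$, in which $Y(f_{\{1/\tau\}}v_0)(F)$ is the action of $f_{\{F\}}$ for all $f\in\mathrm{CToda}$, $F\in K$, and $T^n_V(f_{\{p\}}w)=f_{\{T^{-n}p\}}T^n_Vw$. Moreover: (a) *(Quantization.)* For $k\in\mathbb Z$ let $\mathrm{VToda}_{\le k}$ be the span of the $x_1\cdots x_lv_0$, $l\le k$, $x_i\in\mathcal L\mathrm{Toda}$, and let $P_{\le k}$ be the polynomials of total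 degree $\le k$. The filtration $\mathrm{VToda}_{\le k}$ is increasing and exhaustive, zero for $k<0$, contains $v_0$ for $k=0$, and for $f,g,h$ of filtration degree $\le k,l,m$: $f_{\{F\}}g$ has degree $\le k+l$ for $F\in K$ and $\le k+l-1$ for $F\in\mathbb C[\tau]$; $f_{\{1/\tau\}}g-g_{\{1/\tau\}}f$ has degree $\le k+l-1$; and $f_{\{1/\tau\}}(g_{\{1/\tau\}}h)-(f_{\{1/\tau\}}g)_{\{1/\tau\}}h$ has degree $\le k+l+m-1$. There is a linear map $Q\colon P\to\mathrm{VToda}$ with $Q(1)=v_0$, $Q(T^nB)=B_{\{1/(\tau-n)\}}v_0$, $Q(T^nC)=C_{\{1/(\tau-n)\}}v_0$ and $Q(P_{\le k})\subset\mathrm{VToda}_{\le k}$, injective on associated graded spaces ($f\in P_{\le k}$ and $Q(f)\in\mathrm{VToda}_{\le k-1}$ imply $f\in P_{\le k-1}$), such that for $f\in P_{\le k}$, $g\in P_{\le l}$, $n\in\mathbb Z$ and $G\in\mathbb C[\tau]$ $$Q(fg)-Q(f)_{\{1/\tau\}}Q(g)\in\mathrm{VToda}_{\le k+l-1},\qquad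 Q(T^nf)-T^n_VQ(f)\in\mathrm{VToda}_{\le k-1},$$ $$Q(f)_{\{G\}}Q(g)-Q\Big(\sum_{n}G(n)\,f_ng\Big)\in\mathrm{VToda}_{\le k+l-2}.$$ (b) *(Noncommutativity.)* There are $f,g\in\mathrm{VToda}$ with $f_{\{1\}}g\ne g_{\{1\}}f$, and there are $f,g\in\mathrm{VToda}$ with $f_{\{1/\tau\}}g\ne g_{\{1/\tau\}}f$. -/

import Mathlib

open scoped TensorProduct

noncomputable section

namespace HTVertex

open Polynomial in
/-- The multiplicative set generated by the translates `τ - n`, `n ∈ ℤ`, of the coordinate `τ`. -/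
def poleSet : Submonoid ℂ[X] :=
  Submonoid.closure (Set.range fun n : ℤ => (X - C (n : ℂ) : ℂ[X]))

/-- The algebra `K` of rational functions in `τ` all of whose poles are integers. -/
def K : Type := Localization poleSet

instance : CommRing K := inferInstanceAs (CommRing (Localization poleSet))
instance : Algebra ℂ K := inferInstanceAs (Algebra ℂ (Localization poleSet))
instance : Algebra (Polynomial ℂ) K := inferInstanceAs (Algebra (Polynomial ℂ) (Localization poleSet))
instance : IsScalarTower ℂ (Polynomial ℂ) K :=
  inferInstanceAs (IsScalarTower ℂ (Polynomial ℂ) (Localization poleSet))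
instance : IsLocalization poleSet K :=
  inferInstanceAs (IsLocalization poleSet (Localization poleSet))

/-- The inclusion of the polynomials `ℂ[τ]` in `K`. -/
def pol : Polynomial ℂ →ₐ[ℂ] K := Algebra.ofId (Polynomial ℂ) K |>.restrictScalars ℂ

namespace K

/-- A homomorphism out of `K` is given by the image `a` of `τ`, provided all `a - n` are units. -/
def lift {A : Type*} [CommRing A] [Algebra ℂ A] (a : A)
    (h : ∀ n : ℤ, IsUnit (a - (n : A))) : K →ₐ[ℂ] A :=
  IsLocalization.liftAlgHom (M := poleSet) (f := Polynomial.aeval a) (by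
    rintro ⟨y, hy⟩
    change IsUnit (Polynomial.aeval a y)
    refine Submonoid.closure_induction (motive := fun y _ => IsUnit (Polynomial.aeval a y))
      ?_ ?_ ?_ hy
    · rintro _ ⟨n, rfl⟩
      simpa using h n
    · simp
    · intro x y _ _ hx hy
      simpa using hx.mul hy)

theorem lift_pol {A : Type*} [CommRing A] [Algebra ℂ A] (a : A)
    (h : ∀ n : ℤ, IsUnit (a - (n : A))) (p : Polynomial ℂ) :
    lift a h (pol p) = Polynomial.aeval a p :=
  IsLocalization.lift_eq _ p

theorem algHom_ext {A : Type*} [CommRing A] [Algebra ℂ A] {f g : K →ₐ[ℂ] A}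
    (h : f (pol Polynomial.X) = g (pol Polynomial.X)) : f = g := by
  have h1 : f.comp pol = g.comp pol := Polynomial.algHom_ext h
  have h2 : (f : K →+* A) = (g : K →+* A) :=
    IsLocalization.ringHom_ext poleSet (RingHom.ext fun p => DFunLike.congr_fun h1 p)
  exact AlgHom.ext fun x => DFunLike.congr_fun h2 x

/-- `τ - n` is invertible in `K`. -/
theorem isUnit_sub (n : ℤ) : IsUnit (pol Polynomial.X - (n : K)) := by
  have := IsLocalization.map_units K
    (⟨Polynomial.X - Polynomial.C (n : ℂ), Submonoid.subset_closure ⟨n, rfl⟩⟩ : poleSet)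
  have h2 : pol (Polynomial.X - Polynomial.C (n : ℂ)) =
      pol Polynomial.X - (n : K) := by
    rw [map_sub, map_intCast, map_intCast]
  rw [← h2]
  exact this

/-- The action of `T ^ n` on `K`: `(T ^ n F)(τ) = F (τ + n)`. -/
def shift (n : ℤ) : K →ₐ[ℂ] K :=
  lift (pol Polynomial.X + (n : K)) fun m => by
    have := isUnit_sub (m - n)
    push_cast at this
    rwa [← sub_add, sub_add_eq_add_sub] at this

/-- The antipode of `K`: `(S F)(τ) = F (-τ)`. -/
def antipode : K →ₐ[ℂ] K :=
  lift (-pol Polynomial.X) fun m => by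
    have := (isUnit_sub (-m)).neg
    push_cast at this
    rwa [sub_neg_eq_add, neg_add, ← sub_eq_add_neg] at this

/-- The Laurent expansion of `F ∈ K` at `τ = n`, in the local coordinate `t = τ - n`. -/
def expand (n : ℤ) : K →ₐ[ℂ] LaurentSeries ℂ :=
  lift (HahnSeries.single 1 1 + (n : LaurentSeries ℂ)) fun m => by
    refine isUnit_iff_ne_zero.mpr fun h => ?_
    have := congrArg (fun s : LaurentSeries ℂ => s.coeff 1) h
    have e (k : ℤ) : (k : LaurentSeries ℂ).coeff 1 = 0 := by
      rw [← map_intCast (HahnSeries.C : ℂ →+* LaurentSeries ℂ) k, HahnSeries.C_apply,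
        HahnSeries.coeff_single_of_ne one_ne_zero]
    simp [e] at this

/-- The trace: the sum of the residues of `F(τ) dτ` at the integers. -/
def tr (F : K) : ℂ := ∑ᶠ n : ℤ, (expand n F).coeff (-1)

/-- The element `1 / (τ - n) ^ (j + 1)`, i.e. `S(Tⁿ ∂^j / j!)` applied to `1 / τ`. -/
def u (n : ℤ) (j : ℕ) : K := ((isUnit_sub n).unit⁻¹ : Kˣ) ^ (j + 1)

/-- `K_Sing`, the span of the elements `1 / (τ - n) ^ (j + 1)`. -/
def sing : Submodule ℂ K := Submodule.span ℂ (Set.range fun p : ℤ × ℕ => u p.1 p.2)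

/-- The coefficient of `1 / (τ - n) ^ (j + 1)` in the partial fraction expansion of `F`. -/
def polarCoeff (n : ℤ) (j : ℕ) (F : K) : ℂ := (expand n F).coeff (-(j : ℤ) - 1)

theorem shift_X (n : ℤ) : shift n (pol Polynomial.X) = pol Polynomial.X + (n : K) := by
  simp [shift, lift_pol]

theorem shift_shift (m n : ℤ) (F : K) : shift m (shift n F) = shift (m + n) F := by
  have : (shift m).comp (shift n) = shift (m + n) := by
    apply algHom_ext
    simp only [AlgHom.comp_apply, shift_X, map_add, map_intCast, Int.cast_add]
    ring
  exact DFunLike.congr_fun this F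

theorem shift_zero (F : K) : shift 0 F = F := by
  have : shift 0 = AlgHom.id ℂ K := by
    apply algHom_ext
    simp [shift_X]
  exact DFunLike.congr_fun this F

theorem u_spec (n : ℤ) (j : ℕ) :
    u n j * (pol Polynomial.X - (n : K)) ^ (j + 1) = 1 := by
  rw [u, ← mul_pow, IsUnit.val_inv_mul, one_pow]

theorem u_mul_same (n : ℤ) (j k : ℕ) : u n j * u n k = u n (j + k + 1) := by
  simp only [u]; rw [← pow_add]; congr 1; omega

theorem shift_u (m n : ℤ) (j : ℕ) : shift m (u n j) = u (n - m) j := by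
  have h := congrArg (shift m) (u_spec n j)
  simp only [map_mul, map_pow, map_sub, shift_X, map_intCast, map_one] at h
  have h2 := u_spec (n - m) j
  have e : pol Polynomial.X + (m : K) - (n : K) =
      pol Polynomial.X - ((n - m : ℤ) : K) := by
    push_cast; ring
  rw [e] at h
  exact left_inv_eq_right_inv h (by rw [mul_comm]; exact h2)

theorem u_mem (n : ℤ) (j : ℕ) : u n j ∈ sing := Submodule.subset_span ⟨(n, j), rfl⟩

theorem u_mul_u_mem {m n : ℤ} (hmn : m ≠ n) : ∀ N j k : ℕ, j + k = N → u n j * u m k ∈ sing := by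
  set x := pol Polynomial.X with hx
  have hd : ((n - m : ℤ) : ℂ) ≠ 0 := by
    rw [Int.cast_ne_zero]; omega
  have a1 (n : ℤ) : u n 0 * (x - (n : K)) = 1 := by simpa using u_spec n 0
  have key : u n 0 * u m 0 = (((n - m : ℤ) : ℂ))⁻¹ • (u n 0 - u m 0) := by
    rw [eq_inv_smul_iff₀ hd, Algebra.smul_def]
    rw [map_intCast]
    push_cast
    linear_combination u n 0 * a1 m - u m 0 * a1 n
  have us (n : ℤ) (j : ℕ) : u n (j + 1) = u n j * u n 0 := by rw [u_mul_same]
  intro N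
  induction N with
  | zero =>
    intro j k h
    obtain ⟨rfl, rfl⟩ : j = 0 ∧ k = 0 := by omega
    rw [key]
    exact sing.smul_mem _ (sing.sub_mem (u_mem _ _) (u_mem _ _))
  | succ N ih =>
    have h0 : ∀ j k : ℕ, u n j * u m k =
        (((n - m : ℤ) : ℂ))⁻¹ • (u n j * (u m k * (x - (m : K)))
          - (u n j * (x - (n : K))) * u m k) := by
      intro j k
      rw [eq_inv_smul_iff₀ hd, Algebra.smul_def]
      rw [map_intCast]
      push_cast
      ring
    have r1 (n : ℤ) (j : ℕ) : u n (j + 1) * (x - (n : K)) = u n j := by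
      rw [us, mul_assoc, a1, mul_one]
    intro j k h
    rw [h0]
    refine sing.smul_mem _ (sing.sub_mem ?_ ?_)
    · cases k with
      | zero => rw [a1, mul_one]; exact u_mem _ _
      | succ k => rw [r1]; exact ih j k (by omega)
    · cases j with
      | zero => rw [a1, one_mul]; exact u_mem _ _
      | succ j => rw [r1]; exact ih j k (by omega)

theorem sing_mul_mem {F G : K} (hF : F ∈ sing) (hG : G ∈ sing) : F * G ∈ sing := by
  induction hF using Submodule.span_induction with
  | zero => rw [zero_mul]; exact sing.zero_mem
  | add x y _ _ hx hy => rw [add_mul]; exact sing.add_mem hx hy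
  | smul c x _ hx => rw [smul_mul_assoc]; exact sing.smul_mem _ hx
  | mem x hx =>
    obtain ⟨⟨n, j⟩, rfl⟩ := hx
    induction hG using Submodule.span_induction with
    | zero => rw [mul_zero]; exact sing.zero_mem
    | add x y _ _ hx hy => rw [mul_add]; exact sing.add_mem hx hy
    | smul c x _ hx => rw [mul_smul_comm]; exact sing.smul_mem _ hx
    | mem x hx =>
      obtain ⟨⟨m, k⟩, rfl⟩ := hx
      rcases eq_or_ne m n with rfl | h
      · dsimp only; rw [u_mul_same]; exact u_mem _ _
      · exact u_mul_u_mem h _ j k rfl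

theorem shift_mem_sing (n : ℤ) {F : K} (hF : F ∈ sing) : shift n F ∈ sing := by
  induction hF using Submodule.span_induction with
  | zero => simp
  | add x y _ _ hx hy => rw [map_add]; exact sing.add_mem hx hy
  | smul c x _ hx => rw [map_smul]; exact sing.smul_mem _ hx
  | mem x hx => obtain ⟨⟨m, k⟩, rfl⟩ := hx; dsimp only; rw [shift_u]; exact u_mem _ _

theorem shift_pol (n : ℤ) (p : Polynomial ℂ) : shift n (pol p) ∈ pol.range := by
  refine ⟨Polynomial.aeval (Polynomial.X + Polynomial.C (n : ℂ)) p, ?_⟩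
  rw [shift, lift_pol]
  have : pol.comp (Polynomial.aeval (Polynomial.X + Polynomial.C (n : ℂ))) =
      Polynomial.aeval (pol Polynomial.X + (n : K)) := by
    apply Polynomial.algHom_ext
    simp
  exact DFunLike.congr_fun this p

end K

/-- The axioms of an `H_T`-conformal algebra. The action of `H_T = ℂ[T, T⁻¹]` on `C` is given by
the automorphism `T`, and `D f g n` is the product `f_n g`; as `D f g` is finitely supported,
the finiteness axiom is part of the type of `D`. -/
structure IsHTConformal {C : Type*} [AddCommGroup C] [Module ℂ C]
    (T : C ≃ₗ[ℂ] C) (D : C →ₗ[ℂ] C →ₗ[ℂ] (ℤ →₀ C)) : Prop where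
  covariance : ∀ (f g : C) (n p : ℤ), D ((T ^ p) f) g n = D f g (n + p)
  skew : ∀ (f g : C) (n : ℤ), D f g n = -(T ^ n) (D g f (-n))
  commutator : ∀ (f g h : C) (m n : ℤ),
    D f (D g h n) m - D g (D f h m) n = D (D f g (m - n)) h n

/-- An `H_T`-conformal algebra. -/
class HTConformalAlgebra (C : Type*) [AddCommGroup C] [Module ℂ C] where
  /-- The automorphism `T`. -/
  T : C ≃ₗ[ℂ] C
  /-- The products, `prod f g n = f_n g`. -/
  prod : C →ₗ[ℂ] C →ₗ[ℂ] (ℤ →₀ C)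
  isHTConformal : IsHTConformal T prod

/-! ### The Toda conformal algebra -/

/-- The two generators of the Toda conformal algebra. -/
inductive TodaGen : Type
  | B : TodaGen
  | C : TodaGen
  deriving DecidableEq

/-- The free `H_T`-module on `B` and `C`, with basis `T ^ m X`, `X ∈ {B, C}`, `m ∈ ℤ`. -/
def CToda : Type := (TodaGen × ℤ) →₀ ℂ

instance : AddCommGroup CToda := inferInstanceAs (AddCommGroup ((TodaGen × ℤ) →₀ ℂ))
instance : Module ℂ CToda := inferInstanceAs (Module ℂ ((TodaGen × ℤ) →₀ ℂ))

namespace CToda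

/-- The basis of the elements `T ^ m X`. -/
def basis : Module.Basis (TodaGen × ℤ) ℂ CToda := ⟨LinearEquiv.refl ℂ ((TodaGen × ℤ) →₀ ℂ)⟩

/-- The basis element `T ^ m X`. -/
def e (x : TodaGen × ℤ) : CToda := basis x

/-- The automorphism `T`, which maps `T ^ m X` to `T ^ (m + 1) X`. -/
def T : CToda ≃ₗ[ℂ] CToda :=
  basis.equiv basis ((Equiv.refl TodaGen).prodCongr (Equiv.addRight (1 : ℤ)))

/-- The products on the generators: `genProd X Y n = X_n Y`. -/
def genProd : TodaGen → TodaGen → (ℤ →₀ CToda)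
  | .B, .B => 0
  | .B, .C => Finsupp.single 0 (-e (.C, 0)) + Finsupp.single (-1) (e (.C, 0))
  | .C, .B => Finsupp.single 0 (e (.C, 0)) + Finsupp.single 1 (-e (.C, 1))
  | .C, .C => 0

/-- The products on the basis elements, `(T ^ m X)_n (T ^ k Y) = T ^ k (X_(n + m - k) Y)`. -/
def basisProd (x y : TodaGen × ℤ) : ℤ →₀ CToda :=
  ((genProd x.1 y.1).mapRange (T ^ y.2) (map_zero _)).mapDomain (fun n => n + y.2 - x.2)

/-- The products of the Toda conformal algebra, `prod f g n = f_n g`. -/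
def prod : CToda →ₗ[ℂ] CToda →ₗ[ℂ] (ℤ →₀ CToda) :=
  basis.constr ℂ fun x => basis.constr ℂ fun y => basisProd x y

theorem T_e (p : TodaGen) (m : ℤ) : T (e (p, m)) = e (p, m + 1) := by
  simp [T, e]

theorem T_pow_e (n : ℤ) (p : TodaGen) (m : ℤ) : (T ^ n) (e (p, m)) = e (p, m + n) := by
  have h : ∀ m, T⁻¹ (e (p, m)) = e (p, m - 1) := fun m => by
    rw [← sub_add_cancel m 1, ← T_e, sub_add_cancel]
    exact T.symm_apply_apply _
  induction n generalizing m with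
  | zero => simp
  | succ n ih =>
    rw [zpow_add_one, LinearEquiv.mul_apply, T_e, ih]; congr 2; ring
  | pred n ih =>
    rw [zpow_sub_one, LinearEquiv.mul_apply, h, ih]; congr 2; ring

theorem prod_e (x y : TodaGen × ℤ) : prod (e x) (e y) = basisProd x y := by
  simp [prod, e]

theorem hom_ext {M : Type*} [AddCommMonoid M] [Module ℂ M] {f g : CToda →ₗ[ℂ] M}
    (h : ∀ x, f (e x) = g (e x)) : f = g := by
  exact basis.ext h

theorem basisProd_apply (x y : TodaGen × ℤ) (n : ℤ) :
    basisProd x y n = (T ^ y.2) (genProd x.1 y.1 (n + x.2 - y.2)) := by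
  have h : Function.Injective fun n : ℤ => n + y.2 - x.2 := fun a b h => by
    simpa using h
  have := Finsupp.mapDomain_apply h ((genProd x.1 y.1).mapRange (T ^ y.2) (map_zero _))
    (n + x.2 - y.2)
  simp only [sub_add_cancel, add_sub_cancel_right] at this
  rw [basisProd, this, Finsupp.mapRange_apply]

theorem prod_BB (m k n : ℤ) : prod (e (.B, m)) (e (.B, k)) n = 0 := by
  rw [prod_e, basisProd_apply]; simp [genProd]

theorem prod_CC (m k n : ℤ) : prod (e (.C, m)) (e (.C, k)) n = 0 := by
  rw [prod_e, basisProd_apply]; simp [genProd]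

theorem prod_BC (m k n : ℤ) : prod (e (.B, m)) (e (.C, k)) n =
    (if n + m = k - 1 then (1 : ℂ) else 0) • e (.C, k) -
      (if n + m = k then (1 : ℂ) else 0) • e (.C, k) := by
  rw [prod_e, basisProd_apply]
  have h1 : (0 = n + m - k) ↔ n + m = k := by omega
  have h2 : (-1 = n + m - k) ↔ n + m = k - 1 := by omega
  simp only [genProd, Finsupp.add_apply, Finsupp.single_apply, h1, h2]
  split_ifs <;> simp [T_pow_e]

theorem prod_CB (m k n : ℤ) : prod (e (.C, m)) (e (.B, k)) n =
    (if n + m = k then (1 : ℂ) else 0) • e (.C, k) -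
      (if n + m = k + 1 then (1 : ℂ) else 0) • e (.C, k + 1) := by
  rw [prod_e, basisProd_apply]
  have h1 : (0 = n + m - k) ↔ n + m = k := by omega
  have h2 : (1 = n + m - k) ↔ n + m = k + 1 := by omega
  simp only [genProd, Finsupp.add_apply, Finsupp.single_apply, h1, h2]
  split_ifs <;> simp [T_pow_e, add_comm, sub_eq_add_neg]

theorem smul_e {P : Prop} [Decidable P] {m k : ℤ} (h : P → m = k) :
    (if P then (1 : ℂ) else 0) • e (.C, m) = (if P then (1 : ℂ) else 0) • e (.C, k) := by
  split_ifs with hP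
  · rw [h hP]
  · rw [zero_smul, zero_smul]

/-- The products, with fixed index, as bilinear maps. -/
def prodAt (n : ℤ) : CToda →ₗ[ℂ] CToda →ₗ[ℂ] CToda :=
  prod.compr₂ (Finsupp.lapply n)

theorem prodAt_apply (n : ℤ) (f g : CToda) : prodAt n f g = prod f g n := rfl

theorem isHTConformal : IsHTConformal T prod where
  covariance f g n p := by
    have : (prodAt n).comp (T ^ p).toLinearMap = prodAt (n + p) := by
      refine hom_ext fun x => hom_ext fun y => ?_
      change prod ((T ^ p) (e x)) (e y) n = prod (e x) (e y) (n + p)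
      obtain ⟨x, m⟩ := x
      rw [T_pow_e, prod_e, prod_e, basisProd_apply, basisProd_apply]
      congr 3
      simp only; ring
    exact LinearMap.congr_fun₂ this f g
  skew f g n := by
    have : prodAt n = -(((prodAt (-n)).flip).compr₂ (T ^ n).toLinearMap) := by
      refine hom_ext fun x => hom_ext fun y => ?_
      change prod (e x) (e y) n = -(T ^ n) (prod (e y) (e x) (-n))
      obtain ⟨x | x, m⟩ := x <;> obtain ⟨y | y, k⟩ := y <;>
        simp only [prod_BB, prod_CC, prod_BC, prod_CB, map_zero, neg_zero, map_sub, map_smul,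
          T_pow_e, neg_sub]
      · have h1 : (-n + k = m) ↔ n + m = k := by omega
        have h2 : (-n + k = m + 1) ↔ n + m = k - 1 := by omega
        simp only [h1, h2]
        rw [smul_e (by omega : n + m = k → m + n = k),
          smul_e (by omega : n + m = k - 1 → m + 1 + n = k)]
      · have h1 : (-n + k = m) ↔ n + m = k := by omega
        have h2 : (-n + k = m - 1) ↔ n + m = k + 1 := by omega
        simp only [h1, h2]
        rw [smul_e (by omega : n + m = k → m + n = k),
          smul_e (by omega : n + m = k + 1 → m + n = k + 1)]
    exact LinearMap.congr_fun₂ this f g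
  commutator f g h m n := by
    have : (LinearMap.llcomp ℂ CToda CToda CToda).compl₁₂ (prodAt m) (prodAt n) -
        ((LinearMap.llcomp ℂ CToda CToda CToda).compl₁₂ (prodAt n) (prodAt m)).flip =
        (prodAt (m - n)).compr₂ (prodAt n) := by
      refine hom_ext fun x => hom_ext fun y => hom_ext fun z => ?_
      change prod (e x) (prod (e y) (e z) n) m - prod (e y) (prod (e x) (e z) m) n =
        prod (prod (e x) (e y) (m - n)) (e z) n
      obtain ⟨x | x, a⟩ := x <;> obtain ⟨y | y, b⟩ := y <;> obtain ⟨z | z, c⟩ := z <;>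
        simp only [prod_BB, prod_CC, prod_BC, prod_CB, map_zero, map_sub, map_smul,
          Finsupp.sub_apply, Finsupp.smul_apply, Finsupp.zero_apply, LinearMap.sub_apply,
          LinearMap.smul_apply, LinearMap.zero_apply, smul_zero, sub_zero, zero_sub,
          sub_self]
      · module
      · have h1 : (m - n + a = b - 1) ↔ m + a = n + b - 1 := by omega
        have h2 : (m - n + a = b) ↔ m + a = n + b := by omega
        simp only [h1, h2, add_sub_cancel_right]
        generalize n + b = d
        rcases eq_or_ne d c with rfl | h3
        · simp only [if_true, left_eq_add, one_ne_zero, if_false, zero_smul, sub_zero]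
          module
        · rcases eq_or_ne d (c + 1) with rfl | h4
          · simp only [if_true, add_eq_left, one_ne_zero, if_false, zero_smul, zero_sub,
              add_sub_cancel_right]
            module
          · simp only [if_neg h3, if_neg h4, zero_smul, smul_zero, sub_zero]
      · have h1 : (m - n + a = b) ↔ n + b = m + a := by omega
        have h2 : (m - n + a = b + 1) ↔ n + b = m + a - 1 := by omega
        have h3 : (n + (b + 1) = c) ↔ n + b = c - 1 := by omega
        have h4 : (n + (b + 1) = c + 1) ↔ n + b = c := by omega
        simp only [h1, h2, h3, h4, add_sub_cancel_right]
        generalize n + b = d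
        generalize m + a = r
        generalize e (.C, c + 1) = y
        generalize e (.C, c) = x
        split_ifs <;> first | omega | module
    have := LinearMap.congr_fun₂ this f g
    exact LinearMap.congr_fun this h

instance : HTConformalAlgebra CToda := ⟨T, prod, isHTConformal⟩

end CToda

/-! ### The Lie algebra of a conformal algebra -/

section LieOf

open HTConformalAlgebra

variable (C : Type*) [AddCommGroup C] [Module ℂ C] [HTConformalAlgebra C]

/-- The total differences in the affinization `C ⊗ K`. -/
def totalDiff : Submodule ℂ (C ⊗[ℂ] K) :=
  LinearMap.range (TensorProduct.map (T (C := C)).toLinearMap (K.shift 1).toLinearMap -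
    LinearMap.id)

/-- The space `𝓛C = (C ⊗ K) / (T - 1)(C ⊗ K)`. -/
def LieOf : Type _ := (C ⊗[ℂ] K) ⧸ totalDiff C

instance : AddCommGroup (LieOf C) := inferInstanceAs (AddCommGroup ((C ⊗[ℂ] K) ⧸ totalDiff C))
instance : Module ℂ (LieOf C) := inferInstanceAs (Module ℂ ((C ⊗[ℂ] K) ⧸ totalDiff C))

/-- The quotient map `C ⊗ K → 𝓛C`. -/
def trace : C ⊗[ℂ] K →ₗ[ℂ] LieOf C := (totalDiff C).mkQ

variable {C}

/-- `mode f p` is the class `f_{p}` of `f ⊗ p`. -/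
def mode : C →ₗ[ℂ] K →ₗ[ℂ] LieOf C := (TensorProduct.mk ℂ C K).compr₂ (trace C)

theorem mode_T (f : C) (p : K) : mode (T f) (K.shift 1 p) = mode f p :=
  (Submodule.Quotient.eq _).mpr ⟨f ⊗ₜ p, rfl⟩

theorem mode_T_pow (n : ℤ) (f : C) (p : K) : mode ((T ^ n : C ≃ₗ[ℂ] C) f) (K.shift n p) = mode f p := by
  induction n generalizing f p with
  | zero => simp [K.shift_zero]
  | succ n ih =>
    rw [zpow_add_one, LinearEquiv.mul_apply, ← K.shift_shift, ih, mode_T]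
  | pred n ih =>
    rw [← mode_T, ← LinearEquiv.mul_apply, K.shift_shift, ← zpow_one_add]
    simpa using ih f p

theorem lieOf_ext {M : Type*} [AddCommGroup M] [Module ℂ M] {a b : LieOf C →ₗ[ℂ] M}
    (h : ∀ f p, a (mode f p) = b (mode f p)) : a = b :=
  Submodule.linearMap_qext _ (TensorProduct.ext' h)

/-- `(x, p ⊗ q) ↦ ∑ₙ (x n)_{(Tⁿ p) q}` for `x` a finitely supported family in `C`. -/
def modeSum : (ℤ →₀ C) →ₗ[ℂ] (K ⊗[ℂ] K) →ₗ[ℂ] LieOf C :=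
  Finsupp.lsum ℂ fun n => mode.compl₂
    ((LinearMap.mul' ℂ K).comp (TensorProduct.map (K.shift n).toLinearMap LinearMap.id))

/-- The bilinear map `(f ⊗ p, g ⊗ q) ↦ ∑ₙ (f_n g)_{(Tⁿ p) q}`. -/
def preBracket : C ⊗[ℂ] K →ₗ[ℂ] C ⊗[ℂ] K →ₗ[ℂ] LieOf C :=
  (TensorProduct.map₂ (prod (C := C)) (TensorProduct.mk ℂ K K)).compr₂
    (TensorProduct.lift modeSum)

theorem preBracket_tmul (f g : C) (p q : K) : preBracket (f ⊗ₜ p) (g ⊗ₜ q) =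
    (prod f g).sum fun n x => mode x (K.shift n p * q) := by
  simp [preBracket, modeSum, Finsupp.sum, LinearMap.sum_apply, TensorProduct.map₂_apply_tmul]

theorem finsum_mode (x : ℤ →₀ C) (p q : K) : (x.sum fun n x => mode x (K.shift n p * q)) =
    ∑ᶠ n, mode (x n) (K.shift n p * q) := by
  rw [finsum_eq_sum_of_support_subset (s := x.support)]
  · rfl
  · intro n hn
    simp only [Function.mem_support] at hn
    simp only [Finset.mem_coe, Finsupp.mem_support_iff]
    intro h
    simp [h] at hn

theorem preBracket_T (x y : C ⊗[ℂ] K) :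
    preBracket (TensorProduct.map (T (C := C)).toLinearMap (K.shift 1).toLinearMap x) y =
      preBracket x y := by
  have : preBracket.comp (TensorProduct.map (T (C := C)).toLinearMap (K.shift 1).toLinearMap) =
      preBracket := by
    refine TensorProduct.ext' fun f p => TensorProduct.ext' fun g q => ?_
    rw [LinearMap.comp_apply, TensorProduct.map_tmul, preBracket_tmul, preBracket_tmul,
      finsum_mode, finsum_mode]
    conv_rhs => rw [← finsum_comp_equiv (Equiv.addRight (1 : ℤ))]
    refine finsum_congr fun n => ?_
    have := (isHTConformal (C := C)).covariance f g n 1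
    rw [zpow_one] at this
    change mode (prod (T f) g n) (K.shift n (K.shift 1 p) * q) = _
    rw [this, K.shift_shift]
    rfl
  exact LinearMap.congr_fun₂ this x y

theorem preBracket_skew (x y : C ⊗[ℂ] K) : preBracket x y = -preBracket y x := by
  have : preBracket = -(preBracket (C := C)).flip := by
    refine TensorProduct.ext' fun f p => TensorProduct.ext' fun g q => ?_
    rw [LinearMap.neg_apply, LinearMap.neg_apply, LinearMap.flip_apply, preBracket_tmul,
      preBracket_tmul, finsum_mode, finsum_mode, ← finsum_comp_equiv (Equiv.neg ℤ),
      ← finsum_neg_distrib]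
    refine finsum_congr fun n => ?_
    rw [Equiv.neg_apply, (isHTConformal (C := C)).skew f g (-n), neg_neg, map_neg,
      LinearMap.neg_apply, ← mode_T_pow n, ← LinearEquiv.mul_apply, ← zpow_add, add_neg_cancel,
      zpow_zero, LinearEquiv.coe_one, id_eq, map_mul, K.shift_shift, add_neg_cancel, K.shift_zero,
      mul_comm]
  exact LinearMap.congr_fun₂ this x y

/-- The Lie bracket of `𝓛C` as a bilinear map. -/
def bracket : LieOf C →ₗ[ℂ] LieOf C →ₗ[ℂ] LieOf C :=
  (totalDiff C).liftQ
    ((totalDiff C).liftQ preBracket.flip (by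
      rintro _ ⟨x, rfl⟩
      refine LinearMap.ext fun y => ?_
      rw [LinearMap.flip_apply, preBracket_skew, LinearMap.sub_apply, LinearMap.id_apply, map_sub,
        LinearMap.sub_apply, preBracket_T, sub_self, neg_zero, LinearMap.zero_apply])).flip (by
    rintro _ ⟨x, rfl⟩
    refine Submodule.linearMap_qext _ (LinearMap.ext fun y => ?_)
    change preBracket (TensorProduct.map (T (C := C)).toLinearMap (K.shift 1).toLinearMap x - x) y
      = 0
    rw [map_sub, LinearMap.sub_apply, preBracket_T, sub_self])

theorem bracket_mode (f g : C) (p q : K) : bracket (mode f p) (mode g q) =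
    ∑ᶠ n : ℤ, mode (prod f g n) (K.shift n p * q) := by
  rw [← finsum_mode, ← preBracket_tmul]
  rfl

end LieOf

section LieOf

open HTConformalAlgebra

variable {C : Type*} [AddCommGroup C] [Module ℂ C] [HTConformalAlgebra C]

theorem finite_double (x : ℤ →₀ C) (Φ : ℤ → C →ₗ[ℂ] (ℤ →₀ C)) (G : ℤ × ℤ → K) :
    Function.HasFiniteSupport fun k : ℤ × ℤ => mode (Φ k.1 (x k.1) k.2) (G k) := by
  refine Set.Finite.subset (s := ((x.support ×ˢ x.support.biUnion
    fun n => (Φ n (x n)).support : Finset (ℤ × ℤ)) : Set (ℤ × ℤ))) (Finset.finite_toSet _) ?_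
  rintro ⟨n, m⟩ hk
  have h2 : Φ n (x n) m ≠ 0 := fun h => hk (by simp [h])
  have h1 : x n ≠ 0 := fun h => h2 (by simp [h])
  simp only [Finset.coe_product, Set.mem_prod, Finset.mem_coe, Finset.mem_biUnion,
    Finsupp.mem_support_iff]
  exact ⟨h1, n, h1, h2⟩

theorem bracket_bracket (f g h : C) (p q r : K) :
    bracket (mode f p) (bracket (mode g q) (mode h r)) = ∑ᶠ k : ℤ × ℤ,
      mode (prod f (prod g h k.1) k.2) (K.shift k.2 p * (K.shift k.1 q * r)) := by
  rw [finsum_curry _ (finite_double (prod g h) (fun _ => prod f) _), bracket_mode, ← finsum_mode,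
    map_finsuppSum, Finsupp.sum, ← finsum_eq_sum_of_support_subset]
  · exact finsum_congr fun n => bracket_mode _ _ _ _
  · intro n hn
    simp only [Function.mem_support] at hn
    simp only [Finset.mem_coe, Finsupp.mem_support_iff]
    intro h
    simp [h] at hn

theorem bracket_bracket' (f g h : C) (p q r : K) :
    bracket (bracket (mode f p) (mode g q)) (mode h r) = ∑ᶠ k : ℤ × ℤ,
      mode (prod (prod f g (k.2 - k.1)) h k.1) (K.shift k.2 p * (K.shift k.1 q * r)) := by
  have e : Function.Bijective fun k : ℤ × ℤ => (k.2, k.1 + k.2) := by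
    refine ⟨fun a b hab => ?_, fun a => ⟨(a.2 - a.1, a.1), by simp⟩⟩
    simp only [Prod.mk.injEq] at hab
    exact Prod.ext (by omega) hab.1
  rw [← finsum_comp_equiv (Equiv.ofBijective _ e),
    finsum_curry _ ?_, bracket_mode, ← finsum_mode,
    map_finsuppSum, Finsupp.sum, LinearMap.sum_apply, ← finsum_eq_sum_of_support_subset]
  · refine finsum_congr fun n => ?_
    rw [bracket_mode]
    refine finsum_congr fun m => ?_
    simp only [Equiv.ofBijective_apply, add_sub_cancel_right, map_mul, K.shift_shift]
    rw [add_comm m n, mul_assoc]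
  · intro n hn
    simp only [Function.mem_support] at hn
    simp only [Finset.mem_coe, Finsupp.mem_support_iff]
    intro h
    simp [h] at hn
  · simp only [Equiv.ofBijective_apply, add_sub_cancel_right]
    exact finite_double (prod f g) (fun _ => (prod (C := C)).flip h) _

theorem bracket_skew (x y : LieOf C) : bracket x y = -bracket y x := by
  have : bracket = -(bracket (C := C)).flip := by
    refine lieOf_ext fun f p => lieOf_ext fun g q => ?_
    exact preBracket_skew (f ⊗ₜ p) (g ⊗ₜ q)
  exact LinearMap.congr_fun₂ this x y

theorem bracket_jacobi_mode (f g h : C) (p q r : K) :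
    bracket (mode f p) (bracket (mode g q) (mode h r)) =
      bracket (bracket (mode f p) (mode g q)) (mode h r) +
        bracket (mode g q) (bracket (mode f p) (mode h r)) := by
  have hf : Function.HasFiniteSupport fun k : ℤ × ℤ =>
      mode (prod f (prod g h k.1) k.2) (K.shift k.2 p * (K.shift k.1 q * r)) :=
    finite_double (prod g h) (fun _ => prod f) _
  have hg : Function.HasFiniteSupport fun k : ℤ × ℤ =>
      mode (prod g (prod f h k.2) k.1) (K.shift k.1 q * (K.shift k.2 p * r)) :=
    (finite_double (prod f h) (fun _ => prod g)
      fun k => K.shift k.2 q * (K.shift k.1 p * r)).preimage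
      (f := fun k : ℤ × ℤ => (k.2, k.1)) (fun a _ b _ hab => by
        simp only [Prod.mk.injEq] at hab
        exact Prod.ext hab.2 hab.1)
  have e : bracket (mode g q) (bracket (mode f p) (mode h r)) = ∑ᶠ k : ℤ × ℤ,
      mode (prod g (prod f h k.2) k.1) (K.shift k.1 q * (K.shift k.2 p * r)) := by
    rw [bracket_bracket, ← finsum_comp_equiv (Equiv.prodComm ℤ ℤ)]
    rfl
  rw [← sub_eq_iff_eq_add, e, bracket_bracket, bracket_bracket', ← finsum_sub_distrib hf hg]
  refine finsum_congr fun k => ?_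
  rw [mul_left_comm (K.shift k.1 q), ← LinearMap.sub_apply, ← map_sub,
    (isHTConformal (C := C)).commutator f g h]

theorem bracket_jacobi (x y z : LieOf C) :
    bracket x (bracket y z) = bracket (bracket x y) z + bracket y (bracket x z) := by
  have h1 : ∀ (f g : C) (p q : K) (z : LieOf C), bracket (mode f p) (bracket (mode g q) z) =
      bracket (bracket (mode f p) (mode g q)) z + bracket (mode g q) (bracket (mode f p) z) := by
    intro f g p q
    refine LinearMap.congr_fun (f := (bracket (mode f p)).comp (bracket (mode g q)))
      (g := bracket (bracket (mode f p) (mode g q)) +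
        (bracket (mode g q)).comp (bracket (mode f p))) ?_
    exact lieOf_ext fun h r => bracket_jacobi_mode f g h p q r
  have h2 : ∀ (f : C) (p : K) (y z : LieOf C), bracket (mode f p) (bracket y z) =
      bracket (bracket (mode f p) y) z + bracket y (bracket (mode f p) z) := by
    intro f p y z
    refine LinearMap.congr_fun (f := (bracket (mode f p)).comp (bracket.flip z))
      (g := (bracket.flip z).comp (bracket (mode f p)) +
        bracket.flip (bracket (mode f p) z)) ?_ y
    exact lieOf_ext fun g q => h1 f g p q z
  refine LinearMap.congr_fun (f := bracket.flip (bracket y z))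
    (g := (bracket.flip z).comp (bracket.flip y) + (bracket y).comp (bracket.flip z)) ?_ x
  exact lieOf_ext fun f p => h2 f p y z

instance : LieRing (LieOf C) where
  bracket x y := bracket x y
  add_lie x y z := by
    change bracket (x + y) z = bracket x z + bracket y z
    rw [map_add, LinearMap.add_apply]
  lie_add x y z := map_add (bracket x) y z
  lie_self x := by
    change bracket x x = 0
    have h : (2 : ℂ) • bracket x x = 0 := by
      rw [two_smul]
      nth_rewrite 1 [bracket_skew]
      exact neg_add_cancel _
    exact (smul_eq_zero.mp h).resolve_left two_ne_zero
  leibniz_lie x y z := bracket_jacobi x y z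

instance : LieAlgebra ℂ (LieOf C) where
  lie_smul c x y := map_smul (bracket x) c y

theorem lie_mode (f g : C) (p q : K) :
    ⁅mode f p, mode g q⁆ = ∑ᶠ n : ℤ, mode (prod f g n) (K.shift n p * q) :=
  bracket_mode f g p q

/-- A subspace `P` of `K` stable under shifts and products yields the Lie subalgebra of `𝓛C`
spanned by the `f_{p}`, `p ∈ P`. -/
def modeSubalgebra (P : Submodule ℂ K) (hs : ∀ n : ℤ, ∀ p ∈ P, K.shift n p ∈ P)
    (hm : ∀ p ∈ P, ∀ q ∈ P, p * q ∈ P) : LieSubalgebra ℂ (LieOf C) where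
  toSubmodule := Submodule.span ℂ {x | ∃ f : C, ∃ p ∈ P, x = mode f p}
  lie_mem' := by
    intro x y hx hy
    simp only [AddSubsemigroup.mem_carrier, AddSubmonoid.mem_toSubsemigroup,
      Submodule.mem_toAddSubmonoid] at hx hy ⊢
    change bracket x y ∈ _
    induction hx using Submodule.span_induction with
    | zero => rw [map_zero]; exact Submodule.zero_mem _
    | add x z _ _ hx hz =>
      rw [map_add, LinearMap.add_apply]; exact Submodule.add_mem _ hx hz
    | smul c x _ hx => rw [map_smul]; exact Submodule.smul_mem _ _ hx
    | mem x hx =>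
      obtain ⟨f, p, hp, rfl⟩ := hx
      induction hy using Submodule.span_induction with
      | zero => rw [map_zero]; exact Submodule.zero_mem _
      | add x z _ _ hx hz => rw [map_add]; exact Submodule.add_mem _ hx hz
      | smul c x _ hx => rw [map_smul]; exact Submodule.smul_mem _ _ hx
      | mem y hy =>
        obtain ⟨g, q, hq, rfl⟩ := hy
        rw [bracket_mode]
        exact finsum_induction (· ∈ _) (Submodule.zero_mem _)
          (fun _ _ => Submodule.add_mem _)
          fun n => Submodule.subset_span ⟨_, _, hm _ (hs n p hp) _ hq, rfl⟩

variable (C) in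
/-- The annihilation subalgebra, spanned by the `f_{p}` with `p` a polynomial. -/
def ann : LieSubalgebra ℂ (LieOf C) :=
  modeSubalgebra (Subalgebra.toSubmodule pol.range)
    (by rintro n _ ⟨p, rfl⟩; exact K.shift_pol n p) fun _ hp _ hq => pol.range.mul_mem hp hq

variable (C) in
/-- The creation subalgebra, spanned by the `f_{p}` with `p ∈ K_Sing`. -/
def cr : LieSubalgebra ℂ (LieOf C) :=
  modeSubalgebra K.sing (fun n _ => K.shift_mem_sing n) (fun _ hp _ hq => K.sing_mul_mem hp hq)

variable (C) in
/-- The left ideal of the enveloping algebra generated by the annihilation subalgebra. -/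
def annIdeal : Submodule (UniversalEnvelopingAlgebra ℂ (LieOf C))
    (UniversalEnvelopingAlgebra ℂ (LieOf C)) :=
  Submodule.span _ (UniversalEnvelopingAlgebra.ι ℂ '' (ann C : Set (LieOf C)))

variable (C) in
/-- The module induced from the one-dimensional trivial module of the annihilation subalgebra:
the quotient of `U(𝓛C)` by the left ideal generated by that subalgebra. -/
def VacMod : Type _ := UniversalEnvelopingAlgebra ℂ (LieOf C) ⧸ annIdeal C

instance : AddCommGroup (VacMod C) :=
  inferInstanceAs (AddCommGroup (UniversalEnvelopingAlgebra ℂ (LieOf C) ⧸ annIdeal C))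
instance : Module (UniversalEnvelopingAlgebra ℂ (LieOf C)) (VacMod C) :=
  inferInstanceAs (Module (UniversalEnvelopingAlgebra ℂ (LieOf C))
    (UniversalEnvelopingAlgebra ℂ (LieOf C) ⧸ annIdeal C))
instance : Module ℂ (VacMod C) :=
  inferInstanceAs (Module ℂ (UniversalEnvelopingAlgebra ℂ (LieOf C) ⧸ annIdeal C))
instance : IsScalarTower ℂ (UniversalEnvelopingAlgebra ℂ (LieOf C)) (VacMod C) :=
  inferInstanceAs (IsScalarTower ℂ (UniversalEnvelopingAlgebra ℂ (LieOf C))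
    (UniversalEnvelopingAlgebra ℂ (LieOf C) ⧸ annIdeal C))

variable (C) in
/-- The vacuum vector, the class of `1`. -/
def v0 : VacMod C := (annIdeal C).mkQ 1

/-- The action of `𝓛C` on the induced module. -/
def act (x : LieOf C) (w : VacMod C) : VacMod C := UniversalEnvelopingAlgebra.ι ℂ x • w

attribute [local instance] LieRing.ofAssociativeRing

variable (C) in
/-- The map `U(𝓛C_cr) → VacMod C`, `u ↦ u v0`. -/
def crMap : UniversalEnvelopingAlgebra ℂ (cr C) →ₗ[ℂ] VacMod C where
  toFun a := UniversalEnvelopingAlgebra.lift ℂ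
    ((UniversalEnvelopingAlgebra.ι ℂ).comp (cr C).incl) a • v0 C
  map_add' a b := by rw [map_add, add_smul]
  map_smul' c a := by rw [map_smul, smul_assoc, RingHom.id_apply]

end LieOf

/-! ### `H_T`-vertex algebras -/

section Vertex

variable {V : Type*} [AddCommGroup V] [Module ℂ V]

/-- The family `s` is the singular part `∑ s (n, j) / (τ - n) ^ (j + 1)` of the `V`-valued
distribution `D`: the values of `D` on polynomials `G` are `∑ Tr(G / (τ - n) ^ (j + 1)) s (n, j)`. -/
def IsSingKernel (D : K →ₗ[ℂ] V) (s : ℤ × ℕ →₀ V) : Prop :=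
  ∀ G : Polynomial ℂ, D (pol G) = s.sum fun p v => K.tr (K.u p.1 p.2 * pol G) • v

/-- The antipodal distribution: its kernel is `D(-τ)`. The substitution `τ ↦ -τ` in
`F ↦ Tr(D(τ) F(τ))` produces the sign. -/
def antipodal (D : K →ₗ[ℂ] V) : K →ₗ[ℂ] V := -(D.comp K.antipode.toLinearMap)

/-- The value at `F` of the product `R(τ) D(τ)`, where `R` is a holomorphic family of operators and
where `D` has singular part `s`. The first sum is the product of `R` with the holomorphic part of
`D`: since `Tr(D(τ) / (τ - n) ^ (j + 1))` is the `j`-th Taylor coefficient at `n` of this part,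
it is given by the Leibniz rule. The second sum is the product of `R` with the singular part. -/
def expMul (R : V →ₗ[ℂ] K →ₗ[ℂ] V) (D : K →ₗ[ℂ] V) (s : ℤ × ℕ →₀ V) (F : K) : V :=
  (∑ᶠ p : ℤ × ℕ, K.polarCoeff p.1 p.2 F • ∑ kl ∈ Finset.HasAntidiagonal.antidiagonal p.2,
    R (D (K.u p.1 kl.2)) (K.u p.1 kl.1)) +
  s.sum fun p v => R v (K.u p.1 p.2 * F)

/-- The action of `T ^ n` on `V`: `T ^ n f` is the coefficient of the vacuum in
`f_{S(T ^ n) 1/τ}`. -/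
def hAct (vac : V) (Y : V →ₗ[ℂ] K →ₗ[ℂ] Module.End ℂ V) (n : ℤ) (f : V) : V :=
  Y f (K.shift (-n) (K.u 0 0)) vac

/-- The exponential operator `R_V(τ)`: `R_V(F) v = v_{F} 1`. -/
def expOp (vac : V) (Y : V →ₗ[ℂ] K →ₗ[ℂ] Module.End ℂ V) : V →ₗ[ℂ] K →ₗ[ℂ] V :=
  Y.compr₂ (LinearMap.applyₗ vac)

/-- The commutator of the vertex operators of `f` and `g`, as a distribution in two variables. -/
def commDist (Y : V →ₗ[ℂ] K →ₗ[ℂ] Module.End ℂ V) (f g : V) : K ⊗[ℂ] K →ₗ[ℂ] Module.End ℂ V :=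
  TensorProduct.lift ((LinearMap.mul ℂ (Module.End ℂ V)).compl₁₂ (Y f) (Y g) -
    ((LinearMap.mul ℂ (Module.End ℂ V)).compl₁₂ (Y g) (Y f)).flip)

/-- The function `τ₁ - τ₂`. -/
def tauDiff : K ⊗[ℂ] K := pol Polynomial.X ⊗ₜ 1 - 1 ⊗ₜ pol Polynomial.X

/-- An `H_T`-vertex algebra on `V` with vacuum `vac`; the component `f_{F}`, `F ∈ K`, of the
vertex operator of `f` is `Y f F`. -/
structure IsHTVertexAlgebra (vac : V) (Y : V →ₗ[ℂ] K →ₗ[ℂ] Module.End ℂ V) : Prop where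
  /-- The vertex operators are fields: `Y(f, τ) g` has a rational singular part. -/
  field : ∀ f g : V, ∃ s, IsSingKernel ((Y f).flip g) s
  /-- `Y(1, τ) g = g`. -/
  vacuum : ∀ (F : K) (g : V), Y vac F g = K.tr F • g
  /-- `Y(f, τ) 1` is holomorphic. -/
  creation : ∀ (f : V) (G : Polynomial ℂ), Y f (pol G) vac = 0
  /-- The value at `0` of `Y(f, τ) 1` is `f`. -/
  constant : ∀ f : V, Y f (K.u 0 0) vac = f
  covariance : ∀ (n : ℤ) (f : V) (F : K), Y f (K.shift (-n) F) = Y (hAct vac Y n f) F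
  /-- `Y(f, τ) g = R_V(τ) Y(g, -τ) f`. -/
  skew : ∀ f g : V, ∃ s, IsSingKernel (antipodal ((Y g).flip f)) s ∧
    ∀ F : K, Y f F g = expMul (expOp vac Y) (antipodal ((Y g).flip f)) s F
  /-- The commutator of two vertex operators is killed by a product of factors `τ₁ - τ₂ - n`. -/
  rational : ∀ f g : V, ∃ F ∈ poleSet, ∀ x : K ⊗[ℂ] K,
    commDist Y f g (Polynomial.aeval tauDiff F * x) = 0

end Vertex

/-! ### `H_T`-vertex Poisson algebras -/

/-- An `H_T`-vertex Poisson algebra: a commutative algebra with an automorphism `T`, and an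
`H_T`-conformal structure for which the operations `f_n` are derivations. -/
structure IsHTVertexPoisson {P : Type*} [CommRing P] [Algebra ℂ P] (T : P ≃ₐ[ℂ] P)
    (D : P →ₗ[ℂ] P →ₗ[ℂ] (ℤ →₀ P)) : Prop where
  conformal : IsHTConformal T.toLinearEquiv D
  derivation : ∀ (f g h : P) (n : ℤ), D f (g * h) n = g * D f h n + h * D f g n

/-- The algebra `ℂ[T ^ n B, T ^ n C; n ∈ ℤ]`. -/
abbrev PToda : Type := MvPolynomial (TodaGen × ℤ) ℂ

namespace PToda

/-- The automorphism `T`. -/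
def T : PToda ≃ₐ[ℂ] PToda :=
  MvPolynomial.renameEquiv ℂ ((Equiv.refl TodaGen).prodCongr (Equiv.addRight (1 : ℤ)))

/-- The inclusion of `CToda` as the linear forms. -/
def lin : CToda →ₗ[ℂ] PToda := CToda.basis.constr ℂ MvPolynomial.X

/-- The operations `f ↦ x_n f`, `n ∈ ℤ`, for a variable `x`: the derivations extending the
products of the Toda conformal algebra. -/
def gen (x : TodaGen × ℤ) : Derivation ℂ PToda (ℤ →₀ PToda) :=
  MvPolynomial.mkDerivation ℂ fun y => (CToda.basisProd x y).mapRange lin (map_zero lin)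

/-- The map that sends the family `n ↦ a n` to the family `n ↦ -T ^ n (a (-n))`. -/
def skewMap : (ℤ →₀ PToda) →ₗ[ℂ] (ℤ →₀ PToda) :=
  Finsupp.lsum ℂ fun m => (Finsupp.lsingle (-m)).comp (-(T ^ (-m)).toLinearMap)

/-- The products `bracket f g n = f_n g` of the Toda vertex Poisson algebra: the `f_n` are
derivations, and on a variable `f_n x = -T ^ n (x_(-n) f)`. -/
def bracket : PToda →ₗ[ℂ] PToda →ₗ[ℂ] (ℤ →₀ PToda) where
  toFun f := (MvPolynomial.mkDerivation ℂ fun x => skewMap (gen x f)).toLinearMap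
  map_add' f g := by
    have : (fun x => skewMap (gen x (f + g))) =
        (fun x => skewMap (gen x f)) + fun x => skewMap (gen x g) := by
      funext x; simp
    rw [this]
    exact congrArg Derivation.toLinearMap ((MvPolynomial.mkDerivationEquiv ℂ).map_add _ _)
  map_smul' c f := by
    have : (fun x => skewMap (gen x (c • f))) = c • fun x => skewMap (gen x f) := by
      funext x; simp
    rw [this]
    exact congrArg Derivation.toLinearMap ((MvPolynomial.mkDerivationEquiv ℂ).map_smul _ _)

/-- The polynomials of total degree at most `k`. -/
def filtration (k : ℤ) : Submodule ℂ PToda :=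
  Submodule.span ℂ {p | ∃ s : (TodaGen × ℤ) →₀ ℕ, (s.degree : ℤ) ≤ k ∧
    p = MvPolynomial.monomial s 1}

end PToda

/-! ### Quantization -/

/-- The filtration of the induced module by the number of factors:
`filtration k` is spanned by the vectors `x₁ ⋯ x_l v0`, `l ≤ k`, `x_i ∈ 𝓛C`. -/
def VacMod.filtration (C : Type*) [AddCommGroup C] [Module ℂ C] [HTConformalAlgebra C] (k : ℤ) :
    Submodule ℂ (VacMod C) :=
  Submodule.span ℂ {w | ∃ l : List (LieOf C), (l.length : ℤ) ≤ k ∧ w = l.foldr act (v0 C)}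

/-- A vertex algebra with filtration `Vf` whose associated graded space is a commutative algebra
under the normal ordered product `f_{1/τ} g`. -/
structure IsFilteredVertexAlgebra {V : Type*} [AddCommGroup V] [Module ℂ V] (vac : V)
    (Y : V →ₗ[ℂ] K →ₗ[ℂ] Module.End ℂ V) (Vf : ℤ → Submodule ℂ V) : Prop where
  mono : Monotone Vf
  neg : ∀ k < 0, Vf k = ⊥
  exhaustive : ∀ v, ∃ k, v ∈ Vf k
  vac_mem : vac ∈ Vf 0
  mem : ∀ (k l : ℤ) (f g : V), f ∈ Vf k → g ∈ Vf l → ∀ F : K, Y f F g ∈ Vf (k + l)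
  sing_mem : ∀ (k l : ℤ) (f g : V), f ∈ Vf k → g ∈ Vf l →
    ∀ G : Polynomial ℂ, Y f (pol G) g ∈ Vf (k + l - 1)
  comm : ∀ (k l : ℤ) (f g : V), f ∈ Vf k → g ∈ Vf l →
    Y f (K.u 0 0) g - Y g (K.u 0 0) f ∈ Vf (k + l - 1)
  assoc : ∀ (k l m : ℤ) (f g h : V), f ∈ Vf k → g ∈ Vf l → h ∈ Vf m →
    Y f (K.u 0 0) (Y g (K.u 0 0) h) - Y (Y f (K.u 0 0) g) (K.u 0 0) h ∈ Vf (k + l + m - 1)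

/-- The linear map `Q`, compatible with the filtrations `Pf` and `Vf`, is a quantization map from a
vertex Poisson algebra to a filtered vertex algebra: the associated graded map is injective, it
respects the unit, the products and the action of `T`, and the leading term of the singular part of
`Y(Q f, τ) Q g` is `Q (∑ₙ f_n g / (τ - n))`. -/
structure IsQuantizationMap {P V : Type*} [CommRing P] [Algebra ℂ P] [AddCommGroup V] [Module ℂ V]
    (T : P ≃ₐ[ℂ] P) (D : P →ₗ[ℂ] P →ₗ[ℂ] (ℤ →₀ P)) (Pf : ℤ → Submodule ℂ P) (vac : V)
    (Y : V →ₗ[ℂ] K →ₗ[ℂ] Module.End ℂ V) (Vf : ℤ → Submodule ℂ V) (Q : P →ₗ[ℂ] V) : Prop where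
  mem : ∀ k, ∀ f ∈ Pf k, Q f ∈ Vf k
  inj : ∀ k, ∀ f ∈ Pf k, Q f ∈ Vf (k - 1) → f ∈ Pf (k - 1)
  one : Q 1 = vac
  mul : ∀ (k l : ℤ) (f g : P), f ∈ Pf k → g ∈ Pf l →
    Q (f * g) - Y (Q f) (K.u 0 0) (Q g) ∈ Vf (k + l - 1)
  shift : ∀ (k : ℤ) (f : P), f ∈ Pf k → ∀ n : ℤ, Q ((T ^ n) f) - hAct vac Y n (Q f) ∈ Vf (k - 1)
  poisson : ∀ (k l : ℤ) (f g : P), f ∈ Pf k → g ∈ Pf l → ∀ G : Polynomial ℂ,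
    Y (Q f) (pol G) (Q g) - Q ((D f g).sum fun n a => G.eval (n : ℂ) • a) ∈ Vf (k + l - 2)

/-- The underlying space of the Toda vertex algebra. -/
abbrev VToda : Type := VacMod CToda

end HTVertex

end

open HTVertex

/-! The state-field correspondence comes from the universal property of the induced module. Fields
on a space V have products indexed by q ∈ K: the residue of q(σ−τ)a(σ)b(τ) minus that of
q(σ−τ)b(τ)a(σ), each with its own expansion of q. With poles allowed at all integers, this expansion
is purely algebraic. The field that acts first has a denominator R(γ), and modulo R(γ) every κ−γ−n
is invertible, because it divides R(κ−n)−R(γ) and R(κ−n) is a unit (`KP.isUnit_diff_sub`). The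
essential fact is `Fields.prod_comm`: if the commutator of a and b is given by fields c_n, then the
operators D ↦ a_q D obey the same commutation relations. Hence the fields on the induced module form
a module over the Lie algebra. Its annihilation part kills the vacuum field, since products with
polynomial index are commutators (`Fields.prod_pol`). The resulting module map that sends v0 to the
vacuum field is Y (`stateField`). All of this holds for every `HTConformalAlgebra`.

The vertex algebra axioms follow by induction over the modes that generate the module. Translation
and d/dτ pass through the products (`conv_map_shift`, `conv_map_deriv`), and locality is preserved
by Dong's lemma (`IsLocal.prod`). For skew symmetry, locality gives P(σ−τ)f(σ)g(τ)v0 =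
P(σ−τ)g(τ)f(σ)v0. The left side is evaluated at τ = 0, and on the right the Taylor coefficients of
f(σ)v0 are moved to the outside by covariance (`vop_skew`).

For the Toda algebra the Lie algebra is K ⊕ K with [B_p, C_q] = C_{(T⁻¹p−p)q}. It acts explicitly on
a polynomial ring: creation modes of B multiply, polynomial modes of B act by derivations, and modes
of C act through a coproduct. Ordered products with B to the left of C span the enveloping algebra
of the creation part, and applied to 1 they reproduce the monomials. This gives
`TodaModel.crMap_bijective` without a general Poincaré–Birkhoff–Witt theorem, and an isomorphism
`TodaModel.modelEquiv` compatible with the degree.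

The quantization map is a substitution of variables followed by this isomorphism. That it respects
products, T and the Poisson products up to lower order is proved by induction on the degree, one
variable at a time. The Jacobi identity on the Poisson side holds because the defect is a derivation
in its last argument, and its symmetries bring each argument to that place. Noncommutativity is read
off from the model for the states C and B. -/

noncomputable section
namespace HTVertex

/-! ### The algebra `K`: partial fractions, residues, the derivation d/dτ. -/

open Polynomial in
theorem X_sub_C_mem_poleSet (n : ℤ) : (X - C (n : ℂ) : ℂ[X]) ∈ poleSet :=
  Submonoid.subset_closure ⟨n, rfl⟩

/-- Induction over the elements of `poleSet`, one linear factor at a time. -/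
theorem poleSet_induction {motive : (R : Polynomial ℂ) → R ∈ poleSet → Prop}
    (one : motive 1 poleSet.one_mem)
    (mul : ∀ (n : ℤ) (R : Polynomial ℂ) (hR : R ∈ poleSet), motive R hR →
      motive ((Polynomial.X - Polynomial.C (n : ℂ)) * R)
        (poleSet.mul_mem (X_sub_C_mem_poleSet n) hR))
    {R : Polynomial ℂ} (hR : R ∈ poleSet) : motive R hR := by
  refine Submonoid.closure_induction_left (motive := motive) one ?_ hR
  rintro _ ⟨n, rfl⟩ y hy h
  exact mul n y hy h

theorem isUnit_aeval_of_mem_poleSet {A : Type*} [CommRing A] [Algebra ℂ A] {a : A}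
    (h : ∀ n : ℤ, IsUnit (a - (n : A))) {R : Polynomial ℂ} (hR : R ∈ poleSet) :
    IsUnit (Polynomial.aeval a R) := by
  induction hR using poleSet_induction with
  | one => simp
  | mul n R _ ih => simpa using (h n).mul ih

theorem pol_eq_aeval (p : Polynomial ℂ) : pol p = Polynomial.aeval (pol Polynomial.X) p := by
  have : pol = Polynomial.aeval (pol Polynomial.X) := Polynomial.algHom_ext (by simp)
  exact DFunLike.congr_fun this p

namespace K

theorem isUnit_pol {R : Polynomial ℂ} (hR : R ∈ poleSet) : IsUnit (pol R) := by
  rw [pol_eq_aeval]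
  exact isUnit_aeval_of_mem_poleSet isUnit_sub hR

theorem exists_pol_mul_eq (F : K) : ∃ R ∈ poleSet, ∃ G, pol R * F = pol G := by
  obtain ⟨⟨G, R⟩, h⟩ := IsLocalization.surj poleSet F
  exact ⟨R, R.2, G, by rw [mul_comm]; exact h⟩

theorem pol_X_sub (n : ℤ) : pol (Polynomial.X - Polynomial.C (n : ℂ)) =
    pol Polynomial.X - (n : K) := by
  rw [map_sub, map_intCast, map_intCast]

theorem u_mul_X_sub_zero (n : ℤ) : u n 0 * (pol Polynomial.X - (n : K)) = 1 := by
  simpa using u_spec n 0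

theorem u_succ_mul_X_sub (n : ℤ) (j : ℕ) :
    u n (j + 1) * (pol Polynomial.X - (n : K)) = u n j := by
  have : u n (j + 1) = u n j * u n 0 := by rw [u_mul_same]
  rw [this, mul_assoc, u_mul_X_sub_zero, mul_one]

theorem antipode_X : antipode (pol Polynomial.X) = -pol Polynomial.X := by
  simp [antipode, lift_pol]

theorem eq_u_of_mul {n : ℤ} {j : ℕ} {F : K}
    (h : F * (pol Polynomial.X - (n : K)) ^ (j + 1) = 1) : F = u n j :=
  left_inv_eq_right_inv h (by rw [mul_comm]; exact u_spec n j)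

theorem antipode_u (n : ℤ) (j : ℕ) : antipode (u n j) = (-1 : K) ^ (j + 1) * u (-n) j := by
  have h := congrArg antipode (u_spec n j)
  simp only [map_mul, map_pow, map_sub, antipode_X, map_intCast, map_one] at h
  have h3 : (-1 : K) ^ (j + 1) * antipode (u n j) = u (-n) j := by
    apply eq_u_of_mul
    have : (-pol Polynomial.X - (n : K)) = (-1) * (pol Polynomial.X - ((-n : ℤ) : K)) := by
      push_cast; ring
    rw [this, mul_pow] at h
    rw [mul_assoc, mul_left_comm]
    exact h
  rw [← h3, ← mul_assoc, ← mul_pow]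
  simp

theorem sub_dvd_pol_sub (n : ℤ) (G : Polynomial ℂ) :
    ∃ G', G = Polynomial.C (G.eval (n : ℂ)) + (Polynomial.X - Polynomial.C (n : ℂ)) * G' := by
  obtain ⟨G', h⟩ := Polynomial.X_sub_C_dvd_sub_C_eval (a := (n : ℂ)) (p := G)
  exact ⟨G', by rw [← h]; ring⟩

theorem pol_C (c : ℂ) : pol (Polynomial.C c) = algebraMap ℂ K c :=
  pol.commutes c

theorem u_zero_mul_pol (n : ℤ) (G : Polynomial ℂ) :
    ∃ G', u n 0 * pol G = G.eval (n : ℂ) • u n 0 + pol G' := by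
  obtain ⟨G', h⟩ := sub_dvd_pol_sub n G
  refine ⟨G', ?_⟩
  conv_lhs => rw [h]
  rw [map_add, map_mul, pol_X_sub, pol_C, mul_add, ← mul_assoc, u_mul_X_sub_zero, Algebra.smul_def]
  ring

/-- Every `F ∈ K` is the sum of a polynomial and an element of `K_Sing`. -/
theorem exists_pol_add_sing (F : K) : ∃ G, ∃ s ∈ sing, F = pol G + s := by
  obtain ⟨R, hR, G, h⟩ := exists_pol_mul_eq F
  induction hR using poleSet_induction generalizing F G with
  | one => exact ⟨G, 0, sing.zero_mem, by simpa using h⟩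
  | mul n R hR ih =>
    -- One linear factor of the denominator is absorbed into F. Dividing the decomposition of (τ−n)F
    -- by τ−n then turns the polynomial part G₁ into G₁(n)/(τ−n) plus a polynomial, and keeps the
    -- singular part singular.
    obtain ⟨G₁, s, hs, h1⟩ := ih ((pol Polynomial.X - (n : K)) * F) G (by
      rw [← h, map_mul, pol_X_sub]; ring)
    obtain ⟨G', h2⟩ := u_zero_mul_pol n G₁
    refine ⟨G', G₁.eval (n : ℂ) • u n 0 + u n 0 * s,
      sing.add_mem (sing.smul_mem _ (u_mem _ _)) (sing_mul_mem (u_mem _ _) hs), ?_⟩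
    have h3 := congrArg (u n 0 * ·) h1
    simp only [mul_add, h2, ← mul_assoc, u_mul_X_sub_zero, one_mul] at h3
    rw [h3]; abel

/-- Induction on `K` along the partial fraction decomposition. -/
theorem linear_ext {M : Type*} [AddCommMonoid M] [Module ℂ M] {f g : K →ₗ[ℂ] M}
    (h1 : ∀ G, f (pol G) = g (pol G)) (h2 : ∀ n j, f (u n j) = g (u n j)) : f = g := by
  refine LinearMap.ext fun F => ?_
  obtain ⟨G, s, hs, rfl⟩ := exists_pol_add_sing F
  rw [map_add, map_add, h1]
  congr 1
  exact LinearMap.eqOn_span (by rintro _ ⟨⟨n, j⟩, rfl⟩; exact h2 n j) hs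

theorem expand_X (n : ℤ) : expand n (pol Polynomial.X) =
    HahnSeries.single 1 1 + (n : LaurentSeries ℂ) := by
  simp [expand, lift_pol]

theorem algebraMap_laurentSeries (c : ℂ) :
    algebraMap ℂ (LaurentSeries ℂ) c = HahnSeries.C c := by
  rw [HahnSeries.algebraMap_apply', PowerSeries.algebraMap_apply]
  simp

theorem expand_pol (n : ℤ) (G : Polynomial ℂ) : expand n (pol G) =
    ((Polynomial.aeval (PowerSeries.X + (n : PowerSeries ℂ)) G : PowerSeries ℂ) :
      LaurentSeries ℂ) := by
  have : ((expand n).comp pol : Polynomial ℂ →+* LaurentSeries ℂ) = (HahnSeries.ofPowerSeries ℤ ℂ).comp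
      (Polynomial.aeval (PowerSeries.X + (n : PowerSeries ℂ)) : Polynomial ℂ →ₐ[ℂ] PowerSeries ℂ) := by
    apply Polynomial.ringHom_ext
    · intro c
      change expand n (pol (Polynomial.C c)) = _
      rw [show pol (Polynomial.C c) = algebraMap ℂ K c from pol.commutes c, AlgHom.commutes,
        algebraMap_laurentSeries]
      simp
    · simp [expand_X]
  exact DFunLike.congr_fun this G

theorem coeff_coe_neg (f : PowerSeries ℂ) {i : ℤ} (hi : i < 0) : (f : LaurentSeries ℂ).coeff i = 0 := by
  rw [PowerSeries.coeff_coe, if_pos hi]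

theorem polarCoeff_pol (n : ℤ) (j : ℕ) (G : Polynomial ℂ) : polarCoeff n j (pol G) = 0 := by
  rw [polarCoeff, expand_pol, coeff_coe_neg _ (by omega)]

theorem expand_u_same (n : ℤ) (j : ℕ) :
    expand n (u n j) = HahnSeries.single (-(j : ℤ) - 1) 1 := by
  have h := congrArg (expand n) (u_spec n j)
  simp only [map_mul, map_pow, map_sub, expand_X, map_intCast, map_one, add_sub_cancel_right] at h
  refine left_inv_eq_right_inv h ?_
  rw [HahnSeries.single_pow, HahnSeries.single_mul_single]
  simp

theorem expand_u_ne {m n : ℤ} (h : m ≠ n) (j : ℕ) :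
    ∃ f : PowerSeries ℂ, expand n (u m j) = (f : LaurentSeries ℂ) := by
  have h1 := congrArg (expand n) (u_spec m j)
  simp only [map_mul, map_pow, map_sub, expand_X, map_intCast, map_one] at h1
  -- In the local coordinate at n the factor τ−m is t + (n−m), a unit of the power series ring
  -- because m ≠ n.
  set g : PowerSeries ℂ := PowerSeries.X + PowerSeries.C ((n : ℂ) - m)
  have hg : IsUnit (g ^ (j + 1)) := by
    refine IsUnit.pow _ (PowerSeries.isUnit_iff_constantCoeff.mpr ?_)
    simp [g, sub_eq_zero, h.symm]
  obtain ⟨f, hf⟩ := hg.exists_right_inv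
  refine ⟨f, left_inv_eq_right_inv h1 ?_⟩
  have : (HahnSeries.single 1 1 + (n : LaurentSeries ℂ) - (m : LaurentSeries ℂ)) =
      (g : LaurentSeries ℂ) := by
    simp [g, add_sub_assoc]
  rw [this, ← PowerSeries.coe_pow, ← PowerSeries.coe_mul, hf, PowerSeries.coe_one]

/-- Duality between the polar coefficients and the functions `u`. Singular parts and traces are
computed from it on generators. -/
theorem polarCoeff_u (n m : ℤ) (i j : ℕ) :
    polarCoeff n i (u m j) = if n = m ∧ i = j then 1 else 0 := by
  by_cases h : n = m
  · subst h
    rw [polarCoeff, expand_u_same, HahnSeries.coeff_single]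
    congr 1
    simp
  · obtain ⟨f, hf⟩ := expand_u_ne (fun e => h e.symm) j
    rw [polarCoeff, hf, coeff_coe_neg _ (by omega), if_neg (fun e => h e.1)]

/-- `polarCoeff` as a linear form. -/
def polarCoeffₗ (n : ℤ) (j : ℕ) : K →ₗ[ℂ] ℂ where
  toFun := polarCoeff n j
  map_add' F G := by simp [polarCoeff]
  map_smul' c F := by
    rw [polarCoeff, Algebra.smul_def, map_mul, AlgHom.commutes, algebraMap_laurentSeries, HahnSeries.C_mul_eq_smul]
    rfl

theorem polarCoeffₗ_apply (n : ℤ) (j : ℕ) (F : K) : polarCoeffₗ n j F = polarCoeff n j F := rfl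

theorem finite_polarCoeff (F : K) : {p : ℤ × ℕ | polarCoeff p.1 p.2 F ≠ 0}.Finite := by
  obtain ⟨G, s, hs, rfl⟩ := exists_pol_add_sing F
  have e : ∀ p : ℤ × ℕ, polarCoeff p.1 p.2 (pol G + s) = polarCoeff p.1 p.2 s := fun p => by
    rw [← polarCoeffₗ_apply, map_add, polarCoeffₗ_apply, polarCoeff_pol, zero_add]; rfl
  simp only [e]
  clear e
  induction hs using Submodule.span_induction with
  | zero => simp [← polarCoeffₗ_apply]
  | add x y _ _ hx hy =>
    refine (hx.union hy).subset fun p hp => ?_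
    by_contra h
    simp only [Set.mem_union, Set.mem_ofPred_eq, not_or, not_not] at h
    exact hp (by rw [← polarCoeffₗ_apply, map_add, polarCoeffₗ_apply, polarCoeffₗ_apply, h.1, h.2,
      add_zero])
  | smul c x _ hx =>
    refine hx.subset fun p hp h => hp ?_
    rw [← polarCoeffₗ_apply, map_smul, polarCoeffₗ_apply, h, smul_zero]
  | mem x hx =>
    obtain ⟨⟨n, j⟩, rfl⟩ := hx
    refine (Set.finite_singleton (n, j)).subset fun p hp => ?_
    simp only [polarCoeff_u, Set.mem_ofPred_eq, ne_eq, ite_eq_right_iff, one_ne_zero, imp_false,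
      not_not] at hp
    exact Prod.ext hp.1 hp.2

/-- The polar coefficients of `F`, as a finitely supported function. -/
def polar : K →ₗ[ℂ] (ℤ × ℕ →₀ ℂ) where
  toFun F := Finsupp.ofSupportFinite (fun p => polarCoeff p.1 p.2 F) (finite_polarCoeff F)
  map_add' F G := by ext p; exact map_add (polarCoeffₗ p.1 p.2) F G
  map_smul' c F := by ext p; exact map_smul (polarCoeffₗ p.1 p.2) c F

theorem polar_apply (F : K) (p : ℤ × ℕ) : polar F p = polarCoeff p.1 p.2 F := rfl

theorem polar_pol (G : Polynomial ℂ) : polar (pol G) = 0 := by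
  ext p; rw [polar_apply, polarCoeff_pol]; rfl

theorem polar_u (n : ℤ) (j : ℕ) : polar (u n j) = Finsupp.single (n, j) 1 := by
  ext p
  rw [polar_apply, polarCoeff_u, Finsupp.single_apply]
  congr 1
  rw [Prod.ext_iff]
  simp only [eq_comm]

theorem tr_eq_finsum (F : K) : tr F = ∑ᶠ n : ℤ, polar F (n, 0) := by
  simp [tr, polar_apply, polarCoeff]

/-- The trace as a linear form. -/
def trₗ : K →ₗ[ℂ] ℂ where
  toFun := tr
  map_add' F G := by
    have h (F : K) : (Function.support fun n : ℤ => polar F (n, 0)).Finite :=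
      ((polar F).hasFiniteSupport.preimage
        (f := fun n : ℤ => (n, 0)) (fun a _ b _ e => (Prod.ext_iff.mp e).1))
    rw [tr_eq_finsum, tr_eq_finsum, tr_eq_finsum, ← finsum_add_distrib (h F) (h G)]
    simp
  map_smul' c F := by
    rw [tr_eq_finsum, tr_eq_finsum, RingHom.id_apply, smul_finsum]
    simp

theorem trₗ_apply (F : K) : trₗ F = tr F := rfl

theorem tr_pol (G : Polynomial ℂ) : tr (pol G) = 0 := by
  rw [tr_eq_finsum, polar_pol]; simp

theorem tr_u (n : ℤ) (j : ℕ) : tr (u n j) = if j = 0 then 1 else 0 := by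
  rw [tr_eq_finsum, polar_u, finsum_eq_single _ n]
  · simp [Finsupp.single_apply]
  · intro m hm
    rw [Finsupp.single_apply, if_neg]
    exact fun h => hm (Prod.ext_iff.mp h).1.symm

theorem tr_add (F G : K) : tr (F + G) = tr F + tr G := map_add trₗ F G
theorem tr_sub (F G : K) : tr (F - G) = tr F - tr G := map_sub trₗ F G
theorem tr_smul (c : ℂ) (F : K) : tr (c • F) = c * tr F := map_smul trₗ c F

/-- Writing n−m = (τ−m)−(τ−n) lowers the order of one of the two poles. The recursion ends either
with two simple poles of opposite residues or with a single pole of order at least two, which has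
residue zero. -/
theorem tr_u_mul_u {m n : ℤ} (hmn : m ≠ n) : ∀ N j k : ℕ, j + k = N → tr (u n j * u m k) = 0 := by
  have hd : ((n - m : ℤ) : ℂ) ≠ 0 := by
    rw [Int.cast_ne_zero]; omega
  have h0 : ∀ j k : ℕ, u n j * u m k =
      (((n - m : ℤ) : ℂ))⁻¹ • (u n j * (u m k * (pol Polynomial.X - (m : K)))
        - (u n j * (pol Polynomial.X - (n : K))) * u m k) := by
    intro j k
    rw [eq_inv_smul_iff₀ hd, Algebra.smul_def, map_intCast]
    push_cast
    ring
  intro N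
  induction N with
  | zero =>
    intro j k h
    obtain ⟨rfl, rfl⟩ : j = 0 ∧ k = 0 := by omega
    rw [h0, u_mul_X_sub_zero, u_mul_X_sub_zero, tr_smul, mul_one, one_mul, tr_sub, tr_u, tr_u]
    simp
  | succ N ih =>
    intro j k h
    rw [h0, tr_smul, tr_sub]
    have h1 : tr (u n j * (u m k * (pol Polynomial.X - (m : K)))) = 0 := by
      cases k with
      | zero => rw [u_mul_X_sub_zero, mul_one, tr_u, if_neg (by omega)]
      | succ k => rw [u_succ_mul_X_sub]; exact ih j k (by omega)
    have h2 : tr (u n j * (pol Polynomial.X - (n : K)) * u m k) = 0 := by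
      cases j with
      | zero => rw [u_mul_X_sub_zero, one_mul, tr_u, if_neg (by omega)]
      | succ j => rw [u_succ_mul_X_sub]; exact ih j k (by omega)
    rw [h1, h2]; simp

/-- A product of two elements of `K_Sing` has no residue at infinity. -/
theorem tr_sing_mul_sing {F G : K} (hF : F ∈ sing) (hG : G ∈ sing) : tr (F * G) = 0 := by
  induction hF using Submodule.span_induction with
  | zero => rw [zero_mul]; exact map_zero trₗ
  | add x y _ _ hx hy => rw [add_mul, tr_add, hx, hy, add_zero]
  | smul c x _ hx => rw [smul_mul_assoc, tr_smul, hx, mul_zero]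
  | mem x hx =>
    obtain ⟨⟨n, j⟩, rfl⟩ := hx
    induction hG using Submodule.span_induction with
    | zero => rw [mul_zero]; exact map_zero trₗ
    | add x y _ _ hx hy => rw [mul_add, tr_add, hx, hy, add_zero]
    | smul c x _ hx => rw [mul_smul_comm, tr_smul, hx, mul_zero]
    | mem x hx =>
      obtain ⟨⟨m, k⟩, rfl⟩ := hx
      rcases eq_or_ne m n with rfl | h
      · dsimp only; rw [u_mul_same, tr_u, if_neg (by omega)]
      · exact tr_u_mul_u h _ j k rfl

theorem tr_shift (n : ℤ) (F : K) : tr (shift n F) = tr F := by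
  have : trₗ.comp (shift n).toLinearMap = trₗ := by
    refine linear_ext (fun G => ?_) fun m j => ?_
    · obtain ⟨G', h⟩ := shift_pol n G
      rw [LinearMap.comp_apply, AlgHom.toLinearMap_apply, ← h]
      exact (tr_pol _).trans (tr_pol _).symm
    · rw [LinearMap.comp_apply, AlgHom.toLinearMap_apply, shift_u, trₗ_apply, trₗ_apply, tr_u, tr_u]
  exact LinearMap.congr_fun this F

/-- The singular part of `F`. -/
def singPart : K →ₗ[ℂ] K := (Finsupp.lsum ℂ fun p : ℤ × ℕ => LinearMap.toSpanSingleton ℂ K (u p.1 p.2)).comp polar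

theorem singPart_pol (G : Polynomial ℂ) : singPart (pol G) = 0 := by
  simp [singPart, polar_pol]

theorem singPart_of_mem {s : K} (hs : s ∈ sing) : singPart s = s := by
  refine LinearMap.eqOn_span (f := singPart) (g := LinearMap.id) ?_ hs
  rintro _ ⟨⟨n, j⟩, rfl⟩
  simp [singPart, polar_u]

theorem singPart_mem (F : K) : singPart F ∈ sing := by
  rw [singPart, LinearMap.comp_apply, Finsupp.lsum_apply, Finsupp.sum]
  exact sing.sum_mem fun p _ => by
    rw [LinearMap.toSpanSingleton_apply]; exact sing.smul_mem _ (u_mem _ _)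

theorem exists_eq_pol_add_singPart (F : K) : ∃ G, F = pol G + singPart F := by
  obtain ⟨G, s, hs, rfl⟩ := exists_pol_add_sing F
  exact ⟨G, by rw [map_add, singPart_pol, zero_add, singPart_of_mem hs]⟩

/-- `K = ℂ[τ] ⊕ K_Sing`. -/
theorem isCompl_sing_pol : IsCompl sing (Subalgebra.toSubmodule pol.range) := by
  constructor
  · rw [Submodule.disjoint_def]
    rintro s hs ⟨G, h : pol G = s⟩
    rw [← singPart_of_mem hs, ← h, singPart_pol]
  · rw [codisjoint_iff, eq_top_iff]
    intro F _
    obtain ⟨G, s, hs, rfl⟩ := exists_pol_add_sing F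
    exact add_comm s (pol G) ▸ Submodule.add_mem_sup hs ⟨G, rfl⟩

/-- The derivation `d/dτ`, as the infinitesimal part of `F(τ + ε)`, `ε² = 0`. -/
def dualShift : K →ₐ[ℂ] DualNumber K :=
  lift (TrivSqZeroExt.inl (pol Polynomial.X) + DualNumber.eps) fun n => by
    rw [TrivSqZeroExt.isUnit_iff_isUnit_fst]
    simpa using isUnit_sub n

theorem fst_dualShift (F : K) : (dualShift F).fst = F := by
  have : (TrivSqZeroExt.fstHom ℂ K K).comp dualShift = AlgHom.id ℂ K := by
    apply algHom_ext
    simp [dualShift, lift_pol]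
  exact DFunLike.congr_fun this F

/-- The derivation `d/dτ` of `K`. -/
def deriv : K →ₗ[ℂ] K := (TrivSqZeroExt.sndHom K K).restrictScalars ℂ ∘ₗ dualShift.toLinearMap

theorem deriv_mul (F G : K) : deriv (F * G) = F * deriv G + G * deriv F := by
  simp [deriv, fst_dualShift, mul_comm G]

theorem deriv_X : deriv (pol Polynomial.X) = 1 := by
  simp [deriv, dualShift, lift_pol]

theorem deriv_one : deriv 1 = 0 := by
  simp [deriv]

end K
end HTVertex
end

noncomputable section
namespace HTVertex

/-! ### Expansions of functions of a difference -/

/-- The functions of two variables `(κ, γ)`, polynomial in the second one. -/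
abbrev KP : Type := K ⊗[ℂ] Polynomial ℂ

namespace KP

/-- The difference `κ - γ`. -/
def diff : KP := pol Polynomial.X ⊗ₜ 1 - 1 ⊗ₜ Polynomial.X

/-- The ideal generated by `R(γ)`. -/
def rel (R : poleSet) : Ideal KP := Ideal.span {1 ⊗ₜ (R : Polynomial ℂ)}

/-- The inclusion of functions of `κ`. -/
def inlK : K →ₐ[ℂ] KP := Algebra.TensorProduct.includeLeft

/-- The inclusion of functions of `γ`. -/
def inrP : Polynomial ℂ →ₐ[ℂ] KP := Algebra.TensorProduct.includeRight

theorem inlK_apply (k : K) : inlK k = k ⊗ₜ 1 := rfl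
theorem inrP_apply (G : Polynomial ℂ) : inrP G = 1 ⊗ₜ G := rfl
theorem inlK_mul_inrP (k : K) (G : Polynomial ℂ) : inlK k * inrP G = k ⊗ₜ G := by
  rw [inlK_apply, inrP_apply, Algebra.TensorProduct.tmul_mul_tmul, mul_one, one_mul]

theorem diff_eq : diff = inlK (pol Polynomial.X) - inrP Polynomial.X := rfl

theorem mem_rel {R : poleSet} {z : KP} : z ∈ rel R ↔ ∃ w, w * inrP R = z := by
  rw [rel, Ideal.mem_span_singleton']; rfl

/-- The functions of `(κ, γ)` modulo `R(γ)`. -/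
def Quo (R : poleSet) : Type := KP ⧸ rel R

instance (R : poleSet) : CommRing (Quo R) := inferInstanceAs (CommRing (KP ⧸ rel R))
instance (R : poleSet) : Algebra ℂ (Quo R) := inferInstanceAs (Algebra ℂ (KP ⧸ rel R))

/-- The quotient map modulo `R(γ)`. -/
def quo (R : poleSet) : KP →ₐ[ℂ] Quo R where
  toRingHom := Ideal.Quotient.mk (rel R)
  commutes' _ := rfl

theorem quo_surjective (R : poleSet) : Function.Surjective (quo R) :=
  Ideal.Quotient.mk_surjective

theorem quo_eq_iff {R : poleSet} {z w : KP} : quo R z = quo R w ↔ z - w ∈ rel R :=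
  Ideal.Quotient.eq

theorem quo_eq_zero_iff {R : poleSet} {z : KP} : quo R z = 0 ↔ z ∈ rel R :=
  Ideal.Quotient.eq_zero_iff_mem

/-- Descent to the quotient. -/
def quoLift {A : Type*} [CommRing A] [Algebra ℂ A] (R : poleSet) (f : KP →ₐ[ℂ] A)
    (h : ∀ z ∈ rel R, f z = 0) : Quo R →ₐ[ℂ] A where
  toRingHom := Ideal.Quotient.lift (rel R) f.toRingHom h
  commutes' c := f.commutes c

/-- Modulo R(γ), the element R(κ−n) equals R(κ−n)−R(γ), which κ−n−γ divides. As R(κ−n) is a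
translate of a unit of `K`, the divisor is a unit too. This is what gives q(κ−γ) a meaning for all q
∈ `K`, although only polynomials in γ are available. -/
theorem isUnit_diff_sub (R : poleSet) (n : ℤ) :
    IsUnit ((quo R) diff - (n : Quo R)) := by
  set π := quo R
  have h1 : IsUnit (π (inlK (K.shift (-n) (pol R)))) :=
    (((K.isUnit_pol R.2).map (K.shift (-n))).map inlK).map π
  have h2 : π (inrP R) = 0 := quo_eq_zero_iff.mpr (mem_rel.mpr ⟨1, one_mul _⟩)
  refine isUnit_of_dvd_unit ?_ h1
  have e1 : π (inlK (K.shift (-n) (pol R))) =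
      ((R : Polynomial ℂ).map (algebraMap ℂ (Quo R))).eval
        (π (inlK (pol Polynomial.X)) - (n : Quo R)) := by
    rw [← Polynomial.eval₂_eq_eval_map, ← Polynomial.aeval_def]
    have : ((π.comp inlK).comp (K.shift (-n))).comp pol =
        Polynomial.aeval (π (inlK (pol Polynomial.X)) - (n : Quo R)) := by
      apply Polynomial.algHom_ext
      simp [K.shift_X, sub_eq_add_neg]
    exact DFunLike.congr_fun this _
  have e2 : π (inrP R) = ((R : Polynomial ℂ).map (algebraMap ℂ (Quo R))).eval
      (π (inrP Polynomial.X)) := by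
    rw [← Polynomial.eval₂_eq_eval_map, ← Polynomial.aeval_def]
    have : π.comp inrP = Polynomial.aeval (π (inrP Polynomial.X)) := by
      apply Polynomial.algHom_ext
      simp
    exact DFunLike.congr_fun this _
  have := Polynomial.sub_dvd_eval_sub (π (inlK (pol Polynomial.X)) - (n : Quo R))
    (π (inrP Polynomial.X)) ((R : Polynomial ℂ).map (algebraMap ℂ (Quo R)))
  rw [← e1, ← e2, h2, sub_zero] at this
  rw [diff_eq, map_sub]
  convert this using 1
  ring

/-- The expansion of `q(κ - γ)` modulo `R(γ)`. -/
def exp (R : poleSet) : K →ₐ[ℂ] Quo R :=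
  K.lift (quo R diff) (isUnit_diff_sub R)

/-- `z` represents the expansion of `q(κ - γ)` modulo `R(γ)`. -/
def IsRep (R : poleSet) (q : K) (z : KP) : Prop := quo R z = exp R q

theorem exists_isRep (R : poleSet) (q : K) : ∃ z, IsRep R q z :=
  quo_surjective R _

theorem exp_X (R : poleSet) :
    exp R (pol Polynomial.X) = quo R diff := by
  simp [exp, K.lift_pol]

theorem IsRep.add {R : poleSet} {q q' : K} {z z' : KP} (h : IsRep R q z) (h' : IsRep R q' z') :
    IsRep R (q + q') (z + z') := by
  rw [IsRep, map_add, map_add, h, h']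

theorem IsRep.mul {R : poleSet} {q q' : K} {z z' : KP} (h : IsRep R q z) (h' : IsRep R q' z') :
    IsRep R (q * q') (z * z') := by
  rw [IsRep, map_mul, map_mul, h, h']

theorem IsRep.smul {R : poleSet} {q : K} {z : KP} (c : ℂ) (h : IsRep R q z) :
    IsRep R (c • q) (c • z) := by
  rw [IsRep, map_smul, map_smul, h]

theorem isRep_pol (R : poleSet) (p : Polynomial ℂ) : IsRep R (pol p) (Polynomial.aeval diff p) := by
  rw [IsRep, exp, K.lift_pol]
  exact (Polynomial.aeval_algHom_apply _ _ _).symm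

theorem isRep_X (R : poleSet) : IsRep R (pol Polynomial.X) diff := (exp_X R).symm

/-- Algebra homomorphisms that map differences to functions of the difference map expansions to
expansions. -/
theorem IsRep.map {R R' : poleSet} {q : K} {z : KP} (h : IsRep R q z) (θ : KP →ₐ[ℂ] KP)
    (σ : K →ₐ[ℂ] K) (hR : θ (inrP R) ∈ rel R')
    (hσ : IsRep R' (σ (pol Polynomial.X)) (θ diff)) : IsRep R' (σ q) (θ z) := by
  have hle : ∀ x ∈ rel R, ((quo R').comp θ) x = 0 := by
    intro x hx
    obtain ⟨w, rfl⟩ := mem_rel.mp hx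
    rw [map_mul, AlgHom.comp_apply, AlgHom.comp_apply, quo_eq_zero_iff.mpr hR, mul_zero]
  have : ((quoLift R ((quo R').comp θ) hle).comp (exp R)) =
      (exp R').comp σ := by
    apply K.algHom_ext
    rw [AlgHom.comp_apply, exp_X, AlgHom.comp_apply, ← hσ]
    rfl
  have := DFunLike.congr_fun this q
  rw [AlgHom.comp_apply, ← h] at this
  exact this

/-- An expansion computed modulo a large common denominator serves every divisor of it, so forms
with different denominators can share one representative. -/
theorem IsRep.of_dvd {R R' : poleSet} {q : K} {z : KP} (h : IsRep R q z)
    (hR : (R' : Polynomial ℂ) ∣ R) : IsRep R' q z := by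
  refine h.map (AlgHom.id ℂ KP) (AlgHom.id ℂ K) ?_ (isRep_X R')
  obtain ⟨S, h⟩ := hR
  rw [h]
  exact mem_rel.mpr ⟨inrP S, by rw [AlgHom.id_apply, map_mul, mul_comm]⟩

/-- The shift `κ ↦ κ + n`. -/
def shiftL (n : ℤ) : KP →ₐ[ℂ] KP := Algebra.TensorProduct.map (K.shift n) (AlgHom.id ℂ _)

/-- The translation `X ↦ X + n` of polynomials. -/
def pshift (n : ℤ) : Polynomial ℂ →ₐ[ℂ] Polynomial ℂ :=
  Polynomial.aeval (Polynomial.X + Polynomial.C (n : ℂ))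

theorem pol_pshift (n : ℤ) (G : Polynomial ℂ) : pol (pshift n G) = K.shift n (pol G) := by
  have : pol.comp (pshift n) = (K.shift n).comp pol := by
    apply Polynomial.algHom_ext
    simp [pshift, K.shift_X]
  exact DFunLike.congr_fun this G

theorem pshift_pshift (m n : ℤ) (G : Polynomial ℂ) : pshift m (pshift n G) = pshift (m + n) G := by
  have : (pshift m).comp (pshift n) = pshift (m + n) := by
    apply Polynomial.algHom_ext
    simp [pshift, add_assoc]
  exact DFunLike.congr_fun this G

theorem pshift_zero (G : Polynomial ℂ) : pshift 0 G = G := by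
  have : pshift 0 = AlgHom.id ℂ _ := by
    apply Polynomial.algHom_ext
    simp [pshift]
  exact DFunLike.congr_fun this G

theorem pshift_mem (n : ℤ) {R : Polynomial ℂ} (hR : R ∈ poleSet) : pshift n R ∈ poleSet := by
  induction hR using poleSet_induction with
  | one => rw [map_one]; exact poleSet.one_mem
  | mul m R _ ih =>
    rw [map_mul]
    refine poleSet.mul_mem ?_ ih
    convert X_sub_C_mem_poleSet (m - n) using 1
    simp [pshift]
    ring

/-- The shift `γ ↦ γ + n`. -/
def shiftR (n : ℤ) : KP →ₐ[ℂ] KP := Algebra.TensorProduct.map (AlgHom.id ℂ _) (pshift n)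

theorem shiftL_tmul (n : ℤ) (k : K) (G : Polynomial ℂ) : shiftL n (k ⊗ₜ G) = K.shift n k ⊗ₜ G := rfl
theorem shiftR_tmul (n : ℤ) (k : K) (G : Polynomial ℂ) : shiftR n (k ⊗ₜ G) = k ⊗ₜ pshift n G := rfl

theorem shiftL_diff (n : ℤ) : shiftL n diff = diff + (n : KP) := by
  rw [diff, map_sub, shiftL_tmul, shiftL_tmul, K.shift_X, TensorProduct.add_tmul, map_one,
    ← zsmul_one (n : ℤ), ← TensorProduct.smul_tmul', ← Algebra.TensorProduct.one_def, zsmul_one]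
  ring

theorem shiftR_diff (n : ℤ) : shiftR n diff = diff - (n : KP) := by
  rw [diff, map_sub, shiftR_tmul, shiftR_tmul, map_one]
  have : pshift n Polynomial.X = Polynomial.X + n • (1 : Polynomial ℂ) := by
    simp [pshift]
  rw [this, TensorProduct.tmul_add, TensorProduct.tmul_smul, ← Algebra.TensorProduct.one_def,
    zsmul_one]
  ring

theorem isRep_int (R : poleSet) (n : ℤ) : IsRep R (n : K) (n : KP) := by
  rw [IsRep, map_intCast, map_intCast]

theorem IsRep.shiftL {R : poleSet} {q : K} {z : KP} (h : IsRep R q z) (n : ℤ) :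
    IsRep R (K.shift n q) (shiftL n z) := by
  refine h.map (KP.shiftL n) (K.shift n) (mem_rel.mpr ⟨1, ?_⟩) ?_
  · rw [one_mul, inrP_apply, shiftL_tmul, map_one]
  · rw [K.shift_X, shiftL_diff]
    exact (isRep_X R).add (isRep_int R n)

theorem inrP_mem_rel {R : poleSet} {G : Polynomial ℂ} (h : (R : Polynomial ℂ) ∣ G) :
    inrP G ∈ rel R := by
  obtain ⟨S, rfl⟩ := h
  exact mem_rel.mpr ⟨inrP S, by rw [map_mul, mul_comm]⟩

theorem IsRep.shiftR {R R' : poleSet} {q : K} {z : KP} (h : IsRep R q z) (n : ℤ)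
    (hR : (R' : Polynomial ℂ) ∣ pshift n R) : IsRep R' (K.shift (-n) q) (shiftR n z) := by
  refine h.map (KP.shiftR n) (K.shift (-n)) ?_ ?_
  · rw [inrP_apply, shiftR_tmul]
    exact inrP_mem_rel hR
  · rw [K.shift_X, shiftR_diff, sub_eq_add_neg]
    have := (isRep_X R').add (isRep_int R' (-n))
    push_cast at this ⊢
    exact this

end KP

open KP

variable {V : Type*} [AddCommGroup V] [Module ℂ V]

/-- The linear form `β` is killed by `R(γ)`. -/
def Kills (R : poleSet) (β : KP →ₗ[ℂ] V) : Prop := ∀ z, β (z * inrP R) = 0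

/-- The linear form `β` is torsion in the second variable. -/
def IsTors (β : KP →ₗ[ℂ] V) : Prop := ∃ R, Kills R β

theorem Kills.of_dvd {R R' : poleSet} {β : KP →ₗ[ℂ] V} (h : Kills R β)
    (hR : (R : Polynomial ℂ) ∣ R') : Kills R' β := by
  obtain ⟨S, hS⟩ := hR
  intro z
  rw [hS, map_mul inrP, mul_comm (inrP _), ← mul_assoc]
  exact h _

theorem Kills.eq_of_isRep {R : poleSet} {β : KP →ₗ[ℂ] V} (h : Kills R β) {q : K} {z z' : KP}
    (hz : IsRep R q z) (hz' : IsRep R q z') : β z = β z' := by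
  have : z - z' ∈ rel R := quo_eq_iff.mp (hz.trans hz'.symm)
  obtain ⟨w, hw⟩ := mem_rel.mp this
  rw [← sub_eq_zero, ← map_sub, ← hw, h]

open Classical in
/-- The value of `β` at the expansion of `q(κ - γ)`. -/
def contract (β : KP →ₗ[ℂ] V) (q : K) : V :=
  -- The value 0 for forms without torsion is a convention. For torsion forms the chosen denominator
  -- and representative are irrelevant by `contract_eq`.
  if h : IsTors β then β (exists_isRep h.choose q).choose else 0

/-- Two representatives modulo R differ by a multiple of R(γ), which β kills. The arbitrary
denominator chosen in `contract` is compared with R through a representative modulo their product.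
-/
theorem contract_eq {R : poleSet} {β : KP →ₗ[ℂ] V} (h : Kills R β) {q : K} {z : KP}
    (hz : IsRep R q z) : contract β q = β z := by
  have h' : IsTors β := ⟨R, h⟩
  rw [contract, dif_pos h']
  obtain ⟨w, hw⟩ := exists_isRep (R * h'.choose) q
  have h1 : β z = β w := h.eq_of_isRep hz (hw.of_dvd (Dvd.intro _ rfl))
  rw [h1]
  exact h'.choose_spec.eq_of_isRep (exists_isRep h'.choose q).choose_spec
    (hw.of_dvd (Dvd.intro_left _ rfl))

theorem IsTors.add {β β' : KP →ₗ[ℂ] V} (h : IsTors β) (h' : IsTors β') : IsTors (β + β') := by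
  obtain ⟨R, h⟩ := h
  obtain ⟨R', h'⟩ := h'
  refine ⟨R * R', fun z => ?_⟩
  rw [LinearMap.add_apply, h.of_dvd (Dvd.intro _ rfl), h'.of_dvd (Dvd.intro_left _ rfl), add_zero]

theorem IsTors.comp {W : Type*} [AddCommGroup W] [Module ℂ W] {β : KP →ₗ[ℂ] V} (h : IsTors β)
    (φ : V →ₗ[ℂ] W) : IsTors (φ ∘ₗ β) := by
  obtain ⟨R, h⟩ := h
  exact ⟨R, fun z => by rw [LinearMap.comp_apply, h, map_zero]⟩

theorem contract_add {β β' : KP →ₗ[ℂ] V} (h : IsTors β) (h' : IsTors β') (q : K) :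
    contract (β + β') q = contract β q + contract β' q := by
  obtain ⟨R, h⟩ := h
  obtain ⟨R', h'⟩ := h'
  have h1 : Kills (R * R') β := h.of_dvd (Dvd.intro _ rfl)
  have h2 : Kills (R * R') β' := h'.of_dvd (Dvd.intro_left _ rfl)
  have h3 : Kills (R * R') (β + β') := fun z => by rw [LinearMap.add_apply, h1, h2, add_zero]
  obtain ⟨z, hz⟩ := exists_isRep (R * R') q
  rw [contract_eq h1 hz, contract_eq h2 hz, contract_eq h3 hz, LinearMap.add_apply]

theorem contract_comp {W : Type*} [AddCommGroup W] [Module ℂ W] {β : KP →ₗ[ℂ] V} (h : IsTors β)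
    (φ : V →ₗ[ℂ] W) (q : K) : contract (φ ∘ₗ β) q = φ (contract β q) := by
  obtain ⟨R, h⟩ := h
  obtain ⟨z, hz⟩ := exists_isRep R q
  have h1 : Kills R (φ ∘ₗ β) := fun z => by rw [LinearMap.comp_apply, h, map_zero]
  rw [contract_eq h hz, contract_eq h1 hz, LinearMap.comp_apply]

theorem contract_smul {β : KP →ₗ[ℂ] V} (h : IsTors β) (c : ℂ) (q : K) :
    contract (c • β) q = c • contract β q :=
  contract_comp h (c • LinearMap.id) q

theorem contract_add_right {β : KP →ₗ[ℂ] V} (h : IsTors β) (q q' : K) :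
    contract β (q + q') = contract β q + contract β q' := by
  obtain ⟨R, h⟩ := h
  obtain ⟨z, hz⟩ := exists_isRep R q
  obtain ⟨z', hz'⟩ := exists_isRep R q'
  rw [contract_eq h hz, contract_eq h hz', contract_eq h (hz.add hz'), map_add]

theorem contract_smul_right {β : KP →ₗ[ℂ] V} (h : IsTors β) (c : ℂ) (q : K) :
    contract β (c • q) = c • contract β q := by
  obtain ⟨R, h⟩ := h
  obtain ⟨z, hz⟩ := exists_isRep R q
  rw [contract_eq h hz, contract_eq h (hz.smul c), map_smul]

theorem contract_zero (q : K) : contract (0 : KP →ₗ[ℂ] V) q = 0 := by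
  obtain ⟨z, hz⟩ := exists_isRep 1 q
  rw [contract_eq (R := 1) (fun _ => rfl) hz, LinearMap.zero_apply]

theorem contract_pol {β : KP →ₗ[ℂ] V} (h : IsTors β) (p : Polynomial ℂ) :
    contract β (pol p) = β (Polynomial.aeval diff p) := by
  obtain ⟨R, h⟩ := h
  exact contract_eq h (isRep_pol R p)

theorem contract_mulLeft {R : poleSet} {β : KP →ₗ[ℂ] V} (h : Kills R β) {q : K} {z : KP}
    (hz : IsRep R q z) (q' : K) :
    contract (β ∘ₗ LinearMap.mulLeft ℂ z) q' = contract β (q * q') := by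
  obtain ⟨w, hw⟩ := exists_isRep R q'
  have h1 : Kills R (β ∘ₗ LinearMap.mulLeft ℂ z) := fun y => by
    rw [LinearMap.comp_apply, LinearMap.mulLeft_apply, ← mul_assoc, h]
  rw [contract_eq h1 hw, contract_eq h (hz.mul hw)]
  rfl

/-- Forms supported at `γ = n`. -/
theorem contract_eval {n : ℤ} {β : KP →ₗ[ℂ] V} (h : Kills ⟨_, X_sub_C_mem_poleSet n⟩ β) (q : K) :
    contract β q = β (K.shift (-n) q ⊗ₜ 1) := by
  refine contract_eq h ?_
  -- Modulo γ−n, the expansion of q(κ−γ) is q(κ−n): both are algebra homomorphisms in q, so it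
  -- suffices to compare them at τ.
  have : exp ⟨_, X_sub_C_mem_poleSet n⟩ =
      ((quo ⟨_, X_sub_C_mem_poleSet n⟩).comp inlK).comp (K.shift (-n)) := by
    apply K.algHom_ext
    rw [exp_X, AlgHom.comp_apply, AlgHom.comp_apply, K.shift_X]
    refine quo_eq_iff.mpr (mem_rel.mpr ⟨-1, ?_⟩)
    simp only [diff_eq, map_sub, map_add, map_intCast]
    push_cast
    ring
  exact (DFunLike.congr_fun this q).symm

/-- Forms supported at the first order neighbourhood of `γ = 0`. -/
theorem contract_eval_sq {β : KP →ₗ[ℂ] V}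
    (h : Kills (⟨_, X_sub_C_mem_poleSet 0⟩ * ⟨_, X_sub_C_mem_poleSet 0⟩) β) (q : K) :
    contract β q = β (q ⊗ₜ 1) - β (K.deriv q ⊗ₜ Polynomial.X) := by
  rw [← map_sub]
  refine contract_eq h ?_
  set R : poleSet := ⟨_, X_sub_C_mem_poleSet 0⟩ * ⟨_, X_sub_C_mem_poleSet 0⟩
  have hR : (R : Polynomial ℂ) = Polynomial.X * Polynomial.X := by
    simp [R]
  -- The first order Taylor polynomial q(κ)−q′(κ)γ. It is multiplicative modulo γ², the error for x,
  -- y being x′y′γ², and it agrees with the expansion at τ; hence it is the expansion.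
  set φ : K →ₗ[ℂ] KP := inlK.toLinearMap - (LinearMap.mulRight ℂ (inrP Polynomial.X)) ∘ₗ
    inlK.toLinearMap ∘ₗ K.deriv
  have hφ (q : K) : φ q = inlK q - inlK (K.deriv q) * inrP Polynomial.X := rfl
  have e : exp R = AlgHom.ofLinearMap ((quo R).toLinearMap ∘ₗ φ)
      (by simp [φ, K.deriv_one]) (by
        intro x y
        simp only [LinearMap.comp_apply, AlgHom.toLinearMap_apply]
        rw [← map_mul]
        refine quo_eq_iff.mpr (mem_rel.mpr ⟨-inlK (K.deriv x) * inlK (K.deriv y), ?_⟩)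
        simp only [hφ, hR, K.deriv_mul, map_mul, map_add]
        ring) := by
    apply K.algHom_ext
    rw [exp_X]
    simp only [AlgHom.ofLinearMap_apply, LinearMap.comp_apply, AlgHom.toLinearMap_apply, hφ,
      K.deriv_X, diff_eq, map_one, one_mul]
  have := (DFunLike.congr_fun e q).symm
  rw [IsRep, ← this]
  simp only [AlgHom.ofLinearMap_apply, LinearMap.comp_apply, AlgHom.toLinearMap_apply, hφ,
    inlK_mul_inrP]
  rfl

/-- The simultaneous derivative `∂_κ + ∂_γ`. -/
def derivBoth : KP →ₗ[ℂ] KP :=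
  TensorProduct.map K.deriv LinearMap.id +
    TensorProduct.map LinearMap.id (Polynomial.derivative (R := ℂ))

theorem derivBoth_tmul (k : K) (G : Polynomial ℂ) :
    derivBoth (k ⊗ₜ G) = K.deriv k ⊗ₜ G + k ⊗ₜ Polynomial.derivative G := rfl

theorem derivBoth_mul (z w : KP) : derivBoth (z * w) = z * derivBoth w + w * derivBoth z := by
  induction z using TensorProduct.induction_on with
  | zero => simp
  | add x y hx hy => rw [add_mul, map_add, hx, hy, map_add]; ring
  | tmul k G =>
    induction w using TensorProduct.induction_on with
    | zero => simp
    | add x y hx hy => rw [mul_add, map_add, hx, hy, map_add]; ring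
    | tmul l H =>
      simp only [Algebra.TensorProduct.tmul_mul_tmul, derivBoth_tmul, K.deriv_mul,
        Polynomial.derivative_mul, TensorProduct.add_tmul, TensorProduct.tmul_add, mul_add]
      rw [mul_comm H G, mul_comm l k, mul_comm H (Polynomial.derivative G)]
      abel

theorem derivBoth_one : derivBoth 1 = 0 := by
  rw [Algebra.TensorProduct.one_def, derivBoth_tmul, K.deriv_one]; simp

theorem derivBoth_diff : derivBoth diff = 0 := by
  rw [diff, map_sub, derivBoth_tmul, derivBoth_tmul, K.deriv_X, K.deriv_one]; simp

theorem derivBoth_aeval_diff (p : Polynomial ℂ) : derivBoth (Polynomial.aeval diff p) = 0 := by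
  induction p using Polynomial.induction_on' with
  | add p q hp hq => rw [map_add, map_add, hp, hq, add_zero]
  | monomial n c =>
    rw [Polynomial.aeval_monomial, ← Algebra.smul_def, map_smul]
    suffices derivBoth (diff ^ n) = 0 by rw [this, smul_zero]
    induction n with
    | zero => rw [pow_zero, derivBoth_one]
    | succ n ih => rw [pow_succ, derivBoth_mul, ih, derivBoth_diff]; simp

/-- Functions of a difference are constant along the diagonal. -/
theorem contract_derivBoth {β : KP →ₗ[ℂ] V} (h : IsTors β) (q : K) :
    contract (β ∘ₗ derivBoth) q = 0 := by
  obtain ⟨R, h⟩ := h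
  -- The square is needed because a derivation maps multiples of R² only to multiples of R.
  have hk : Kills (R * R) (β ∘ₗ derivBoth) := fun z => by
    rw [LinearMap.comp_apply, Submonoid.coe_mul, map_mul inrP, ← mul_assoc, derivBoth_mul,
      derivBoth_mul, map_add, mul_assoc z, mul_comm (inrP _) (derivBoth _), ← mul_assoc, h,
      mul_comm (inrP _), h, add_zero]
  obtain ⟨z, hz⟩ := exists_isRep (R * R) q
  rw [contract_eq hk hz, LinearMap.comp_apply]
  -- Clear the denominator of q: B(κ−γ)z ≡ A(κ−γ) modulo R². The derivation kills polynomials in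
  -- κ−γ, so B(κ−γ) times the derivative of z is a multiple of R. As B(κ−γ) is invertible modulo R,
  -- the derivative of z is itself a multiple of R, and β kills it.
  obtain ⟨B, hB, A, hA⟩ := K.exists_pol_mul_eq q
  obtain ⟨w, hw⟩ := exists_isRep (R * R) ((K.isUnit_pol hB).unit⁻¹ : Kˣ)
  set b := Polynomial.aeval diff B
  have h1 : IsRep (R * R) (pol A) (b * z) := hA ▸ (isRep_pol _ B).mul hz
  have h2 : b * z - Polynomial.aeval diff A ∈ rel (R * R) :=
    quo_eq_iff.mp (h1.trans (isRep_pol _ A).symm)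
  have h3 : ∀ y ∈ rel (R * R), derivBoth y ∈ rel R := by
    intro y hy
    obtain ⟨x, rfl⟩ := mem_rel.mp hy
    rw [Submonoid.coe_mul, map_mul inrP, ← mul_assoc, derivBoth_mul]
    have h0 : inrP R ∈ rel R := inrP_mem_rel dvd_rfl
    refine Ideal.add_mem _ (Ideal.mul_mem_right _ _ ?_) (Ideal.mul_mem_right _ _ h0)
    exact Ideal.mul_mem_left _ _ h0
  have h4 : b * derivBoth z ∈ rel R := by
    have := h3 _ h2
    rwa [map_sub, derivBoth_aeval_diff, sub_zero, derivBoth_mul, derivBoth_aeval_diff, mul_zero,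
      add_zero] at this
  have h5 : IsRep R 1 (w * b) := by
    rw [← IsUnit.val_inv_mul (K.isUnit_pol hB)]
    exact (hw.mul (isRep_pol _ B)).of_dvd (Dvd.intro _ rfl)
  have h6 : w * b - 1 ∈ rel R := by
    refine quo_eq_iff.mp (h5.trans ?_)
    rw [map_one, map_one]
  have h7 : derivBoth z ∈ rel R := by
    have e : derivBoth z = w * (b * derivBoth z) - (w * b - 1) * derivBoth z := by ring
    rw [e]
    exact Ideal.sub_mem _ (Ideal.mul_mem_left _ _ h4) (Ideal.mul_mem_right _ _ h6)
  obtain ⟨y, hy⟩ := mem_rel.mp h7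
  rw [← hy, h]

end HTVertex
end

noncomputable section
namespace HTVertex
open KP

variable {V : Type*} [AddCommGroup V] [Module ℂ V]
variable {W : Type*} [AddCommGroup W] [Module ℂ W]

/-! ### Rational distributions -/

/-- The distribution `ξ` has a rational singular part: it is holomorphic after multiplication by a
product of factors `τ - n`. -/
def IsRat (ξ : K →ₗ[ℂ] V) : Prop := ∃ R : poleSet, ∀ G, ξ (pol (R * G)) = 0

/-- The values of a distribution on polynomials. -/
def polRes (ξ : K →ₗ[ℂ] V) : Polynomial ℂ →ₗ[ℂ] V := ξ ∘ₗ pol.toLinearMap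

theorem polRes_apply (ξ : K →ₗ[ℂ] V) (G : Polynomial ℂ) : polRes ξ G = ξ (pol G) := rfl

/-- The product of a distribution with `F ∈ K`. -/
def tw (F : K) (ξ : K →ₗ[ℂ] V) : K →ₗ[ℂ] V := ξ ∘ₗ LinearMap.mulLeft ℂ F

theorem tw_apply (F : K) (ξ : K →ₗ[ℂ] V) (k : K) : tw F ξ k = ξ (F * k) := rfl

theorem tw_add (F : K) (ξ η : K →ₗ[ℂ] V) : tw F (ξ + η) = tw F ξ + tw F η := rfl

theorem tw_smul (F : K) (c : ℂ) (ξ : K →ₗ[ℂ] V) : tw F (c • ξ) = c • tw F ξ := rfl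

theorem add_tw (F F' : K) (ξ : K →ₗ[ℂ] V) : tw (F + F') ξ = tw F ξ + tw F' ξ := by
  ext k; simp [tw_apply, add_mul]

theorem smul_tw (c : ℂ) (F : K) (ξ : K →ₗ[ℂ] V) : tw (c • F) ξ = c • tw F ξ := by
  ext k; simp [tw_apply]

theorem tw_tw (F F' : K) (ξ : K →ₗ[ℂ] V) : tw F (tw F' ξ) = tw (F' * F) ξ := by
  ext k; simp [tw_apply, mul_assoc]

theorem tw_one (ξ : K →ₗ[ℂ] V) : tw 1 ξ = ξ := by
  ext k; simp [tw_apply]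

theorem IsRat.add {ξ η : K →ₗ[ℂ] V} (h : IsRat ξ) (h' : IsRat η) : IsRat (ξ + η) := by
  obtain ⟨R, h⟩ := h
  obtain ⟨R', h'⟩ := h'
  refine ⟨R * R', fun G => ?_⟩
  have h2 := h' (R * G)
  rw [LinearMap.add_apply, Submonoid.coe_mul, mul_assoc, h, zero_add, ← h2]
  congr 2; ring

theorem isRat_zero : IsRat (0 : K →ₗ[ℂ] V) := ⟨1, fun _ => rfl⟩

theorem IsRat.comp {ξ : K →ₗ[ℂ] V} (h : IsRat ξ) (φ : V →ₗ[ℂ] W) : IsRat (φ ∘ₗ ξ) := by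
  obtain ⟨R, h⟩ := h
  exact ⟨R, fun G => by rw [LinearMap.comp_apply, h, map_zero]⟩

theorem IsRat.smul {ξ : K →ₗ[ℂ] V} (h : IsRat ξ) (c : ℂ) : IsRat (c • ξ) :=
  h.comp (c • LinearMap.id)

theorem IsRat.tw {ξ : K →ₗ[ℂ] V} (h : IsRat ξ) (F : K) : IsRat (tw F ξ) := by
  obtain ⟨R, h⟩ := h
  obtain ⟨B, hB, A, hA⟩ := K.exists_pol_mul_eq F
  refine ⟨R * ⟨B, hB⟩, fun G => ?_⟩
  have : F * pol (↑(R * ⟨B, hB⟩) * G) = pol (R * (A * G)) := by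
    simp only [Submonoid.coe_mul, map_mul]
    rw [← hA]; ring
  rw [tw_apply, this, h]

/-- The bilinear form `(k, G) ↦ a(k) g(G)`. -/
def pair (a : K →ₗ[ℂ] Module.End ℂ V) (g : Polynomial ℂ →ₗ[ℂ] V) : KP →ₗ[ℂ] V :=
  TensorProduct.lift (LinearMap.compl₂ (a : K →ₗ[ℂ] V →ₗ[ℂ] V) g)

theorem pair_tmul (a : K →ₗ[ℂ] Module.End ℂ V) (g : Polynomial ℂ →ₗ[ℂ] V) (k : K)
    (G : Polynomial ℂ) : pair a g (k ⊗ₜ G) = a k (g G) := rfl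

theorem KP.hom_ext {f g : KP →ₗ[ℂ] V} (h : ∀ k G, f (k ⊗ₜ G) = g (k ⊗ₜ G)) : f = g :=
  TensorProduct.ext' h

theorem pair_add (a : K →ₗ[ℂ] Module.End ℂ V) (g g' : Polynomial ℂ →ₗ[ℂ] V) :
    pair a (g + g') = pair a g + pair a g' :=
  KP.hom_ext fun k G => by simp [pair_tmul]

theorem pair_smul (a : K →ₗ[ℂ] Module.End ℂ V) (c : ℂ) (g : Polynomial ℂ →ₗ[ℂ] V) :
    pair a (c • g) = c • pair a g :=
  KP.hom_ext fun k G => by simp [pair_tmul]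

theorem pair_zero (a : K →ₗ[ℂ] Module.End ℂ V) : pair a 0 = 0 :=
  KP.hom_ext fun k G => by simp [pair_tmul]

theorem add_pair (a a' : K →ₗ[ℂ] Module.End ℂ V) (g : Polynomial ℂ →ₗ[ℂ] V) :
    pair (a + a') g = pair a g + pair a' g :=
  KP.hom_ext fun k G => by simp [pair_tmul]

theorem smul_pair (c : ℂ) (a : K →ₗ[ℂ] Module.End ℂ V) (g : Polynomial ℂ →ₗ[ℂ] V) :
    pair (c • a) g = c • pair a g :=
  KP.hom_ext fun k G => by simp [pair_tmul]

theorem kills_pair {R : poleSet} {g : Polynomial ℂ →ₗ[ℂ] V} (h : ∀ G, g (R * G) = 0)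
    (a : K →ₗ[ℂ] Module.End ℂ V) : Kills R (pair a g) := by
  intro z
  induction z using TensorProduct.induction_on with
  | zero => simp
  | add x y hx hy => rw [add_mul, map_add, hx, hy, add_zero]
  | tmul k G =>
    rw [inrP_apply, Algebra.TensorProduct.tmul_mul_tmul, pair_tmul, mul_comm G, h, map_zero]

theorem IsRat.isTors {ξ : K →ₗ[ℂ] V} (h : IsRat ξ) (a : K →ₗ[ℂ] Module.End ℂ V) :
    IsTors (pair a (polRes ξ)) := by
  obtain ⟨R, h⟩ := h
  exact ⟨R, kills_pair h a⟩

/-- `conv a ξ q` is the value of `a(κ) ξ(γ)` at the expansion of `q(κ - γ)`, polynomial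
in `γ`. -/
def conv (a : K →ₗ[ℂ] Module.End ℂ V) (ξ : K →ₗ[ℂ] V) (q : K) : V := contract (pair a (polRes ξ)) q

theorem conv_eq {R : poleSet} {ξ : K →ₗ[ℂ] V} (h : ∀ G, ξ (pol (R * G)) = 0)
    (a : K →ₗ[ℂ] Module.End ℂ V) {q : K} {z : KP} (hz : IsRep R q z) :
    conv a ξ q = pair a (polRes ξ) z :=
  contract_eq (kills_pair h a) hz

theorem conv_add {ξ η : K →ₗ[ℂ] V} (hξ : IsRat ξ) (hη : IsRat η) (a : K →ₗ[ℂ] Module.End ℂ V)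
    (q : K) : conv a (ξ + η) q = conv a ξ q + conv a η q := by
  rw [conv, conv, conv, ← contract_add (hξ.isTors a) (hη.isTors a), ← pair_add]; rfl

theorem conv_smul {ξ : K →ₗ[ℂ] V} (hξ : IsRat ξ) (c : ℂ) (a : K →ₗ[ℂ] Module.End ℂ V)
    (q : K) : conv a (c • ξ) q = c • conv a ξ q := by
  rw [conv, conv, ← contract_smul (hξ.isTors a), ← pair_smul]; rfl

theorem add_conv {ξ : K →ₗ[ℂ] V} (hξ : IsRat ξ) (a a' : K →ₗ[ℂ] Module.End ℂ V)
    (q : K) : conv (a + a') ξ q = conv a ξ q + conv a' ξ q := by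
  rw [conv, conv, conv, ← contract_add (hξ.isTors a) (hξ.isTors a'), ← add_pair]

theorem smul_conv {ξ : K →ₗ[ℂ] V} (hξ : IsRat ξ) (c : ℂ) (a : K →ₗ[ℂ] Module.End ℂ V)
    (q : K) : conv (c • a) ξ q = c • conv a ξ q := by
  rw [conv, conv, ← contract_smul (hξ.isTors a), ← smul_pair]

theorem conv_add_right {ξ : K →ₗ[ℂ] V} (hξ : IsRat ξ) (a : K →ₗ[ℂ] Module.End ℂ V)
    (q q' : K) : conv a ξ (q + q') = conv a ξ q + conv a ξ q' :=
  contract_add_right (hξ.isTors a) q q'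

theorem conv_smul_right {ξ : K →ₗ[ℂ] V} (hξ : IsRat ξ) (c : ℂ) (a : K →ₗ[ℂ] Module.End ℂ V)
    (q : K) : conv a ξ (c • q) = c • conv a ξ q :=
  contract_smul_right (hξ.isTors a) c q

/-- `conv` sees ξ only through its values on polynomials, that is, through its singular part. A
holomorphic ξ contributes nothing. -/
theorem conv_eq_zero {ξ : K →ₗ[ℂ] V} (h : ∀ G, ξ (pol G) = 0) (a : K →ₗ[ℂ] Module.End ℂ V)
    (q : K) : conv a ξ q = 0 := by
  have : polRes ξ = 0 := LinearMap.ext h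
  rw [conv, this, pair_zero, contract_zero]

theorem conv_congr {ξ η : K →ₗ[ℂ] V} (h : ∀ G, ξ (pol G) = η (pol G))
    (a : K →ₗ[ℂ] Module.End ℂ V) (q : K) : conv a ξ q = conv a η q := by
  have : polRes ξ = polRes η := LinearMap.ext h
  rw [conv, this, conv]

/-! ### Fields -/

variable (V) in
/-- The fields: the distributions with values in `End V` such that all `D(τ) h` have rational
singular part. -/
def fieldSubmodule : Submodule ℂ (K →ₗ[ℂ] Module.End ℂ V) where
  carrier := {D | ∀ h, IsRat (D.flip h)}
  add_mem' hD hE h := (hD h).add (hE h)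
  zero_mem' _ := isRat_zero
  smul_mem' c _ hD h := (hD h).smul c

variable (V) in
/-- The space of fields. -/
def Fields : Type _ := fieldSubmodule V

instance : AddCommGroup (Fields V) := inferInstanceAs (AddCommGroup (fieldSubmodule V))
instance : Module ℂ (Fields V) := inferInstanceAs (Module ℂ (fieldSubmodule V))

namespace Fields

/-- The distribution `D(τ) h`. -/
def app (D : Fields V) (h : V) : K →ₗ[ℂ] V := D.1.flip h

theorem app_apply (D : Fields V) (h : V) (F : K) : D.app h F = D.1 F h := rfl

theorem isRat (D : Fields V) (h : V) : IsRat (D.app h) := D.2 h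

theorem app_add (D : Fields V) (h h' : V) : D.app (h + h') = D.app h + D.app h' := map_add D.1.flip h h'
theorem app_smul (D : Fields V) (c : ℂ) (h : V) : D.app (c • h) = c • D.app h := map_smul D.1.flip c h
theorem coe_add (D E : Fields V) : (D + E).1 = D.1 + E.1 := rfl
theorem coe_smul (c : ℂ) (D : Fields V) : (c • D).1 = c • D.1 := rfl
theorem add_app (D E : Fields V) (h : V) : (D + E).app h = D.app h + E.app h := rfl
theorem smul_app (D : Fields V) (c : ℂ) (h : V) : (c • D).app h = c • D.app h := rfl

theorem ext {D E : Fields V} (h : ∀ F v, D.1 F v = E.1 F v) : D = E :=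
  Subtype.ext (LinearMap.ext fun F => LinearMap.ext fun v => h F v)

/-- A denominator of ξ is also one for Φ: for F a multiple of R the distribution F ξ is holomorphic.
-/
theorem isRat_conv {ξ : K →ₗ[ℂ] V} (hξ : IsRat ξ) (a : K →ₗ[ℂ] Module.End ℂ V) (q : K)
    (Φ : K →ₗ[ℂ] V) (hΦ : ∀ F, Φ F = conv a (tw F ξ) q) : IsRat Φ := by
  obtain ⟨R, h⟩ := hξ
  refine ⟨R, fun G => ?_⟩
  rw [hΦ]
  refine conv_eq_zero (fun G' => ?_) a q
  rw [tw_apply, ← map_mul, mul_assoc, h]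

/-- The left half `a_+(τ) D(τ)` of the products of fields. -/
def left (a : K →ₗ[ℂ] Module.End ℂ V) (q : K) : Fields V →ₗ[ℂ] Fields V where
  toFun D := ⟨LinearMap.mk₂ ℂ (fun F h => conv a (tw F (D.app h)) q)
      (fun F F' h => by
        rw [add_tw]; exact conv_add ((D.isRat h).tw _) ((D.isRat h).tw _) _ _)
      (fun c F h => by rw [smul_tw]; exact conv_smul ((D.isRat h).tw _) _ _ _)
      (fun F h h' => by
        rw [app_add, tw_add]; exact conv_add ((D.isRat h).tw _) ((D.isRat h').tw _) _ _)
      (fun c F h => by rw [app_smul, tw_smul]; exact conv_smul ((D.isRat h).tw _) _ _ _),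
    fun h => isRat_conv (D.isRat h) a q _ fun F => rfl⟩
  map_add' D E := ext fun F h => conv_add ((D.isRat h).tw F) ((E.isRat h).tw F) a q
  map_smul' c D := ext fun F h => conv_smul ((D.isRat h).tw F) c a q

theorem left_apply (a : K →ₗ[ℂ] Module.End ℂ V) (q : K) (D : Fields V) (F : K) (h : V) :
    (left a q D).1 F h = conv a (tw F (D.app h)) q := rfl

/-- Since z is a finite sum of tensors k ⊗ G, the distribution is a finite sum of the k(τ)D(τ)g(G),
each rational because D is a field. -/
theorem isRat_pair (D : Fields V) (g : Polynomial ℂ →ₗ[ℂ] V) (z : KP) (Φ : K →ₗ[ℂ] V)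
    (hΦ : ∀ F, Φ F = pair (tw F D.1) g z) : IsRat Φ := by
  suffices h : ∀ z, ∃ Ψ : K →ₗ[ℂ] V, IsRat Ψ ∧ ∀ F, Ψ F = pair (tw F D.1) g z by
    obtain ⟨Ψ, h1, h2⟩ := h z
    have : Φ = Ψ := LinearMap.ext fun F => (hΦ F).trans (h2 F).symm
    exact this ▸ h1
  intro z
  induction z using TensorProduct.induction_on with
  | zero => exact ⟨0, isRat_zero, by simp⟩
  | add x y hx hy =>
    obtain ⟨Ψ, h1, h2⟩ := hx
    obtain ⟨Ψ', h1', h2'⟩ := hy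
    exact ⟨Ψ + Ψ', h1.add h1', fun F => by rw [LinearMap.add_apply, h2, h2', map_add]⟩
  | tmul k G =>
    refine ⟨tw k (D.app (g G)), (D.isRat _).tw k, fun F => ?_⟩
    rw [tw_apply, app_apply, pair_tmul, tw_apply, mul_comm]

/-- The right half `D(τ) b_-(τ)` of the products of fields. -/
def right (b : Fields V) (q : K) : Fields V →ₗ[ℂ] Fields V where
  toFun D := ⟨LinearMap.mk₂ ℂ (fun F h => conv (tw F D.1) (b.app h) q)
      (fun F F' h => by rw [add_tw]; exact add_conv (b.isRat h) _ _ _)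
      (fun c F h => by rw [smul_tw]; exact smul_conv (b.isRat h) _ _ _)
      (fun F h h' => by rw [app_add]; exact conv_add (b.isRat h) (b.isRat h') _ _)
      (fun c F h => by rw [app_smul]; exact conv_smul (b.isRat h) _ _ _),
    fun h => by
      obtain ⟨R, hR⟩ := b.isRat h
      obtain ⟨z, hz⟩ := exists_isRep R q
      exact isRat_pair D _ z _ fun F => conv_eq hR _ hz⟩
  map_add' D E := ext fun F h => by
    refine Eq.trans ?_ (add_conv (b.isRat h) (tw F D.1) (tw F E.1) q)
    rfl
  map_smul' c D := ext fun F h => by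
    refine Eq.trans ?_ (smul_conv (b.isRat h) c (tw F D.1) q)
    rfl

theorem right_apply (b : Fields V) (q : K) (D : Fields V) (F : K) (h : V) :
    (right b q D).1 F h = conv (tw F D.1) (b.app h) q := rfl

/-- The product of the fields `a` and `D` indexed by `q ∈ K`, i.e. the residue at `σ = τ + n`,
`n ∈ ℤ`, of `q(σ - τ) a(σ) D(τ)`. -/
def prodAt (a : Fields V) (q : K) : Fields V →ₗ[ℂ] Fields V := left a.1 q - right a (K.antipode q)

/-- In the first term κ = σ belongs to a, and γ = τ to D. In the second the roles are exchanged, so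
q(σ−τ) becomes `antipode q` at κ−γ. In both, the polynomial variable γ belongs to the operator that
acts first, whose poles are bounded by a denominator. -/
theorem prodAt_apply (a : Fields V) (q : K) (D : Fields V) (F : K) (h : V) :
    (prodAt a q D).1 F h =
      conv a.1 (tw F (D.app h)) q - conv (tw F D.1) (a.app h) (K.antipode q) := rfl

/-- The products of fields, as a trilinear map. -/
def prod : Fields V →ₗ[ℂ] K →ₗ[ℂ] Module.End ℂ (Fields V) :=
  LinearMap.mk₂ ℂ (fun a q => prodAt a q)
    (fun a b q => LinearMap.ext fun D => ext fun F h => by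
      change _ = (prodAt a q D).1 F h + (prodAt b q D).1 F h
      rw [prodAt_apply, prodAt_apply, prodAt_apply, add_app,
        conv_add (a.isRat h) (b.isRat h), coe_add,
        add_conv ((D.isRat h).tw F)]
      abel)
    (fun c a q => LinearMap.ext fun D => ext fun F h => by
      change _ = c • (prodAt a q D).1 F h
      rw [prodAt_apply, prodAt_apply, smul_app, conv_smul (a.isRat h), coe_smul,
        smul_conv ((D.isRat h).tw F), smul_sub])
    (fun a q q' => LinearMap.ext fun D => ext fun F h => by
      change _ = (prodAt a q D).1 F h + (prodAt a q' D).1 F h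
      rw [prodAt_apply, prodAt_apply, prodAt_apply, map_add, conv_add_right (a.isRat h),
        conv_add_right ((D.isRat h).tw F)]
      abel)
    (fun c a q => LinearMap.ext fun D => ext fun F h => by
      change _ = c • (prodAt a q D).1 F h
      rw [prodAt_apply, prodAt_apply, map_smul, conv_smul_right (a.isRat h),
        conv_smul_right ((D.isRat h).tw F), smul_sub])

theorem prod_apply (a : Fields V) (q : K) (D : Fields V) (F : K) (h : V) :
    (prod a q D).1 F h =
      conv a.1 (tw F (D.app h)) q - conv (tw F D.1) (a.app h) (K.antipode q) := rfl

end Fields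
end HTVertex
end

noncomputable section
namespace HTVertex
open KP

variable {V : Type*} [AddCommGroup V] [Module ℂ V]

theorem K.antipode_shift (n : ℤ) (F : K) :
    K.antipode (K.shift n F) = K.shift (-n) (K.antipode F) := by
  have : K.antipode.comp (K.shift n) = (K.shift (-n)).comp K.antipode := by
    apply K.algHom_ext
    simp [K.antipode_X, K.shift_X]
    ring
  exact DFunLike.congr_fun this F

/-! ### Commutators of the products of fields -/

/-- The form `G ↦ β(G(γ) w)`. -/
def slide (β : KP →ₗ[ℂ] V) (w : KP) : Polynomial ℂ →ₗ[ℂ] V :=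
  β ∘ₗ LinearMap.mulRight ℂ w ∘ₗ inrP.toLinearMap

theorem slide_apply (β : KP →ₗ[ℂ] V) (w : KP) (G : Polynomial ℂ) :
    slide β w G = β (inrP G * w) := rfl

theorem slide_add (β : KP →ₗ[ℂ] V) (w w' : KP) : slide β (w + w') = slide β w + slide β w' := by
  ext G; simp [slide_apply, mul_add]

theorem slide_zero (β : KP →ₗ[ℂ] V) : slide β 0 = 0 := by
  ext G; simp [slide_apply]

theorem slide_pair_tmul (b : K →ₗ[ℂ] Module.End ℂ V) (g : Polynomial ℂ →ₗ[ℂ] V) (l : K)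
    (H G : Polynomial ℂ) : slide (pair b g) (l ⊗ₜ H) G = b l (g (G * H)) := by
  rw [slide_apply, inrP_apply, Algebra.TensorProduct.tmul_mul_tmul, one_mul, pair_tmul]

/-- On pure tensors this is the commutation relation applied to the vector g(GH). Both forms share
the variable γ, so the shift affects only the κ of z. -/
theorem pair_slide_comm {a b : K →ₗ[ℂ] Module.End ℂ V} {s : Finset ℤ}
    {c : ℤ → K →ₗ[ℂ] Module.End ℂ V}
    (h : ∀ p q, a p * b q - b q * a p = ∑ n ∈ s, c n (K.shift n p * q))
    (g : Polynomial ℂ →ₗ[ℂ] V) (z w : KP) :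
    pair a (slide (pair b g) w) z - pair b (slide (pair a g) z) w =
      ∑ n ∈ s, pair (c n) g (shiftL n z * w) := by
  induction z using TensorProduct.induction_on with
  | zero => simp [slide_zero, pair_zero]
  | add x y hx hy =>
    rw [map_add, slide_add, pair_add, LinearMap.add_apply, add_sub_add_comm, hx, hy,
      ← Finset.sum_add_distrib]
    exact Finset.sum_congr rfl fun n _ => by rw [map_add, add_mul, map_add]
  | tmul k G =>
    induction w using TensorProduct.induction_on with
    | zero => simp [slide_zero, pair_zero]
    | add x y hx hy =>
      rw [map_add, slide_add, pair_add, LinearMap.add_apply, add_sub_add_comm, hx, hy,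
        ← Finset.sum_add_distrib]
      exact Finset.sum_congr rfl fun n _ => by rw [mul_add, map_add]
    | tmul l H =>
      rw [pair_tmul, pair_tmul, slide_pair_tmul, slide_pair_tmul, mul_comm H G]
      have := LinearMap.congr_fun (h k l) (g (G * H))
      rw [LinearMap.sum_apply] at this
      refine Eq.trans this (Finset.sum_congr rfl fun n _ => ?_)
      rw [shiftL_tmul, Algebra.TensorProduct.tmul_mul_tmul, pair_tmul]

theorem apply_pol_eq_zero_of_dvd {ξ : K →ₗ[ℂ] V} {R R' : poleSet}
    (h : ∀ G, ξ (pol (R * G)) = 0) (hR : (R : Polynomial ℂ) ∣ R') (G : Polynomial ℂ) :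
    ξ (pol (R' * G)) = 0 := by
  obtain ⟨S, hS⟩ := hR
  rw [hS, mul_assoc, h]

theorem pair_tw (b : K →ₗ[ℂ] Module.End ℂ V) (ξ : K →ₗ[ℂ] V) (G : Polynomial ℂ) :
    pair b (polRes (tw (pol G) ξ)) = pair b (polRes ξ) ∘ₗ LinearMap.mulLeft ℂ (inrP G) :=
  KP.hom_ext fun k H => by
    rw [LinearMap.comp_apply, LinearMap.mulLeft_apply, inrP_apply,
      Algebra.TensorProduct.tmul_mul_tmul, one_mul, pair_tmul, pair_tmul, polRes_apply, tw_apply,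
      polRes_apply, map_mul pol]

namespace Fields

/-- Both left halves are expanded with respect to the same γ, the variable of D. The commutator
substitutes κ+n for the first κ, and p(κ+n−γ)q(κ−γ) is the expansion of (Tⁿp)q. -/
theorem left_comm_left {a b : K →ₗ[ℂ] Module.End ℂ V} {s : Finset ℤ}
    {c : ℤ → K →ₗ[ℂ] Module.End ℂ V}
    (h : ∀ p q, a p * b q - b q * a p = ∑ n ∈ s, c n (K.shift n p * q)) (p q : K) (D : Fields V)
    (F : K) (v : V) :
    (left a p (left b q D)).1 F v - (left b q (left a p D)).1 F v =
      ∑ n ∈ s, (left (c n) (K.shift n p * q) D).1 F v := by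
  obtain ⟨R, hR⟩ := (D.isRat v).tw F
  obtain ⟨z, hz⟩ := exists_isRep R p
  obtain ⟨w, hw⟩ := exists_isRep R q
  have hG (G H : Polynomial ℂ) : tw (pol H) (tw F (D.app v)) (pol (R * G)) = 0 := by
    rw [tw_apply, ← map_mul, mul_left_comm, hR]
  have e (b : K →ₗ[ℂ] Module.End ℂ V) {q : K} {w : KP} (hw : IsRep R q w) :
      polRes (tw F ((left b q D).app v)) = slide (pair b (polRes (tw F (D.app v)))) w := by
    refine LinearMap.ext fun G => ?_
    rw [polRes_apply, tw_apply, app_apply, left_apply, ← tw_tw, conv_eq (hG · G) b hw, pair_tw]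
    rfl
  have hR' (b : K →ₗ[ℂ] Module.End ℂ V) (q : K) (G : Polynomial ℂ) :
      tw F ((left b q D).app v) (pol (R * G)) = 0 := by
    rw [tw_apply, app_apply, left_apply]
    refine conv_eq_zero (fun G' => ?_) _ _
    rw [← tw_tw, tw_apply, ← map_mul, mul_assoc, hR]
  rw [left_apply, left_apply, conv_eq (hR' b q) a hz, conv_eq (hR' a p) b hw, e b hw, e a hz,
    pair_slide_comm h]
  refine Finset.sum_congr rfl fun n _ => ?_
  rw [left_apply, conv_eq hR _ ((hz.shiftL n).mul hw)]

theorem shift_antipode_isRep {R R' : poleSet} {p : K} {z : KP} (hz : IsRep R (K.antipode p) z)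
    (n : ℤ) (hR : (R' : Polynomial ℂ) ∣ pshift n R) :
    IsRep R' (K.antipode (K.shift n p)) (shiftR n z) := by
  rw [K.antipode_shift]
  exact hz.shiftR n hR

/-- A common denominator for the singular parts of `b(τ) a_{G} v`, `G ∈ ℂ[τ]`. -/
theorem exists_uniform (a b : Fields V) (v : V) :
    ∃ R : poleSet, ∀ G G', b.1 (pol (R * G')) (a.1 (pol G) v) = 0 := by
  obtain ⟨⟨R₀, hR₀⟩, h⟩ := a.isRat v
  -- The map G ↦ a_{G}v factors through polynomials modulo R₀, so only finitely many vectors matter.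
  -- The induction on the linear factors of R₀ splits off the value of G at one root at a time.
  suffices H : ∀ g : Polynomial ℂ →ₗ[ℂ] V, (∀ G, g (R₀ * G) = 0) →
      ∃ R : poleSet, ∀ G G', b.1 (pol (R * G')) (g G) = 0 from H (polRes (a.app v)) h
  clear h
  induction hR₀ using poleSet_induction with
  | one => exact fun g h => ⟨1, fun G G' => by rw [← one_mul G, h, map_zero]⟩
  | mul n R₀ hR₀ ih =>
    intro g h
    obtain ⟨R, hR⟩ := ih (g ∘ₗ LinearMap.mulLeft ℂ (Polynomial.X - Polynomial.C (n : ℂ)))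
      fun G => by rw [LinearMap.comp_apply, LinearMap.mulLeft_apply, ← mul_assoc, h]
    obtain ⟨R', hR'⟩ := b.isRat (g 1)
    refine ⟨R * R', fun G G' => ?_⟩
    obtain ⟨G₁, hG⟩ := K.sub_dvd_pol_sub n G
    have e : g G = G.eval (n : ℂ) • g 1 + g ((Polynomial.X - Polynomial.C (n : ℂ)) * G₁) := by
      conv_lhs => rw [hG]
      rw [map_add, ← map_smul]
      congr 2
      rw [Polynomial.smul_eq_C_mul, mul_one]
    rw [e, map_add, map_smul]
    have h1 := hR G₁ (R' * G')
    have h2 := hR' (R * G')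
    rw [app_apply] at h2
    rw [Submonoid.coe_mul, mul_assoc]
    rw [LinearMap.comp_apply, LinearMap.mulLeft_apply] at h1
    rw [h1, add_zero, mul_left_comm, h2, smul_zero]

/-- The form `(k, G), (l, H) ↦ D(k l) b(H) a(G) v`. -/
def rightRight (a b : Fields V) (D : K →ₗ[ℂ] Module.End ℂ V) (v : V) : KP →ₗ[ℂ] KP →ₗ[ℂ] V :=
  TensorProduct.lift (LinearMap.mk₂ ℂ
    (fun k G => pair (tw k D) (polRes (b.app (a.1 (pol G) v))))
    (fun k k' G => by rw [add_tw, add_pair])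
    (fun c k G => by rw [smul_tw, smul_pair])
    (fun k G G' => by
      rw [map_add, map_add, LinearMap.add_apply, app_add, ← pair_add]; rfl)
    (fun c k G => by
      rw [map_smul, map_smul, LinearMap.smul_apply, app_smul, ← pair_smul]; rfl))

theorem rightRight_tmul (a b : Fields V) (D : K →ₗ[ℂ] Module.End ℂ V) (v : V) (k : K)
    (G : Polynomial ℂ) : rightRight a b D v (k ⊗ₜ G) =
      pair (tw k D) (polRes (b.app (a.1 (pol G) v))) := rfl

theorem rightRight_tmul_tmul (a b : Fields V) (D : K →ₗ[ℂ] Module.End ℂ V) (v : V) (k l : K)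
    (G H : Polynomial ℂ) : rightRight a b D v (k ⊗ₜ G) (l ⊗ₜ H) =
      D (k * l) (b.1 (pol H) (a.1 (pol G) v)) := rfl

theorem rightRight_comm {a b : Fields V} {s : Finset ℤ} {c : ℤ → Fields V}
    (h : ∀ p q, a.1 p * b.1 q - b.1 q * a.1 p = ∑ n ∈ s, (c n).1 (K.shift n p * q))
    (D : K →ₗ[ℂ] Module.End ℂ V) (v : V) (z w : KP) :
    rightRight a b D v z w - rightRight b a D v w z =
      -∑ n ∈ s, pair D (polRes ((c n).app v)) (shiftR n z * w) := by
  induction z using TensorProduct.induction_on with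
  | zero => simp
  | add x y hx hy =>
    rw [map_add, map_add, LinearMap.add_apply, add_sub_add_comm, hx, hy, ← neg_add,
      ← Finset.sum_add_distrib]
    congr 1
    exact Finset.sum_congr rfl fun n _ => by rw [map_add, add_mul, map_add]
  | tmul k G =>
    induction w using TensorProduct.induction_on with
    | zero => simp
    | add x y hx hy =>
      rw [map_add, map_add, LinearMap.add_apply, add_sub_add_comm, hx, hy, ← neg_add,
        ← Finset.sum_add_distrib]
      congr 1
      exact Finset.sum_congr rfl fun n _ => by rw [mul_add, map_add]
    | tmul l H =>
      rw [rightRight_tmul_tmul, rightRight_tmul_tmul, mul_comm l k]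
      have := congrArg (D (k * l)) (LinearMap.congr_fun (h (pol G) (pol H)) v)
      rw [LinearMap.sum_apply, map_sum] at this
      rw [← neg_sub, ← map_sub]
      refine congrArg _ (Eq.trans this (Finset.sum_congr rfl fun n _ => ?_))
      rw [shiftR_tmul, Algebra.TensorProduct.tmul_mul_tmul, pair_tmul, polRes_apply, map_mul pol,
        pol_pshift]
      rfl

/-- The inner product is expanded for all vectors a_{G}v at once. This is possible with one
representative w only because the denominator in `hb` is uniform in G. -/
theorem right_right_eq {a b : Fields V} {R : poleSet} {v : V}
    (ha : ∀ G, a.app v (pol (R * G)) = 0)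
    (hb : ∀ G G', b.1 (pol (R * G')) (a.1 (pol G) v) = 0) {p q : K} {z w : KP} (hz : IsRep R p z)
    (hw : IsRep R q w) (D : Fields V) (F : K) :
    (right a p (right b q D)).1 F v = rightRight a b (tw F D.1) v z w := by
  rw [right_apply, conv_eq ha _ hz]
  have : pair (tw F (right b q D).1) (polRes (a.app v)) = (rightRight a b (tw F D.1) v).flip w := by
    refine KP.hom_ext fun k G => ?_
    rw [pair_tmul, tw_apply, right_apply, LinearMap.flip_apply, rightRight_tmul, tw_tw]
    exact conv_eq (hb G) _ hw
  rw [this, LinearMap.flip_apply]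

/-- Multiplying by R n and by its translate by −n achieves both divisibilities. The commutator
formulas need them because they substitute γ+n for γ. -/
theorem exists_common_shift (s : Finset ℤ) (R : ℤ → poleSet) :
    ∃ R' : poleSet, ∀ n ∈ s, (R n : Polynomial ℂ) ∣ R' ∧ (R n : Polynomial ℂ) ∣ pshift n R' := by
  induction s using Finset.induction_on with
  | empty => exact ⟨1, by simp⟩
  | insert n s _ ih =>
    obtain ⟨R', h⟩ := ih
    refine ⟨R' * (R n * ⟨_, pshift_mem (-n) (R n).2⟩), fun m hm => ?_⟩
    rw [Submonoid.coe_mul, Submonoid.coe_mul, map_mul, map_mul]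
    rcases Finset.mem_insert.mp hm with rfl | hm
    · rw [pshift_pshift, add_neg_cancel, pshift_zero]
      exact ⟨(dvd_mul_right _ _).mul_left _, (dvd_mul_left _ _).mul_left _⟩
    · exact ⟨(h m hm).1.mul_right _, (h m hm).2.mul_right _⟩

/-- Here D carries the common κ, while a and b carry the polynomial variables. The commutator
substitutes γ+n on the γ side, which turns (Sp)(κ−γ) into (Sp)(κ−γ−n), the expansion of S(Tⁿp). The
sign arises because right factors compose in the opposite order. -/
theorem right_comm_right {a b : Fields V} {s : Finset ℤ} {c : ℤ → Fields V}
    (h : ∀ p q, a.1 p * b.1 q - b.1 q * a.1 p = ∑ n ∈ s, (c n).1 (K.shift n p * q)) (p q : K)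
    (D : Fields V) (F : K) (v : V) :
    (right a (K.antipode p) (right b (K.antipode q) D)).1 F v -
      (right b (K.antipode q) (right a (K.antipode p) D)).1 F v =
      -∑ n ∈ s, (right (c n) (K.antipode (K.shift n p * q)) D).1 F v := by
  obtain ⟨R₁, h₁⟩ := a.isRat v
  obtain ⟨R₂, h₂⟩ := b.isRat v
  obtain ⟨R₃, h₃⟩ := exists_uniform a b v
  obtain ⟨R₄, h₄⟩ := exists_uniform b a v
  choose R₅ h₅ using fun n => (c n).isRat v
  obtain ⟨R₆, h₆⟩ := exists_common_shift s R₅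
  obtain ⟨R, d₁, d₂, d₃, d₄, d₅⟩ : ∃ R : poleSet, (R₁ : Polynomial ℂ) ∣ R ∧
      (R₂ : Polynomial ℂ) ∣ R ∧ (R₃ : Polynomial ℂ) ∣ R ∧ (R₄ : Polynomial ℂ) ∣ R ∧
      (R₆ : Polynomial ℂ) ∣ R :=
    ⟨R₁ * (R₂ * (R₃ * (R₄ * R₆))), dvd_mul_right _ _, (dvd_mul_right _ _).mul_left _,
      ((dvd_mul_right _ _).mul_left _).mul_left _,
      (((dvd_mul_right _ _).mul_left _).mul_left _).mul_left _,
      (((dvd_mul_left _ _).mul_left _).mul_left _).mul_left _⟩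
  have k₁ := apply_pol_eq_zero_of_dvd h₁ d₁
  have k₂ := apply_pol_eq_zero_of_dvd h₂ d₂
  have k₃ (G : Polynomial ℂ) := apply_pol_eq_zero_of_dvd (ξ := b.app (a.1 (pol G) v)) (h₃ G) d₃
  have k₄ (G : Polynomial ℂ) := apply_pol_eq_zero_of_dvd (ξ := a.app (b.1 (pol G) v)) (h₄ G) d₄
  obtain ⟨z, hz⟩ := exists_isRep R (K.antipode p)
  obtain ⟨w, hw⟩ := exists_isRep R (K.antipode q)
  rw [right_right_eq k₁ k₃ hz hw, right_right_eq k₂ k₄ hw hz, rightRight_comm h]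
  congr 1
  refine Finset.sum_congr rfl fun n hn => ?_
  have d1 : (R₅ n : Polynomial ℂ) ∣ R := (h₆ n hn).1.trans d₅
  have d2 : (R₅ n : Polynomial ℂ) ∣ pshift n R := by
    exact (h₆ n hn).2.trans (map_dvd (pshift n) d₅)
  rw [right_apply, map_mul K.antipode]
  exact (conv_eq (h₅ n) _ ((shift_antipode_isRep hz n d2).mul (hw.of_dvd d1))).symm

/-- The distribution `F ↦ ∑ D(F k) g(G)` for `w = ∑ k ⊗ G`. -/
def pairAt (D : Fields V) (g : Polynomial ℂ →ₗ[ℂ] V) (w : KP) : K →ₗ[ℂ] V where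
  toFun F := pair (tw F D.1) g w
  map_add' F F' := by rw [add_tw, add_pair, LinearMap.add_apply]
  map_smul' c F := by rw [smul_tw, smul_pair]; rfl

theorem pairAt_add (D : Fields V) (g : Polynomial ℂ →ₗ[ℂ] V) (w w' : KP) :
    pairAt D g (w + w') = pairAt D g w + pairAt D g w' :=
  LinearMap.ext fun F => map_add (pair (tw F D.1) g) w w'

theorem isRat_pairAt (D : Fields V) (g : Polynomial ℂ →ₗ[ℂ] V) (w : KP) : IsRat (pairAt D g w) :=
  isRat_pair D g w _ fun _ => rfl

/-- In both orders a acts last and b acts first, with D in between. Once the right half is written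
as a finite sum of multiples of D, applied to fixed vectors, the left half acts on each summand
separately. -/
theorem left_comm_right (a : K →ₗ[ℂ] Module.End ℂ V) (b : Fields V) (p q : K) (D : Fields V)
    (F : K) (v : V) : (left a p (right b q D)).1 F v = (right b q (left a p D)).1 F v := by
  obtain ⟨R, hR⟩ := b.isRat v
  obtain ⟨w, hw⟩ := exists_isRep R q
  have e1 : (right b q D).app v = pairAt D (polRes (b.app v)) w :=
    LinearMap.ext fun F => conv_eq hR _ hw
  rw [left_apply, e1, right_apply, conv_eq hR _ hw]
  clear hw e1
  induction w using TensorProduct.induction_on with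
  | zero =>
    rw [map_zero]
    refine conv_eq_zero (fun G => ?_) _ _
    exact map_zero (pair (tw (F * pol G) D.1) (polRes (b.app v)))
  | add x y hx hy =>
    rw [pairAt_add, tw_add, conv_add ((isRat_pairAt D _ x).tw F) ((isRat_pairAt D _ y).tw F), hx, hy,
      map_add]
  | tmul k G =>
    rw [pair_tmul, tw_apply, left_apply]
    refine conv_congr (fun H => ?_) _ _
    change D.1 (F * pol H * k) _ = D.1 (F * k * pol H) _
    rw [mul_right_comm]

/-- Split each product into its halves. Mixed halves commute, the two left halves yield the left
halves of the products with c_n, and the two right halves yield minus their right halves. No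
locality is used, so this makes the space of all fields a module over the Lie algebra. -/
theorem prod_comm {a b : Fields V} {s : Finset ℤ} {c : ℤ → Fields V}
    (h : ∀ p q, a.1 p * b.1 q - b.1 q * a.1 p = ∑ n ∈ s, (c n).1 (K.shift n p * q)) (p q : K) :
    prod a p * prod b q - prod b q * prod a p = ∑ n ∈ s, prod (c n) (K.shift n p * q) := by
  refine LinearMap.ext fun D => ext fun F v => ?_
  have e (a b : Fields V) (p q : K) : (prod a p (prod b q D)).1 F v =
      (left a.1 p (left b.1 q D)).1 F v - (right a (K.antipode p) (left b.1 q D)).1 F v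
        - ((left a.1 p (right b (K.antipode q) D)).1 F v -
          (right a (K.antipode p) (right b (K.antipode q) D)).1 F v) := by
    change ((prodAt a p (prodAt b q D))).1 F v = _
    rw [prodAt, prodAt]
    simp only [LinearMap.sub_apply, map_sub]
    rfl
  have e1 := left_comm_left h p q D F v
  have e2 := right_comm_right h p q D F v
  have e3 : (∑ n ∈ s, prod (c n) (K.shift n p * q)) D = ∑ n ∈ s, prod (c n) (K.shift n p * q) D :=
    LinearMap.sum_apply _ _ _
  have e4 : (∑ n ∈ s, prod (c n) (K.shift n p * q) D).1 F v =
      ∑ n ∈ s, (prod (c n) (K.shift n p * q) D).1 F v := by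
    let ψ : Fields V →ₗ[ℂ] V := LinearMap.applyₗ v ∘ₗ LinearMap.applyₗ F ∘ₗ (fieldSubmodule V).subtype
    exact map_sum ψ _ _
  rw [e3, e4]
  change (prod a p (prod b q D)).1 F v - (prod b q (prod a p D)).1 F v = _
  rw [e, e, left_comm_right a.1 b, ← left_comm_right b.1 a]
  have e5 : ∑ n ∈ s, (prod (c n) (K.shift n p * q) D).1 F v =
      ∑ n ∈ s, (left (c n).1 (K.shift n p * q) D).1 F v -
      ∑ n ∈ s, (right (c n) (K.antipode (K.shift n p * q)) D).1 F v := by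
    rw [← Finset.sum_sub_distrib]; rfl
  rw [e5, ← e1, sub_eq_add_neg _ (∑ n ∈ s, _), ← e2]
  abel

end Fields
end HTVertex
end

/-! ### The induced module, its generating fields, and the state-field correspondence. -/

noncomputable section
namespace HTVertex
open KP

variable {C : Type*} [AddCommGroup C] [Module ℂ C] [HTConformalAlgebra C]

attribute [local instance] LieRing.ofAssociativeRing

theorem act_add (x y : LieOf C) (w : VacMod C) : act (x + y) w = act x w + act y w := by
  rw [act, map_add, add_smul]; rfl

theorem act_smul (c : ℂ) (x : LieOf C) (w : VacMod C) : act (c • x) w = c • act x w := by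
  rw [act, map_smul, smul_assoc]; rfl

/-- The action of `𝓛C` on the induced module, as a representation. -/
def actₗ : LieOf C →ₗ[ℂ] Module.End ℂ (VacMod C) :=
  LinearMap.mk₂ ℂ (fun x w => act x w) act_add act_smul
    (fun _ w w' => smul_add _ w w') (fun c _ w => smul_algebra_smul_comm c _ w)

theorem actₗ_apply (x : LieOf C) (w : VacMod C) : actₗ x w = act x w := rfl

theorem act_add_right (x : LieOf C) (w w' : VacMod C) : act x (w + w') = act x w + act x w' :=
  map_add (actₗ x) w w'
theorem act_sub_right (x : LieOf C) (w w' : VacMod C) : act x (w - w') = act x w - act x w' :=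
  map_sub (actₗ x) w w'
theorem act_smul_right (x : LieOf C) (c : ℂ) (w : VacMod C) : act x (c • w) = c • act x w :=
  map_smul (actₗ x) c w
theorem act_zero_right (x : LieOf C) : act x (0 : VacMod C) = 0 := map_zero (actₗ x)

theorem act_lie (x y : LieOf C) (w : VacMod C) :
    act ⁅x, y⁆ w = act x (act y w) - act y (act x w) := by
  rw [act, LieHom.map_lie, LieRing.of_associative_ring_bracket, sub_smul, mul_smul, mul_smul]; rfl

/-- Every element of the enveloping algebra is a sum of products of elements of the Lie
algebra. -/
theorem envelopingAlgebra_induction {L : Type*} [LieRing L] [LieAlgebra ℂ L]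
    {p : UniversalEnvelopingAlgebra ℂ L → Prop} (one : p 1)
    (ι_mul : ∀ x a, p a → p (UniversalEnvelopingAlgebra.ι ℂ x * a))
    (add : ∀ a b, p a → p b → p (a + b)) (smul : ∀ (c : ℂ) a, p a → p (c • a))
    (a : UniversalEnvelopingAlgebra ℂ L) : p a := by
  -- The elements whose left multiplication preserves p form a subalgebra containing the Lie
  -- algebra. The universal property gives a homomorphism into it that splits the inclusion, so it
  -- is everything.
  let S : Subalgebra ℂ (UniversalEnvelopingAlgebra ℂ L) :=
    { carrier := {a | ∀ b, p b → p (a * b)}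
      mul_mem' := fun {a a'} h h' b hb => by rw [mul_assoc]; exact h _ (h' _ hb)
      add_mem' := fun {a a'} h h' b hb => by rw [add_mul]; exact add _ _ (h _ hb) (h' _ hb)
      algebraMap_mem' := fun c b hb => by rw [← Algebra.smul_def]; exact smul c b hb }
  let f : L →ₗ⁅ℂ⁆ S :=
    { toFun := fun x => ⟨UniversalEnvelopingAlgebra.ι ℂ x, fun b hb => ι_mul x b hb⟩
      map_add' := fun x y => Subtype.ext (map_add _ x y)
      map_smul' := fun c x => Subtype.ext (map_smul _ c x)
      map_lie' := fun {x y} => Subtype.ext (LieHom.map_lie _ x y) }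
  have h : S.val.comp (UniversalEnvelopingAlgebra.lift ℂ f) = AlgHom.id ℂ _ := by
    apply UniversalEnvelopingAlgebra.hom_ext
    refine LieHom.ext fun x => ?_
    change S.val (UniversalEnvelopingAlgebra.lift ℂ f (UniversalEnvelopingAlgebra.ι ℂ x)) = _
    rw [UniversalEnvelopingAlgebra.lift_ι_apply]
    rfl
  have h1 : a = S.val (UniversalEnvelopingAlgebra.lift ℂ f a) := (DFunLike.congr_fun h a).symm
  rw [h1, ← mul_one (S.val _)]
  exact (UniversalEnvelopingAlgebra.lift ℂ f a).2 1 one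

/-- The span of the modes is the whole Lie algebra. -/
theorem lieOf_induction {p : LieOf C → Prop} (zero : p 0) (mode : ∀ f F, p (HTVertex.mode f F))
    (add : ∀ x y, p x → p y → p (x + y)) (x : LieOf C) : p x := by
  obtain ⟨y, rfl⟩ := (totalDiff C).mkQ_surjective x
  induction y using TensorProduct.induction_on with
  | zero => rw [map_zero]; exact zero
  | add x y hx hy => rw [map_add]; exact add _ _ hx hy
  | tmul f F => exact mode f F

theorem vacMod_induction_lie {p : VacMod C → Prop} (v0 : p (v0 C)) (act : ∀ x w, p w → p (HTVertex.act x w))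
    (add : ∀ w w', p w → p w' → p (w + w')) (smul : ∀ (c : ℂ) w, p w → p (c • w))
    (w : VacMod C) : p w := by
  obtain ⟨a, rfl⟩ := (annIdeal C).mkQ_surjective w
  induction a using envelopingAlgebra_induction with
  | one => exact v0
  | ι_mul x a ih => exact act x _ ih
  | add a b ha hb => exact add _ _ ha hb
  | smul c a ih => exact smul c _ ih

theorem vacMod_induction {p : VacMod C → Prop} (v0 : p (v0 C))
    (act : ∀ f F w, p w → p (HTVertex.act (mode f F) w))
    (add : ∀ w w', p w → p w' → p (w + w')) (smul : ∀ (c : ℂ) w, p w → p (c • w))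
    (w : VacMod C) : p w := by
  refine vacMod_induction_lie v0 (fun x w hw => ?_) add smul w
  induction x using lieOf_induction with
  | zero => 
    have : HTVertex.act (0 : LieOf C) w = (0 : ℂ) • w := by
      rw [← actₗ_apply, map_zero, zero_smul]; rfl
    rw [this]; exact smul _ _ hw
  | mode f F => exact act f F w hw
  | add x y hx hy => rw [act_add]; exact add _ _ hx hy

theorem mode_mem_ann (f : C) (G : Polynomial ℂ) : mode f (pol G) ∈ ann C :=
  Submodule.subset_span ⟨f, pol G, ⟨G, rfl⟩, rfl⟩

theorem mode_mem_cr (f : C) {p : K} (hp : p ∈ K.sing) : mode f p ∈ cr C :=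
  Submodule.subset_span ⟨f, p, hp, rfl⟩

theorem act_v0_of_mem_ann {x : LieOf C} (hx : x ∈ ann C) : act x (v0 C) = 0 := by
  have h : act x (v0 C) = (annIdeal C).mkQ (UniversalEnvelopingAlgebra.ι ℂ x * 1) := rfl
  rw [h, mul_one]
  refine (Submodule.Quotient.mk_eq_zero _).mpr ?_
  exact Submodule.subset_span ⟨x, hx, rfl⟩

theorem act_pol_v0 (f : C) (G : Polynomial ℂ) : act (mode f (pol G)) (v0 C) = 0 :=
  act_v0_of_mem_ann (mode_mem_ann f G)

section lift
variable {N : Type*} [AddCommGroup N] [Module ℂ N]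

/-- The universal property of the induced module. -/
theorem exists_vacMod_lift (ρ : LieOf C →ₗ[ℂ] Module.End ℂ N)
    (hρ : ∀ x y, ρ ⁅x, y⁆ = ρ x * ρ y - ρ y * ρ x) (n : N) (hn : ∀ x ∈ ann C, ρ x n = 0) :
    ∃ φ : VacMod C →ₗ[ℂ] N, φ (v0 C) = n ∧ ∀ x w, φ (act x w) = ρ x (φ w) := by
  let f : LieOf C →ₗ⁅ℂ⁆ Module.End ℂ N := { ρ with map_lie' := fun {x y} => hρ x y }
  let F := UniversalEnvelopingAlgebra.lift ℂ f
  have hF (x : LieOf C) : F (UniversalEnvelopingAlgebra.ι ℂ x) = ρ x :=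
    UniversalEnvelopingAlgebra.lift_ι_apply ℂ f x
  let ψ : UniversalEnvelopingAlgebra ℂ (LieOf C) →ₗ[ℂ] N := LinearMap.applyₗ n ∘ₗ F.toLinearMap
  have hψ (a b : UniversalEnvelopingAlgebra ℂ (LieOf C)) : ψ (a * b) = F a (ψ b) := by
    change F (a * b) n = F a (F b n)
    rw [map_mul]; rfl
  have hker : (annIdeal C).restrictScalars ℂ ≤ LinearMap.ker ψ := by
    intro a ha
    change a ∈ annIdeal C at ha
    rw [LinearMap.mem_ker]
    induction ha using Submodule.span_induction with
    | zero => exact map_zero ψ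
    | add x y _ _ hx hy => rw [map_add, hx, hy, add_zero]
    | smul a x _ hx => rw [smul_eq_mul, hψ, hx, map_zero]
    | mem y hy =>
      obtain ⟨x, hx, rfl⟩ := hy
      change F _ n = 0
      rw [hF, hn x hx]
  refine ⟨((annIdeal C).restrictScalars ℂ).liftQ ψ hker, ?_, fun x w => ?_⟩
  · change F 1 n = n
    rw [map_one]; rfl
  · obtain ⟨a, rfl⟩ := (annIdeal C).mkQ_surjective w
    change ψ (_ * a) = ρ x (ψ a)
    rw [hψ, hF]

end lift

theorem lie_mode_sum (f g : C) (p q : K) :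
    ⁅mode f p, mode g q⁆ = ∑ n ∈ (HTConformalAlgebra.prod f g).support,
      mode (HTConformalAlgebra.prod f g n) (K.shift n p * q) := by
  rw [lie_mode, ← finsum_mode]; rfl

/-- The vertex operator of a generating field. -/
def modeEnd (f : C) : K →ₗ[ℂ] Module.End ℂ (VacMod C) := actₗ ∘ₗ mode f

theorem modeEnd_apply (f : C) (p : K) (w : VacMod C) : modeEnd f p w = act (mode f p) w := rfl

/-- A polynomial mode f_{G} moved past g_{q} leaves the finitely many terms (f_n g)_{(TⁿG)q}w. By
induction each has a denominator, and a common multiple of suitable translates serves them all,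
together with the denominator for f_{G}w. -/
theorem isRat_modeEnd (f : C) (w : VacMod C) : IsRat ((modeEnd f).flip w) := by
  induction w using vacMod_induction generalizing f with
  | v0 => exact ⟨1, fun G => by rw [LinearMap.flip_apply, modeEnd_apply, act_pol_v0]⟩
  | add w w' h h' => rw [map_add]; exact (h f).add (h' f)
  | smul c w h => rw [map_smul]; exact (h f).smul c
  | act g q w ih =>
    choose R hR using fun n => (ih (HTConformalAlgebra.prod f g n)).tw q
    obtain ⟨R₁, h₁⟩ := ih f
    obtain ⟨R₂, h₂⟩ := Fields.exists_common_shift (HTConformalAlgebra.prod f g).support R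
    refine ⟨R₁ * R₂, fun G => ?_⟩
    have e1 := h₁ (R₂ * G)
    rw [← mul_assoc, LinearMap.flip_apply, modeEnd_apply] at e1
    rw [LinearMap.flip_apply, modeEnd_apply, Submonoid.coe_mul]
    have := act_lie (mode f (pol (R₁ * R₂ * G))) (mode g q) w
    rw [e1, act_zero_right, sub_zero] at this
    rw [← this, lie_mode_sum, ← actₗ_apply, map_sum, LinearMap.sum_apply]
    refine Finset.sum_eq_zero fun n hn => ?_
    obtain ⟨S, hS⟩ := (h₂ n hn).2
    have e2 := hR n (S * pshift n R₁ * pshift n G)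
    rw [tw_apply, LinearMap.flip_apply, modeEnd_apply] at e2
    rw [actₗ_apply, ← e2]
    congr 2
    rw [← pol_pshift, map_mul (pshift n), map_mul (pshift n), hS, mul_comm q]
    congr 2
    ring

/-- The generating fields. -/
def gen : C →ₗ[ℂ] Fields (VacMod C) where
  toFun f := ⟨modeEnd f, isRat_modeEnd f⟩
  map_add' f g := Fields.ext fun F v => by
    change act (mode (f + g) F) v = act (mode f F) v + act (mode g F) v
    rw [map_add, LinearMap.add_apply, act_add]
  map_smul' c f := Fields.ext fun F v => by
    change act (mode (c • f) F) v = c • act (mode f F) v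
    rw [map_smul, LinearMap.smul_apply, act_smul]

theorem gen_apply (f : C) (F : K) (v : VacMod C) : (gen f).1 F v = act (mode f F) v := rfl

theorem gen_comm (f g : C) (p q : K) : (gen f).1 p * (gen g).1 q - (gen g).1 q * (gen f).1 p =
    ∑ n ∈ (HTConformalAlgebra.prod f g).support,
      (gen (HTConformalAlgebra.prod f g n)).1 (K.shift n p * q) := by
  refine LinearMap.ext fun w => ?_
  rw [LinearMap.sum_apply]
  refine (act_lie (mode f p) (mode g q) w).symm.trans ?_
  rw [lie_mode_sum, ← actₗ_apply, map_sum, LinearMap.sum_apply]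
  rfl

/-- Covariance of the generating fields under `T`. -/
theorem mode_T_eq (f : C) (p : K) :
    mode (HTConformalAlgebra.T f) p = mode f (K.shift (-1) p) := by
  rw [← mode_T f (K.shift (-1) p), K.shift_shift, add_neg_cancel, K.shift_zero]

section
variable {V : Type*} [AddCommGroup V] [Module ℂ V]

/-- Translation of the first argument. -/
theorem conv_shift_left {ξ : K →ₗ[ℂ] V} (h : IsRat ξ) (a : K →ₗ[ℂ] Module.End ℂ V) (n : ℤ) (q : K) :
    conv (a ∘ₗ (K.shift n).toLinearMap) ξ q = conv a ξ (K.shift n q) := by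
  obtain ⟨R, hR⟩ := h
  obtain ⟨z, hz⟩ := exists_isRep R q
  rw [conv_eq hR _ hz, conv_eq hR _ (hz.shiftL n)]
  have : pair (a ∘ₗ (K.shift n).toLinearMap) (polRes ξ) =
      pair a (polRes ξ) ∘ₗ (shiftL n).toLinearMap := KP.hom_ext fun k G => rfl
  rw [this]; rfl

theorem IsRat.shift {ξ : K →ₗ[ℂ] V} (h : IsRat ξ) (n : ℤ) :
    IsRat (ξ ∘ₗ (K.shift n).toLinearMap) := by
  obtain ⟨R, hR⟩ := h
  refine ⟨⟨_, pshift_mem (-n) R.2⟩, fun G => ?_⟩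
  rw [LinearMap.comp_apply, AlgHom.toLinearMap_apply, ← pol_pshift, map_mul, pshift_pshift,
    add_neg_cancel, pshift_zero, hR]

/-- Translation of the second argument. -/
theorem conv_shift_right {ξ : K →ₗ[ℂ] V} (h : IsRat ξ) (a : K →ₗ[ℂ] Module.End ℂ V) (n : ℤ)
    (q : K) : conv a (ξ ∘ₗ (K.shift n).toLinearMap) q = conv a ξ (K.shift (-n) q) := by
  obtain ⟨R, hR⟩ := h
  set R' : poleSet := R * ⟨_, pshift_mem (-n) R.2⟩
  obtain ⟨z, hz⟩ := exists_isRep R' q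
  have h1 : ∀ G, (ξ ∘ₗ (K.shift n).toLinearMap) (pol (R' * G)) = 0 := by
    intro G
    rw [LinearMap.comp_apply, AlgHom.toLinearMap_apply, ← pol_pshift, Submonoid.coe_mul, map_mul (pshift n),
      map_mul (pshift n), pshift_pshift, add_neg_cancel, pshift_zero, mul_comm (pshift n _), mul_assoc, hR]
  have h2 : IsRep R (K.shift (-n) q) (shiftR n z) := hz.shiftR n (by
    rw [Submonoid.coe_mul, map_mul, pshift_pshift, add_neg_cancel, pshift_zero]
    exact dvd_mul_left _ _)
  rw [conv_eq h1 _ hz, conv_eq hR _ h2]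
  have : pair a (polRes (ξ ∘ₗ (K.shift n).toLinearMap)) =
      pair a (polRes ξ) ∘ₗ (shiftR n).toLinearMap := KP.hom_ext fun k G => by
    rw [LinearMap.comp_apply, AlgHom.toLinearMap_apply, shiftR_tmul, pair_tmul, pair_tmul,
      polRes_apply, polRes_apply, pol_pshift]
    rfl
  rw [this]; rfl

/-- Translating the field a is absorbed by translating the index. This makes the action on fields
vanish on the total differences. -/
theorem Fields.prod_shift (a b : Fields V) (n : ℤ)
    (h : ∀ F, a.1 F = b.1 (K.shift n F)) (q : K) : Fields.prod a q = Fields.prod b (K.shift n q) := by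
  refine LinearMap.ext fun D => Fields.ext fun F v => ?_
  rw [prod_apply, prod_apply]
  have h1 : a.1 = b.1 ∘ₗ (K.shift n).toLinearMap := LinearMap.ext h
  have h2 : a.app v = (b.app v) ∘ₗ (K.shift n).toLinearMap :=
    LinearMap.ext fun F => LinearMap.congr_fun (h F) v
  rw [h1, h2, conv_shift_left ((D.isRat v).tw F), conv_shift_right (b.isRat v), K.antipode_shift]

/-- The commutator of two distributions. -/
def commD (a b : K →ₗ[ℂ] Module.End ℂ V) : K ⊗[ℂ] K →ₗ[ℂ] Module.End ℂ V :=
  TensorProduct.lift ((LinearMap.mul ℂ (Module.End ℂ V)).compl₁₂ a b -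
    ((LinearMap.mul ℂ (Module.End ℂ V)).compl₁₂ b a).flip)

theorem commD_tmul (a b : K →ₗ[ℂ] Module.End ℂ V) (p q : K) :
    commD a b (p ⊗ₜ q) = a p * b q - b q * a p := rfl

/-- For a polynomial index no expansion is needed: both halves use the same polynomial p(σ−τ), and
their difference is the commutator multiplied by it. Hence locality annihilates suitable polynomial
products, and commuting fields have vanishing polynomial products. -/
theorem Fields.prod_pol (a D : Fields V) (p : Polynomial ℂ) (F : K) :
    (prod a (pol p) D).1 F = commD a.1 D.1 (Polynomial.aeval tauDiff p * (1 ⊗ₜ F)) := by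
  refine LinearMap.ext fun v => ?_
  let i : KP →ₐ[ℂ] K ⊗[ℂ] K := Algebra.TensorProduct.map (AlgHom.id ℂ K) pol
  let i' : KP →ₐ[ℂ] K ⊗[ℂ] K :=
    (Algebra.TensorProduct.comm ℂ K K : K ⊗[ℂ] K →ₐ[ℂ] K ⊗[ℂ] K).comp i
  let m : K ⊗[ℂ] K →ₗ[ℂ] Module.End ℂ V :=
    TensorProduct.lift ((LinearMap.mul ℂ (Module.End ℂ V)).compl₁₂ a.1 D.1)
  let m' : K ⊗[ℂ] K →ₗ[ℂ] Module.End ℂ V :=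
    TensorProduct.lift ((LinearMap.mul ℂ (Module.End ℂ V)).compl₁₂ D.1 a.1).flip
  have e : commD a.1 D.1 = m - m' := TensorProduct.ext' fun _ _ => rfl
  have e1 : pair a.1 (polRes (tw F (D.app v))) =
      LinearMap.applyₗ v ∘ₗ m ∘ₗ LinearMap.mulRight ℂ (1 ⊗ₜ F) ∘ₗ i.toLinearMap := by
    refine KP.hom_ext fun k G => ?_
    change a.1 k (D.1 (F * pol G) v) = m ((k ⊗ₜ pol G) * (1 ⊗ₜ F)) v
    rw [Algebra.TensorProduct.tmul_mul_tmul, mul_one, mul_comm F]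
    rfl
  have e2 : pair (tw F D.1) (polRes (a.app v)) =
      LinearMap.applyₗ v ∘ₗ m' ∘ₗ LinearMap.mulRight ℂ (1 ⊗ₜ F) ∘ₗ i'.toLinearMap := by
    refine KP.hom_ext fun k G => ?_
    change D.1 (F * k) (a.1 (pol G) v) = m' ((pol G ⊗ₜ k) * (1 ⊗ₜ F)) v
    rw [Algebra.TensorProduct.tmul_mul_tmul, mul_one, mul_comm F]
    rfl
  have e3 : K.antipode (pol p) = pol (Polynomial.aeval (-Polynomial.X) p) := by
    have : K.antipode.comp pol = pol.comp (Polynomial.aeval (-Polynomial.X)) := by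
      apply Polynomial.algHom_ext
      simp [K.antipode_X]
    exact DFunLike.congr_fun this p
  have e4 : i (Polynomial.aeval diff p) = Polynomial.aeval tauDiff p := by
    have h1 : i diff = tauDiff := by
      rw [diff, map_sub, tauDiff]
      change pol Polynomial.X ⊗ₜ[ℂ] pol 1 - (1 : K) ⊗ₜ[ℂ] pol Polynomial.X = _
      rw [map_one]
    rw [← Polynomial.aeval_algHom_apply, h1]
  have e5 : i' (Polynomial.aeval diff (Polynomial.aeval (-Polynomial.X : Polynomial ℂ) p)) =
      Polynomial.aeval tauDiff p := by
    rw [← Polynomial.aeval_algHom_apply]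
    have h1 : i' diff = -tauDiff := by
      rw [diff, map_sub, tauDiff, neg_sub]
      change pol 1 ⊗ₜ pol Polynomial.X - pol Polynomial.X ⊗ₜ 1 = _
      rw [map_one]
    rw [h1, ← Polynomial.aeval_algHom_apply]
    simp
  rw [prod_apply, conv, conv, contract_pol (((D.isRat v).tw F).isTors _), e3,
    contract_pol ((a.isRat v).isTors _), e1, e2, e]
  simp only [LinearMap.comp_apply, AlgHom.toLinearMap_apply, e4, e5]
  rfl

end

/-- The vacuum field. -/
def vacField (V : Type*) [AddCommGroup V] [Module ℂ V] : Fields V :=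
  ⟨LinearMap.toSpanSingleton ℂ _ 1 ∘ₗ K.trₗ, fun h => ⟨1, fun G => by
    change (K.trₗ (pol _)) • h = 0
    rw [K.trₗ_apply, K.tr_pol, zero_smul]⟩⟩

theorem vacField_apply {V : Type*} [AddCommGroup V] [Module ℂ V] (F : K) (v : V) :
    (vacField V).1 F v = K.tr F • v := rfl

theorem commD_vacField {V : Type*} [AddCommGroup V] [Module ℂ V] (a : K →ₗ[ℂ] Module.End ℂ V) :
    commD a (vacField V).1 = 0 :=
  TensorProduct.ext' fun p q => LinearMap.ext fun v => by
    change a p (K.tr q • v) - K.tr q • a p v = 0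
    rw [map_smul, sub_self]

/-- The action of `𝓛C` on the fields on `VacMod C`. -/
def fieldRep (C : Type*) [AddCommGroup C] [Module ℂ C] [HTConformalAlgebra C] :
    LieOf C →ₗ[ℂ] Module.End ℂ (Fields (VacMod C)) :=
  (totalDiff C).liftQ (TensorProduct.lift (Fields.prod ∘ₗ gen)) (by
    rintro _ ⟨x, rfl⟩
    rw [LinearMap.mem_ker]
    have : TensorProduct.lift (Fields.prod ∘ₗ gen) ∘ₗ
        (TensorProduct.map (HTConformalAlgebra.T (C := C)).toLinearMap (K.shift 1).toLinearMap -
          LinearMap.id) = 0 := by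
      refine TensorProduct.ext' fun f p => ?_
      rw [LinearMap.comp_apply, LinearMap.sub_apply, TensorProduct.map_tmul, map_sub]
      change Fields.prod (gen (HTConformalAlgebra.T f)) (K.shift 1 p) - Fields.prod (gen f) p = 0
      rw [Fields.prod_shift (gen (HTConformalAlgebra.T f)) (gen f) (-1), K.shift_shift,
        neg_add_cancel, K.shift_zero, sub_self]
      intro F
      refine LinearMap.ext fun v => ?_
      rw [gen_apply, gen_apply, mode_T_eq]
    exact LinearMap.congr_fun this x)

theorem fieldRep_mode (f : C) (p : K) : fieldRep C (mode f p) = Fields.prod (gen f) p := rfl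

theorem fieldRep_lie (x y : LieOf C) :
    fieldRep C ⁅x, y⁆ = fieldRep C x * fieldRep C y - fieldRep C y * fieldRep C x := by
  induction x using lieOf_induction with
  | zero => simp
  | add x x' hx hx' => rw [add_lie, map_add, hx, hx', map_add, add_mul, mul_add]; abel
  | mode f p =>
    induction y using lieOf_induction with
    | zero => simp
    | add x x' hx hx' => rw [lie_add, map_add, hx, hx', map_add, add_mul, mul_add]; abel
    | mode g q =>
      rw [lie_mode_sum, map_sum]
      simp only [fieldRep_mode]
      exact (Fields.prod_comm (c := fun n => gen (HTConformalAlgebra.prod f g n))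
        (gen_comm f g) p q).symm

theorem fieldRep_ann {x : LieOf C} (hx : x ∈ ann C) :
    fieldRep C x (vacField (VacMod C)) = 0 := by
  change x ∈ Submodule.span ℂ _ at hx
  induction hx using Submodule.span_induction with
  | zero => rw [map_zero]; rfl
  | add x y _ _ hx hy => rw [map_add, LinearMap.add_apply, hx, hy, add_zero]
  | smul c x _ hx => rw [map_smul, LinearMap.smul_apply, hx, smul_zero]
  | mem x hx =>
    obtain ⟨f, _, ⟨G, rfl⟩, rfl⟩ := hx
    refine Fields.ext fun F v => ?_
    rw [fieldRep_mode]
    refine (LinearMap.congr_fun (Fields.prod_pol (gen f) (vacField _) G F) v).trans ?_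
    rw [commD_vacField]; rfl

/-- The vacuum field is a scalar distribution, so it commutes with all fields and is killed by the
annihilation subalgebra. The universal property of the induced module then applies to the module of
fields. -/
theorem exists_stateField (C : Type*) [AddCommGroup C] [Module ℂ C] [HTConformalAlgebra C] :
    ∃ φ : VacMod C →ₗ[ℂ] Fields (VacMod C), φ (v0 C) = vacField _ ∧
      ∀ x w, φ (act x w) = fieldRep C x (φ w) :=
  exists_vacMod_lift (fieldRep C) fieldRep_lie _ fun _ => fieldRep_ann

/-- The state-field correspondence of the induced module, with values in the fields. -/
def stateField (C : Type*) [AddCommGroup C] [Module ℂ C] [HTConformalAlgebra C] :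
    VacMod C →ₗ[ℂ] Fields (VacMod C) :=
  (exists_stateField C).choose

theorem stateField_v0 : stateField C (v0 C) = vacField _ := (exists_stateField C).choose_spec.1

theorem stateField_act (f : C) (p : K) (w : VacMod C) :
    stateField C (act (mode f p) w) = Fields.prod (gen f) p (stateField C w) :=
  (exists_stateField C).choose_spec.2 _ _

end HTVertex
end

/-! ### Products with the vacuum field, operators that pass through products, existence of singular
parts. -/

noncomputable section
namespace HTVertex
open KP

section
variable {V : Type*} [AddCommGroup V] [Module ℂ V]

theorem K.X_mul_u_zero : pol Polynomial.X * K.u 0 0 = 1 := by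
  have := K.u_mul_X_sub_zero 0
  rwa [Int.cast_zero, sub_zero, mul_comm] at this

theorem K.pol_X_sub_mul_u_zero (n : ℤ) : pol (Polynomial.X - Polynomial.C (n : ℂ)) * K.u n 0 = 1 := by
  rw [K.pol_X_sub, mul_comm, K.u_mul_X_sub_zero]

theorem K.pol_X_sub_mul_u_succ (n : ℤ) (j : ℕ) :
    pol (Polynomial.X - Polynomial.C (n : ℂ)) * K.u n (j + 1) = K.u n j := by
  rw [K.pol_X_sub, mul_comm, K.u_succ_mul_X_sub]

theorem tw_pair (a : K →ₗ[ℂ] Module.End ℂ V) (F : K) (g : Polynomial ℂ →ₗ[ℂ] V) :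
    pair (tw F a) g = pair a g ∘ₗ LinearMap.mulLeft ℂ (inlK F) :=
  KP.hom_ext fun k G => by
    rw [LinearMap.comp_apply, LinearMap.mulLeft_apply, inlK_apply,
      Algebra.TensorProduct.tmul_mul_tmul, one_mul, pair_tmul, pair_tmul, tw_apply]

/-- Multiplication by `κ - n` differs from multiplication by `γ - n` by `κ - γ`. -/
theorem conv_tw_X_sub {ξ : K →ₗ[ℂ] V} (h : IsRat ξ) (a : K →ₗ[ℂ] Module.End ℂ V) (n : ℤ) (q : K) :
    conv (tw (pol (Polynomial.X - Polynomial.C (n : ℂ))) a) ξ q =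
      conv a ξ (pol Polynomial.X * q) +
        conv a (tw (pol (Polynomial.X - Polynomial.C (n : ℂ))) ξ) q := by
  obtain ⟨R, hR⟩ := h
  have hk := kills_pair (g := polRes ξ) hR a
  have ht (z : KP) : IsTors (pair a (polRes ξ) ∘ₗ LinearMap.mulLeft ℂ z) := ⟨R, fun y => by
    rw [LinearMap.comp_apply, LinearMap.mulLeft_apply, ← mul_assoc, hk]⟩
  rw [conv, tw_pair, conv, conv, pair_tw, ← contract_mulLeft hk (isRep_X R), ← contract_add (ht _) (ht _)]
  congr 1
  refine LinearMap.ext fun z => ?_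
  simp only [LinearMap.add_apply, LinearMap.comp_apply, LinearMap.mulLeft_apply, ← map_add, ← add_mul,
    diff_eq, map_sub]
  congr 2
  have : inlK (pol (Polynomial.C (n : ℂ))) = inrP (Polynomial.C (n : ℂ)) := by
    rw [K.pol_C, AlgHom.commutes]; exact (inrP.commutes _).symm
  rw [this]; ring

theorem conv_one {ξ : K →ₗ[ℂ] V} (h : IsRat ξ) (a : K →ₗ[ℂ] Module.End ℂ V) :
    conv a ξ 1 = a 1 (ξ 1) := by
  have := contract_pol (h.isTors a) 1
  rw [map_one pol, map_one (Polynomial.aeval diff), Algebra.TensorProduct.one_def, pair_tmul,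
    polRes_apply, map_one pol] at this
  exact this

theorem conv_u_zero_tw {ξ : K →ₗ[ℂ] V} (h : IsRat ξ) (a : K →ₗ[ℂ] Module.End ℂ V) (n : ℤ) :
    conv (tw (pol (Polynomial.X - Polynomial.C (n : ℂ))) a) ξ (K.u 0 0) =
      a 1 (ξ 1) + conv a (tw (pol (Polynomial.X - Polynomial.C (n : ℂ))) ξ) (K.u 0 0) := by
  rw [conv_tw_X_sub h, K.X_mul_u_zero, conv_one h]

theorem isRat_tr (v : V) : IsRat ((vacField V).app v) := (vacField V).isRat v

/-- For singular s, the function s(κ)/(κ−γ) decays like κ⁻² and has no residue at infinity.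
Formally, writing s as (κ−n) times s/(κ−n) removes a factor τ−n from the denominator of ξ, and the
boundary term is the trace of a product of two singular functions. -/
theorem tr_conv_sing {ξ : K →ₗ[ℂ] V} (h : IsRat ξ) {s : K} (hs : s ∈ K.sing) :
    conv (tw s (vacField V).1) ξ (K.u 0 0) = 0 := by
  obtain ⟨⟨R, hR⟩, h⟩ := h
  induction hR using poleSet_induction generalizing ξ s with
  | one => exact conv_eq_zero (fun G => by simpa using h G) _ _
  | mul n R hR ih =>
    have hu : K.u n 0 * s ∈ K.sing := K.sing_mul_mem (K.u_mem n 0) hs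
    have h1 := conv_u_zero_tw ⟨_, h⟩ (tw (K.u n 0 * s) (vacField V).1) n
    rw [tw_tw, mul_right_comm, mul_comm (K.u n 0), K.pol_X_sub_mul_u_zero, one_mul] at h1
    rw [h1, tw_apply, vacField_apply, mul_one, K.tr_sing_mul_sing (K.u_mem n 0) hs, zero_smul,
      zero_add]
    refine ih hu fun G => ?_
    rw [tw_apply, ← map_mul, ← h G, mul_assoc]

/-- Cauchy's formula: the residues of G(κ)/(κ−γ) in κ add up to G(γ). For G = 1, writing 1 as
(κ−n)·1/(κ−n) produces the value ξ(1), and `tr_conv_sing` disposes of the rest. Powers follow from κ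
= γ + (κ−γ). -/
theorem tr_conv_pol {ξ : K →ₗ[ℂ] V} (h : IsRat ξ) (G : Polynomial ℂ) :
    conv (tw (pol G) (vacField V).1) ξ (K.u 0 0) = ξ (pol G) := by
  have h1 : ∀ ξ : K →ₗ[ℂ] V, IsRat ξ → conv (vacField V).1 ξ (K.u 0 0) = ξ 1 := by
    rintro ξ ⟨⟨R, hR⟩, h⟩
    induction hR using poleSet_induction with
    | one =>
      have h' : ∀ G, ξ (pol G) = 0 := fun G => by simpa using h G
      rw [conv_eq_zero h', ← map_one pol, h']
    | mul n R hR ih =>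
      have h1 := conv_u_zero_tw ⟨_, h⟩ (tw (K.u n 0) (vacField V).1) n
      rw [tw_tw, mul_comm (K.u n 0), K.pol_X_sub_mul_u_zero, tw_one] at h1
      rw [h1, tr_conv_sing (IsRat.tw ⟨_, h⟩ _) (K.u_mem n 0), tw_apply, vacField_apply, mul_one,
        K.tr_u, if_pos rfl, one_smul, add_zero]
  induction G using Polynomial.induction_on' with
  | add p q hp hq => rw [map_add, add_tw, add_conv h, hp, hq, map_add]
  | monomial n c =>
    have h2 : ∀ n : ℕ, ∀ ξ : K →ₗ[ℂ] V, IsRat ξ →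
        conv (tw (pol (Polynomial.X ^ n)) (vacField V).1) ξ (K.u 0 0) = ξ (pol (Polynomial.X ^ n)) := by
      intro n
      induction n with
      | zero => intro ξ h; rw [pow_zero, map_one, tw_one, h1 ξ h]
      | succ n ih =>
        intro ξ h
        have h3 := conv_u_zero_tw h (tw (pol (Polynomial.X ^ n)) (vacField V).1) 0
        rw [Int.cast_zero, Polynomial.C_0, sub_zero, tw_tw, ← map_mul, ih _ (h.tw _), tw_apply,
          vacField_apply, mul_one, K.tr_pol, zero_smul, zero_add, tw_apply, ← map_mul] at h3
        rw [pow_succ, h3, mul_comm]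
    rw [← Polynomial.smul_X_eq_monomial, map_smul, smul_tw, smul_conv h, h2 n ξ h, map_smul]

/-- Cauchy's formula in the other variable: 1/(κ−γ) is the sum of the (γ−m)ⁱ/(κ−m)^{i+1}, and
pairing with the trace of (γ−m)^{−j−1} picks the coefficient i = j. -/
theorem conv_tr_u (a : K →ₗ[ℂ] Module.End ℂ V) (v : V) (m : ℤ) (j : ℕ) :
    conv a (tw (K.u m j) ((vacField V).app v)) (K.u 0 0) = a (K.u m j) v := by
  induction j generalizing a with
  | zero =>
    have h1 := conv_u_zero_tw ((isRat_tr v).tw (K.u m 0)) (tw (K.u m 0) a) m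
    rw [tw_tw, tw_tw, mul_comm (K.u m 0), K.pol_X_sub_mul_u_zero, tw_one, tw_one,
      conv_eq_zero (ξ := (vacField V).app v), add_zero, tw_apply, tw_apply, Fields.app_apply,
      vacField_apply, mul_one, K.tr_u, if_pos rfl, one_smul] at h1
    · exact h1
    · intro G
      rw [Fields.app_apply, vacField_apply, K.tr_pol, zero_smul]
  | succ j ih =>
    have h1 := conv_u_zero_tw ((isRat_tr v).tw (K.u m (j + 1))) (tw (K.u m 0) a) m
    rw [tw_tw, tw_tw, mul_comm (K.u m 0), K.pol_X_sub_mul_u_zero, tw_one,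
      mul_comm (K.u m (j + 1)), K.pol_X_sub_mul_u_succ, ih, tw_apply (K.u m (j + 1)),
      Fields.app_apply, vacField_apply, mul_one, K.tr_u, if_neg (Nat.succ_ne_zero j), zero_smul,
      map_zero, zero_add, tw_apply, K.u_mul_same] at h1
    rw [h1]
    congr 3; omega

/-- The product of a field with the vacuum field. -/
theorem Fields.prod_vacField (a : Fields V) : prod a (K.u 0 0) (vacField V) = a := by
  refine ext fun F v => ?_
  -- On polynomials only the right half contributes, and on the `u` only the left half. The sign of
  -- the antipode of 1/τ cancels the sign of the right half.
  refine LinearMap.congr_fun (f := (prod a (K.u 0 0) (vacField V)).app v) (g := a.app v)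
    (K.linear_ext (fun G => ?_) fun m j => ?_) F
  all_goals
    have e : K.antipode (K.u 0 0) = (-1 : ℂ) • K.u 0 0 := by
      rw [K.antipode_u]; simp
    rw [app_apply, prod_apply, e, conv_smul_right (a.isRat v)]
  · rw [conv_eq_zero, tr_conv_pol (a.isRat v)]
    · simp
    · intro G'
      rw [tw_apply, app_apply, vacField_apply, ← map_mul, K.tr_pol, zero_smul]
  · rw [conv_tr_u, tr_conv_sing (a.isRat v) (K.u_mem m j), smul_zero, sub_zero, app_apply]

/-- Linear maps that intertwine translated distributions commute with their products. -/
theorem conv_map_shift {ξ ξ' : K →ₗ[ℂ] V} (h : IsRat ξ) (h' : IsRat ξ')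
    {a a' : K →ₗ[ℂ] Module.End ℂ V} (T : V →ₗ[ℂ] V) (m : ℤ)
    (ha : ∀ k v, T (a k v) = a' (K.shift m k) (T v)) (hξ : ∀ k, T (ξ k) = ξ' (K.shift m k)) (q : K) :
    T (conv a ξ q) = conv a' ξ' q := by
  have e : T ∘ₗ pair a (polRes ξ) = pair (a' ∘ₗ (K.shift m).toLinearMap)
      (polRes (ξ' ∘ₗ (K.shift m).toLinearMap)) := KP.hom_ext fun k G => by
    rw [LinearMap.comp_apply, pair_tmul, ha, polRes_apply, hξ]; rfl
  rw [conv, ← contract_comp (h.isTors a), e]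
  change conv _ _ q = _
  rw [conv_shift_left (h'.shift m), conv_shift_right h', K.shift_shift, neg_add_cancel,
    K.shift_zero]

theorem K.deriv_pol (G : Polynomial ℂ) : K.deriv (pol G) = pol (Polynomial.derivative G) := by
  induction G using Polynomial.induction_on' with
  | add p q hp hq => simp only [map_add, hp, hq]
  | monomial n c =>
    rw [← Polynomial.smul_X_eq_monomial]
    simp only [map_smul]
    congr 1
    induction n with
    | zero => simp [K.deriv_one]
    | succ n ih =>
      rw [pow_succ, map_mul, K.deriv_mul, ih, K.deriv_X, Polynomial.derivative_mul, map_add,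
        map_mul, map_mul, Polynomial.derivative_X, map_one]
      ring

/-- The hypothesis is a Leibniz rule for d up to the simultaneous derivative in κ and γ. That
derivative contributes nothing, because q(κ−γ) is constant along the diagonal
(`contract_derivBoth`). -/
theorem conv_map_deriv {ξ η ξ₁ : K →ₗ[ℂ] V} (h : IsRat ξ) (h₁ : IsRat ξ₁)
    {a a₁ : K →ₗ[ℂ] Module.End ℂ V} (d : V →ₗ[ℂ] V)
    (hd : ∀ k G, d (a k (ξ (pol G))) = a k (η (pol G)) - a₁ k (ξ₁ (pol G)) -
      (a (K.deriv k) (ξ (pol G)) + a k (ξ (pol (Polynomial.derivative G))))) (q : K) :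
    d (conv a ξ q) = conv a η q - conv a₁ ξ₁ q := by
  have e : pair a (polRes η) = d ∘ₗ pair a (polRes ξ) + pair a₁ (polRes ξ₁) +
      pair a (polRes ξ) ∘ₗ derivBoth := KP.hom_ext fun k G => by
    rw [LinearMap.add_apply, LinearMap.add_apply, LinearMap.comp_apply, LinearMap.comp_apply,
      derivBoth_tmul, map_add, pair_tmul, pair_tmul, pair_tmul, pair_tmul, pair_tmul, polRes_apply,
      polRes_apply, polRes_apply, polRes_apply, hd]
    abel
  obtain ⟨R, hR⟩ := h
  have hk := kills_pair (g := polRes ξ) hR a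
  have ht : IsTors (pair a (polRes ξ) ∘ₗ derivBoth) := ⟨R * R, fun z => by
    have h0 (z w : KP) : pair a (polRes ξ) (z * inrP R * w) = 0 := by
      rw [mul_right_comm]; exact hk _
    rw [LinearMap.comp_apply, Submonoid.coe_mul, map_mul inrP, ← mul_assoc, derivBoth_mul, map_add,
      h0, mul_comm (inrP _) (derivBoth _), hk, add_zero]⟩
  have hξ : IsRat ξ := ⟨R, hR⟩
  rw [conv, conv, conv, e, contract_add (((hξ.isTors a).comp d).add (h₁.isTors a₁)) ht,
    contract_derivBoth ⟨R, hk⟩, contract_add ((hξ.isTors a).comp d) (h₁.isTors a₁),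
    contract_comp (hξ.isTors a)]
  abel

/-- A rational distribution has a singular part. -/
theorem IsRat.exists_isSingKernel {ξ : K →ₗ[ℂ] V} (h : IsRat ξ) : ∃ s, IsSingKernel ξ s := by
  let Φ : (ℤ × ℕ →₀ V) →ₗ[ℂ] (Polynomial ℂ →ₗ[ℂ] V) := Finsupp.lsum ℂ fun p =>
    LinearMap.smulRightₗ (K.trₗ ∘ₗ LinearMap.mulLeft ℂ (K.u p.1 p.2) ∘ₗ pol.toLinearMap)
  have hΦ (s : ℤ × ℕ →₀ V) (G : Polynomial ℂ) :
      Φ s G = s.sum fun p v => K.tr (K.u p.1 p.2 * pol G) • v := by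
    simp only [Φ, Finsupp.lsum_apply, Finsupp.sum, LinearMap.sum_apply]
    rfl
  have h1 (F : K) (hF : F ∈ K.sing) (v : V) :
      (K.trₗ ∘ₗ LinearMap.mulLeft ℂ F ∘ₗ pol.toLinearMap).smulRight v ∈ LinearMap.range Φ := by
    induction hF using Submodule.span_induction with
    | zero =>
      convert (LinearMap.range Φ).zero_mem using 1
      ext; simp
    | add x y _ _ hx hy =>
      convert (LinearMap.range Φ).add_mem hx hy using 1
      ext; simp [add_mul, add_smul]
    | smul c x _ hx =>
      convert (LinearMap.range Φ).smul_mem c hx using 1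
      ext; simp [mul_smul]
    | mem x hx =>
      obtain ⟨p, rfl⟩ := hx
      exact ⟨Finsupp.single p v, by simp [Φ]⟩
  obtain ⟨⟨R, hR⟩, h⟩ := h
  suffices H : ∀ g : Polynomial ℂ →ₗ[ℂ] V, (∀ G, g (R * G) = 0) → g ∈ LinearMap.range Φ by
    obtain ⟨s, hs⟩ := H (polRes ξ) h
    exact ⟨s, fun G => by rw [← hΦ, hs, polRes_apply]⟩
  clear h
  induction hR using poleSet_induction with
  | one =>
    intro g h
    have : g = 0 := LinearMap.ext fun G => by simpa using h G
    rw [this]; exact Submodule.zero_mem _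
  | mul n R hR ih =>
    intro g h
    obtain ⟨s, hs⟩ := ih (g ∘ₗ LinearMap.mulLeft ℂ (Polynomial.X - Polynomial.C (n : ℂ)))
      fun G => by rw [LinearMap.comp_apply, LinearMap.mulLeft_apply, ← mul_assoc, h]
    -- Split G = G(n) + (τ−n)G′. The constant yields G(n)g(1), where G(n) = Tr(G/(τ−n)). The rest is
    -- the singular part from the induction divided by τ−n; there the constant G(n) drops out, as a
    -- product of two singular functions has trace zero.
    have e : g = (K.trₗ ∘ₗ LinearMap.mulLeft ℂ (K.u n 0) ∘ₗ pol.toLinearMap).smulRight (g 1) +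
        s.sum fun p v => (K.trₗ ∘ₗ LinearMap.mulLeft ℂ (K.u p.1 p.2 * K.u n 0) ∘ₗ
          pol.toLinearMap).smulRight v := by
      refine LinearMap.ext fun G => ?_
      obtain ⟨G', hG'⟩ := K.sub_dvd_pol_sub n G
      have h2 : K.tr (K.u n 0 * pol G) = G.eval (n : ℂ) := by
        obtain ⟨G₁, h2⟩ := K.u_zero_mul_pol n G
        rw [h2, K.tr_add, K.tr_smul, K.tr_pol, K.tr_u, if_pos rfl, mul_one, add_zero]
      have h3 := LinearMap.congr_fun hs G'
      rw [hΦ, LinearMap.comp_apply, LinearMap.mulLeft_apply] at h3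
      have h4 (p : ℤ × ℕ) : K.tr (K.u p.1 p.2 * pol G') =
          K.tr (K.u p.1 p.2 * K.u n 0 * pol G) := by
        have : pol G = G.eval (n : ℂ) • 1 + pol (Polynomial.X - Polynomial.C (n : ℂ)) * pol G' := by
          conv_lhs => rw [hG', map_add, map_mul pol, K.pol_C, Algebra.algebraMap_eq_smul_one]
        rw [this, mul_add, K.tr_add, mul_smul_comm, K.tr_smul, mul_one,
          K.tr_sing_mul_sing (K.u_mem _ _) (K.u_mem _ _), mul_zero, zero_add, mul_assoc,
          ← mul_assoc (K.u n 0), mul_comm (K.u n 0), K.pol_X_sub_mul_u_zero, one_mul]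
      rw [LinearMap.add_apply, Finsupp.sum, LinearMap.sum_apply]
      conv_lhs => rw [hG', map_add, ← h3]
      congr 1
      · rw [LinearMap.smulRight_apply]
        change _ = K.tr (K.u n 0 * pol G) • _
        rw [h2, Polynomial.C_eq_algebraMap, Algebra.algebraMap_eq_smul_one, map_smul]
      · exact Finset.sum_congr rfl fun p _ => by dsimp only; rw [h4]; rfl
    rw [e]
    refine Submodule.add_mem _ (h1 _ (K.u_mem _ _) _) (Submodule.sum_mem _ fun p _ => ?_)
    exact h1 _ (K.sing_mul_mem (K.u_mem _ _) (K.u_mem _ _)) _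

end

end HTVertex
end

/-! ### Vertex operators of the induced module and their covariance. -/

noncomputable section
namespace HTVertex
open KP

variable {C : Type*} [AddCommGroup C] [Module ℂ C] [HTConformalAlgebra C]

theorem K.deriv_u (n : ℤ) (j : ℕ) : K.deriv (K.u n j) = -((j : ℂ) + 1) • K.u n (j + 1) := by
  have h0 : K.deriv (pol (Polynomial.X - Polynomial.C (n : ℂ))) = 1 := by
    rw [K.deriv_pol]; simp
  have h1 : K.deriv (K.u n 0) = -K.u n 1 := by
    have h := congrArg K.deriv (K.pol_X_sub_mul_u_zero n)
    rw [K.deriv_mul, h0, K.deriv_one, mul_one] at h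
    have h2 := congrArg (K.u n 0 * ·) h
    simp only [mul_add, mul_zero, ← mul_assoc, K.u_mul_same] at h2
    rw [mul_comm (K.u n 0), K.pol_X_sub_mul_u_zero, one_mul] at h2
    exact eq_neg_of_add_eq_zero_left h2
  induction j with
  | zero => rw [h1]; simp
  | succ j ih =>
    have e : K.u n (j + 1) = K.u n j * K.u n 0 := by rw [K.u_mul_same]
    have e2 : K.u n (j + 1 + 1) = K.u n j * K.u n 1 := by rw [K.u_mul_same]
    rw [e, K.deriv_mul, h1, ih, mul_smul_comm, K.u_mul_same, Nat.zero_add, mul_neg, ← e2]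
    push_cast
    module

variable (C) in
/-- The state-field correspondence of the induced module. -/
def vop : VacMod C →ₗ[ℂ] K →ₗ[ℂ] Module.End ℂ (VacMod C) where
  toFun w := (stateField C w).1
  map_add' w w' := by rw [map_add]; rfl
  map_smul' c w := by rw [map_smul]; rfl

theorem vop_eq (w : VacMod C) : vop C w = (stateField C w).1 := rfl

theorem isRat_vop (w h : VacMod C) : IsRat ((vop C w).flip h) := (stateField C w).isRat h

theorem vop_v0 (F : K) (w : VacMod C) : vop C (v0 C) F w = K.tr F • w := by
  rw [vop_eq, stateField_v0, vacField_apply]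

theorem vop_act (f : C) (p : K) (w : VacMod C) (F : K) (h : VacMod C) :
    vop C (act (mode f p) w) F h = conv (gen f).1 (tw F ((vop C w).flip h)) p -
      conv (tw F (vop C w)) ((gen f).app h) (K.antipode p) := by
  rw [vop_eq, stateField_act, Fields.prod_apply]; rfl

theorem vop_gen (f : C) (F : K) (w : VacMod C) :
    vop C (act (mode f (K.u 0 0)) (v0 C)) F w = act (mode f F) w := by
  rw [vop_eq, stateField_act, stateField_v0, Fields.prod_vacField, gen_apply]

theorem gen_app_v0_pol (f : C) (G : Polynomial ℂ) : (gen f).app (v0 C) (pol G) = 0 := act_pol_v0 f G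

theorem vop_pol_v0 (w : VacMod C) (G : Polynomial ℂ) : vop C w (pol G) (v0 C) = 0 := by
  induction w using vacMod_induction generalizing G with
  | v0 => rw [vop_v0, K.tr_pol, zero_smul]
  | add w w' h h' => rw [map_add, LinearMap.add_apply, LinearMap.add_apply, h, h', add_zero]
  | smul c w h => rw [map_smul, LinearMap.smul_apply, LinearMap.smul_apply, h, smul_zero]
  | act f p w ih =>
    rw [vop_act, conv_eq_zero, conv_eq_zero (gen_app_v0_pol f), sub_zero]
    intro G'
    rw [tw_apply, ← map_mul, LinearMap.flip_apply, ih]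

/-- On the vacuum the right half of the product vanishes. In the left half, Y(w)v0 is holomorphic,
so after multiplication by 1/(τ−n) it has at most a simple pole at n, where the expansion of p(κ−γ)
is p(κ−n). -/
theorem vop_act_u_zero (f : C) (p : K) (w : VacMod C) (n : ℤ) :
    vop C (act (mode f p) w) (K.u n 0) (v0 C) =
      act (mode f (K.shift (-n) p)) (vop C w (K.u n 0) (v0 C)) := by
  rw [vop_act, conv_eq_zero (gen_app_v0_pol f), sub_zero, conv, contract_eval (n := n), pair_tmul,
    polRes_apply, map_one, tw_apply, mul_one, gen_apply, LinearMap.flip_apply]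
  refine kills_pair (fun G => ?_) _
  rw [polRes_apply, tw_apply, map_mul pol, ← mul_assoc, mul_comm (K.u n 0), K.pol_X_sub_mul_u_zero,
    one_mul, LinearMap.flip_apply, vop_pol_v0]

variable (C) in
/-- The action of `T ^ n` on the induced module. -/
def tPow (n : ℤ) : Module.End ℂ (VacMod C) where
  toFun w := vop C w (K.u n 0) (v0 C)
  map_add' w w' := by rw [map_add]; rfl
  map_smul' c w := by rw [map_smul]; rfl

theorem tPow_apply (n : ℤ) (w : VacMod C) : tPow C n w = vop C w (K.u n 0) (v0 C) := rfl

theorem hAct_vop (n : ℤ) (w : VacMod C) : hAct (v0 C) (vop C) n w = tPow C n w := by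
  rw [hAct, K.shift_u, tPow_apply]; congr 3; ring

theorem tPow_v0 (n : ℤ) : tPow C n (v0 C) = v0 C := by
  rw [tPow_apply, vop_v0, K.tr_u, if_pos rfl, one_smul]

theorem tPow_act (n : ℤ) (f : C) (p : K) (w : VacMod C) :
    tPow C n (act (mode f p) w) = act (mode f (K.shift (-n) p)) (tPow C n w) :=
  vop_act_u_zero f p w n

theorem tPow_zero (w : VacMod C) : tPow C 0 w = w := by
  induction w using vacMod_induction with
  | v0 => exact tPow_v0 0
  | add w w' h h' => rw [map_add, h, h']
  | smul c w h => rw [map_smul, h]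
  | act f p w ih => rw [tPow_act, ih, neg_zero, K.shift_zero]

theorem vop_u_zero_v0 (w : VacMod C) : vop C w (K.u 0 0) (v0 C) = w := tPow_zero w

variable (C) in
/-- The infinitesimal translation of the induced module. -/
def infT : Module.End ℂ (VacMod C) where
  toFun w := vop C w (K.u 0 1) (v0 C)
  map_add' w w' := by rw [map_add]; rfl
  map_smul' c w := by rw [map_smul]; rfl

theorem infT_apply (w : VacMod C) : infT C w = vop C w (K.u 0 1) (v0 C) := rfl

theorem infT_v0 : infT C (v0 C) = 0 := by
  rw [infT_apply, vop_v0, K.tr_u, if_neg one_ne_zero, zero_smul]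

/-- The same computation with a double pole at 0: the expansion p(κ)−p′(κ)γ to first order produces
the derivative term. -/
theorem infT_act (f : C) (p : K) (w : VacMod C) :
    infT C (act (mode f p) w) = act (mode f p) (infT C w) - act (mode f (K.deriv p)) w := by
  have e0 := K.pol_X_sub_mul_u_succ 0 0
  rw [infT_apply, vop_act, conv_eq_zero (gen_app_v0_pol f), sub_zero, conv, contract_eval_sq,
    pair_tmul, pair_tmul, polRes_apply, map_one, tw_apply, mul_one, gen_apply, LinearMap.flip_apply,
    gen_apply, polRes_apply, tw_apply, LinearMap.flip_apply]
  · rw [Int.cast_zero, Polynomial.C_0, sub_zero, mul_comm] at e0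
    rw [e0, vop_u_zero_v0]; rfl
  · refine kills_pair (fun G => ?_) _
    rw [polRes_apply, tw_apply, Submonoid.coe_mul, map_mul pol, map_mul pol, mul_assoc, mul_left_comm,
      ← mul_assoc (K.u 0 1), mul_comm (K.u 0 1), e0, ← mul_assoc, K.pol_X_sub_mul_u_zero,
      one_mul, LinearMap.flip_apply, vop_pol_v0]

/-- Covariance of the vertex operators. -/
theorem vop_tPow (n : ℤ) (w : VacMod C) (F : K) :
    vop C (tPow C n w) F = vop C w (K.shift (-n) F) := by
  induction w using vacMod_induction generalizing F with
  | v0 => refine LinearMap.ext fun h => ?_; rw [tPow_v0, vop_v0, vop_v0, K.tr_shift]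
  | add w w' h h' => rw [map_add, map_add, LinearMap.add_apply, h, h', map_add, LinearMap.add_apply]
  | smul c w h => rw [map_smul, map_smul, LinearMap.smul_apply, h, map_smul, LinearMap.smul_apply]
  | act f p w ih =>
    refine LinearMap.ext fun h => ?_
    have e1 : tw F ((vop C (tPow C n w)).flip h) =
        tw (K.shift (-n) F) ((vop C w).flip h) ∘ₗ (K.shift (-n)).toLinearMap := by
      refine LinearMap.ext fun k => ?_
      rw [tw_apply, LinearMap.flip_apply, ih, map_mul]; rfl
    have e2 : tw F (vop C (tPow C n w)) =
        tw (K.shift (-n) F) (vop C w) ∘ₗ (K.shift (-n)).toLinearMap := by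
      refine LinearMap.ext fun k => ?_
      rw [tw_apply, ih, map_mul]; rfl
    rw [tPow_act, vop_act, vop_act, e1, e2, conv_shift_right ((isRat_vop w h).tw _),
      conv_shift_left ((gen f).isRat h), K.antipode_shift, K.shift_shift, K.shift_shift]
    simp only [neg_neg, neg_add_cancel, add_neg_cancel, K.shift_zero]

theorem tPow_vop (m : ℤ) (w : VacMod C) (k : K) (h : VacMod C) :
    tPow C m (vop C w k h) = vop C w (K.shift (-m) k) (tPow C m h) := by
  induction w using vacMod_induction generalizing k h with
  | v0 => rw [vop_v0, vop_v0, K.tr_shift, map_smul]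
  | add w w' ih ih' => simp only [map_add, LinearMap.add_apply, ih, ih']
  | smul c w ih => simp only [map_smul, LinearMap.smul_apply, ih]
  | act f p w ih =>
    rw [vop_act, vop_act, map_sub]
    congr 1
    · refine conv_map_shift ((isRat_vop w h).tw _) ((isRat_vop w _).tw _) _ (-m)
        (fun k v => ?_) (fun k => ?_) p
      · rw [gen_apply, gen_apply, tPow_act]
      · rw [tw_apply, tw_apply, LinearMap.flip_apply, LinearMap.flip_apply, ih, map_mul]
    · refine conv_map_shift ((gen f).isRat h) ((gen f).isRat _) _ (-m)
        (fun k v => ?_) (fun k => ?_) _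
      · rw [tw_apply, tw_apply, ih, map_mul]
      · rw [Fields.app_apply, Fields.app_apply, gen_apply, gen_apply, tPow_act]

/-- Induction over the modes: both halves of the product satisfy the Leibniz rule required by
`conv_map_deriv`, and the terms with a derivative of the test function add up. On the vacuum, the
trace of a derivative is zero. -/
theorem infT_vop (w : VacMod C) (k : K) (h : VacMod C) :
    infT C (vop C w k h) = vop C w k (infT C h) - vop C w (K.deriv k) h := by
  induction w using vacMod_induction generalizing k h with
  | v0 =>
    rw [vop_v0, vop_v0, vop_v0, map_smul]
    have : K.tr (K.deriv k) = 0 := by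
      have : K.trₗ ∘ₗ K.deriv = 0 := K.linear_ext (fun G => by
        rw [LinearMap.comp_apply, K.deriv_pol, K.trₗ_apply, K.tr_pol]; rfl) fun n j => by
        rw [LinearMap.comp_apply, K.deriv_u, map_smul, K.trₗ_apply, K.tr_u,
          if_neg (Nat.succ_ne_zero j), smul_zero]; rfl
      exact LinearMap.congr_fun this k
    rw [this, zero_smul, sub_zero]
  | add w w' ih ih' => simp only [map_add, LinearMap.add_apply, ih, ih']; abel
  | smul c w ih => simp only [map_smul, LinearMap.smul_apply, ih, smul_sub]
  | act f p w ih =>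
    rw [vop_act, vop_act, vop_act, map_sub,
      conv_map_deriv (η := tw k ((vop C w).flip (infT C h))) (a₁ := (gen f).1)
        (ξ₁ := tw (K.deriv k) ((vop C w).flip h)) ((isRat_vop w h).tw _) ((isRat_vop w h).tw _),
      conv_map_deriv (η := (gen f).app (infT C h)) (a₁ := tw (K.deriv k) (vop C w))
        (ξ₁ := (gen f).app h) ((gen f).isRat h) ((gen f).isRat h)]
    · abel
    · intro l G
      simp only [tw_apply, Fields.app_apply, gen_apply, ih, infT_act, K.deriv_mul, map_sub, map_add,
        LinearMap.add_apply, K.deriv_pol, mul_comm l (K.deriv k)]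
      abel
    · intro l G
      simp only [tw_apply, LinearMap.flip_apply, gen_apply, ih, infT_act, K.deriv_mul,
        map_add, LinearMap.add_apply, K.deriv_pol, act_sub_right, act_add_right,
        mul_comm (pol G) (K.deriv k)]
      abel

end HTVertex
end

noncomputable section
namespace HTVertex
open KP

section
variable {V : Type*} [AddCommGroup V] [Module ℂ V]

/-! ### Locality -/

/-- The commutator of `a` and `b` is killed by a product of factors `τ₁ - τ₂ - n`. -/
def IsLocal (a b : K →ₗ[ℂ] Module.End ℂ V) : Prop :=
  ∃ P ∈ poleSet, ∀ x, commD a b (Polynomial.aeval tauDiff P * x) = 0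

theorem IsLocal.add {a b b' : K →ₗ[ℂ] Module.End ℂ V} (h : IsLocal a b) (h' : IsLocal a b') :
    IsLocal a (b + b') := by
  obtain ⟨P, hP, h⟩ := h
  obtain ⟨P', hP', h'⟩ := h'
  refine ⟨P * P', poleSet.mul_mem hP hP', fun x => ?_⟩
  have e : commD a (b + b') = commD a b + commD a b' := TensorProduct.ext' fun p q => by
    rw [LinearMap.add_apply, commD_tmul, commD_tmul, commD_tmul, LinearMap.add_apply, mul_add, add_mul]
    abel
  rw [e, LinearMap.add_apply, map_mul (Polynomial.aeval tauDiff), mul_assoc, h, mul_left_comm, h',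
    add_zero]

theorem IsLocal.smul {a b : K →ₗ[ℂ] Module.End ℂ V} (c : ℂ) (h : IsLocal a b) :
    IsLocal a (c • b) := by
  obtain ⟨P, hP, h⟩ := h
  refine ⟨P, hP, fun x => ?_⟩
  have e : commD a (c • b) = c • commD a b := TensorProduct.ext' fun p q => by
    rw [LinearMap.smul_apply, commD_tmul, commD_tmul, LinearMap.smul_apply, mul_smul_comm,
      smul_mul_assoc, smul_sub]
  rw [e, LinearMap.smul_apply, h, smul_zero]

theorem exists_poleSet_neg {P : Polynomial ℂ} (hP : P ∈ poleSet) :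
    ∃ P' ∈ poleSet, ∃ c : ℂ, Polynomial.aeval (-Polynomial.X : Polynomial ℂ) P' = c • P := by
  induction hP using poleSet_induction with
  | one => exact ⟨1, poleSet.one_mem, 1, by simp⟩
  | mul n P _ ih =>
    obtain ⟨P', hP', c, h⟩ := ih
    refine ⟨_, poleSet.mul_mem (X_sub_C_mem_poleSet (-n)) hP', -c, ?_⟩
    rw [map_mul, h]
    simp only [map_sub, Polynomial.aeval_X, Polynomial.aeval_C, Int.cast_neg,
      Polynomial.algebraMap_eq, map_neg, neg_smul, Algebra.mul_smul_comm, ← smul_neg]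
    congr 1
    ring

theorem IsLocal.symm {a b : K →ₗ[ℂ] Module.End ℂ V} (h : IsLocal a b) : IsLocal b a := by
  obtain ⟨P, hP, h⟩ := h
  obtain ⟨P', hP', c, h'⟩ := exists_poleSet_neg hP
  refine ⟨P', hP', fun x => ?_⟩
  let e : K ⊗[ℂ] K →ₐ[ℂ] K ⊗[ℂ] K := Algebra.TensorProduct.comm ℂ K K
  have e1 : commD b a = -(commD a b ∘ₗ e.toLinearMap) := TensorProduct.ext' fun p q => by
    change _ = -commD a b (q ⊗ₜ p)
    rw [commD_tmul, commD_tmul, neg_sub]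
  have e2 : e (Polynomial.aeval tauDiff P') = c • Polynomial.aeval tauDiff P := by
    have h1 : e tauDiff = -tauDiff := by
      rw [tauDiff, map_sub, neg_sub]; rfl
    rw [← Polynomial.aeval_algHom_apply, h1, ← map_smul, ← h', ← Polynomial.aeval_algHom_apply]
    simp
  rw [e1, LinearMap.neg_apply, LinearMap.comp_apply, AlgHom.toLinearMap_apply, map_mul, e2,
    smul_mul_assoc, map_smul, h, smul_zero, neg_zero]

/-- A product of factors `x + y - n` lies in the ideal generated by two products of factors `x - n`
and `y - n`. -/
theorem exists_aeval_add {P Q : Polynomial ℂ} (hP : P ∈ poleSet) (hQ : Q ∈ poleSet) {A : Type*}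
    [CommRing A] [Algebra ℂ A] (x y : A) : ∃ H ∈ poleSet, ∃ U W, Polynomial.aeval (x + y) H =
      Polynomial.aeval x P * U + Polynomial.aeval y Q * W := by
  induction hP using poleSet_induction generalizing Q with
  | one => exact ⟨1, poleSet.one_mem, 1, 0, by simp⟩
  | mul n P hP ih =>
    induction hQ using poleSet_induction with
    | one => exact ⟨1, poleSet.one_mem, 0, 1, by simp⟩
    | mul m Q hQ ihQ =>
      obtain ⟨H₁, hH₁, U₁, W₁, h₁⟩ := ih (poleSet.mul_mem (X_sub_C_mem_poleSet m) hQ)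
      obtain ⟨H₂, hH₂, U₂, W₂, h₂⟩ := ihQ
      -- Use x+y−n−m = (x−n)+(y−m). The relation for H₁ multiplied by x−n, and that for H₂
      -- multiplied by y−m, both lie in the required ideal.
      refine ⟨_, poleSet.mul_mem (X_sub_C_mem_poleSet (n + m)) (poleSet.mul_mem hH₁ hH₂),
        U₁ * Polynomial.aeval (x + y) H₂ + (y - m) * Polynomial.aeval (x + y) H₁ * U₂,
        (x - n) * W₁ * Polynomial.aeval (x + y) H₂ + Polynomial.aeval (x + y) H₁ * W₂, ?_⟩
      simp only [map_mul, map_sub, Polynomial.aeval_X, map_intCast] at h₁ h₂ ⊢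
      push_cast
      linear_combination (x - n) * Polynomial.aeval (x + y) H₂ * h₁ +
        (y - m) * Polynomial.aeval (x + y) H₁ * h₂

namespace Fields

/-- The product of a field with a function. -/
def twist (b : Fields V) : K →ₗ[ℂ] Fields V where
  toFun s := ⟨tw s b.1, fun h => (b.isRat h).tw s⟩
  map_add' s t := Subtype.ext (add_tw s t b.1)
  map_smul' c s := Subtype.ext (smul_tw c s b.1)

theorem twist_coe (b : Fields V) (s : K) : (twist b s).1 = tw s b.1 := rfl
theorem twist_app (b : Fields V) (s : K) (h : V) : (twist b s).app h = tw s (b.app h) := rfl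

/-- The product with index `q` of `b(ρ)` and `c(τ)`, as a distribution in `ρ` and `τ`. -/
def prod₂ (b c : Fields V) (q : K) : K ⊗[ℂ] K →ₗ[ℂ] Module.End ℂ V :=
  TensorProduct.lift ((fieldSubmodule V).subtype ∘ₗ LinearMap.applyₗ c ∘ₗ prod.flip q ∘ₗ twist b)

theorem prod₂_tmul (b c : Fields V) (q s F : K) :
    prod₂ b c q (s ⊗ₜ F) = (prod (twist b s) q c).1 F := rfl

theorem prod₂_pol (b c : Fields V) (p : Polynomial ℂ) (w : K ⊗[ℂ] K) :
    prod₂ b c (pol p) w = commD b.1 c.1 (Polynomial.aeval tauDiff p * w) := by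
  induction w using TensorProduct.induction_on with
  | zero => simp
  | add x y hx hy => rw [map_add, hx, hy, mul_add, map_add]
  | tmul s F =>
    have e : commD (twist b s).1 c.1 = commD b.1 c.1 ∘ₗ LinearMap.mulLeft ℂ (s ⊗ₜ 1) :=
      TensorProduct.ext' fun p q => by
        rw [LinearMap.comp_apply, LinearMap.mulLeft_apply, Algebra.TensorProduct.tmul_mul_tmul,
          one_mul, commD_tmul, commD_tmul, twist_coe, tw_apply]
    rw [prod₂_tmul, prod_pol, e, LinearMap.comp_apply, LinearMap.mulLeft_apply, mul_left_comm,
      Algebra.TensorProduct.tmul_mul_tmul, one_mul, mul_one]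

theorem prod₂_add (b c : Fields V) (q q' : K) (w : K ⊗[ℂ] K) :
    prod₂ b c (q + q') w = prod₂ b c q w + prod₂ b c q' w := by
  induction w using TensorProduct.induction_on with
  | zero => simp
  | add x y hx hy => rw [map_add, hx, hy, map_add, map_add]; abel
  | tmul s F => rw [prod₂_tmul, map_add, LinearMap.add_apply]; rfl

theorem prod₂_smul (b c : Fields V) (r : ℂ) (q : K) (w : K ⊗[ℂ] K) :
    prod₂ b c (r • q) w = r • prod₂ b c q w := by
  induction w using TensorProduct.induction_on with
  | zero => simp
  | add x y hx hy => rw [map_add, hx, hy, map_add, smul_add]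
  | tmul s F => rw [prod₂_tmul, map_smul, LinearMap.smul_apply]; rfl

/-- In each half this is the identity κ = γ + (κ−γ). In the right half the variables are exchanged,
and the antipode of τ supplies the sign. It converts functions of ρ−τ into changes of the index. -/
theorem prod₂_tauDiff_mul (b c : Fields V) (q : K) (w : K ⊗[ℂ] K) :
    prod₂ b c q (tauDiff * w) = prod₂ b c (pol Polynomial.X * q) w := by
  induction w using TensorProduct.induction_on with
  | zero => simp
  | add x y hx hy => rw [mul_add, map_add, hx, hy, map_add]
  | tmul s F =>
    refine LinearMap.ext fun h => ?_
    have e : Polynomial.X = Polynomial.X - Polynomial.C ((0 : ℤ) : ℂ) := by simp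
    rw [tauDiff, sub_mul, Algebra.TensorProduct.tmul_mul_tmul, Algebra.TensorProduct.tmul_mul_tmul,
      one_mul, one_mul, map_sub, prod₂_tmul, prod₂_tmul, prod₂_tmul, LinearMap.sub_apply,
      prod_apply, prod_apply, prod_apply, twist_coe, twist_coe, twist_app, twist_app,
      mul_comm _ s, mul_comm _ F, ← tw_tw, ← tw_tw, ← tw_tw, ← tw_tw, e, conv_tw_X_sub ((c.isRat h).tw F),
      conv_tw_X_sub ((b.isRat h).tw s), ← e, map_mul, K.antipode_X, neg_mul, ← neg_one_smul ℂ,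
      conv_smul_right ((b.isRat h).tw s)]
    module

theorem prod₂_aeval_mul (b c : Fields V) (Q : Polynomial ℂ) (q : K) (w : K ⊗[ℂ] K) :
    prod₂ b c q (Polynomial.aeval tauDiff Q * w) = prod₂ b c (pol Q * q) w := by
  induction Q using Polynomial.induction_on' with
  | add p q hp hq => rw [map_add, map_add, add_mul, add_mul, map_add, hp, hq, prod₂_add]
  | monomial n r =>
    rw [← Polynomial.smul_X_eq_monomial, map_smul, map_smul, smul_mul_assoc, smul_mul_assoc,
      map_smul, prod₂_smul]
    congr 1
    induction n generalizing q with
    | zero => simp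
    | succ n ih =>
      rw [pow_succ', map_mul (Polynomial.aeval tauDiff), map_mul pol, Polynomial.aeval_X, mul_assoc, prod₂_tauDiff_mul, ih,
        mul_left_comm, mul_assoc]

/-- The product with index `q` of local fields is a product with polynomial index, hence it
vanishes after multiplication by a product of factors `ρ - τ - n`. -/
theorem exists_prod₂_eq_zero {b c : Fields V} (h : IsLocal b.1 c.1) (q : K) :
    ∃ Q ∈ poleSet, ∀ w, prod₂ b c q (Polynomial.aeval tauDiff Q * w) = 0 := by
  obtain ⟨P, hP, h⟩ := h
  obtain ⟨B, hB, A, hA⟩ := K.exists_pol_mul_eq q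
  refine ⟨P * B, poleSet.mul_mem hP hB, fun w => ?_⟩
  rw [prod₂_aeval_mul, map_mul pol, mul_assoc, hA, ← map_mul, prod₂_pol,
    map_mul (Polynomial.aeval tauDiff), mul_assoc, h]

end Fields

/-- `p ⊗ s ⊗ F ↦ (p ⊗ s) ⊗ F`. -/
def assoc₁₂ : K ⊗[ℂ] (K ⊗[ℂ] K) →ₐ[ℂ] (K ⊗[ℂ] K) ⊗[ℂ] K :=
  (Algebra.TensorProduct.assoc ℂ ℂ ℂ K K K).symm

/-- `p ⊗ s ⊗ F ↦ (p ⊗ F) ⊗ s`. -/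
def assoc₁₃ : K ⊗[ℂ] (K ⊗[ℂ] K) →ₐ[ℂ] (K ⊗[ℂ] K) ⊗[ℂ] K :=
  assoc₁₂.comp (Algebra.TensorProduct.map (AlgHom.id ℂ K) (Algebra.TensorProduct.comm ℂ K K))

/-- `p ⊗ s ⊗ F ↦ [a_p, b_s c_F]`. -/
def commMul (a b c : K →ₗ[ℂ] Module.End ℂ V) : K ⊗[ℂ] (K ⊗[ℂ] K) →ₗ[ℂ] Module.End ℂ V :=
  TensorProduct.lift (LinearMap.mul ℂ (Module.End ℂ V)) ∘ₗ TensorProduct.map (commD a b) c ∘ₗ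
      assoc₁₂.toLinearMap +
    TensorProduct.lift (LinearMap.mul ℂ (Module.End ℂ V)).flip ∘ₗ TensorProduct.map (commD a c) b ∘ₗ
      assoc₁₃.toLinearMap

/-- `p ⊗ s ⊗ F ↦ [a_p, c_F b_s]`. -/
def commMul' (a b c : K →ₗ[ℂ] Module.End ℂ V) : K ⊗[ℂ] (K ⊗[ℂ] K) →ₗ[ℂ] Module.End ℂ V :=
  TensorProduct.lift (LinearMap.mul ℂ (Module.End ℂ V)) ∘ₗ TensorProduct.map (commD a c) b ∘ₗ
      assoc₁₃.toLinearMap +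
    TensorProduct.lift (LinearMap.mul ℂ (Module.End ℂ V)).flip ∘ₗ TensorProduct.map (commD a b) c ∘ₗ
      assoc₁₂.toLinearMap

theorem commMul_tmul (a b c : K →ₗ[ℂ] Module.End ℂ V) (p s F : K) :
    commMul a b c (p ⊗ₜ (s ⊗ₜ F)) = a p * (b s * c F) - b s * c F * a p := by
  change (a p * b s - b s * a p) * c F + b s * (a p * c F - c F * a p) = _
  noncomm_ring

theorem commMul'_tmul (a b c : K →ₗ[ℂ] Module.End ℂ V) (p s F : K) :
    commMul' a b c (p ⊗ₜ (s ⊗ₜ F)) = a p * (c F * b s) - c F * b s * a p := by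
  change (a p * c F - c F * a p) * b s + c F * (a p * b s - b s * a p) = _
  noncomm_ring

theorem map_eq_zero_of_forall {M N : Type*} [AddCommGroup M] [Module ℂ M] [AddCommGroup N]
    [Module ℂ N] {β : K ⊗[ℂ] K →ₗ[ℂ] M} {t : K ⊗[ℂ] K} (h : ∀ x, β (t * x) = 0) (γ : K →ₗ[ℂ] N)
    (x : (K ⊗[ℂ] K) ⊗[ℂ] K) : TensorProduct.map β γ (t ⊗ₜ 1 * x) = 0 := by
  induction x using TensorProduct.induction_on with
  | zero => simp
  | add x y hx hy => rw [mul_add, map_add, hx, hy, add_zero]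
  | tmul x y => rw [Algebra.TensorProduct.tmul_mul_tmul, TensorProduct.map_tmul, h, TensorProduct.zero_tmul]

/-- `σ - ρ` in the variables `σ`, `ρ`, `τ`. -/
def diff₁₂ : K ⊗[ℂ] (K ⊗[ℂ] K) := pol Polynomial.X ⊗ₜ 1 - 1 ⊗ₜ (pol Polynomial.X ⊗ₜ 1)

/-- `σ - τ` in the variables `σ`, `ρ`, `τ`. -/
def diff₁₃ : K ⊗[ℂ] (K ⊗[ℂ] K) := pol Polynomial.X ⊗ₜ 1 - 1 ⊗ₜ (1 ⊗ₜ pol Polynomial.X)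

theorem assoc₁₂_aeval (P : Polynomial ℂ) : assoc₁₂ (Polynomial.aeval diff₁₂ P) =
    Polynomial.aeval tauDiff P ⊗ₜ 1 := by
  have h : assoc₁₂ diff₁₂ = (Algebra.TensorProduct.includeLeft : _ →ₐ[ℂ] _) tauDiff := by
    rw [diff₁₂, tauDiff, map_sub, map_sub]; rfl
  rw [← Polynomial.aeval_algHom_apply, h, Polynomial.aeval_algHom_apply]; rfl

theorem assoc₁₃_aeval (P : Polynomial ℂ) : assoc₁₃ (Polynomial.aeval diff₁₃ P) =
    Polynomial.aeval tauDiff P ⊗ₜ 1 := by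
  have h : assoc₁₃ diff₁₃ = (Algebra.TensorProduct.includeLeft : _ →ₐ[ℂ] _) tauDiff := by
    rw [diff₁₃, tauDiff, map_sub, map_sub]; rfl
  rw [← Polynomial.aeval_algHom_apply, h, Polynomial.aeval_algHom_apply]; rfl

/-- The Leibniz rule [a, bc] = [a, b]c + b[a, c] leaves one term killed by P(σ−ρ) and one killed by
Q(σ−τ). -/
theorem commMul_eq_zero {a b c : K →ₗ[ℂ] Module.End ℂ V} {P Q : Polynomial ℂ}
    (h : ∀ x, commD a b (Polynomial.aeval tauDiff P * x) = 0)
    (h' : ∀ x, commD a c (Polynomial.aeval tauDiff Q * x) = 0) (x : K ⊗[ℂ] (K ⊗[ℂ] K)) :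
    commMul a b c (Polynomial.aeval diff₁₂ P * (Polynomial.aeval diff₁₃ Q * x)) = 0 ∧
      commMul' a b c (Polynomial.aeval diff₁₂ P * (Polynomial.aeval diff₁₃ Q * x)) = 0 := by
  have e1 (y : K ⊗[ℂ] (K ⊗[ℂ] K)) :
      TensorProduct.map (commD a b) c (assoc₁₂ (Polynomial.aeval diff₁₂ P * y)) = 0 := by
    rw [map_mul, assoc₁₂_aeval, map_eq_zero_of_forall h]
  have e2 (y : K ⊗[ℂ] (K ⊗[ℂ] K)) :
      TensorProduct.map (commD a c) b (assoc₁₃ (Polynomial.aeval diff₁₃ Q * y)) = 0 := by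
    rw [map_mul, assoc₁₃_aeval, map_eq_zero_of_forall h']
  constructor <;>
  simp only [commMul, commMul', LinearMap.add_apply, LinearMap.comp_apply, AlgHom.toLinearMap_apply,
    mul_left_comm _ (Polynomial.aeval diff₁₃ Q), e2, map_zero] <;>
  rw [mul_left_comm, e1, map_zero, add_zero]

/-- `k ⊗ G ↦ k ⊗ G`. -/
def inclKP : KP →ₐ[ℂ] K ⊗[ℂ] K := Algebra.TensorProduct.map (AlgHom.id ℂ K) pol

/-- `k ⊗ G ↦ G ⊗ k`. -/
def swapKP : KP →ₐ[ℂ] K ⊗[ℂ] K :=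
  (Algebra.TensorProduct.comm ℂ K K : K ⊗[ℂ] K →ₐ[ℂ] K ⊗[ℂ] K).comp inclKP

theorem commMul_inclKP (a : K →ₗ[ℂ] Module.End ℂ V) (b c : Fields V) (z : KP) (p s F : K) (h : V) :
    commMul a b.1 c.1 (1 ⊗ₜ inclKP z * (p ⊗ₜ (s ⊗ₜ F))) h =
      a p (pair (tw s b.1) (polRes (tw F (c.app h))) z) -
        pair (tw s b.1) (polRes (tw F (c.app (a p h)))) z := by
  induction z using TensorProduct.induction_on with
  | zero => simp
  | add x y hx hy =>
    rw [map_add, TensorProduct.tmul_add, add_mul, map_add, LinearMap.add_apply, hx, hy, map_add,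
      map_add, map_add]
    abel
  | tmul k G =>
    have e : inclKP (k ⊗ₜ G) = k ⊗ₜ pol G := rfl
    rw [e, Algebra.TensorProduct.tmul_mul_tmul, Algebra.TensorProduct.tmul_mul_tmul, commMul_tmul, one_mul, mul_comm k, mul_comm _ F]
    rfl

theorem commMul'_swapKP (a : K →ₗ[ℂ] Module.End ℂ V) (b c : Fields V) (z : KP) (p s F : K) (h : V) :
    commMul' a b.1 c.1 (1 ⊗ₜ swapKP z * (p ⊗ₜ (s ⊗ₜ F))) h =
      a p (pair (tw F c.1) (polRes (tw s (b.app h))) z) -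
        pair (tw F c.1) (polRes (tw s (b.app (a p h)))) z := by
  induction z using TensorProduct.induction_on with
  | zero => simp
  | add x y hx hy =>
    rw [map_add, TensorProduct.tmul_add, add_mul, map_add, LinearMap.add_apply, hx, hy, map_add,
      map_add, map_add]
    abel
  | tmul k G =>
    have e : swapKP (k ⊗ₜ G) = pol G ⊗ₜ k := rfl
    rw [e, Algebra.TensorProduct.tmul_mul_tmul, Algebra.TensorProduct.tmul_mul_tmul, commMul'_tmul, one_mul, mul_comm k, mul_comm _ s]
    rfl

/-- `p ⊗ w ↦ [a_p, Ψ w]`. -/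
def commWith (a : K →ₗ[ℂ] Module.End ℂ V) (Ψ : K ⊗[ℂ] K →ₗ[ℂ] Module.End ℂ V) :
    K ⊗[ℂ] (K ⊗[ℂ] K) →ₗ[ℂ] Module.End ℂ V :=
  TensorProduct.lift ((LinearMap.mul ℂ (Module.End ℂ V)).compl₁₂ a Ψ -
    ((LinearMap.mul ℂ (Module.End ℂ V)).compl₁₂ Ψ a).flip)

theorem commWith_tmul (a : K →ₗ[ℂ] Module.End ℂ V) (Ψ : K ⊗[ℂ] K →ₗ[ℂ] Module.End ℂ V) (p : K)
    (w : K ⊗[ℂ] K) : commWith a Ψ (p ⊗ₜ w) = a p * Ψ w - Ψ w * a p := rfl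

/-- For fixed h and x, only finitely many singular parts occur. One representative of each expansion
then expresses the product through bc and cb, multiplied by functions of ρ and τ alone.
Multiplication by functions of σ−ρ and σ−τ commutes with these factors. -/
theorem exists_commWith_eq (a : K →ₗ[ℂ] Module.End ℂ V) (b c : Fields V) (q : K) (h : V)
    (x : K ⊗[ℂ] (K ⊗[ℂ] K)) : ∃ R : poleSet, ∀ R' : poleSet, (R : Polynomial ℂ) ∣ R' →
      ∀ z z', IsRep R' q z → IsRep R' (K.antipode q) z' →
        commWith a (Fields.prod₂ b c q) x h = commMul a b.1 c.1 (1 ⊗ₜ inclKP z * x) h -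
          commMul' a b.1 c.1 (1 ⊗ₜ swapKP z' * x) h := by
  have hadd : ∀ x y : K ⊗[ℂ] (K ⊗[ℂ] K), (∃ R : poleSet, ∀ R' : poleSet, (R : Polynomial ℂ) ∣ R' →
      ∀ z z', IsRep R' q z → IsRep R' (K.antipode q) z' →
        commWith a (Fields.prod₂ b c q) x h = commMul a b.1 c.1 (1 ⊗ₜ inclKP z * x) h -
          commMul' a b.1 c.1 (1 ⊗ₜ swapKP z' * x) h) →
      (∃ R : poleSet, ∀ R' : poleSet, (R : Polynomial ℂ) ∣ R' →
      ∀ z z', IsRep R' q z → IsRep R' (K.antipode q) z' →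
        commWith a (Fields.prod₂ b c q) y h = commMul a b.1 c.1 (1 ⊗ₜ inclKP z * y) h -
          commMul' a b.1 c.1 (1 ⊗ₜ swapKP z' * y) h) → ∃ R : poleSet, ∀ R' : poleSet, (R : Polynomial ℂ) ∣ R' →
      ∀ z z', IsRep R' q z → IsRep R' (K.antipode q) z' →
        commWith a (Fields.prod₂ b c q) (x + y) h = commMul a b.1 c.1 (1 ⊗ₜ inclKP z * (x + y)) h -
          commMul' a b.1 c.1 (1 ⊗ₜ swapKP z' * (x + y)) h := by
    rintro x y ⟨R₁, h₁⟩ ⟨R₂, h₂⟩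
    refine ⟨R₁ * R₂, fun R' hR' z z' hz hz' => ?_⟩
    rw [map_add, LinearMap.add_apply, h₁ R' ((dvd_mul_right _ _).trans hR') z z' hz hz',
      h₂ R' ((dvd_mul_left _ _).trans hR') z z' hz hz', mul_add, mul_add, map_add, map_add,
      LinearMap.add_apply, LinearMap.add_apply]
    abel
  induction x using TensorProduct.induction_on with
  | zero => exact ⟨1, fun _ _ _ _ _ _ => by simp⟩
  | add x y hx hy => exact hadd x y hx hy
  | tmul p w =>
    induction w using TensorProduct.induction_on with
    | zero => exact ⟨1, fun _ _ _ _ _ _ => by simp⟩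
    | add x y hx hy => rw [TensorProduct.tmul_add]; exact hadd _ _ hx hy
    | tmul s F =>
      obtain ⟨R₁, h₁⟩ := (c.isRat h).tw F
      obtain ⟨R₂, h₂⟩ := (c.isRat (a p h)).tw F
      obtain ⟨R₃, h₃⟩ := (b.isRat h).tw s
      obtain ⟨R₄, h₄⟩ := (b.isRat (a p h)).tw s
      refine ⟨R₁ * R₂ * (R₃ * R₄), fun R' hR' z z' hz hz' => ?_⟩
      rw [commMul_inclKP, commMul'_swapKP, commWith_tmul, LinearMap.sub_apply, Module.End.mul_apply,
        Module.End.mul_apply, Fields.prod₂_tmul, Fields.prod_apply, Fields.prod_apply,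
        Fields.twist_coe, Fields.twist_app, Fields.twist_app]
      have d12 : ((R₁ * R₂ : poleSet) : Polynomial ℂ) ∣ R' := (dvd_mul_right _ _).trans hR'
      have d34 : ((R₃ * R₄ : poleSet) : Polynomial ℂ) ∣ R' := (dvd_mul_left _ _).trans hR'
      rw [conv_eq (apply_pol_eq_zero_of_dvd h₁ ((dvd_mul_right _ _).trans d12)) _ hz,
        conv_eq (apply_pol_eq_zero_of_dvd h₂ ((dvd_mul_left _ _).trans d12)) _ hz,
        conv_eq (apply_pol_eq_zero_of_dvd h₃ ((dvd_mul_right _ _).trans d34)) _ hz',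
        conv_eq (apply_pol_eq_zero_of_dvd h₄ ((dvd_mul_left _ _).trans d34)) _ hz', map_sub]
      abel

/-- Dong's lemma: the products of mutually local fields are local. -/
theorem IsLocal.prod {a : K →ₗ[ℂ] Module.End ℂ V} {b c : Fields V} (hab : IsLocal a b.1)
    (hac : IsLocal a c.1) (hbc : IsLocal b.1 c.1) (q : K) : IsLocal a (Fields.prod b q c).1 := by
  obtain ⟨P, hP, hab⟩ := hab
  obtain ⟨Q, hQ, hac⟩ := hac
  obtain ⟨S, hS, hbc⟩ := Fields.exists_prod₂_eq_zero hbc q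
  -- Here x = σ−ρ and y = ρ−τ, so x+y = σ−τ. The part of H(σ−τ) divisible by P(σ−ρ) is handled by
  -- the locality of a, with the help of Q(σ−τ). The part divisible by S(ρ−τ) kills the product of b
  -- and c. Finally ρ is paired with 1.
  obtain ⟨H, hH, U, W, e⟩ := exists_aeval_add hP hS diff₁₂ (1 ⊗ₜ tauDiff)
  let j : K ⊗[ℂ] K →ₐ[ℂ] K ⊗[ℂ] (K ⊗[ℂ] K) :=
    Algebra.TensorProduct.map (AlgHom.id ℂ K) Algebra.TensorProduct.includeRight
  have hj (p F : K) : j (p ⊗ₜ F) = p ⊗ₜ (1 ⊗ₜ F) := rfl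
  have e1 : commD a (Fields.prod b q c).1 = commWith a (Fields.prod₂ b c q) ∘ₗ j.toLinearMap :=
    TensorProduct.ext' fun p F => by
      have : Fields.twist b 1 = b := Subtype.ext (tw_one b.1)
      rw [LinearMap.comp_apply, AlgHom.toLinearMap_apply, hj, commWith_tmul, Fields.prod₂_tmul,
        this, commD_tmul]
  have e2 : j tauDiff = diff₁₃ := by
    rw [tauDiff, map_sub, hj, hj, ← Algebra.TensorProduct.one_def, diff₁₃]
  have e3 : diff₁₂ + 1 ⊗ₜ tauDiff = diff₁₃ := by
    rw [diff₁₂, diff₁₃, tauDiff, TensorProduct.tmul_sub]; abel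
  have h1 (x : K ⊗[ℂ] (K ⊗[ℂ] K)) : commWith a (Fields.prod₂ b c q)
      (Polynomial.aeval diff₁₂ P * (Polynomial.aeval diff₁₃ Q * x)) = 0 := by
    refine LinearMap.ext fun h => ?_
    obtain ⟨R, hR⟩ := exists_commWith_eq a b c q h
      (Polynomial.aeval diff₁₂ P * (Polynomial.aeval diff₁₃ Q * x))
    obtain ⟨z, hz⟩ := exists_isRep R q
    obtain ⟨z', hz'⟩ := exists_isRep R (K.antipode q)
    rw [hR R dvd_rfl z z' hz hz', mul_left_comm, mul_left_comm _ (Polynomial.aeval diff₁₃ Q),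
      (commMul_eq_zero hab hac _).1, mul_left_comm (1 ⊗ₜ swapKP z'),
      mul_left_comm (1 ⊗ₜ swapKP z') (Polynomial.aeval diff₁₃ Q), (commMul_eq_zero hab hac _).2,
      sub_self]
    rfl
  have h2 (x : K ⊗[ℂ] (K ⊗[ℂ] K)) : commWith a (Fields.prod₂ b c q)
      (Polynomial.aeval (1 ⊗ₜ tauDiff) S * x) = 0 := by
    have : Polynomial.aeval ((1 : K) ⊗ₜ[ℂ] tauDiff) S = 1 ⊗ₜ Polynomial.aeval tauDiff S :=
      Polynomial.aeval_algHom_apply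
        (Algebra.TensorProduct.includeRight : K ⊗[ℂ] K →ₐ[ℂ] K ⊗[ℂ] (K ⊗[ℂ] K)) _ _
    rw [this]
    induction x using TensorProduct.induction_on with
    | zero => simp
    | add x y hx hy => rw [mul_add, map_add, hx, hy, add_zero]
    | tmul p w =>
      rw [Algebra.TensorProduct.tmul_mul_tmul, commWith_tmul, hbc, mul_zero, zero_mul, sub_zero]
  refine ⟨H * Q, poleSet.mul_mem hH hQ, fun x => ?_⟩
  rw [e1, LinearMap.comp_apply, AlgHom.toLinearMap_apply, map_mul j, ← Polynomial.aeval_algHom_apply,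
    e2, map_mul (Polynomial.aeval _), ← e3, e, e3, add_mul, add_mul, map_add]
  rw [mul_assoc, mul_assoc, mul_left_comm U, h1, mul_assoc, mul_assoc, h2, add_zero]

end

variable {C : Type*} [AddCommGroup C] [Module ℂ C] [HTConformalAlgebra C]

/-- The n-th term of the commutator depends on the test function only through the substitution τ₁ =
τ₂+n, so the factor τ₁−τ₂−n kills it. -/
theorem isLocal_gen (f g : C) : IsLocal (gen f).1 (gen g).1 := by
  set s := (HTConformalAlgebra.prod f g).support
  refine ⟨∏ n ∈ s, (Polynomial.X - Polynomial.C (n : ℂ)),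
    poleSet.prod_mem fun n _ => X_sub_C_mem_poleSet n, fun x => ?_⟩
  let φ (n : ℤ) : K ⊗[ℂ] K →ₐ[ℂ] K :=
    (Algebra.TensorProduct.lmul' ℂ).comp (Algebra.TensorProduct.map (K.shift n) (AlgHom.id ℂ K))
  have hφ (n : ℤ) (p q : K) : φ n (p ⊗ₜ q) = K.shift n p * q := by
    simp [φ]
  have e : commD (gen f).1 (gen g).1 =
      ∑ n ∈ s, (gen (HTConformalAlgebra.prod f g n)).1 ∘ₗ (φ n).toLinearMap :=
    TensorProduct.ext' fun p q => by
      rw [commD_tmul, gen_comm, LinearMap.sum_apply]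
      exact Finset.sum_congr rfl fun n _ => by
        rw [LinearMap.comp_apply, AlgHom.toLinearMap_apply, hφ]
  rw [e, LinearMap.sum_apply]
  refine Finset.sum_eq_zero fun n hn => ?_
  have h1 : φ n tauDiff = algebraMap ℂ K n := by
    rw [tauDiff, map_sub, hφ, hφ, K.shift_X, map_one, map_intCast]; ring
  rw [LinearMap.comp_apply, AlgHom.toLinearMap_apply, map_mul, ← Polynomial.aeval_algHom_apply, h1,
    Polynomial.aeval_algebraMap_apply, map_prod]
  rw [Finset.prod_eq_zero hn (by simp), map_zero, zero_mul, map_zero]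

theorem isLocal_vacField {V : Type*} [AddCommGroup V] [Module ℂ V] (a : K →ₗ[ℂ] Module.End ℂ V) :
    IsLocal a (vacField V).1 :=
  ⟨1, poleSet.one_mem, fun x => by rw [commD_vacField]; rfl⟩

theorem isLocal_gen_vop (f : C) (w : VacMod C) : IsLocal (gen f).1 (vop C w) := by
  induction w using vacMod_induction generalizing f with
  | v0 => rw [vop_eq, stateField_v0]; exact isLocal_vacField _
  | add w w' h h' => rw [map_add]; exact (h f).add (h' f)
  | smul c w h => rw [map_smul]; exact (h f).smul c
  | act g p w ih =>
    rw [vop_eq, stateField_act]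
    exact (isLocal_gen f g).prod (ih f) (ih g) p

/-- The vertex operators are local. -/
theorem isLocal_vop (v w : VacMod C) : IsLocal (vop C v) (vop C w) := by
  induction v using vacMod_induction generalizing w with
  | v0 => rw [vop_eq (v0 C), stateField_v0]; exact (isLocal_vacField _).symm
  | add v v' h h' => rw [map_add]; exact ((h w).symm.add (h' w).symm).symm
  | smul c v h => rw [map_smul]; exact ((h w).symm.smul c).symm
  | act f p v ih =>
    rw [vop_eq (act _ v), stateField_act]
    exact ((isLocal_gen_vop f w).symm.prod (ih w).symm (isLocal_gen_vop f v) p).symm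

end HTVertex
end

noncomputable section
namespace HTVertex
open KP Finset

/-! ### Skew symmetry -/

section
variable {W : Type*} [AddCommGroup W] [Module ℂ W]

/-- On the antidiagonal of j+1 the two indices add up to j+1. Distributing this factor over them and
reindexing gives the two sums. It is the Leibniz rule for divided powers. -/
theorem sum_antidiagonal_natCast_mul (A : ℕ × ℕ → W) (j : ℕ) :
    ∑ p ∈ antidiagonal j, (((p.1 : ℂ) + 1) • A (p.1 + 1, p.2) + ((p.2 : ℂ) + 1) • A (p.1, p.2 + 1)) =
      ((j : ℂ) + 1) • ∑ p ∈ antidiagonal (j + 1), A p := by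
  have h : ((j : ℂ) + 1) • ∑ p ∈ antidiagonal (j + 1), A p =
      ∑ p ∈ antidiagonal (j + 1), (p.1 : ℂ) • A p + ∑ p ∈ antidiagonal (j + 1), (p.2 : ℂ) • A p := by
    rw [smul_sum, ← sum_add_distrib]
    refine sum_congr rfl fun p hp => ?_
    rw [← add_smul, ← Nat.cast_add, mem_antidiagonal.mp hp]
    push_cast; rfl
  rw [h, sum_add_distrib, Finset.Nat.sum_antidiagonal_succ, Finset.Nat.sum_antidiagonal_succ' (f := fun p : ℕ × ℕ => (p.2 : ℂ) • A p)]
  simp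

/-- The divided powers of the derivative. -/
def K.divDeriv (l : ℕ) : K →ₗ[ℂ] K := ((l.factorial : ℂ)⁻¹) • K.deriv ^ l

theorem K.divDeriv_zero (F : K) : K.divDeriv 0 F = F := by simp [K.divDeriv]

theorem K.deriv_pow_deriv (l : ℕ) (F : K) : (K.deriv ^ l) (K.deriv F) = (K.deriv ^ (l + 1)) F := by
  rw [pow_succ]; rfl

theorem K.divDeriv_deriv (l : ℕ) (F : K) :
    K.divDeriv l (K.deriv F) = ((l : ℂ) + 1) • K.divDeriv (l + 1) F := by
  rw [K.divDeriv, K.divDeriv, LinearMap.smul_apply, LinearMap.smul_apply, K.deriv_pow_deriv, smul_smul,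
    Nat.factorial_succ]
  congr 1
  have h1 : (l.factorial : ℂ) ≠ 0 := Nat.cast_ne_zero.mpr l.factorial_ne_zero
  have h2 : (l : ℂ) + 1 ≠ 0 := by exact_mod_cast Nat.succ_ne_zero l
  push_cast
  field_simp

theorem K.deriv_divDeriv (l : ℕ) (F : K) :
    K.deriv (K.divDeriv l F) = ((l : ℂ) + 1) • K.divDeriv (l + 1) F := by
  rw [← K.divDeriv_deriv, K.divDeriv, LinearMap.smul_apply, LinearMap.smul_apply, map_smul,
    K.deriv_pow_deriv, pow_succ']
  rfl

/-- L has derivative −1 and no higher derivatives, so only two terms of the Leibniz rule survive. -/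
theorem K.divDeriv_mul {L : K} (hL : K.deriv L = -1) (l : ℕ) (F : K) :
    K.divDeriv (l + 1) (L * F) = L * K.divDeriv (l + 1) F - K.divDeriv l F := by
  have h2 (l : ℕ) : (l : ℂ) + 1 ≠ 0 := by exact_mod_cast Nat.succ_ne_zero l
  refine smul_right_injective _ (h2 l) ?_
  dsimp only
  rw [← K.deriv_divDeriv, smul_sub, ← mul_smul_comm, ← K.deriv_divDeriv]
  induction l with
  | zero => simp [K.divDeriv_zero, K.deriv_mul, hL, sub_eq_add_neg]
  | succ l ih =>
    have h3 : K.divDeriv (l + 1) (L * F) = L * K.divDeriv (l + 1) F - K.divDeriv l F := by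
      refine smul_right_injective _ (h2 l) ?_
      dsimp only
      rw [← K.deriv_divDeriv, ih, smul_sub, ← mul_smul_comm, ← K.deriv_divDeriv]
    rw [h3, map_sub, K.deriv_mul, hL, K.deriv_divDeriv l]
    push_cast
    rw [mul_neg, mul_one]
    module

theorem K.divDeriv_u (n : ℤ) (l : ℕ) : K.divDeriv l (K.u n 0) = (-1 : ℂ) ^ l • K.u n l := by
  have h2 (l : ℕ) : (l : ℂ) + 1 ≠ 0 := by exact_mod_cast Nat.succ_ne_zero l
  induction l with
  | zero => simp [K.divDeriv_zero]
  | succ l ih =>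
    refine smul_right_injective _ (h2 l) ?_
    dsimp only
    rw [← K.deriv_divDeriv, ih, map_smul, K.deriv_u, pow_succ]
    module

/-- Two families of functionals that vanish on polynomials satisfy the same Leibniz rule after
multiplication by a polynomial. -/
theorem antidiagonal_leibniz (m : ℤ) (Φ : K →ₗ[ℂ] W) (Θ : ℕ → K →ₗ[ℂ] W) (hΦ : ∀ G, Φ (pol G) = 0)
    (hΘ : ∀ k G, Θ k (pol G) = 0)
    (h : ∀ j, Φ (K.u m j) = ∑ p ∈ antidiagonal j, Θ p.1 (K.u m p.2)) (A : Polynomial ℂ) (j : ℕ) :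
    Φ (pol A * K.u m j) = ∑ p ∈ antidiagonal j, Θ p.1 (pol A * K.u m p.2) := by
  have hX (A : Polynomial ℂ)
      (ih : ∀ j, Φ (pol A * K.u m j) = ∑ p ∈ antidiagonal j, Θ p.1 (pol A * K.u m p.2)) (j : ℕ) :
      Φ (pol (A * (Polynomial.X - Polynomial.C (m : ℂ))) * K.u m j) =
        ∑ p ∈ antidiagonal j, Θ p.1 (pol (A * (Polynomial.X - Polynomial.C (m : ℂ))) * K.u m p.2) := by
    cases j with
    | zero =>
      rw [Finset.Nat.antidiagonal_zero, Finset.sum_singleton, map_mul pol, mul_assoc, K.pol_X_sub_mul_u_zero,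
        mul_one, hΦ, hΘ]
    | succ j =>
      rw [Finset.Nat.sum_antidiagonal_succ']
      simp only [map_mul pol, mul_assoc, K.pol_X_sub_mul_u_zero, K.pol_X_sub_mul_u_succ, mul_one, hΘ,
        zero_add, ih]
  induction A using Polynomial.induction_on generalizing j with
  | C a =>
    simp only [K.pol_C, ← Algebra.smul_def, map_smul, h, smul_sum]
  | add p q hp hq =>
    simp only [map_add, add_mul, hp, hq, sum_add_distrib]
  | monomial n a ih =>
    have h1 := hX _ ih
    have e : Polynomial.C a * Polynomial.X ^ (n + 1) =
        Polynomial.C a * Polynomial.X ^ n * (Polynomial.X - Polynomial.C (m : ℂ)) +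
          (m : ℂ) • (Polynomial.C a * Polynomial.X ^ n) := by
      rw [Polynomial.smul_eq_C_mul]; ring
    rw [e]
    simp only [map_add, add_mul, map_smul, smul_mul_assoc, h1, ih, sum_add_distrib, smul_sum]

theorem K.deriv_shift (n : ℤ) (F : K) : K.deriv (K.shift n F) = K.shift n (K.deriv F) := by
  refine LinearMap.congr_fun (f := K.deriv ∘ₗ (K.shift n).toLinearMap)
    (g := (K.shift n).toLinearMap ∘ₗ K.deriv) (K.linear_ext (fun G => ?_) fun m j => ?_) F
  · simp only [LinearMap.comp_apply, AlgHom.toLinearMap_apply]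
    rw [← pol_pshift, K.deriv_pol, K.deriv_pol, ← pol_pshift]
    congr 1
    rw [pshift, ← Polynomial.comp_eq_aeval, Polynomial.derivative_comp, ← Polynomial.comp_eq_aeval]
    simp
  · simp only [LinearMap.comp_apply, AlgHom.toLinearMap_apply, K.shift_u, K.deriv_u, map_smul]

end

variable {C : Type*} [AddCommGroup C] [Module ℂ C] [HTConformalAlgebra C]

/-- For j = 0 this is covariance under the translation by m. Applying `infT` raises the Taylor index
on both sides, and its commutator with a vertex operator supplies the derivatives of q. -/
theorem sum_taylor_deriv (g f : VacMod C) (m : ℤ) (j : ℕ) (q : K) :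
    vop C g q (vop C f (K.u m j) (v0 C)) = ∑ p ∈ antidiagonal j,
      vop C (vop C g (K.divDeriv p.2 (K.shift m q)) f) (K.u m p.1) (v0 C) := by
  induction j generalizing q with
  | zero =>
    rw [Finset.Nat.antidiagonal_zero, Finset.sum_singleton, K.divDeriv_zero]
    change vop C g q (tPow C m f) = tPow C m (vop C g (K.shift m q) f)
    rw [tPow_vop, K.shift_shift, neg_add_cancel, K.shift_zero]
  | succ j ih =>
    have h0 : (j : ℂ) + 1 ≠ 0 := by exact_mod_cast Nat.succ_ne_zero j
    have hR (w : VacMod C) (k : ℕ) : infT C (vop C w (K.u m k) (v0 C)) =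
        ((k : ℂ) + 1) • vop C w (K.u m (k + 1)) (v0 C) := by
      rw [infT_vop, infT_v0, map_zero, zero_sub, K.deriv_u, neg_smul, map_neg, LinearMap.neg_apply,
        neg_neg, map_smul, LinearMap.smul_apply]
    refine smul_right_injective _ h0 ?_
    dsimp only
    have h1 := infT_vop g q (vop C f (K.u m j) (v0 C))
    rw [hR, map_smul, eq_sub_iff_add_eq, ih, ih, map_sum] at h1
    rw [← h1, ← sum_antidiagonal_natCast_mul, sum_add_distrib]
    congr 1
    · exact sum_congr rfl fun p _ => hR _ _
    · refine sum_congr rfl fun p _ => ?_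
      rw [← K.deriv_shift, K.divDeriv_deriv]
      simp only [map_smul, LinearMap.smul_apply]

/-- `p ⊗ q ↦ a_p b_q v`. -/
def applyMul {V : Type*} [AddCommGroup V] [Module ℂ V] (a b : K →ₗ[ℂ] Module.End ℂ V) (v : V) :
    K ⊗[ℂ] K →ₗ[ℂ] V :=
  LinearMap.applyₗ v ∘ₗ TensorProduct.lift ((LinearMap.mul ℂ (Module.End ℂ V)).compl₁₂ a b)

/-- `p ⊗ q ↦ b_q a_p v`. -/
def applyMul' {V : Type*} [AddCommGroup V] [Module ℂ V] (a b : K →ₗ[ℂ] Module.End ℂ V) (v : V) :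
    K ⊗[ℂ] K →ₗ[ℂ] V :=
  LinearMap.applyₗ v ∘ₗ TensorProduct.lift ((LinearMap.mul ℂ (Module.End ℂ V)).compl₁₂ b a).flip

section
variable {V : Type*} [AddCommGroup V] [Module ℂ V]

theorem applyMul_tmul (a b : K →ₗ[ℂ] Module.End ℂ V) (v : V) (p q : K) :
    applyMul a b v (p ⊗ₜ q) = a p (b q v) := rfl

theorem applyMul'_tmul (a b : K →ₗ[ℂ] Module.End ℂ V) (v : V) (p q : K) :
    applyMul' a b v (p ⊗ₜ q) = b q (a p v) := rfl

theorem commD_apply (a b : K →ₗ[ℂ] Module.End ℂ V) (v : V) (x : K ⊗[ℂ] K) :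
    commD a b x v = applyMul a b v x - applyMul' a b v x := by
  induction x using TensorProduct.induction_on with
  | zero => simp
  | add x y hx hy => simp only [map_add, LinearMap.add_apply, hx, hy]; abel
  | tmul p q => rfl

end

/-- τ₁−τ₂−n = (τ₁−m) + (m−n−τ₂). The free parameter m adapts the first summand to a pole at m, so
that functions of the difference can be removed one linear factor at a time. -/
theorem aeval_tauDiff_mul (m n : ℤ) (P : Polynomial ℂ) (x y : K) :
    Polynomial.aeval tauDiff ((Polynomial.X - Polynomial.C (n : ℂ)) * P) * (x ⊗ₜ y) =
      Polynomial.aeval tauDiff P * ((pol (Polynomial.X - Polynomial.C (m : ℂ)) * x) ⊗ₜ y) +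
        Polynomial.aeval tauDiff P *
          (x ⊗ₜ (pol (Polynomial.C ((m - n : ℤ) : ℂ) - Polynomial.X) * y)) := by
  have hs (n : ℤ) (z : K ⊗[ℂ] K) : (n : ℂ) • z = n * z :=
    (Algebra.smul_def (n : ℂ) z).trans (by rw [map_intCast])
  have h1 : ((pol (Polynomial.X - Polynomial.C (m : ℂ)) * x) ⊗ₜ[ℂ] y : K ⊗[ℂ] K) =
      (pol Polynomial.X * x) ⊗ₜ y - (m : K ⊗[ℂ] K) * (x ⊗ₜ y) := by
    rw [map_sub, K.pol_C, sub_mul, TensorProduct.sub_tmul, ← Algebra.smul_def,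
      ← TensorProduct.smul_tmul']
    exact congrArg (_ - ·) (hs m _)
  have h2 : (x ⊗ₜ[ℂ] (pol (Polynomial.C ((m - n : ℤ) : ℂ) - Polynomial.X) * y) : K ⊗[ℂ] K) =
      ((m - n : ℤ) : K ⊗[ℂ] K) * (x ⊗ₜ y) - x ⊗ₜ (pol Polynomial.X * y) := by
    rw [map_sub, K.pol_C, sub_mul, TensorProduct.tmul_sub, ← Algebra.smul_def,
      TensorProduct.tmul_smul]
    exact congrArg (· - _) (hs _ _)
  rw [h1, h2, map_mul, map_sub, Polynomial.aeval_X, Polynomial.aeval_C, map_intCast]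
  have e : tauDiff * (x ⊗ₜ y) = (pol Polynomial.X * x) ⊗ₜ y - x ⊗ₜ (pol Polynomial.X * y) := by
    rw [tauDiff, sub_mul, Algebra.TensorProduct.tmul_mul_tmul, Algebra.TensorProduct.tmul_mul_tmul,
      one_mul, one_mul]
  push_cast
  linear_combination Polynomial.aeval tauDiff P * e

/-- Polynomial modes of g kill the vacuum, and multiplication by functions of τ₁−τ₂ keeps the second
test function polynomial. -/
theorem applyMul_pol (f g : VacMod C) {P : Polynomial ℂ} (hP : P ∈ poleSet) (F : K)
    (G : Polynomial ℂ) : applyMul (vop C f) (vop C g) (v0 C)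
      (Polynomial.aeval tauDiff P * (F ⊗ₜ pol G)) = 0 := by
  induction hP using poleSet_induction generalizing F G with
  | one => rw [map_one, one_mul, applyMul_tmul, vop_pol_v0, map_zero]
  | mul n P hP ih => rw [aeval_tauDiff_mul 0, map_add, ih, ← map_mul pol, ih, add_zero]

theorem applyMul'_pol (f g : VacMod C) {P : Polynomial ℂ} (hP : P ∈ poleSet) (G : Polynomial ℂ)
    (q : K) : applyMul' (vop C f) (vop C g) (v0 C)
      (Polynomial.aeval tauDiff P * (pol G ⊗ₜ q)) = 0 := by
  induction hP using poleSet_induction generalizing G q with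
  | one => rw [map_one, one_mul, applyMul'_tmul, vop_pol_v0, map_zero]
  | mul n P hP ih => rw [aeval_tauDiff_mul 0, map_add, ih, ← map_mul pol, ih, add_zero]

/-- Since τ·(1/τ) is a polynomial, it contributes nothing on the vacuum. So τ₂ may be set to 0, and
P(τ₁−τ₂) becomes P(τ₁). -/
theorem applyMul_vacuum (f g : VacMod C) {P : Polynomial ℂ} (hP : P ∈ poleSet) (F : K) :
    applyMul (vop C f) (vop C g) (v0 C) (Polynomial.aeval tauDiff P * (F ⊗ₜ K.u 0 0)) =
      vop C f (pol P * F) g := by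
  induction hP using poleSet_induction generalizing F with
  | one => rw [map_one, one_mul, applyMul_tmul, vop_u_zero_v0, map_one, one_mul]
  | mul n P hP ih =>
    have e : pol (Polynomial.C ((0 - n : ℤ) : ℂ) - Polynomial.X) * K.u 0 0 =
        (-n : ℂ) • K.u 0 0 - pol 1 := by
      rw [map_sub, sub_mul, K.X_mul_u_zero, K.pol_C, map_one, ← Algebra.smul_def]
      simp
    rw [aeval_tauDiff_mul 0, map_add, ih, e, TensorProduct.tmul_sub, mul_sub,
      map_sub (applyMul _ _ _),
      applyMul_pol f g hP,      TensorProduct.tmul_smul, mul_smul_comm, map_smul, ih, sub_zero, ← LinearMap.smul_apply,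
      ← map_smul, ← LinearMap.add_apply, ← map_add]
    congr 2
    rw [map_mul pol, map_sub, map_sub, K.pol_C, K.pol_C, Algebra.smul_def, map_neg, Int.cast_zero, map_zero]
    ring

theorem K.antipode_pol (p : Polynomial ℂ) :
    K.antipode (pol p) = pol (Polynomial.aeval (-Polynomial.X : Polynomial ℂ) p) := by
  have : K.antipode.comp pol = pol.comp (Polynomial.aeval (-Polynomial.X : Polynomial ℂ)) := by
    apply Polynomial.algHom_ext
    simp [K.antipode_X]
  exact DFunLike.congr_fun this p

/-- Moving the Taylor expansion of f(σ)v0 out of g(τ) replaces τ by τ−σ in the field of g. In the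
new variable P(σ−τ) is P(−τ), the antipode of P. -/
theorem applyMul'_vacuum (f g : VacMod C) {P : Polynomial ℂ} (hP : P ∈ poleSet) (m : ℤ) (j : ℕ)
    (q : K) : applyMul' (vop C f) (vop C g) (v0 C) (Polynomial.aeval tauDiff P * (K.u m j ⊗ₜ q)) =
      ∑ p ∈ antidiagonal j, vop C (vop C g (K.antipode (pol P) * K.divDeriv p.2 (K.shift m q)) f)
        (K.u m p.1) (v0 C) := by
  let A (k : ℕ) : K →ₗ[ℂ] VacMod C := (expOp (v0 C) (vop C)).flip (K.u m k) ∘ₗ (vop C g).flip f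
  change _ = ∑ p ∈ antidiagonal j, A p.1 (K.antipode (pol P) * K.divDeriv p.2 (K.shift m q))
  have hA (k : ℕ) (F : K) : A k F = vop C (vop C g F f) (K.u m k) (v0 C) := rfl
  induction hP using poleSet_induction generalizing j q with
  | one =>
    simp only [map_one, one_mul]
    rw [applyMul'_tmul, sum_taylor_deriv]; rfl
  | mul n P hP ih =>
    -- L is the antipode of the linear factor being added. The term −`divDeriv` of the Leibniz rule
    -- for L cancels the contribution of τ₁−m, which lowers the order of the pole.
    set L : K := pol (-Polynomial.X - Polynomial.C (n : ℂ)) with hL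
    have e1 : K.shift m (pol (Polynomial.C ((m - n : ℤ) : ℂ) - Polynomial.X) * q) =
        L * K.shift m q := by
      rw [map_mul, ← pol_pshift, pshift, hL]
      congr 2
      simp
      ring
    have e2 : K.antipode (pol ((Polynomial.X - Polynomial.C (n : ℂ)) * P)) =
        K.antipode (pol P) * L := by
      rw [map_mul pol, map_mul, mul_comm, K.antipode_pol (Polynomial.X - _), hL]
      congr 2
      simp
    have e3 : K.deriv L = -1 := by
      rw [hL, K.deriv_pol]; simp
    rw [aeval_tauDiff_mul m, map_add, ih, e1, e2]
    cases j with
    | zero =>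
      rw [K.pol_X_sub_mul_u_zero, ← map_one pol, applyMul'_pol f g hP, zero_add]
      simp only [Finset.Nat.antidiagonal_zero, Finset.sum_singleton, K.divDeriv_zero, mul_assoc]
    | succ j =>
      rw [K.pol_X_sub_mul_u_succ, ih, Finset.Nat.sum_antidiagonal_succ',
        Finset.Nat.sum_antidiagonal_succ']
      simp only [K.divDeriv_mul e3, K.divDeriv_zero, mul_sub, map_sub, Finset.sum_sub_distrib,
        mul_assoc]
      abel

theorem IsRat.antipodal {V : Type*} [AddCommGroup V] [Module ℂ V] {ξ : K →ₗ[ℂ] V} (h : IsRat ξ) :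
    IsRat (antipodal ξ) := by
  obtain ⟨⟨R, hR⟩, h⟩ := h
  obtain ⟨R', hR', c, e⟩ := exists_poleSet_neg hR
  refine ⟨⟨R', hR'⟩, fun G => ?_⟩
  change -ξ (K.antipode (pol (R' * G))) = 0
  rw [K.antipode_pol, map_mul, e, smul_mul_assoc, map_smul, map_smul, h, smul_zero, neg_zero]

theorem exists_poleSet_clearing (s : Finset (ℤ × ℕ)) :
    ∃ P ∈ poleSet, ∀ p ∈ s, ∃ G, K.u p.1 p.2 * pol P = pol G := by
  induction s using Finset.induction_on with
  | empty => exact ⟨1, poleSet.one_mem, by simp⟩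
  | insert q s _ ih =>
    obtain ⟨P, hP, h⟩ := ih
    refine ⟨(Polynomial.X - Polynomial.C (q.1 : ℂ)) ^ (q.2 + 1) * P,
      poleSet.mul_mem (poleSet.pow_mem (X_sub_C_mem_poleSet _) _) hP, fun p hp => ?_⟩
    rcases Finset.mem_insert.mp hp with rfl | hp
    · exact ⟨P, by rw [map_mul pol, map_pow, K.pol_X_sub, ← mul_assoc, K.u_spec, one_mul]⟩
    · obtain ⟨G, hG⟩ := h p hp
      exact ⟨_ * G, by rw [map_mul pol, mul_left_comm, hG, map_mul pol]⟩

theorem exists_common_poleSet (f g : VacMod C) (s : Finset (ℤ × ℕ)) :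
    ∃ P ∈ poleSet, (∀ G, vop C f (pol P * pol G) g = 0) ∧
      (∀ x, commD (vop C f) (vop C g) (Polynomial.aeval tauDiff P * x) = 0) ∧
      ∀ p ∈ s, ∃ G, K.u p.1 p.2 * pol P = pol G := by
  obtain ⟨⟨P₁, hP₁⟩, h₁⟩ := isRat_vop f g
  obtain ⟨P₂, hP₂, h₂⟩ := isLocal_vop f g
  obtain ⟨P₃, hP₃, h₃⟩ := exists_poleSet_clearing s
  refine ⟨P₁ * (P₂ * P₃), poleSet.mul_mem hP₁ (poleSet.mul_mem hP₂ hP₃), fun G => ?_, fun x => ?_,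
    fun p hp => ?_⟩
  · rw [← map_mul pol, mul_assoc P₁]
    exact h₁ _
  · rw [mul_left_comm, map_mul (Polynomial.aeval tauDiff), mul_assoc, h₂]
  · obtain ⟨G, hG⟩ := h₃ p hp
    exact ⟨P₁ * (P₂ * G), by
      rw [map_mul pol, map_mul pol, mul_left_comm, mul_left_comm (K.u _ _), hG, map_mul pol,
        map_mul pol]⟩

/-- Skew symmetry of the vertex operators. -/
theorem vop_skew (f g : VacMod C) : ∃ s, IsSingKernel (antipodal ((vop C g).flip f)) s ∧
    ∀ F : K, vop C f F g = expMul (expOp (v0 C) (vop C)) (antipodal ((vop C g).flip f)) s F := by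
  set D := antipodal ((vop C g).flip f) with hD
  obtain ⟨s, hs⟩ := (isRat_vop g f).antipodal.exists_isSingKernel
  refine ⟨s, hs, ?_⟩
  -- P is chosen so that it clears the singular part of Y(f)g, kills the commutator of the two
  -- fields, and clears the poles that occur in s.
  obtain ⟨P, hP, h₁, h₂, h₃⟩ := exists_common_poleSet f g s.support
  let Rk (m : ℤ) (k : ℕ) : VacMod C →ₗ[ℂ] VacMod C := (expOp (v0 C) (vop C)).flip (K.u m k)
  let B (p : ℤ × ℕ) : VacMod C := ∑ kl ∈ antidiagonal p.2, Rk p.1 kl.1 (D (K.u p.1 kl.2))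
  let E₁ : K →ₗ[ℂ] VacMod C :=
    (Finsupp.lsum ℂ fun p => LinearMap.toSpanSingleton ℂ (VacMod C) (B p)) ∘ₗ K.polar
  let E₂ : K →ₗ[ℂ] VacMod C := ∑ p ∈ s.support,
    expOp (v0 C) (vop C) (s p) ∘ₗ LinearMap.mulLeft ℂ (K.u p.1 p.2)
  have hE (F : K) : expMul (expOp (v0 C) (vop C)) D s F = E₁ F + E₂ F := by
    rw [expMul]
    congr 1
    · rw [finsum_eq_sum_of_support_subset (s := (K.polar F).support)]
      · rfl
      · intro p hp
        rw [Finset.mem_coe, Finsupp.mem_support_iff, K.polar_apply]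
        intro h
        exact hp (by simp only [h, zero_smul])
    · simp only [E₂, LinearMap.sum_apply]; rfl
  have hE₁pol (G : Polynomial ℂ) : E₁ (pol G) = 0 := by
    simp only [E₁, LinearMap.comp_apply, K.polar_pol, map_zero]
  have hRpol (v : VacMod C) (G : Polynomial ℂ) : expOp (v0 C) (vop C) v (pol G) = 0 := vop_pol_v0 v G
  -- D is split into its holomorphic part, which sees only the singular part of F, and its singular
  -- part. In the latter the singular part of F may be restored, because products of singular
  -- functions have trace zero.
  have hDF (F : K) : D F = D (K.singPart F) +
      ∑ p ∈ s.support, K.tr (K.u p.1 p.2 * F) • s p := by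
    obtain ⟨G, hG⟩ := K.exists_eq_pol_add_singPart F
    have h1 : D F = D (pol G) + D (K.singPart F) := by rw [← map_add, ← hG]
    rw [h1, hs G, add_comm]
    congr 1
    refine Finset.sum_congr rfl fun p _ => ?_
    conv_rhs => rw [hG, mul_add, K.tr_add, K.tr_sing_mul_sing (K.u_mem _ _) (K.singPart_mem F), add_zero]
  have key : (vop C f).flip g ∘ₗ LinearMap.mulLeft ℂ (pol P) =
      (E₁ + E₂) ∘ₗ LinearMap.mulLeft ℂ (pol P) := by
    refine K.linear_ext (fun G => ?_) fun m j => ?_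
    · simp only [LinearMap.comp_apply, LinearMap.mulLeft_apply, ← map_mul pol]
      have e1 : (vop C f).flip g (pol (P * G)) = 0 := by
        rw [map_mul]; exact h₁ _
      have e2 : E₂ (pol (P * G)) = 0 := by
        simp only [E₂, LinearMap.sum_apply, LinearMap.comp_apply, LinearMap.mulLeft_apply]
        refine Finset.sum_eq_zero fun p hp => ?_
        obtain ⟨G', hG'⟩ := h₃ p hp
        rw [map_mul pol, ← mul_assoc, hG', ← map_mul pol, hRpol]
      rw [e1, LinearMap.add_apply, hE₁pol, e2, add_zero]
    -- Locality multiplied by P equates the two orders of f and g on the vacuum, tested against `u m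
    -- j` and 1/τ. The signs of the divided derivatives of 1/(τ+m) combine into the antipode of `u m
    -- j`.
    · have e1 : vop C f (pol P * K.u m j) g =
          ∑ p ∈ antidiagonal j, Rk m p.1 (D (pol P * K.u m p.2)) := by
        have h5 := commD_apply (vop C f) (vop C g) (v0 C)
          (Polynomial.aeval tauDiff P * (K.u m j ⊗ₜ K.u 0 0))
        rw [h₂, LinearMap.zero_apply, applyMul_vacuum f g hP, applyMul'_vacuum f g hP] at h5
        rw [sub_eq_zero.mp h5.symm]
        refine Finset.sum_congr rfl fun p _ => ?_
        change Rk m p.1 (vop C g _ f) = Rk m p.1 (-(vop C g (K.antipode _) f))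
        rw [K.shift_u, K.divDeriv_u, map_mul K.antipode, K.antipode_u, zero_sub, ← LinearMap.neg_apply, ← map_neg]
        congr 3
        rw [Algebra.smul_def, map_pow, map_neg, map_one, pow_succ]
        ring
      have e2 : E₁ (pol P * K.u m j) =
          ∑ p ∈ antidiagonal j, Rk m p.1 (D (K.singPart (pol P * K.u m p.2))) :=
        antidiagonal_leibniz m E₁ (fun k => Rk m k ∘ₗ D ∘ₗ K.singPart) hE₁pol
          (fun k G => by simp only [LinearMap.comp_apply, K.singPart_pol, map_zero])
          (fun j => by
            simp only [E₁, LinearMap.comp_apply, K.polar_u, Finsupp.lsum_single,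
              LinearMap.toSpanSingleton_apply, one_smul, B, K.singPart_of_mem (K.u_mem _ _)]) P j
      have e3 (p : ℤ × ℕ) (hp : p ∈ s.support) :
          expOp (v0 C) (vop C) (s p) (K.u p.1 p.2 * (pol P * K.u m j)) =
            ∑ i ∈ antidiagonal j, K.tr (K.u p.1 p.2 * (pol P * K.u m i.2)) • Rk m i.1 (s p) := by
        obtain ⟨G, hG⟩ := h₃ p hp
        simp only [← mul_assoc, hG]
        refine antidiagonal_leibniz m (expOp (v0 C) (vop C) (s p))
          (fun k => K.trₗ.smulRight (Rk m k (s p))) (hRpol _)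
          (fun k G => by rw [LinearMap.smulRight_apply, K.trₗ_apply, K.tr_pol, zero_smul])
          (fun j => ?_) G j
        rw [Finset.sum_eq_single (j, 0)]
        · rw [LinearMap.smulRight_apply, K.trₗ_apply, K.tr_u, if_pos rfl, one_smul]; rfl
        · intro i hi h
          rw [LinearMap.smulRight_apply, K.trₗ_apply, K.tr_u, if_neg, zero_smul]
          intro h'
          have := HasAntidiagonal.mem_antidiagonal.mp hi
          exact h (Prod.ext (by omega) h')
        · intro h
          exact absurd (HasAntidiagonal.mem_antidiagonal.mpr (add_zero j)) h
      rw [LinearMap.comp_apply, LinearMap.mulLeft_apply, LinearMap.flip_apply, e1,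
        LinearMap.comp_apply, LinearMap.mulLeft_apply, LinearMap.add_apply, e2]
      simp only [E₂, LinearMap.sum_apply, LinearMap.comp_apply, LinearMap.mulLeft_apply]
      rw [Finset.sum_congr rfl e3, Finset.sum_comm, ← Finset.sum_add_distrib]
      refine Finset.sum_congr rfl fun i _ => ?_
      rw [hDF (pol P * K.u m i.2), map_add, map_sum]
      simp only [map_smul]
  intro F
  -- P is invertible in `K`, so every F is a multiple of P and the identity for multiples of P is
  -- enough.
  obtain ⟨w, hw⟩ := (K.isUnit_pol hP).exists_right_inv
  have := LinearMap.congr_fun key (w * F)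
  simp only [LinearMap.comp_apply, LinearMap.mulLeft_apply, ← mul_assoc, hw, one_mul] at this
  rw [hE]
  exact this

theorem isHTVertexAlgebra_vop : IsHTVertexAlgebra (v0 C) (vop C) where
  field f g := (isRat_vop f g).exists_isSingKernel
  vacuum F g := vop_v0 F g
  creation := vop_pol_v0
  constant := vop_u_zero_v0
  covariance n f F := by rw [hAct_vop, vop_tPow]
  skew := vop_skew
  rational := isLocal_vop

end HTVertex
end

noncomputable section
namespace HTVertex
open KP

/-! ### The filtration of the induced module -/

variable {C : Type*} [AddCommGroup C] [Module ℂ C] [HTConformalAlgebra C]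

theorem conv_mem {V : Type*} [AddCommGroup V] [Module ℂ V] {S : Submodule ℂ V} {ξ : K →ₗ[ℂ] V}
    (h : IsRat ξ) {a : K →ₗ[ℂ] Module.End ℂ V} (ha : ∀ k G, a k (ξ (pol G)) ∈ S) (q : K) :
    conv a ξ q ∈ S := by
  obtain ⟨R, hR⟩ := h
  obtain ⟨z, hz⟩ := exists_isRep R q
  rw [conv_eq hR _ hz]
  clear hz
  induction z using TensorProduct.induction_on with
  | zero => rw [map_zero]; exact S.zero_mem
  | add x y hx hy => rw [map_add]; exact S.add_mem hx hy
  | tmul k G => exact ha k G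

namespace VacMod

theorem filtration_mono : Monotone (filtration C) := fun _ _ h =>
  Submodule.span_mono fun _ ⟨L, hL, e⟩ => ⟨L, hL.trans h, e⟩

theorem filtration_mem_of_le {k l : ℤ} (h : k ≤ l) {w : VacMod C} (hw : w ∈ filtration C k) :
    w ∈ filtration C l := filtration_mono h hw

theorem v0_mem_filtration : v0 C ∈ filtration C 0 := Submodule.subset_span ⟨[], le_rfl, rfl⟩

theorem act_mem_filtration (x : LieOf C) {k : ℤ} {w : VacMod C} (hw : w ∈ filtration C k) :
    act x w ∈ filtration C (k + 1) := by
  induction hw using Submodule.span_induction with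
  | zero => rw [act_zero_right]; exact Submodule.zero_mem _
  | add w w' _ _ h h' => rw [act_add_right]; exact Submodule.add_mem _ h h'
  | smul c w _ h => rw [act_smul_right]; exact Submodule.smul_mem _ c h
  | mem w hw =>
    obtain ⟨L, hL, rfl⟩ := hw
    exact Submodule.subset_span ⟨x :: L, by rw [List.length_cons]; push_cast; omega, rfl⟩

theorem filtration_induction {p : ℤ → VacMod C → Prop} (zero : ∀ k, p k 0) (v0 : p 0 (v0 C))
    (act : ∀ k f F w, w ∈ filtration C k → p k w → p (k + 1) (HTVertex.act (mode f F) w))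
    (mono : ∀ k l w, k ≤ l → p k w → p l w)
    (add : ∀ k w w', p k w → p k w' → p k (w + w')) (smul : ∀ k (c : ℂ) w, p k w → p k (c • w))
    {k : ℤ} {w : VacMod C} (hw : w ∈ filtration C k) : p k w := by
  induction hw using Submodule.span_induction with
  | zero => exact zero k
  | add w w' _ _ h h' => exact add k w w' h h'
  | smul c w _ h => exact smul k c w h
  | mem w hw =>
    obtain ⟨L, hL, rfl⟩ := hw
    refine mono _ _ _ hL ?_
    clear hL
    induction L with
    | nil => exact v0
    | cons x L ih =>
      have hm : L.foldr HTVertex.act (HTVertex.v0 C) ∈ filtration C L.length :=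
        Submodule.subset_span ⟨L, le_rfl, rfl⟩
      rw [List.foldr_cons, List.length_cons]
      push_cast
      generalize L.foldr HTVertex.act (HTVertex.v0 C) = w at ih hm
      induction x using lieOf_induction with
      | zero =>
        have : HTVertex.act (0 : LieOf C) w = 0 := by
          rw [← actₗ_apply, map_zero]; rfl
        rw [this]; exact zero _
      | mode f F => exact act _ f F w hm ih
      | add x y hx hy => rw [act_add]; exact add _ _ _ hx hy

/-- An annihilating element moved past a factor replaces that factor by a bracket, so the number of
factors does not grow, and it finally kills the vacuum. -/
theorem act_ann_mem_filtration {x : LieOf C} (hx : x ∈ ann C) {k : ℤ} {w : VacMod C}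
    (hw : w ∈ filtration C k) : act x w ∈ filtration C k := by
  refine filtration_induction (p := fun k w => act x w ∈ filtration C k) (fun k => ?_) ?_
    (fun k f F w hw ih => ?_) (fun k l w h ih => filtration_mem_of_le h ih) (fun k w w' h h' => ?_)
    (fun k c w h => ?_) hw
  · rw [act_zero_right]; exact Submodule.zero_mem _
  · rw [act_v0_of_mem_ann hx]; exact Submodule.zero_mem _
  · have : act x (act (mode f F) w) = act (mode f F) (act x w) + act ⁅x, mode f F⁆ w := by
      rw [act_lie]; abel
    rw [this]
    exact Submodule.add_mem _ (act_mem_filtration _ ih) (act_mem_filtration _ hw)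
  · rw [act_add_right]; exact Submodule.add_mem _ h h'
  · rw [act_smul_right]; exact Submodule.smul_mem _ _ h

/-- Both bounds are proved together. The left half prepends one factor and inherits either bound
from the induction. The right half first applies a polynomial mode, which does not raise the degree,
so it always lies one degree lower. -/
theorem vop_mem_filtration_and {k : ℤ} {f : VacMod C} (hf : f ∈ filtration C k) :
    ∀ l g, g ∈ filtration C l → (∀ F, vop C f F g ∈ filtration C (k + l)) ∧
      ∀ G, vop C f (pol G) g ∈ filtration C (k + l - 1) := by
  refine filtration_induction (p := fun k f => ∀ l g, g ∈ filtration C l →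
    (∀ F, vop C f F g ∈ filtration C (k + l)) ∧ ∀ G, vop C f (pol G) g ∈ filtration C (k + l - 1))
    (fun k l g hg => ?_) (fun l g hg => ?_) (fun k a p f hf ih l g hg => ?_)
    (fun k k' f h ih l g hg => ?_) (fun k f f' h h' l g hg => ?_) (fun k c f h l g hg => ?_) hf
  · simp
  · refine ⟨fun F => ?_, fun G => ?_⟩
    · rw [vop_v0, zero_add]; exact Submodule.smul_mem _ _ hg
    · rw [vop_v0, K.tr_pol, zero_smul]; exact Submodule.zero_mem _
  · have h2 (F : K) : conv (tw F (vop C f)) ((gen a).app g) (K.antipode p) ∈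
        filtration C (k + 1 + l - 1) := by
      refine conv_mem ((gen a).isRat g) (fun k' G => ?_) _
      rw [tw_apply, Fields.app_apply, gen_apply]
      exact filtration_mem_of_le (by omega)
        ((ih l _ (act_ann_mem_filtration (mode_mem_ann a G) hg)).1 _)
    refine ⟨fun F => ?_, fun G => ?_⟩
    · rw [vop_act]
      refine Submodule.sub_mem _ (conv_mem ((isRat_vop f g).tw F) (fun k' G => ?_) _)
        (filtration_mem_of_le (by omega) (h2 F))
      rw [tw_apply, LinearMap.flip_apply, gen_apply]
      exact filtration_mem_of_le (by omega) (act_mem_filtration _ ((ih l g hg).1 _))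
    · rw [vop_act]
      refine Submodule.sub_mem _ (conv_mem ((isRat_vop f g).tw _) (fun k' G' => ?_) _) (h2 _)
      rw [tw_apply, LinearMap.flip_apply, gen_apply, ← map_mul]
      exact filtration_mem_of_le (by omega) (act_mem_filtration _ ((ih l g hg).2 _))
  · exact ⟨fun F => filtration_mem_of_le (by omega) ((ih l g hg).1 F),
      fun G => filtration_mem_of_le (by omega) ((ih l g hg).2 G)⟩
  · simp only [map_add, LinearMap.add_apply]
    exact ⟨fun F => Submodule.add_mem _ ((h l g hg).1 F) ((h' l g hg).1 F),
      fun G => Submodule.add_mem _ ((h l g hg).2 G) ((h' l g hg).2 G)⟩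
  · simp only [map_smul, LinearMap.smul_apply]
    exact ⟨fun F => Submodule.smul_mem _ _ ((h l g hg).1 F),
      fun G => Submodule.smul_mem _ _ ((h l g hg).2 G)⟩

theorem vop_mem_filtration {k l : ℤ} {f g : VacMod C} (hf : f ∈ filtration C k)
    (hg : g ∈ filtration C l) (F : K) : vop C f F g ∈ filtration C (k + l) :=
  (vop_mem_filtration_and hf l g hg).1 F

theorem vop_pol_mem_filtration {k l : ℤ} {f g : VacMod C} (hf : f ∈ filtration C k)
    (hg : g ∈ filtration C l) (G : Polynomial ℂ) : vop C f (pol G) g ∈ filtration C (k + l - 1) :=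
  (vop_mem_filtration_and hf l g hg).2 G

/-- Up to terms of lower order, the expansion of `q(κ - γ)` is evaluated at `γ = 0`. -/
theorem _root_.HTVertex.conv_sub_mem {V : Type*} [AddCommGroup V] [Module ℂ V] {S : Submodule ℂ V}
    {ξ : K →ₗ[ℂ] V} (h : IsRat ξ) {a : K →ₗ[ℂ] Module.End ℂ V} (n : ℤ)
    (ha : ∀ k G, a k (ξ (pol ((Polynomial.X - Polynomial.C (n : ℂ)) * G))) ∈ S) (q : K) :
    conv a ξ q - a (K.shift (-n) q) (ξ 1) ∈ S := by
  obtain ⟨R, hR⟩ := h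
  set R' : poleSet := R * ⟨_, X_sub_C_mem_poleSet n⟩
  obtain ⟨z, hz⟩ := exists_isRep R' q
  rw [conv_eq hR _ (hz.of_dvd (dvd_mul_right _ _))]
  -- Evaluation at γ = n. By `contract_eval` it maps a representative of q to q(κ−n). The
  -- representative is taken modulo R·(γ−n) so that it serves both ξ and this evaluation.
  let ε : KP →ₗ[ℂ] K := TensorProduct.lift ((LinearMap.lsmul ℂ K).flip.compl₂
    (Polynomial.aeval (n : ℂ)).toLinearMap)
  have hε (k : K) (G : Polynomial ℂ) : ε (k ⊗ₜ G) = G.eval (n : ℂ) • k := by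
    change (Polynomial.aeval (n : ℂ) G) • k = _
    rw [Polynomial.coe_aeval_eq_eval]
  have hk : Kills ⟨_, X_sub_C_mem_poleSet n⟩ ε := by
    intro z
    induction z using TensorProduct.induction_on with
    | zero => simp
    | add x y hx hy => rw [add_mul, map_add, hx, hy, add_zero]
    | tmul k G =>
      rw [inrP_apply, Algebra.TensorProduct.tmul_mul_tmul, hε]
      simp
  have e : ε z = K.shift (-n) q := by
    rw [← contract_eq hk (hz.of_dvd (dvd_mul_left _ _)), contract_eval hk, hε]
    simp
  rw [← e]
  clear e hz
  induction z using TensorProduct.induction_on with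
  | zero => simp
  | add x y hx hy =>
    simp only [map_add, LinearMap.add_apply]
    rw [add_sub_add_comm]
    exact S.add_mem hx hy
  | tmul k G =>
    obtain ⟨G', hG⟩ := K.sub_dvd_pol_sub n G
    have e1 : ξ (pol G) = G.eval (n : ℂ) • ξ 1 +
        ξ (pol ((Polynomial.X - Polynomial.C (n : ℂ)) * G')) := by
      conv_lhs => rw [hG, map_add, map_add, K.pol_C, Algebra.algebraMap_eq_smul_one, map_smul]
    rw [hε, pair_tmul, polRes_apply, e1, map_add, map_smul, map_smul, LinearMap.smul_apply,
      add_sub_cancel_left]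
    exact ha k G'

/-- The leading term of the normal ordered product with a product. -/
theorem vop_act_u_zero_sub_mem (a : C) (p : K) {k l : ℤ} {w h : VacMod C}
    (hw : w ∈ filtration C k) (hh : h ∈ filtration C l) :
    vop C (act (mode a p) w) (K.u 0 0) h - act (mode a p) (vop C w (K.u 0 0) h) ∈
      filtration C (k + l) := by
  have h1 : conv (tw (K.u 0 0) (vop C w)) ((gen a).app h) (K.antipode p) ∈ filtration C (k + l) := by
    refine conv_mem ((gen a).isRat h) (fun k' G => ?_) _
    rw [tw_apply, Fields.app_apply, gen_apply]
    exact vop_mem_filtration hw (act_ann_mem_filtration (mode_mem_ann a G) hh) _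
  have h2 := conv_sub_mem ((isRat_vop w h).tw (K.u 0 0)) (a := (gen a).1) (S := filtration C (k + l)) 0
    (fun k' G => by
      have := act_mem_filtration (mode a k') (vop_pol_mem_filtration hw hh G)
      rw [sub_add_cancel] at this
      rw [map_mul pol, tw_apply, ← mul_assoc, mul_comm (K.u 0 0), K.pol_X_sub_mul_u_zero, one_mul]
      exact this) p
  rw [neg_zero, K.shift_zero, tw_apply, mul_one, gen_apply, LinearMap.flip_apply] at h2
  rw [vop_act, sub_right_comm]
  exact Submodule.sub_mem _ h2 h1

/-- Peeling a mode off g, the exchange of x with that mode costs one bracket. This is a single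
factor in place of two, hence of lower order. -/
theorem vop_u_zero_act_sub_mem (x : LieOf C) {k l : ℤ} {g f : VacMod C} (hg : g ∈ filtration C l)
    (hf : f ∈ filtration C k) :
    vop C g (K.u 0 0) (act x f) - act x (vop C g (K.u 0 0) f) ∈ filtration C (l + k) := by
  refine filtration_induction (p := fun l g =>
    vop C g (K.u 0 0) (act x f) - act x (vop C g (K.u 0 0) f) ∈ filtration C (l + k))
    (fun l => ?_) ?_ (fun l a p g hg ih => ?_)
    (fun k k' f h ih => filtration_mem_of_le (by omega) ih) (fun k f f' h h' => ?_) (fun k c f h => ?_) hg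
  · simp [act_zero_right]
  · rw [vop_v0, vop_v0, act_smul_right, sub_self]; exact Submodule.zero_mem _
  · have h1 := vop_act_u_zero_sub_mem a p hg (act_mem_filtration x hf)
    have h2 := act_mem_filtration (mode a p) ih
    have h3 := act_mem_filtration x (vop_act_u_zero_sub_mem a p hg hf)
    have h4 := act_mem_filtration ⁅mode a p, x⁆ (vop_mem_filtration hg hf (K.u 0 0))
    rw [act_lie] at h4
    rw [act_sub_right] at h2 h3
    have e : l + 1 + k = l + k + 1 := by ring
    rw [← add_assoc] at h1
    rw [e]
    have := Submodule.sub_mem _ (Submodule.add_mem _ (Submodule.add_mem _ h1 h2) h4) h3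
    convert this using 1
    abel
  · simp only [map_add, LinearMap.add_apply, act_add_right]
    rw [add_sub_add_comm]; exact Submodule.add_mem _ h h'
  · simp only [map_smul, LinearMap.smul_apply, act_smul_right]
    rw [← smul_sub]; exact Submodule.smul_mem _ _ h

/-- A mode can be peeled off f on either side of the product modulo lower order, so the commutator
of the shorter states determines the leading term. -/
theorem vop_comm_mem {k l : ℤ} {f g : VacMod C} (hf : f ∈ filtration C k) (hg : g ∈ filtration C l) :
    vop C f (K.u 0 0) g - vop C g (K.u 0 0) f ∈ filtration C (k + l - 1) := by
  refine filtration_induction (p := fun k f =>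
    vop C f (K.u 0 0) g - vop C g (K.u 0 0) f ∈ filtration C (k + l - 1))
    (fun l => ?_) ?_ (fun k a p f hf ih => ?_)
    (fun k k' f h ih => filtration_mem_of_le (by omega) ih) (fun k f f' h h' => ?_) (fun k c f h => ?_) hf
  · simp
  · rw [vop_v0, vop_u_zero_v0, K.tr_u, if_pos rfl, one_smul, sub_self]; exact Submodule.zero_mem _
  · have h1 := vop_act_u_zero_sub_mem a p hf hg
    have h2 := act_mem_filtration (mode a p) ih
    have h3 := vop_u_zero_act_sub_mem (mode a p) hg hf
    rw [act_sub_right, sub_add_cancel] at h2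
    rw [add_comm l] at h3
    have e : k + 1 + l - 1 = k + l := by ring
    rw [e]
    convert Submodule.sub_mem _ (Submodule.add_mem _ h1 h2) h3 using 1
    abel
  · simp only [map_add, LinearMap.add_apply]
    rw [add_sub_add_comm]; exact Submodule.add_mem _ h h'
  · simp only [map_smul, LinearMap.smul_apply]
    rw [← smul_sub]; exact Submodule.smul_mem _ _ h

/-- Modulo lower order a mode moves from the left factor to the front of the whole product, for both
bracketings. -/
theorem vop_assoc_mem {k l m : ℤ} {f g h : VacMod C} (hf : f ∈ filtration C k)
    (hg : g ∈ filtration C l) (hh : h ∈ filtration C m) :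
    vop C f (K.u 0 0) (vop C g (K.u 0 0) h) - vop C (vop C f (K.u 0 0) g) (K.u 0 0) h ∈
      filtration C (k + l + m - 1) := by
  refine filtration_induction (p := fun k f =>
    vop C f (K.u 0 0) (vop C g (K.u 0 0) h) - vop C (vop C f (K.u 0 0) g) (K.u 0 0) h ∈
      filtration C (k + l + m - 1))
    (fun l => ?_) ?_ (fun k a p f hf ih => ?_)
    (fun k k' f h ih => filtration_mem_of_le (by omega) ih) (fun k f f' h h' => ?_) (fun k c f h => ?_) hf
  · simp
  · rw [vop_v0, vop_v0, K.tr_u, if_pos rfl, one_smul, one_smul, sub_self]; exact Submodule.zero_mem _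
  · have h1 := vop_act_u_zero_sub_mem a p hf (vop_mem_filtration hg hh (K.u 0 0))
    have h2 := vop_mem_filtration (vop_act_u_zero_sub_mem a p hf hg) hh (K.u 0 0)
    rw [map_sub, LinearMap.sub_apply, LinearMap.sub_apply] at h2
    have h3 := vop_act_u_zero_sub_mem a p (vop_mem_filtration hf hg (K.u 0 0)) hh
    have h4 := act_mem_filtration (mode a p) ih
    rw [act_sub_right, sub_add_cancel] at h4
    have e : k + 1 + l + m - 1 = k + l + m := by ring
    rw [← add_assoc] at h1
    rw [e]
    convert Submodule.sub_mem _ (Submodule.sub_mem _ (Submodule.add_mem _ h1 h4) h3) h2 using 1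
    abel
  · simp only [map_add, LinearMap.add_apply]
    rw [add_sub_add_comm]; exact Submodule.add_mem _ h h'
  · simp only [map_smul, LinearMap.smul_apply]
    rw [← smul_sub]; exact Submodule.smul_mem _ _ h

theorem filtration_neg {k : ℤ} (hk : k < 0) : filtration C k = ⊥ := by
  rw [filtration, Submodule.span_eq_bot]
  rintro w ⟨L, hL, _⟩
  omega

theorem exists_mem_filtration (w : VacMod C) : ∃ k, w ∈ filtration C k := by
  induction w using vacMod_induction with
  | v0 => exact ⟨0, v0_mem_filtration⟩
  | act f F w ih =>
    obtain ⟨k, hk⟩ := ih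
    exact ⟨k + 1, act_mem_filtration _ hk⟩
  | add w w' h h' =>
    obtain ⟨k, hk⟩ := h
    obtain ⟨k', hk'⟩ := h'
    exact ⟨max k k', Submodule.add_mem _ (filtration_mem_of_le (le_max_left _ _) hk)
      (filtration_mem_of_le (le_max_right _ _) hk')⟩
  | smul c w h =>
    obtain ⟨k, hk⟩ := h
    exact ⟨k, Submodule.smul_mem _ _ hk⟩

theorem isFilteredVertexAlgebra : IsFilteredVertexAlgebra (v0 C) (vop C) (filtration C) where
  mono := filtration_mono
  neg _ hk := filtration_neg hk
  exhaustive := exists_mem_filtration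
  vac_mem := v0_mem_filtration
  mem _ _ _ _ hf hg F := vop_mem_filtration hf hg F
  sing_mem _ _ _ _ hf hg G := vop_pol_mem_filtration hf hg G
  comm _ _ _ _ hf hg := vop_comm_mem hf hg
  assoc _ _ _ _ _ _ hf hg hh := vop_assoc_mem hf hg hh

end VacMod

end HTVertex
end

/-! ### The Toda vertex Poisson algebra. -/

noncomputable section
namespace HTVertex

namespace PToda

open MvPolynomial

theorem T_zpow_X (n : ℤ) (x : TodaGen × ℤ) : (T ^ n) (X x) = (X (x.1, x.2 + n) : PToda) := by
  have h1 (x : TodaGen × ℤ) : T (X x) = (X (x.1, x.2 + 1) : PToda) := by simp [T]; rfl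
  have h2 (x : TodaGen × ℤ) : T⁻¹ (X x) = (X (x.1, x.2 - 1) : PToda) := by
    have := h1 (x.1, x.2 - 1)
    rw [sub_add_cancel] at this
    rw [← this]
    exact T.symm_apply_apply _
  induction n generalizing x with
  | zero => simp
  | succ n ih => rw [zpow_add_one, AlgEquiv.mul_apply, h1, ih]; congr 2; ring
  | pred n ih => rw [zpow_sub_one, AlgEquiv.mul_apply, h2, ih]; congr 2; ring

theorem toLinearEquiv_zpow (n : ℤ) (f : PToda) : (T.toLinearEquiv ^ n) f = (T ^ n) f := by
  induction n generalizing f with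
  | zero => rfl
  | succ n ih => rw [zpow_add_one, zpow_add_one, LinearEquiv.mul_apply, ih]; rfl
  | pred n ih => rw [zpow_sub_one, zpow_sub_one, LinearEquiv.mul_apply, ih]; rfl

theorem T_zpow_zpow (m n : ℤ) (f : PToda) : (T ^ m) ((T ^ n) f) = (T ^ (m + n)) f := by
  rw [zpow_add]; rfl

theorem lin_e (x : TodaGen × ℤ) : lin (CToda.e x) = X x := CToda.basis.constr_basis ..

theorem lin_T_zpow (n : ℤ) (f : CToda) : lin ((CToda.T ^ n) f) = (T ^ n) (lin f) := by
  refine LinearMap.congr_fun (f := lin ∘ₗ (CToda.T ^ n).toLinearMap)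
    (g := (T ^ n).toLinearMap ∘ₗ lin) (CToda.hom_ext fun x => ?_) f
  change lin ((CToda.T ^ n) (CToda.e (x.1, x.2))) = (T ^ n) (lin (CToda.e x))
  rw [CToda.T_pow_e, lin_e, lin_e, T_zpow_X]

/-- The products with fixed index, as bilinear maps. -/
def bracketAt (n : ℤ) : PToda →ₗ[ℂ] PToda →ₗ[ℂ] PToda := bracket.compr₂ (Finsupp.lapply n)

theorem bracketAt_apply (n : ℤ) (f g : PToda) : bracketAt n f g = bracket f g n := rfl

theorem bracket_mul (f g h : PToda) (n : ℤ) :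
    bracket f (g * h) n = g * bracket f h n + h * bracket f g n := by
  have : bracket f (g * h) = g • bracket f h + h • bracket f g :=
    Derivation.leibniz (MvPolynomial.mkDerivation ℂ fun x => skewMap (gen x f)) g h
  rw [this]; rfl

theorem bracket_one (f : PToda) : bracket f 1 = 0 :=
  Derivation.map_one_eq_zero (MvPolynomial.mkDerivation ℂ fun x => skewMap (gen x f))

theorem skewMap_apply (a : ℤ →₀ PToda) (n : ℤ) : skewMap a n = -(T ^ n) (a (-n)) := by
  induction a using Finsupp.induction_linear with
  | zero => simp
  | add a b ha hb => rw [map_add, Finsupp.add_apply, ha, hb, Finsupp.add_apply, map_add, neg_add]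
  | single m p =>
    simp only [skewMap, Finsupp.lsum_single, LinearMap.comp_apply, Finsupp.lsingle_apply]
    rcases eq_or_ne n (-m) with rfl | h
    · rw [Finsupp.single_eq_same, neg_neg, Finsupp.single_eq_same]; rfl
    · rw [Finsupp.single_eq_of_ne h, Finsupp.single_eq_of_ne (by omega), map_zero,
        neg_zero]

theorem bracket_X (f : PToda) (x : TodaGen × ℤ) (n : ℤ) :
    bracket f (X x) n = -(T ^ n) (gen x f (-n)) := by
  rw [← skewMap_apply]
  exact congrArg (fun a : ℤ →₀ PToda => a n) (MvPolynomial.mkDerivation_X ℂ _ x)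

theorem gen_X (x y : TodaGen × ℤ) (n : ℤ) : gen x (X y) n = lin (CToda.basisProd x y n) := by
  rw [gen, MvPolynomial.mkDerivation_X, Finsupp.mapRange_apply]

theorem gen_mul (x : TodaGen × ℤ) (f g : PToda) (n : ℤ) :
    gen x (f * g) n = f * gen x g n + g * gen x f n := by
  rw [Derivation.leibniz]; rfl

/-- Two additive maps that satisfy the same twisted Leibniz rule agree if they agree on the
variables. -/
theorem leibniz_ext {a b : PToda →ₗ[ℂ] PToda} (t : PToda → PToda)
    (h1a : a 1 = 0) (h1b : b 1 = 0)
    (ha : ∀ f g, a (f * g) = t f * a g + t g * a f) (hb : ∀ f g, b (f * g) = t f * b g + t g * b f)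
    (hX : ∀ x, a (X x) = b (X x)) (f : PToda) : a f = b f := by
  induction f using MvPolynomial.induction_on with
  | C c => rw [← mul_one (C c), ← MvPolynomial.smul_eq_C_mul, map_smul, map_smul, h1a, h1b]
  | add f g hf hg => rw [map_add, map_add, hf, hg]
  | mul_X f x hf => rw [ha, hb, hf, hX]

theorem T_zpow_mul (n : ℤ) (f g : PToda) : (T ^ n) (f * g) = (T ^ n) f * (T ^ n) g :=
  map_mul (T ^ n) f g

/-- Both sides are derivations in h, so h may be a variable. There the product is defined by skew
symmetry, and the derivation property of the action of that variable becomes a Leibniz rule twisted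
by Tⁿ. -/
theorem mul_bracket (f g h : PToda) (n : ℤ) :
    bracket (f * g) h n = (T ^ n) f * bracket g h n + (T ^ n) g * bracket f h n := by
  refine leibniz_ext (a := bracketAt n (f * g))
    (b := LinearMap.mulLeft ℂ ((T ^ n) f) ∘ₗ bracketAt n g +
      LinearMap.mulLeft ℂ ((T ^ n) g) ∘ₗ bracketAt n f) id ?_ ?_ ?_ ?_ (fun x => ?_) h
  · rw [bracketAt_apply, bracket_one]; rfl
  · simp [bracketAt_apply, bracket_one]
  · exact fun f' g' => bracket_mul _ _ _ _
  · intro f' g'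
    simp only [LinearMap.add_apply, LinearMap.comp_apply, LinearMap.mulLeft_apply, bracketAt_apply,
      bracket_mul, id]
    ring
  · simp only [LinearMap.add_apply, LinearMap.comp_apply, LinearMap.mulLeft_apply, bracketAt_apply,
      bracket_X, gen_mul, map_add, T_zpow_mul]
    ring

theorem one_bracket (g : PToda) : bracket 1 g = 0 := by
  refine Finsupp.ext fun n => leibniz_ext (a := bracketAt n 1) (b := 0) id ?_ rfl
    (fun f' g' => bracket_mul _ _ _ _) (fun f' g' => by simp) (fun x => ?_) g
  · rw [bracketAt_apply, bracket_one]; rfl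
  · rw [bracketAt_apply, bracket_X, Derivation.map_one_eq_zero]; simp

/-- Consistency of the definition: `bracket` was built from `gen` by skew symmetry. By the
derivation property it suffices to compare on pairs of variables, where this is the skew symmetry of
the conformal algebra. -/
theorem X_bracket (x : TodaGen × ℤ) (g : PToda) (n : ℤ) : bracket (X x) g n = gen x g n := by
  refine leibniz_ext (a := bracketAt n (X x))
    (b := Finsupp.lapply n ∘ₗ (gen x).toLinearMap) id ?_ ?_
    (fun f' g' => bracket_mul _ _ _ _) (fun f' g' => gen_mul _ _ _ _) (fun y => ?_) g
  · rw [bracketAt_apply, bracket_one]; rfl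
  · change (gen x 1) n = 0
    rw [Derivation.map_one_eq_zero]; rfl
  · change bracket (X x) (X y) n = gen x (X y) n
    rw [bracket_X, gen_X, gen_X, ← CToda.prod_e, ← CToda.prod_e, CToda.isHTConformal.skew, map_neg,
      lin_T_zpow, map_neg, T_zpow_zpow, add_neg_cancel, zpow_zero, neg_neg, neg_neg]
    rfl

theorem X_bracket_X (x y : TodaGen × ℤ) (n : ℤ) :
    bracket (X x) (X y) n = lin (CToda.prod (CToda.e x) (CToda.e y) n) := by
  rw [X_bracket, gen_X, CToda.prod_e]

theorem bracket_lin (f g : CToda) (n : ℤ) :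
    bracket (lin f) (lin g) n = lin (CToda.prod f g n) := by
  refine LinearMap.congr_fun₂ (f := (bracketAt n).compl₁₂ lin lin)
    (g := (CToda.prodAt n).compr₂ lin) (CToda.hom_ext fun x => CToda.hom_ext fun y => ?_) f g
  change bracket (lin (CToda.e x)) (lin (CToda.e y)) n = lin (CToda.prod (CToda.e x) (CToda.e y) n)
  rw [lin_e, lin_e, X_bracket_X]

theorem bracket_skew (f g : PToda) (n : ℤ) : bracket f g n = -(T ^ n) (bracket g f (-n)) := by
  refine leibniz_ext (a := bracketAt n f)
    (b := -((T ^ n).toLinearMap ∘ₗ (bracketAt (-n)).flip f)) id ?_ ?_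
    (fun f' g' => bracket_mul _ _ _ _) (fun f' g' => ?_) (fun y => ?_) g
  · rw [bracketAt_apply, bracket_one]; rfl
  · change -(T ^ n) (bracket 1 f (-n)) = 0
    rw [one_bracket]; simp
  · change -(T ^ n) (bracket (f' * g') f (-n)) = f' * -(T ^ n) (bracket g' f (-n)) +
      g' * -(T ^ n) (bracket f' f (-n))
    rw [mul_bracket, map_add, T_zpow_mul, T_zpow_mul, T_zpow_zpow, T_zpow_zpow, add_neg_cancel,
      zpow_zero, AlgEquiv.one_apply, AlgEquiv.one_apply]
    ring
  · change bracket f (X y) n = -(T ^ n) (bracket (X y) f (-n))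
    rw [bracket_X, X_bracket]

theorem gen_T_zpow (x : TodaGen × ℤ) (f : PToda) (n p : ℤ) :
    gen x ((T ^ p) f) n = (T ^ p) (gen x f (n - p)) := by
  refine leibniz_ext (a := Finsupp.lapply n ∘ₗ (gen x).toLinearMap ∘ₗ (T ^ p).toLinearMap)
    (b := (T ^ p).toLinearMap ∘ₗ Finsupp.lapply (n - p) ∘ₗ (gen x).toLinearMap) (fun f => (T ^ p) f)
    ?_ ?_ (fun f' g' => ?_) (fun f' g' => ?_) (fun y => ?_) f
  · change gen x ((T ^ p) 1) n = 0
    rw [map_one, Derivation.map_one_eq_zero]; rfl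
  · change (T ^ p) (gen x 1 (n - p)) = 0
    rw [Derivation.map_one_eq_zero]; exact map_zero _
  · change gen x ((T ^ p) (f' * g')) n = _
    rw [T_zpow_mul, gen_mul]; rfl
  · change (T ^ p) (gen x (f' * g') (n - p)) = _
    rw [gen_mul, map_add, T_zpow_mul, T_zpow_mul]; rfl
  · change gen x ((T ^ p) (X y)) n = (T ^ p) (gen x (X y) (n - p))
    rw [T_zpow_X, gen_X, gen_X, ← lin_T_zpow, CToda.basisProd_apply, CToda.basisProd_apply,
      ← LinearEquiv.mul_apply, ← zpow_add]
    dsimp only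
    congr 3 <;> ring_nf

theorem bracket_covariance (f g : PToda) (n p : ℤ) :
    bracket ((T ^ p) f) g n = bracket f g (n + p) := by
  refine leibniz_ext (a := bracketAt n ((T ^ p) f)) (b := bracketAt (n + p) f) id ?_ ?_
    (fun f' g' => bracket_mul _ _ _ _) (fun f' g' => bracket_mul _ _ _ _) (fun y => ?_) g
  · rw [bracketAt_apply, bracket_one]; rfl
  · rw [bracketAt_apply, bracket_one]; rfl
  · rw [bracketAt_apply, bracketAt_apply, bracket_X, bracket_X, gen_T_zpow, T_zpow_zpow]
    congr 3; ring

theorem bracket_T_zpow (f g : PToda) (n p : ℤ) :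
    bracket f ((T ^ p) g) n = (T ^ p) (bracket f g (n - p)) := by
  rw [bracket_skew, bracket_covariance, bracket_skew f g, map_neg, T_zpow_zpow, add_sub_cancel, neg_sub,
    sub_eq_neg_add]

/-- The defect of the commutator formula. -/
def jacobiator (m n : ℤ) (f g : PToda) : PToda →ₗ[ℂ] PToda :=
  bracketAt m f ∘ₗ bracketAt n g - bracketAt n g ∘ₗ bracketAt m f -
    bracketAt n (bracketAt (m - n) f g)

theorem jacobiator_apply (m n : ℤ) (f g h : PToda) : jacobiator m n f g h =
    bracket f (bracket g h n) m - bracket g (bracket f h m) n -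
      bracket (bracket f g (m - n)) h n := rfl

theorem jacobiator_symm (m n : ℤ) (f g h : PToda) :
    jacobiator m n f g h = -jacobiator n m g f h := by
  have : bracket (bracket g f (n - m)) h m = -bracket (bracket f g (m - n)) h n := by
    rw [bracket_skew g f, map_neg, LinearMap.neg_apply, Finsupp.neg_apply, bracket_covariance,
      neg_sub, add_sub_cancel]
  rw [jacobiator_apply, jacobiator_apply, this]
  ring

/-- Skew symmetry exchanges the last two arguments. With the antisymmetry in the first two, every
argument can be brought to the last place. -/
theorem jacobiator_rotate (m n : ℤ) (f g h : PToda) :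
    jacobiator m n f g h = -(T ^ n) (jacobiator (m - n) (-n) f h g) := by
  rw [jacobiator_apply, jacobiator_apply, bracket_skew g h, map_neg, Finsupp.neg_apply,
    bracket_T_zpow, bracket_skew g (bracket f h m), bracket_skew (bracket f g (m - n)) h,
    show m - n - -n = m by ring, map_sub (T ^ n), map_sub (T ^ n)]
  ring

theorem jacobiator_mul (m n : ℤ) (f g h k : PToda) : jacobiator m n f g (h * k) =
    h * jacobiator m n f g k + k * jacobiator m n f g h := by
  simp only [jacobiator_apply, bracket_mul, map_add, Finsupp.add_apply]
  ring

theorem jacobiator_one (m n : ℤ) (f g : PToda) : jacobiator m n f g 1 = 0 := by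
  simp [jacobiator_apply, bracket_one]

theorem jacobiator_eq_zero_of_X {m n : ℤ} {f g : PToda} (h : ∀ x, jacobiator m n f g (X x) = 0)
    (k : PToda) : jacobiator m n f g k = 0 :=
  leibniz_ext (a := jacobiator m n f g) (b := 0) id (jacobiator_one m n f g) rfl
    (jacobiator_mul m n f g) (by simp) h k

theorem jacobiator_X (m n : ℤ) (x y z : TodaGen × ℤ) : jacobiator m n (X x) (X y) (X z) = 0 := by
  rw [jacobiator_apply, ← lin_e, ← lin_e, ← lin_e]
  simp only [bracket_lin]
  rw [← map_sub lin, CToda.isHTConformal.commutator, sub_self]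

/-- The defect is a derivation in its last argument only. Rotating each argument in turn to that
place reduces all three to variables, where the identity is the commutator axiom of the conformal
algebra. -/
theorem jacobiator_eq_zero (m n : ℤ) (f g h : PToda) : jacobiator m n f g h = 0 := by
  refine jacobiator_eq_zero_of_X (fun z => ?_) h
  rw [jacobiator_rotate, jacobiator_eq_zero_of_X (fun y => ?_) g, map_zero, neg_zero]
  rw [jacobiator_symm, jacobiator_rotate, jacobiator_eq_zero_of_X (fun x => ?_) f, map_zero,
    neg_zero, neg_zero]
  rw [jacobiator_symm, jacobiator_rotate, jacobiator_X, map_zero, neg_zero, neg_zero]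

theorem isHTVertexPoisson : IsHTVertexPoisson T bracket where
  conformal :=
    { covariance := fun f g n p => by rw [toLinearEquiv_zpow, bracket_covariance]
      skew := fun f g n => by rw [toLinearEquiv_zpow, bracket_skew]
      commutator := fun f g h m n =>
        sub_eq_zero.mp ((jacobiator_apply m n f g h).symm.trans (jacobiator_eq_zero m n f g h)) }
  derivation := bracket_mul

end PToda

end HTVertex
end

/-! ### The Lie algebra of the Toda conformal algebra. -/

noncomputable section
namespace HTVertex

namespace CToda

/-- The modes of the generators. -/
def genMode (x : TodaGen) : K →ₗ[ℂ] LieOf CToda := mode (e (x, 0))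

theorem mode_e (x : TodaGen × ℤ) (p : K) : mode (e x) p = genMode x.1 (K.shift (-x.2) p) := by
  have h := mode_T_pow (C := CToda) x.2 (e (x.1, 0)) (K.shift (-x.2) p)
  rw [K.shift_shift, add_neg_cancel, K.shift_zero] at h
  change mode ((T ^ x.2) (e (x.1, 0))) p = _ at h
  rw [T_pow_e, zero_add] at h
  exact h

theorem genMode_u (x : TodaGen) (n : ℤ) : genMode x (K.u n 0) = mode (e (x, n)) (K.u 0 0) := by
  rw [mode_e, K.shift_u, zero_sub, neg_neg]

variable {N : Type*} [AddCommGroup N] [Module ℂ N]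

/-- Linear maps out of `𝓛Toda` are given by their values on the modes of the generators. -/
def liftModes (f : TodaGen → K →ₗ[ℂ] N) : LieOf CToda →ₗ[ℂ] N :=
  (totalDiff CToda).liftQ
    (TensorProduct.lift (basis.constr ℂ fun x => f x.1 ∘ₗ (K.shift (-x.2)).toLinearMap)) (by
    rintro _ ⟨z, rfl⟩
    rw [LinearMap.mem_ker]
    refine LinearMap.congr_fun (f := TensorProduct.lift (basis.constr ℂ fun x =>
      f x.1 ∘ₗ (K.shift (-x.2)).toLinearMap) ∘ₗ
        (TensorProduct.map (T : CToda ≃ₗ[ℂ] CToda).toLinearMap (K.shift 1).toLinearMap -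
          LinearMap.id)) (g := 0) (TensorProduct.ext (hom_ext fun x => LinearMap.ext fun p => ?_)) z
    change TensorProduct.lift (basis.constr ℂ fun x =>
      f x.1 ∘ₗ (K.shift (-x.2)).toLinearMap) (T (e x) ⊗ₜ K.shift 1 p - e x ⊗ₜ p) = 0
    have h : T (e x) = e (x.1, x.2 + 1) := by
      have := T_pow_e 1 x.1 x.2
      rwa [zpow_one] at this
    have hc (y : TodaGen × ℤ) : (basis.constr ℂ fun x =>
      f x.1 ∘ₗ (K.shift (-x.2)).toLinearMap) (e y) = f y.1 ∘ₗ (K.shift (-y.2)).toLinearMap :=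
      basis.constr_basis ..
    rw [map_sub, TensorProduct.lift.tmul, TensorProduct.lift.tmul, h, hc, hc]
    simp only [LinearMap.comp_apply, AlgHom.toLinearMap_apply, K.shift_shift]
    rw [neg_add, neg_add_cancel_right, sub_self])

theorem liftModes_genMode (f : TodaGen → K →ₗ[ℂ] N) (x : TodaGen) (p : K) :
    liftModes f (genMode x p) = f x p := by
  have hc : (basis.constr ℂ fun x => f x.1 ∘ₗ (K.shift (-x.2)).toLinearMap) (e (x, 0)) =
      f x ∘ₗ (K.shift (-0)).toLinearMap := basis.constr_basis ..
  refine (LinearMap.congr_fun hc p).trans ?_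
  rw [LinearMap.comp_apply, AlgHom.toLinearMap_apply, neg_zero, K.shift_zero]

theorem modes_ext {a b : LieOf CToda →ₗ[ℂ] N} (h : ∀ x p, a (genMode x p) = b (genMode x p)) :
    a = b := by
  refine lieOf_ext fun f p => ?_
  refine LinearMap.congr_fun (f := a ∘ₗ mode.flip p) (g := b ∘ₗ mode.flip p)
    (hom_ext fun x => ?_) f
  change a (mode (e x) p) = b (mode (e x) p)
  rw [mode_e, h]

/-- The coordinates on `𝓛Toda ≅ K ⊕ K`. -/
def coord (x : TodaGen) : LieOf CToda →ₗ[ℂ] K :=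
  liftModes fun y => if y = x then LinearMap.id else 0

theorem coord_genMode (x y : TodaGen) (p : K) : coord x (genMode y p) = if y = x then p else 0 := by
  rw [coord, liftModes_genMode]
  split_ifs <;> rfl

theorem genMode_coord (z : LieOf CToda) :
    genMode .B (coord .B z) + genMode .C (coord .C z) = z := by
  refine LinearMap.congr_fun (f := genMode .B ∘ₗ coord .B + genMode .C ∘ₗ coord .C)
    (g := LinearMap.id) (modes_ext fun x p => ?_) z
  change genMode .B (coord .B (genMode x p)) + genMode .C (coord .C (genMode x p)) = genMode x p
  cases x <;> simp [coord_genMode]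

theorem coord_mem_of_mem_modeSubalgebra {P : Submodule ℂ K} (hs hm) {z : LieOf CToda}
    (hz : z ∈ modeSubalgebra (C := CToda) P hs hm) (x : TodaGen) : coord x z ∈ P := by
  change z ∈ Submodule.span ℂ _ at hz
  induction hz using Submodule.span_induction with
  | zero => rw [map_zero]; exact P.zero_mem
  | add a b _ _ ha hb => rw [map_add]; exact P.add_mem ha hb
  | smul c a _ ha => rw [map_smul]; exact P.smul_mem _ ha
  | mem a ha =>
    obtain ⟨f, p, hp, rfl⟩ := ha
    refine (Submodule.Quotient.mk_eq_zero P).mp ?_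
    refine LinearMap.congr_fun (f := P.mkQ ∘ₗ coord x ∘ₗ mode.flip p) (g := 0)
      (hom_ext fun y => (Submodule.Quotient.mk_eq_zero P).mpr ?_) f
    change coord x (mode (e y) p) ∈ P
    rw [mode_e, coord_genMode]
    split_ifs
    · exact hs _ _ hp
    · exact P.zero_mem

/-- In the coordinates of B and C the two subalgebras are given by the conditions that both
coordinates lie in `K.sing`, respectively in the polynomials. So this is the partial fraction
decomposition of `K`. -/
theorem isCompl_cr_ann : IsCompl (cr CToda).toSubmodule (ann CToda).toSubmodule := by
  refine ⟨Submodule.disjoint_def.mpr fun z h h' => ?_, codisjoint_iff.mpr (eq_top_iff.mpr fun z _ => ?_)⟩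
  · have h0 (x : TodaGen) : coord x z = 0 :=
      Submodule.disjoint_def.mp K.isCompl_sing_pol.disjoint _
        (coord_mem_of_mem_modeSubalgebra _ _ h x) (coord_mem_of_mem_modeSubalgebra _ _ h' x)
    rw [← genMode_coord z, h0, h0, map_zero, map_zero, add_zero]
  · induction z using lieOf_induction with
    | zero => exact Submodule.zero_mem _
    | add x y hx hy => exact Submodule.add_mem _ (hx trivial) (hy trivial)
    | mode f p =>
      obtain ⟨G, s, hs, rfl⟩ := K.exists_pol_add_sing p
      rw [map_add]
      exact Submodule.add_mem _ (Submodule.mem_sup_right (mode_mem_ann f G))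
        (Submodule.mem_sup_left (mode_mem_cr f hs))

/-- The difference operator `p ↦ p(τ - 1) - p(τ)`. -/
def dif : K →ₗ[ℂ] K := (K.shift (-1)).toLinearMap - LinearMap.id

theorem dif_apply (p : K) : dif p = K.shift (-1) p - p := rfl

theorem dif_mem_sing {p : K} (hp : p ∈ K.sing) : dif p ∈ K.sing :=
  K.sing.sub_mem (K.shift_mem_sing _ hp) hp

theorem dif_pol (G : Polynomial ℂ) : ∃ G', dif (pol G) = pol G' := by
  obtain ⟨G', h⟩ := K.shift_pol (-1) G
  exact ⟨G' - G, by rw [map_sub, dif_apply, ← h]; rfl⟩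

theorem lie_genMode_self (x : TodaGen) (p q : K) : ⁅genMode x p, genMode x q⁆ = 0 := by
  rw [genMode, lie_mode]
  refine (finsum_congr fun n => ?_).trans finsum_zero
  have : HTConformalAlgebra.prod (e (x, 0)) (e (x, 0)) n = 0 := by
    cases x
    · exact prod_BB 0 0 n
    · exact prod_CC 0 0 n
  rw [this, map_zero, LinearMap.zero_apply]

/-- Only the products with index −1 and 0 contribute, with opposite signs. Thus the modes of B act
on the abelian ideal of the modes of C by multiplication with differences. -/
theorem lie_genMode (p q : K) : ⁅genMode .B p, genMode .C q⁆ = genMode .C (dif p * q) := by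
  rw [genMode, genMode, lie_mode]
  have h (n : ℤ) : HTConformalAlgebra.prod (e (.B, 0)) (e (.C, 0)) n =
      (if n = -1 then (1 : ℂ) else 0) • e (.C, 0) - (if n = 0 then (1 : ℂ) else 0) • e (.C, 0) := by
    refine (prod_BC 0 0 n).trans ?_
    rw [add_zero, zero_sub]
  simp only [h]
  rw [finsum_eq_sum_of_support_subset (s := {-1, 0})]
  · rw [Finset.sum_pair (by decide), dif_apply, sub_mul, map_sub]
    simp [K.shift_zero, sub_eq_add_neg]
  · intro n hn
    by_contra hc
    simp only [Finset.coe_insert, Finset.coe_singleton, Set.mem_insert_iff,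
      Set.mem_singleton_iff, not_or] at hc
    exact hn (by simp [hc])

end CToda

end HTVertex
end

/-! ### The polynomial model and the action of the Toda Lie algebra on it. -/

noncomputable section
namespace HTVertex

/-- The polynomial model of the Toda vertex algebra: the variable `(x, n, j)` stands for the mode of
the generator `x` at `1 / (τ - n) ^ (j + 1)`. -/
abbrev TodaModel : Type := MvPolynomial (TodaGen × ℤ × ℕ) ℂ

namespace TodaModel

open MvPolynomial CToda

/-- The linear form attached to the polar part of `p`. -/
def hat (x : TodaGen) : K →ₗ[ℂ] TodaModel :=
  Finsupp.linearCombination ℂ (fun i => X (x, i)) ∘ₗ K.polar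

theorem hat_pol (x : TodaGen) (G : Polynomial ℂ) : hat x (pol G) = 0 := by
  rw [hat, LinearMap.comp_apply, K.polar_pol, map_zero]

theorem hat_u (x : TodaGen) (n : ℤ) (j : ℕ) : hat x (K.u n j) = X (x, n, j) := by
  rw [hat, LinearMap.comp_apply, K.polar_u, Finsupp.linearCombination_single, one_smul]

/-- The image of the singular function of a variable. -/
def fn (i : ℤ × ℕ) : K := K.u i.1 i.2

theorem hat_fn (x : TodaGen) (i : ℤ × ℕ) : hat x (fn i) = X (x, i) := hat_u x i.1 i.2

theorem exists_hat_add {p : K → Prop} (hpol : ∀ G, p (pol G)) (hu : ∀ i, p (fn i))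
    (add : ∀ a b, p a → p b → p (a + b)) (smul : ∀ (c : ℂ) a, p a → p (c • a)) (F : K) : p F := by
  obtain ⟨G, s, hs, rfl⟩ := K.exists_pol_add_sing F
  refine add _ _ (hpol G) ?_
  induction hs using Submodule.span_induction with
  | zero => simpa using hpol 0
  | add a b _ _ ha hb => exact add _ _ ha hb
  | smul c a _ ha => exact smul c a ha
  | mem a ha => obtain ⟨i, rfl⟩ := ha; exact hu i

/-- The coproduct that governs the action of the modes of `C` on the products of modes of `B`. -/
def coprod : TodaModel →ₐ[ℂ] TodaModel ⊗[ℂ] K :=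
  MvPolynomial.aeval fun v => match v with
    | (.B, i) => X (.B, i) ⊗ₜ 1 - 1 ⊗ₜ dif (fn i)
    | (.C, i) => X (.C, i) ⊗ₜ 1

/-- The map `m ⊗ k ↦ m * hat (q k)`. -/
def contr (q : K) : TodaModel ⊗[ℂ] K →ₗ[ℂ] TodaModel :=
  TensorProduct.lift ((LinearMap.mul ℂ TodaModel).compl₂ (hat .C ∘ₗ LinearMap.mulLeft ℂ q))

theorem contr_tmul (q k : K) (m : TodaModel) : contr q (m ⊗ₜ k) = m * hat .C (q * k) := rfl

/-- The action of the modes of `C` on the model. -/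
def opC : K →ₗ[ℂ] Module.End ℂ TodaModel where
  toFun q := contr q ∘ₗ coprod.toLinearMap
  map_add' q r := by
    rw [← LinearMap.add_comp]
    congr 1
    refine TensorProduct.ext' fun m k => ?_
    rw [LinearMap.add_apply, contr_tmul, contr_tmul, contr_tmul, add_mul, map_add, mul_add]
  map_smul' c q := by
    rw [RingHom.id_apply, ← LinearMap.smul_comp]
    congr 1
    refine TensorProduct.ext' fun m k => ?_
    rw [LinearMap.smul_apply, contr_tmul, contr_tmul, smul_mul_assoc, map_smul, mul_smul_comm]

theorem opC_apply (q : K) (m : TodaModel) : opC q m = contr q (coprod m) := rfl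

theorem opC_one (q : K) : opC q 1 = hat .C q := by
  rw [opC_apply, map_one, Algebra.TensorProduct.one_def, contr_tmul, one_mul, mul_one]

theorem contr_tmul_mul (q k : K) (m : TodaModel) (z : TodaModel ⊗[ℂ] K) :
    contr q ((m ⊗ₜ k) * z) = m * contr (q * k) z := by
  induction z using TensorProduct.induction_on with
  | zero => simp
  | add a b ha hb => rw [mul_add, map_add, map_add, mul_add, ha, hb]
  | tmul a b =>
    rw [Algebra.TensorProduct.tmul_mul_tmul, contr_tmul, contr_tmul, mul_assoc, mul_assoc q]

theorem opC_C_mul (q : K) (i : ℤ × ℕ) (m : TodaModel) :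
    opC q (X (.C, i) * m) = X (.C, i) * opC q m := by
  have h : coprod (X (.C, i)) = X (.C, i) ⊗ₜ 1 := MvPolynomial.aeval_X _ _
  rw [opC_apply, map_mul coprod, h, contr_tmul_mul, mul_one, opC_apply]

/-- This is the bracket relation rewritten as C_q B_p = B_p C_q − C_{dif(p)q}. The value of `coprod`
on the variables of B is designed to produce it. -/
theorem opC_B_mul (q : K) (i : ℤ × ℕ) (m : TodaModel) :
    opC q (X (.B, i) * m) = X (.B, i) * opC q m - opC (dif (fn i) * q) m := by
  have h : coprod (X (.B, i)) = X (.B, i) ⊗ₜ 1 - 1 ⊗ₜ dif (fn i) := MvPolynomial.aeval_X _ _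
  rw [opC_apply, map_mul coprod, h, sub_mul, map_sub, contr_tmul_mul, contr_tmul_mul, mul_one,
    one_mul, mul_comm q, opC_apply, opC_apply]

/-- Induction on the number of factors. -/
theorem model_induction {p : TodaModel → Prop} (one : p 1) (B_mul : ∀ i m, p m → p (X (.B, i) * m))
    (C_mul : ∀ i m, p m → p (X (.C, i) * m)) (add : ∀ a b, p a → p b → p (a + b))
    (smul : ∀ (c : ℂ) a, p a → p (c • a)) (m : TodaModel) : p m := by
  induction m using MvPolynomial.induction_on with
  | C c => rw [← mul_one (MvPolynomial.C c), ← MvPolynomial.smul_eq_C_mul]; exact smul _ _ one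
  | add a b ha hb => exact add _ _ ha hb
  | mul_X m v hm =>
    obtain ⟨x | x, i⟩ := v
    · rw [mul_comm]; exact B_mul _ _ hm
    · rw [mul_comm]; exact C_mul _ _ hm

theorem opC_hat_C_mul (q r : K) (m : TodaModel) :
    opC q (hat .C r * m) = hat .C r * opC q m := by
  induction r using exists_hat_add with
  | hpol G => rw [hat_pol, zero_mul, zero_mul, map_zero]
  | hu i => rw [hat_fn, opC_C_mul]
  | add a b ha hb => rw [map_add, add_mul, add_mul, map_add, ha, hb]
  | smul c a ha => rw [map_smul, smul_mul_assoc, smul_mul_assoc, map_smul, ha]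

theorem opC_hat_B_mul (q : K) {r : K} (hr : r ∈ K.sing) (m : TodaModel) :
    opC q (hat .B r * m) = hat .B r * opC q m - opC (dif r * q) m := by
  induction hr using Submodule.span_induction with
  | zero => simp
  | add a b _ _ ha hb =>
    rw [map_add, add_mul, add_mul, map_add, ha, hb, map_add dif, add_mul, map_add opC,
      LinearMap.add_apply]
    abel
  | smul c a _ ha =>
    rw [map_smul, smul_mul_assoc, smul_mul_assoc, map_smul, ha, map_smul dif, smul_mul_assoc,
      map_smul opC, LinearMap.smul_apply, smul_sub]
  | mem a ha => obtain ⟨i, rfl⟩ := ha; exact (hat_fn .B i).symm ▸ opC_B_mul q i m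

theorem opC_comm (q r : K) (m : TodaModel) : opC q (opC r m) = opC r (opC q m) := by
  induction m using model_induction generalizing q r with
  | one => rw [opC_one, opC_one, ← mul_one (hat .C r), ← mul_one (hat .C q), opC_hat_C_mul,
      opC_hat_C_mul, opC_one, opC_one, mul_comm]
  | B_mul i m hm =>
    rw [opC_B_mul, opC_B_mul, map_sub (opC q), map_sub (opC r), opC_B_mul, opC_B_mul, hm q r,
      hm q, hm _ q]
    rw [hm r]
    abel
  | C_mul i m hm => rw [opC_C_mul, opC_C_mul, opC_C_mul, opC_C_mul, hm]
  | add a b ha hb => simp only [map_add, ha q r, hb q r]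
  | smul c a ha => simp only [map_smul, ha q r]

/-- The derivation by which the mode of `B` at `p` acts, for `p` a polynomial. -/
def derB : K →ₗ[ℂ] Derivation ℂ TodaModel TodaModel where
  toFun p := MvPolynomial.mkDerivation ℂ fun v => match v with
    | (.B, _) => 0
    | (.C, i) => hat .C (dif p * fn i)
  map_add' p q := MvPolynomial.derivation_ext fun v => by
    obtain ⟨x | x, i⟩ := v <;> simp [MvPolynomial.mkDerivation_X, add_mul]
  map_smul' c p := MvPolynomial.derivation_ext fun v => by
    obtain ⟨x | x, i⟩ := v <;> simp [MvPolynomial.mkDerivation_X]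

theorem derB_B_mul (p : K) (i : ℤ × ℕ) (m : TodaModel) :
    derB p (X (.B, i) * m) = X (.B, i) * derB p m := by
  have : derB p (X (.B, i)) = 0 := MvPolynomial.mkDerivation_X ..
  rw [Derivation.leibniz, this, smul_zero, add_zero, smul_eq_mul]

theorem derB_C_mul (p : K) (i : ℤ × ℕ) (m : TodaModel) :
    derB p (X (.C, i) * m) = X (.C, i) * derB p m + hat .C (dif p * fn i) * m := by
  have : derB p (X (.C, i)) = hat .C (dif p * fn i) := MvPolynomial.mkDerivation_X ..
  rw [Derivation.leibniz, this, smul_eq_mul, smul_eq_mul, mul_comm m]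

theorem derB_one (p : K) : derB p 1 = 0 := Derivation.map_one_eq_zero _

/-- The index must be polynomial: then `dif (pol G)` times a polynomial is again a polynomial, which
`hat` kills, so the rule known on the variables extends to all q. -/
theorem derB_hat_C (G : Polynomial ℂ) (q : K) :
    derB (pol G) (hat .C q) = hat .C (dif (pol G) * q) := by
  obtain ⟨G', hG⟩ := dif_pol G
  induction q using exists_hat_add with
  | hpol H => rw [hat_pol, map_zero, hG, ← map_mul pol, hat_pol]
  | hu i => rw [hat_fn]; exact MvPolynomial.mkDerivation_X ..
  | add a b ha hb => rw [map_add, map_add, ha, hb, mul_add, map_add]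
  | smul c a ha => rw [map_smul, Derivation.map_smul, ha, mul_smul_comm, map_smul]

theorem derB_hat_B (p q : K) : derB p (hat .B q) = 0 := by
  induction q using exists_hat_add with
  | hpol H => rw [hat_pol, map_zero]
  | hu i => rw [hat_fn]; exact MvPolynomial.mkDerivation_X ..
  | add a b ha hb => rw [map_add, map_add, ha, hb, add_zero]
  | smul c a ha => rw [map_smul, Derivation.map_smul, ha, smul_zero]

theorem derB_opC (G : Polynomial ℂ) (q : K) (m : TodaModel) :
    derB (pol G) (opC q m) - opC q (derB (pol G) m) = opC (dif (pol G) * q) m := by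
  induction m using model_induction generalizing q with
  | one => rw [opC_one, derB_one, map_zero, sub_zero, opC_one, derB_hat_C]
  | B_mul i m hm =>
    rw [opC_B_mul, derB_B_mul, opC_B_mul, opC_B_mul, map_sub, derB_B_mul, ← hm q, mul_left_comm,
      ← hm (dif (fn i) * q), mul_sub]
    abel
  | C_mul i m hm =>
    rw [opC_C_mul, derB_C_mul, derB_C_mul, map_add, opC_C_mul, opC_C_mul, opC_hat_C_mul, ← hm q,
      mul_sub]
    abel
  | add a b ha hb => simp only [map_add, ← ha q, ← hb q]; abel
  | smul c a ha => simp only [map_smul, Derivation.map_smul, ← ha q, smul_sub]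

theorem derB_comm (G H : Polynomial ℂ) (m : TodaModel) :
    derB (pol G) (derB (pol H) m) = derB (pol H) (derB (pol G) m) := by
  induction m using model_induction with
  | one => simp only [derB_one, map_zero]
  | B_mul i m hm => simp only [derB_B_mul, hm]
  | C_mul i m hm =>
    have h : derB (pol G) (hat .C (dif (pol H) * fn i)) =
        derB (pol H) (hat .C (dif (pol G) * fn i)) := by
      rw [derB_hat_C, derB_hat_C, mul_left_comm]
    rw [derB_C_mul, derB_C_mul, map_add, map_add, derB_C_mul, derB_C_mul, hm,
      Derivation.leibniz, Derivation.leibniz, h]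
    simp only [smul_eq_mul]
    ring
  | add a b ha hb => simp only [map_add, ha, hb]
  | smul c a ha => simp only [Derivation.map_smul, ha]

/-- The action of the modes of `B` on the model. -/
def opB : K →ₗ[ℂ] Module.End ℂ TodaModel :=
  LinearMap.mul ℂ TodaModel ∘ₗ hat .B + 
    (LinearMap.mk₂ ℂ (fun p m => derB p m) (fun _ _ _ => by rw [map_add]; rfl)
      (fun _ _ _ => by rw [map_smul]; rfl) (fun _ _ _ => map_add _ _ _)
      (fun _ _ _ => Derivation.map_smul _ _ _)) ∘ₗ (LinearMap.id - K.singPart)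

theorem opB_pol (G : Polynomial ℂ) (m : TodaModel) : opB (pol G) m = derB (pol G) m := by
  change hat .B (pol G) * m + derB (pol G - K.singPart (pol G)) m = _
  rw [hat_pol, zero_mul, zero_add, K.singPart_pol, sub_zero]

theorem opB_sing {s : K} (hs : s ∈ K.sing) (m : TodaModel) : opB s m = hat .B s * m := by
  change hat .B s * m + derB (s - K.singPart s) m = _
  rw [K.singPart_of_mem hs, sub_self, map_zero]
  exact add_zero _

/-- The polynomial part of p acts by a derivation and the singular part by multiplication. The
relation holds for each part separately, by `derB_opC` and `opC_hat_B_mul`. -/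
theorem opB_opC (p q : K) (m : TodaModel) :
    opB p (opC q m) - opC q (opB p m) = opC (dif p * q) m := by
  obtain ⟨G, s, hs, rfl⟩ := K.exists_pol_add_sing p
  simp only [map_add, LinearMap.add_apply, add_mul, opB_pol, opB_sing hs, opC_hat_B_mul q hs,
    ← derB_opC]
  abel

theorem opB_comm (p q : K) (m : TodaModel) : opB p (opB q m) = opB q (opB p m) := by
  obtain ⟨G, s, hs, rfl⟩ := K.exists_pol_add_sing p
  obtain ⟨H, t, ht, rfl⟩ := K.exists_pol_add_sing q
  simp only [map_add, LinearMap.add_apply, opB_pol, opB_sing hs, opB_sing ht, derB_comm G H,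
    Derivation.leibniz, derB_hat_B, smul_eq_mul]
  ring

/-- The action of `𝓛Toda` on the model. -/
def rep : LieOf CToda →ₗ[ℂ] Module.End ℂ TodaModel :=
  liftModes fun x => match x with
    | .B => opB
    | .C => opC

theorem rep_B (p : K) : rep (genMode .B p) = opB p := liftModes_genMode _ _ _

theorem rep_C (p : K) : rep (genMode .C p) = opC p := liftModes_genMode _ _ _

theorem rep_lie (z w : LieOf CToda) : rep ⁅z, w⁆ = rep z * rep w - rep w * rep z := by
  have hBC (p q : K) : opB p * opC q - opC q * opB p = opC (dif p * q) :=
    LinearMap.ext (opB_opC p q)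
  have hB (p q : K) : opB p * opB q = opB q * opB p := LinearMap.ext (opB_comm p q)
  have hC (p q : K) : opC p * opC q = opC q * opC p := LinearMap.ext (opC_comm p q)
  have hCB (p q : K) : ⁅genMode .C p, genMode .B q⁆ = -genMode .C (dif q * p) := by
    rw [← lie_skew, lie_genMode]
  rw [← genMode_coord z, ← genMode_coord w]
  simp only [lie_add, add_lie, lie_genMode_self, lie_genMode, hCB, map_add, map_neg, map_zero,
    rep_B, rep_C, ← hBC, add_mul, mul_add]
  rw [hB (coord .B w), hC (coord .C w)]
  abel

theorem rep_ann {z : LieOf CToda} (hz : z ∈ ann CToda) : rep z 1 = 0 := by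
  obtain ⟨G, hG⟩ : coord .B z ∈ Subalgebra.toSubmodule pol.range :=
    coord_mem_of_mem_modeSubalgebra _ _ hz .B
  obtain ⟨H, hH⟩ : coord .C z ∈ Subalgebra.toSubmodule pol.range :=
    coord_mem_of_mem_modeSubalgebra _ _ hz .C
  rw [← genMode_coord z, map_add, rep_B, rep_C, ← hG, ← hH, LinearMap.add_apply]
  refine (congrArg₂ (· + ·) (opB_pol G 1) (opC_one (pol H))).trans ?_
  rw [derB_one, hat_pol, add_zero]

end TodaModel

end HTVertex
end

/-! ### Ordered products and the bijectivity of the map from the creation algebra. -/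

noncomputable section
namespace HTVertex

attribute [local instance] LieRing.ofAssociativeRing

section
variable {C : Type*} [AddCommGroup C] [Module ℂ C] [HTConformalAlgebra C]

theorem crMap_apply (a : UniversalEnvelopingAlgebra ℂ (cr C)) :
    crMap C a = UniversalEnvelopingAlgebra.lift ℂ
      ((UniversalEnvelopingAlgebra.ι ℂ).comp (cr C).incl) a • v0 C := rfl

theorem crMap_one : crMap C 1 = v0 C := by
  rw [crMap_apply, map_one, one_smul]

theorem crMap_ι_mul (x : cr C) (a : UniversalEnvelopingAlgebra ℂ (cr C)) :
    crMap C (UniversalEnvelopingAlgebra.ι ℂ x * a) = act (x : LieOf C) (crMap C a) := by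
  rw [crMap_apply, map_mul, UniversalEnvelopingAlgebra.lift_ι_apply, mul_smul]
  rfl

/-- The range is stable under the whole Lie algebra. Any x is moved past the creation factors, each
exchange leaving a bracket applied to a shorter product. Once x reaches the vacuum its annihilating
part vanishes. The induction is therefore stated for all x at once. -/
theorem crMap_surjective (h : Codisjoint (cr C).toSubmodule (ann C).toSubmodule) :
    Function.Surjective (crMap C) := by
  have key (a : UniversalEnvelopingAlgebra ℂ (cr C)) :
      ∀ x : LieOf C, act x (crMap C a) ∈ LinearMap.range (crMap C) := by
    induction a using envelopingAlgebra_induction with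
    | one =>
      intro x
      obtain ⟨y, hy, z, hz, rfl⟩ := Submodule.mem_sup.mp
        ((codisjoint_iff.mp h).symm ▸ Submodule.mem_top : x ∈ _ ⊔ _)
      rw [crMap_one, act_add, act_v0_of_mem_ann hz, add_zero]
      exact ⟨UniversalEnvelopingAlgebra.ι ℂ ⟨y, hy⟩ * 1, by rw [crMap_ι_mul, crMap_one]⟩
    | ι_mul y a ih =>
      intro x
      have e : act x (crMap C (UniversalEnvelopingAlgebra.ι ℂ y * a)) =
          act (y : LieOf C) (act x (crMap C a)) + act ⁅x, (y : LieOf C)⁆ (crMap C a) := by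
        rw [crMap_ι_mul, act_lie]; abel
      rw [e]
      refine Submodule.add_mem _ ?_ (ih _)
      obtain ⟨b, hb⟩ := ih x
      exact ⟨UniversalEnvelopingAlgebra.ι ℂ y * b, by rw [crMap_ι_mul, hb]⟩
    | add a b ha hb =>
      intro x
      rw [map_add, act_add_right]; exact Submodule.add_mem _ (ha x) (hb x)
    | smul c a ha =>
      intro x
      rw [map_smul, act_smul_right]; exact Submodule.smul_mem _ _ (ha x)
  intro w
  change w ∈ LinearMap.range (crMap C)
  induction w using vacMod_induction_lie with
  | v0 => exact ⟨1, crMap_one⟩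
  | act x w hw => obtain ⟨a, rfl⟩ := hw; exact key a x
  | add a b ha hb => exact Submodule.add_mem _ ha hb
  | smul c a ha => exact Submodule.smul_mem _ _ ha

end

/-- Commuting elements of an algebra define an evaluation of polynomials. -/
theorem exists_aeval_of_commute {ι A : Type*} [Ring A] [Algebra ℂ A] (g : ι → A)
    (h : ∀ i j, g i * g j = g j * g i) :
    ∃ φ : MvPolynomial ι ℂ →ₐ[ℂ] A, ∀ i, φ (MvPolynomial.X i) = g i := by
  have hc : IsMulCommutative (Algebra.adjoin ℂ (Set.range g)) := Algebra.isMulCommutative_adjoin ℂ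
    (by rintro _ ⟨i, rfl⟩ _ ⟨j, rfl⟩; exact h i j)
  let _ : CommRing (Algebra.adjoin ℂ (Set.range g)) :=
    { (inferInstance : Ring (Algebra.adjoin ℂ (Set.range g))) with mul_comm := hc.is_comm.comm }
  refine ⟨(Algebra.adjoin ℂ (Set.range g)).val.comp (MvPolynomial.aeval fun i =>
    ⟨g i, Algebra.subset_adjoin ⟨i, rfl⟩⟩), fun i => ?_⟩
  rw [AlgHom.comp_apply, MvPolynomial.aeval_X]
  rfl

/-- Two commuting families in an algebra define a map by ordered products. -/
theorem exists_ordered_product {ι A : Type*} [Ring A] [Algebra ℂ A] (b c : ι → A)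
    (hb : ∀ i j, b i * b j = b j * b i) (hc : ∀ i j, c i * c j = c j * c i) :
    ∃ ψ : MvPolynomial (TodaGen × ι) ℂ →ₗ[ℂ] A, ψ 1 = 1 ∧
      (∀ i m, ψ (MvPolynomial.X (.B, i) * m) = b i * ψ m) ∧
      ∀ i m, ψ (MvPolynomial.X (.C, i) * m) = ψ m * c i := by
  -- Left multiplications commute with right multiplications by associativity, even when b and c do
  -- not commute. Polynomials can thus be evaluated on these operators, and applying the result to 1
  -- puts all b to the left of all c.
  let g : TodaGen × ι → Module.End ℂ A := fun v => match v with
    | (.B, i) => LinearMap.mulLeft ℂ (b i)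
    | (.C, i) => LinearMap.mulRight ℂ (c i)
  have gB (i : ι) (a : A) : g (.B, i) a = b i * a := rfl
  have gC (i : ι) (a : A) : g (.C, i) a = a * c i := rfl
  obtain ⟨φ, hφ⟩ := exists_aeval_of_commute g (by
    rintro ⟨x | x, i⟩ ⟨y | y, j⟩ <;> refine LinearMap.ext fun a => ?_ <;>
      simp only [Module.End.mul_apply, gB, gC]
    · rw [← mul_assoc, hb, mul_assoc]
    · rw [mul_assoc]
    · rw [mul_assoc]
    · rw [mul_assoc, hc, mul_assoc])
  have h1 : φ 1 = 1 := map_one φ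
  have key (v : TodaGen × ι) (m : MvPolynomial (TodaGen × ι) ℂ) :
      φ (MvPolynomial.X v * m) = g v * φ m := by
    rw [← hφ]; exact map_mul φ _ _
  refine ⟨LinearMap.applyₗ 1 ∘ₗ φ.toLinearMap, LinearMap.congr_fun h1 1,
    fun i m => (LinearMap.congr_fun (key _ m) 1).trans (gB i _),
    fun i m => (LinearMap.congr_fun (key _ m) 1).trans (gC i _)⟩

namespace TodaModel

open MvPolynomial CToda

/-- The creation modes. -/
def crMode (x : TodaGen) (s : K.sing) : cr CToda := ⟨genMode x s, mode_mem_cr _ s.2⟩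

/-- The creation modes, in the enveloping algebra. -/
def ucr (x : TodaGen) (s : K.sing) : UniversalEnvelopingAlgebra ℂ (cr CToda) :=
  UniversalEnvelopingAlgebra.ι ℂ (crMode x s)

/-- The basis of `K_Sing`, as elements of the subspace. -/
def fnSing (i : ℤ × ℕ) : K.sing := ⟨fn i, K.u_mem _ _⟩

theorem ucr_comm (x : TodaGen) (s t : K.sing) : ucr x s * ucr x t = ucr x t * ucr x s := by
  rw [← sub_eq_zero, ← LieRing.of_associative_ring_bracket, ucr, ucr, ← LieHom.map_lie]
  have : ⁅crMode x s, crMode x t⁆ = 0 := Subtype.ext (lie_genMode_self x s t)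
  rw [this, map_zero]

theorem ucr_C_B (s t : K.sing) : ucr .C s * ucr .B t =
    ucr .B t * ucr .C s - ucr .C ⟨dif t * s, K.sing_mul_mem (dif_mem_sing t.2) s.2⟩ := by
  have : crMode .C ⟨dif t * s, K.sing_mul_mem (dif_mem_sing t.2) s.2⟩ =
      ⁅crMode .B t, crMode .C s⁆ := Subtype.ext (lie_genMode t s).symm
  rw [ucr, ucr, ucr, this, LieHom.map_lie, LieRing.of_associative_ring_bracket]
  abel

theorem exists_order : ∃ ψ : TodaModel →ₗ[ℂ] UniversalEnvelopingAlgebra ℂ (cr CToda),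
    ψ 1 = 1 ∧ (∀ i m, ψ (X (.B, i) * m) = ucr .B (fnSing i) * ψ m) ∧
    ∀ i m, ψ (X (.C, i) * m) = ψ m * ucr .C (fnSing i) :=
  exists_ordered_product (fun i => ucr .B (fnSing i)) (fun i => ucr .C (fnSing i))
    (fun _ _ => ucr_comm _ _ _) fun _ _ => ucr_comm _ _ _

/-- The range is stable under left multiplication by modes of B by construction. A mode of C is
moved to the right past the factors B; by `ucr_C_B` each exchange only adds a term with another mode
of C and fewer factors. Factors of C already on the right are left untouched. -/
theorem order_surjective {ψ : TodaModel →ₗ[ℂ] UniversalEnvelopingAlgebra ℂ (cr CToda)}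
    (h1 : ψ 1 = 1) (hB : ∀ i m, ψ (X (.B, i) * m) = ucr .B (fnSing i) * ψ m)
    (hC : ∀ i m, ψ (X (.C, i) * m) = ψ m * ucr .C (fnSing i)) : Function.Surjective ψ := by
  have kB (s : K.sing) (m : TodaModel) : ucr .B s * ψ m = ψ (hat .B s * m) := by
    obtain ⟨s, hs⟩ := s
    induction hs using Submodule.span_induction with
    | zero =>
      have : ucr .B ⟨0, K.sing.zero_mem⟩ = 0 := by
        rw [← map_zero (UniversalEnvelopingAlgebra.ι ℂ)]
        exact congrArg _ (Subtype.ext (map_zero (genMode .B)) : crMode .B ⟨0, K.sing.zero_mem⟩ = 0)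
      change ucr .B ⟨0, K.sing.zero_mem⟩ * ψ m = ψ (hat .B 0 * m)
      rw [this, map_zero, zero_mul, zero_mul, map_zero]
    | add a b ha' hb' ha hb =>
      have : ucr .B ⟨a + b, K.sing.add_mem ha' hb'⟩ = ucr .B ⟨a, ha'⟩ + ucr .B ⟨b, hb'⟩ := by
        rw [ucr, ucr, ucr, ← map_add]
        exact congrArg _ (Subtype.ext (map_add (genMode .B) a b))
      change ucr .B ⟨a + b, K.sing.add_mem ha' hb'⟩ * ψ m = ψ (hat .B (a + b) * m)
      rw [this, map_add, add_mul, add_mul, map_add]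
      exact congrArg₂ _ ha hb
    | smul c a ha' ha =>
      have : ucr .B ⟨c • a, K.sing.smul_mem c ha'⟩ = c • ucr .B ⟨a, ha'⟩ := by
        rw [ucr, ucr, ← map_smul]
        exact congrArg _ (Subtype.ext (map_smul (genMode .B) c a))
      change ucr .B ⟨c • a, K.sing.smul_mem c ha'⟩ * ψ m = ψ (hat .B (c • a) * m)
      rw [this, map_smul, smul_mul_assoc, smul_mul_assoc, map_smul]
      exact congrArg _ ha
    | mem a ha =>
      obtain ⟨i, rfl⟩ := ha
      exact (hB i m).symm.trans (congrArg (fun v => ψ (v * m)) (hat_fn .B i).symm)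
  have kC1 (s : K.sing) : ucr .C s = ψ (hat .C s) := by
    obtain ⟨s, hs⟩ := s
    induction hs using Submodule.span_induction with
    | zero =>
      change ucr .C ⟨0, K.sing.zero_mem⟩ = ψ (hat .C 0)
      rw [map_zero, map_zero, ← map_zero (UniversalEnvelopingAlgebra.ι ℂ)]
      exact congrArg _ (Subtype.ext (map_zero (genMode .C)) : crMode .C ⟨0, K.sing.zero_mem⟩ = 0)
    | add a b ha' hb' ha hb =>
      refine Eq.trans ?_ ((congrArg₂ (· + ·) ha hb).trans ?_)
      · change ucr .C ⟨a + b, K.sing.add_mem ha' hb'⟩ = ucr .C ⟨a, ha'⟩ + ucr .C ⟨b, hb'⟩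
        rw [ucr, ucr, ucr, ← map_add]
        exact congrArg _ (Subtype.ext (map_add (genMode .C) a b))
      · change _ = ψ (hat .C (a + b))
        rw [map_add, map_add]
    | smul c a ha' ha =>
      refine Eq.trans ?_ ((congrArg (c • ·) ha).trans ?_)
      · change ucr .C ⟨c • a, K.sing.smul_mem c ha'⟩ = c • ucr .C ⟨a, ha'⟩
        rw [ucr, ucr, ← map_smul]
        exact congrArg _ (Subtype.ext (map_smul (genMode .C) c a))
      · change _ = ψ (hat .C (c • a))
        rw [map_smul, map_smul]
    | mem a ha =>
      obtain ⟨i, rfl⟩ := ha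
      have := hC i 1
      rw [h1, one_mul, mul_one] at this
      exact this.symm.trans (congrArg ψ (hat_fn .C i).symm)
  have kC (m : TodaModel) (s : K.sing) : ucr .C s * ψ m ∈ LinearMap.range ψ := by
    induction m using model_induction generalizing s with
    | one => rw [h1, mul_one, kC1]; exact ⟨_, rfl⟩
    | B_mul i m hm =>
      rw [hB, ← mul_assoc, ucr_C_B, sub_mul, mul_assoc]
      refine Submodule.sub_mem _ ?_ (hm _)
      obtain ⟨m', h⟩ := hm s
      exact ⟨_, (hB i m').trans (by rw [h])⟩
    | C_mul i m hm =>
      rw [hC, ← mul_assoc]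
      obtain ⟨m', h⟩ := hm s
      exact ⟨_, (hC i m').trans (by rw [h])⟩
    | add a b ha hb => rw [map_add, mul_add]; exact Submodule.add_mem _ (ha s) (hb s)
    | smul c a ha => rw [map_smul, mul_smul_comm]; exact Submodule.smul_mem _ _ (ha s)
  intro a
  change a ∈ LinearMap.range ψ
  induction a using envelopingAlgebra_induction with
  | one => exact ⟨1, h1⟩
  | ι_mul x a ha =>
    have hx : x = crMode .B ⟨_, coord_mem_of_mem_modeSubalgebra _ _ x.2 .B⟩ +
        crMode .C ⟨_, coord_mem_of_mem_modeSubalgebra _ _ x.2 .C⟩ :=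
      Subtype.ext (genMode_coord x).symm
    obtain ⟨m, rfl⟩ := ha
    rw [hx, map_add, add_mul]
    exact Submodule.add_mem _ ⟨_, (kB _ _).symm⟩ (kC _ _)
  | add a b ha hb => exact Submodule.add_mem _ ha hb
  | smul c a ha => exact Submodule.smul_mem _ _ ha

/-- The action on the model, restricted to the creation subalgebra. -/
def crRep : UniversalEnvelopingAlgebra ℂ (cr CToda) →ₐ[ℂ] Module.End ℂ TodaModel :=
  UniversalEnvelopingAlgebra.lift ℂ
    { rep ∘ₗ (cr CToda).toSubmodule.subtype with
      map_lie' := fun {x y} => rep_lie x y }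

theorem crRep_ucr (x : TodaGen) (s : K.sing) : crRep (ucr x s) = rep (genMode x s) :=
  UniversalEnvelopingAlgebra.lift_ι_apply ..

/-- In an ordered product the factors C act first. The statement is generalized from 1 to vectors m′
on which the modes of C act by multiplication, a property preserved when m′ is multiplied by a
variable of C. -/
theorem crRep_order {ψ : TodaModel →ₗ[ℂ] UniversalEnvelopingAlgebra ℂ (cr CToda)}
    (h1 : ψ 1 = 1) (hB : ∀ i m, ψ (X (.B, i) * m) = ucr .B (fnSing i) * ψ m)
    (hC : ∀ i m, ψ (X (.C, i) * m) = ψ m * ucr .C (fnSing i)) (m m' : TodaModel)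
    (hm' : ∀ i, opC (fn i) m' = X (.C, i) * m') : crRep (ψ m) m' = m * m' := by
  induction m using model_induction generalizing m' with
  | one => rw [h1, map_one, one_mul]; rfl
  | B_mul i m hm =>
    rw [hB, map_mul, crRep_ucr, rep_B, Module.End.mul_apply, hm m' hm', mul_assoc,
      opB_sing (fnSing i).2]
    exact congrArg (· * (m * m')) (hat_fn .B i)
  | C_mul i m hm =>
    rw [hC, map_mul, crRep_ucr, rep_C, Module.End.mul_apply]
    have : opC (fnSing i : K) m' = X (.C, i) * m' := hm' i
    rw [this, hm, mul_left_comm, mul_assoc]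
    intro j
    rw [opC_C_mul, hm', mul_left_comm]
  | add a b ha hb => rw [map_add, map_add, LinearMap.add_apply, ha m' hm', hb m' hm', add_mul]
  | smul c a ha => rw [map_smul, map_smul, LinearMap.smul_apply, ha m' hm', smul_mul_assoc]

theorem exists_toModel : ∃ φ : VToda →ₗ[ℂ] TodaModel, φ (v0 CToda) = 1 ∧
    ∀ x w, φ (act x w) = rep x (φ w) :=
  exists_vacMod_lift rep rep_lie 1 fun _ => rep_ann

/-- The map from the Toda vertex algebra to its polynomial model. -/
def toModel : VToda →ₗ[ℂ] TodaModel := exists_toModel.choose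

theorem toModel_v0 : toModel (v0 CToda) = 1 := exists_toModel.choose_spec.1

theorem toModel_act (x : LieOf CToda) (w : VToda) : toModel (act x w) = rep x (toModel w) :=
  exists_toModel.choose_spec.2 x w

theorem toModel_crMap (a : UniversalEnvelopingAlgebra ℂ (cr CToda)) :
    toModel (crMap CToda a) = crRep a 1 := by
  induction a using envelopingAlgebra_induction with
  | one => rw [crMap_one, toModel_v0, map_one crRep]; rfl
  | ι_mul x a ih =>
    rw [crMap_ι_mul, toModel_act, ih, map_mul, Module.End.mul_apply, crRep,
      UniversalEnvelopingAlgebra.lift_ι_apply]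
    rfl
  | add a b ha hb => rw [map_add, map_add, map_add, ha, hb]; rfl
  | smul c a ha => rw [map_smul, map_smul, map_smul, ha]; rfl

theorem toModel_crMap_order {ψ : TodaModel →ₗ[ℂ] UniversalEnvelopingAlgebra ℂ (cr CToda)}
    (h1 : ψ 1 = 1) (hB : ∀ i m, ψ (X (.B, i) * m) = ucr .B (fnSing i) * ψ m)
    (hC : ∀ i m, ψ (X (.C, i) * m) = ψ m * ucr .C (fnSing i)) (m : TodaModel) :
    toModel (crMap CToda (ψ m)) = m := by
  rw [toModel_crMap, crRep_order h1 hB hC, mul_one]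
  intro i
  rw [opC_one, hat_fn, mul_one]

/-- The ordered product map is onto and has a left inverse that factors through `crMap`, so `crMap`
is injective. -/
theorem crMap_bijective : Function.Bijective (crMap CToda) := by
  refine ⟨?_, crMap_surjective isCompl_cr_ann.codisjoint⟩
  obtain ⟨ψ, h1, hB, hC⟩ := exists_order
  intro a b hab
  obtain ⟨m, rfl⟩ := order_surjective h1 hB hC a
  obtain ⟨m', rfl⟩ := order_surjective h1 hB hC b
  rw [← toModel_crMap_order h1 hB hC m, hab, toModel_crMap_order h1 hB hC m']

theorem toModel_bijective : Function.Bijective toModel := by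
  obtain ⟨ψ, h1, hB, hC⟩ := exists_order
  refine ⟨fun v w h => ?_, fun m => ⟨_, toModel_crMap_order h1 hB hC m⟩⟩
  obtain ⟨a, rfl⟩ := crMap_bijective.2 v
  obtain ⟨b, rfl⟩ := crMap_bijective.2 w
  obtain ⟨m, rfl⟩ := order_surjective h1 hB hC a
  obtain ⟨m', rfl⟩ := order_surjective h1 hB hC b
  rw [toModel_crMap_order h1 hB hC, toModel_crMap_order h1 hB hC] at h
  rw [h]

/-- The Toda vertex algebra is isomorphic to its polynomial model. -/
def modelEquiv : TodaModel ≃ₗ[ℂ] VToda := (LinearEquiv.ofBijective toModel toModel_bijective).symm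

theorem toModel_modelEquiv (m : TodaModel) : toModel (modelEquiv m) = m :=
  (LinearEquiv.ofBijective toModel toModel_bijective).apply_symm_apply m

theorem modelEquiv_one : modelEquiv 1 = v0 CToda :=
  toModel_bijective.1 (by rw [toModel_modelEquiv, toModel_v0])

theorem modelEquiv_rep (x : LieOf CToda) (m : TodaModel) :
    modelEquiv (rep x m) = act x (modelEquiv m) :=
  toModel_bijective.1 (by rw [toModel_modelEquiv, toModel_act, toModel_modelEquiv])

end TodaModel

end HTVertex
end

/-! ### Degree filtrations on polynomial rings and on the model. -/

noncomputable section
namespace HTVertex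

open MvPolynomial CToda

section
variable {σ τ : Type*}

/-- The polynomials of total degree at most `k`. -/
def degFil (σ : Type*) (k : ℤ) : Submodule ℂ (MvPolynomial σ ℂ) :=
  Submodule.span ℂ {p | ∃ s : σ →₀ ℕ, (s.degree : ℤ) ≤ k ∧ p = MvPolynomial.monomial s 1}

theorem degFil_mono {k l : ℤ} (h : k ≤ l) : degFil σ k ≤ degFil σ l :=
  Submodule.span_mono fun _ ⟨s, hs, e⟩ => ⟨s, hs.trans h, e⟩

theorem degFil_eq_bot {k : ℤ} (h : k < 0) : degFil σ k = ⊥ := by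
  rw [degFil, Submodule.span_eq_bot]
  rintro _ ⟨s, hs, rfl⟩
  omega

theorem one_mem_degFil : (1 : MvPolynomial σ ℂ) ∈ degFil σ 0 :=
  Submodule.subset_span ⟨0, by simp, rfl⟩

theorem X_mul_mem_degFil (v : σ) {k : ℤ} {f : MvPolynomial σ ℂ} (hf : f ∈ degFil σ k) :
    X v * f ∈ degFil σ (k + 1) := by
  induction hf using Submodule.span_induction with
  | zero => rw [mul_zero]; exact Submodule.zero_mem _
  | add a b _ _ ha hb => rw [mul_add]; exact Submodule.add_mem _ ha hb
  | smul c a _ ha => rw [mul_smul_comm]; exact Submodule.smul_mem _ _ ha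
  | mem f hf =>
    obtain ⟨s, hs, rfl⟩ := hf
    refine Submodule.subset_span ⟨Finsupp.single v 1 + s, ?_, ?_⟩
    · rw [map_add, Finsupp.degree_single]; push_cast; omega
    · rw [MvPolynomial.X, MvPolynomial.monomial_mul, one_mul]

theorem X_mem_degFil (v : σ) : X v ∈ degFil σ 1 := by
  have := X_mul_mem_degFil v (one_mem_degFil (σ := σ))
  rwa [mul_one] at this

theorem degFil_induction {p : ℤ → MvPolynomial σ ℂ → Prop} (zero : ∀ k, p k 0) (one : p 0 1)
    (X_mul : ∀ k v f, f ∈ degFil σ k → p k f → p (k + 1) (X v * f))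
    (mono : ∀ k l f, k ≤ l → p k f → p l f) (add : ∀ k f g, p k f → p k g → p k (f + g))
    (smul : ∀ k (c : ℂ) f, p k f → p k (c • f)) {k : ℤ} {f : MvPolynomial σ ℂ}
    (hf : f ∈ degFil σ k) : p k f := by
  have key : ∀ (n : ℕ) (s : σ →₀ ℕ), s.degree = n → p n (monomial s 1) := by
    intro n
    induction n with
    | zero =>
      intro s hs
      rw [Finsupp.degree_eq_zero_iff] at hs
      subst hs
      exact one
    | succ n ih =>
      intro s hs
      obtain ⟨v, hv⟩ : ∃ v, s v ≠ 0 := by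
        by_contra! h
        have : s = 0 := Finsupp.ext h
        subst this
        simp at hs
      have hle : Finsupp.single v 1 ≤ s := by
        rw [Finsupp.single_le_iff]; omega
      obtain ⟨t, rfl⟩ := exists_add_of_le hle
      rw [map_add, Finsupp.degree_single] at hs
      have e : monomial (Finsupp.single v 1 + t) (1 : ℂ) = X v * monomial t 1 := by
        rw [MvPolynomial.X, MvPolynomial.monomial_mul, one_mul]
      rw [e]
      push_cast
      exact X_mul _ _ _ (Submodule.subset_span ⟨t, by omega, rfl⟩) (ih t (by omega))
  induction hf using Submodule.span_induction with
  | zero => exact zero k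
  | add a b _ _ ha hb => exact add k a b ha hb
  | smul c a _ ha => exact smul k c a ha
  | mem f hf =>
    obtain ⟨s, hs, rfl⟩ := hf
    exact mono _ _ _ hs (key _ s rfl)

theorem mul_mem_degFil {k l : ℤ} {f g : MvPolynomial σ ℂ} (hf : f ∈ degFil σ k)
    (hg : g ∈ degFil σ l) : f * g ∈ degFil σ (k + l) := by
  refine degFil_induction (p := fun k f => f * g ∈ degFil σ (k + l)) (fun k => ?_) ?_
    (fun k v f hf ih => ?_) (fun k k' f h ih => degFil_mono (by omega) ih) (fun k f f' h h' => ?_)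
    (fun k c f h => ?_) hf
  · rw [zero_mul]; exact Submodule.zero_mem _
  · rwa [one_mul, zero_add]
  · rw [mul_assoc, add_right_comm]
    exact X_mul_mem_degFil v ih
  · rw [add_mul]; exact Submodule.add_mem _ h h'
  · rw [smul_mul_assoc]; exact Submodule.smul_mem _ _ h

theorem aeval_mem_degFil {g : σ → MvPolynomial τ ℂ} (hg : ∀ v, g v ∈ degFil τ 1) {k : ℤ}
    {f : MvPolynomial σ ℂ} (hf : f ∈ degFil σ k) : MvPolynomial.aeval g f ∈ degFil τ k := by
  refine degFil_induction (p := fun k f => MvPolynomial.aeval g f ∈ degFil τ k) (fun k => ?_) ?_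
    (fun k v f hf ih => ?_) (fun k k' f h ih => degFil_mono (by omega) ih) (fun k f f' h h' => ?_)
    (fun k c f h => ?_) hf
  · rw [map_zero]; exact Submodule.zero_mem _
  · rw [map_one]; exact one_mem_degFil
  · rw [map_mul (MvPolynomial.aeval g), MvPolynomial.aeval_X, add_comm]
    exact mul_mem_degFil (hg v) ih
  · rw [map_add]; exact Submodule.add_mem _ h h'
  · rw [map_smul]; exact Submodule.smul_mem _ _ h

theorem derivation_mem_degFil {d : Derivation ℂ (MvPolynomial σ ℂ) (MvPolynomial σ ℂ)}
    (hd : ∀ v, d (X v) ∈ degFil σ 1) {k : ℤ} {f : MvPolynomial σ ℂ} (hf : f ∈ degFil σ k) :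
    d f ∈ degFil σ k := by
  refine degFil_induction (p := fun k f => d f ∈ degFil σ k) (fun k => ?_) ?_
    (fun k v f hf ih => ?_) (fun k k' f h ih => degFil_mono (by omega) ih) (fun k f f' h h' => ?_)
    (fun k c f h => ?_) hf
  · rw [map_zero]; exact Submodule.zero_mem _
  · rw [Derivation.map_one_eq_zero]; exact Submodule.zero_mem _
  · rw [Derivation.leibniz]
    exact Submodule.add_mem _ (X_mul_mem_degFil v ih) (mul_mem_degFil hf (hd v))
  · rw [map_add]; exact Submodule.add_mem _ h h'
  · rw [Derivation.map_smul]; exact Submodule.smul_mem _ _ h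

end

namespace TodaModel

/-- The filtration of the model by the degree. -/
abbrev fil (k : ℤ) : Submodule ℂ TodaModel := degFil _ k

theorem hat_mem (x : TodaGen) (p : K) : hat x p ∈ fil 1 := by
  induction p using exists_hat_add with
  | hpol G => rw [hat_pol]; exact Submodule.zero_mem _
  | hu i => rw [hat_fn]; exact X_mem_degFil _
  | add a b ha hb => rw [map_add]; exact Submodule.add_mem _ ha hb
  | smul c a ha => rw [map_smul]; exact Submodule.smul_mem _ _ ha

/-- The correction terms of the recursion replace a factor B by a linear form in the variables of C,
so they are of lower order than the product with the form of q. -/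
theorem opC_sub_mem {k : ℤ} {m : TodaModel} (hm : m ∈ fil k) (q : K) :
    opC q m - hat .C q * m ∈ fil k := by
  refine degFil_induction (p := fun k m => ∀ q, opC q m - hat .C q * m ∈ fil k) (fun k q => ?_)
    (fun q => ?_) (fun k v m hm ih q => ?_) (fun k k' f h ih q => degFil_mono (by omega) (ih q))
    (fun k f f' h h' q => ?_) (fun k c f h q => ?_) hm q
  · rw [map_zero, mul_zero, sub_zero]; exact Submodule.zero_mem _
  · rw [opC_one, mul_one, sub_self]; exact Submodule.zero_mem _
  · obtain ⟨x | x, i⟩ := v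
    · have e : opC q (X (.B, i) * m) - hat .C q * (X (.B, i) * m) =
          X (.B, i) * (opC q m - hat .C q * m) - (opC (dif (fn i) * q) m -
            hat .C (dif (fn i) * q) * m) - hat .C (dif (fn i) * q) * m := by
        rw [opC_B_mul]; ring
      rw [e]
      have h := mul_mem_degFil (hat_mem .C (dif (fn i) * q)) hm
      rw [add_comm 1] at h
      exact Submodule.sub_mem _ (Submodule.sub_mem _ (X_mul_mem_degFil _ (ih q))
        (degFil_mono (by omega) (ih _))) h
    · have e : opC q (X (.C, i) * m) - hat .C q * (X (.C, i) * m) =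
          X (.C, i) * (opC q m - hat .C q * m) := by
        rw [opC_C_mul]; ring
      rw [e]
      exact X_mul_mem_degFil _ (ih q)
  · rw [map_add, mul_add, add_sub_add_comm]; exact Submodule.add_mem _ (h q) (h' q)
  · rw [map_smul, mul_smul_comm, ← smul_sub]; exact Submodule.smul_mem _ _ (h q)

theorem opC_mem {k : ℤ} {m : TodaModel} (hm : m ∈ fil k) (q : K) : opC q m ∈ fil (k + 1) := by
  have h := mul_mem_degFil (hat_mem .C q) hm
  rw [add_comm 1] at h
  rw [← sub_add_cancel (opC q m) (hat .C q * m)]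
  exact Submodule.add_mem _ (degFil_mono (by omega) (opC_sub_mem hm q)) h

theorem opB_mem {k : ℤ} {m : TodaModel} (hm : m ∈ fil k) (p : K) : opB p m ∈ fil (k + 1) := by
  obtain ⟨G, s, hs, rfl⟩ := K.exists_pol_add_sing p
  have h := mul_mem_degFil (hat_mem .B s) hm
  rw [add_comm 1] at h
  rw [map_add, LinearMap.add_apply, opB_pol, opB_sing hs]
  refine Submodule.add_mem _ (degFil_mono (by omega) (derivation_mem_degFil (fun v => ?_) hm)) h
  obtain ⟨x | x, i⟩ := v
  · rw [← hat_fn, derB_hat_B]; exact Submodule.zero_mem _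
  · rw [← hat_fn, derB_hat_C]; exact hat_mem _ _

theorem rep_mem {k : ℤ} {m : TodaModel} (hm : m ∈ fil k) (z : LieOf CToda) :
    rep z m ∈ fil (k + 1) := by
  rw [← genMode_coord z, map_add, rep_B, rep_C]
  exact Submodule.add_mem _ (opB_mem hm _) (opC_mem hm _)

theorem toModel_mem {k : ℤ} {w : VToda} (hw : w ∈ VacMod.filtration CToda k) :
    toModel w ∈ fil k := by
  refine VacMod.filtration_induction (p := fun k w => toModel w ∈ fil k) (fun k => ?_) ?_
    (fun k f F w hw ih => ?_) (fun k l w h ih => degFil_mono h ih) (fun k w w' h h' => ?_)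
    (fun k c w h => ?_) hw
  · rw [map_zero]; exact Submodule.zero_mem _
  · rw [toModel_v0]; exact one_mem_degFil
  · rw [toModel_act]; exact rep_mem ih _
  · rw [map_add]; exact Submodule.add_mem _ h h'
  · rw [map_smul]; exact Submodule.smul_mem _ _ h

theorem rep_fn_sub_mem (x : TodaGen) (i : ℤ × ℕ) {k : ℤ} {m : TodaModel} (hm : m ∈ fil k) :
    X (x, i) * m - rep (genMode x (fn i)) m ∈ fil k := by
  cases x
  · have h : fn i ∈ K.sing := K.u_mem _ _
    rw [rep_B, opB_sing h, hat_fn, sub_self]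
    exact Submodule.zero_mem _
  · rw [rep_C, ← neg_sub, ← hat_fn]
    exact Submodule.neg_mem _ (opC_sub_mem hm _)

theorem modelEquiv_mem {k : ℤ} {m : TodaModel} (hm : m ∈ fil k) :
    modelEquiv m ∈ VacMod.filtration CToda k := by
  -- Multiplication by a variable differs from the action of its mode by an element of degree k,
  -- which need not be a simpler product. An outer induction on a bound for the degree handles this
  -- term.
  have key : ∀ (n : ℕ) (k : ℤ), k < n → ∀ m ∈ fil k,
      modelEquiv m ∈ VacMod.filtration CToda k := by
    intro n
    induction n with
    | zero =>
      intro k hk m hm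
      rw [fil, degFil_eq_bot (by exact_mod_cast hk), Submodule.mem_bot] at hm
      rw [hm, map_zero]; exact Submodule.zero_mem _
    | succ n IH =>
      intro k hk m hm
      refine degFil_induction (p := fun k m => k < (n + 1 : ℕ) →
        modelEquiv m ∈ VacMod.filtration CToda k) (fun k _ => ?_) (fun _ => ?_)
        (fun k v m hm ih hk => ?_) ?_ (fun k f f' h h' hk => ?_) (fun k c f h hk => ?_) hm hk
      · rw [map_zero]; exact Submodule.zero_mem _
      · rw [modelEquiv_one]; exact VacMod.v0_mem_filtration
      · obtain ⟨x, i⟩ := v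
        push_cast at hk
        rw [← sub_add_cancel (X (x, i) * m) (rep (genMode x (fn i)) m), map_add, modelEquiv_rep]
        exact Submodule.add_mem _ (VacMod.filtration_mem_of_le (by omega)
          (IH k (by omega) _ (rep_fn_sub_mem x i hm)))
          (VacMod.act_mem_filtration _ (ih (by push_cast; omega)))
      · exact fun k l f h ih hl => VacMod.filtration_mem_of_le h (ih (by omega))
      · rw [map_add]; exact Submodule.add_mem _ (h hk) (h' hk)
      · rw [map_smul]; exact Submodule.smul_mem _ _ (h hk)
  exact key (k + 1).toNat k (by omega) m hm

end TodaModel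

end HTVertex
end

/-! ### The quantization map. -/

noncomputable section
namespace HTVertex
open KP

section
variable {V : Type*} [AddCommGroup V] [Module ℂ V]

/-- The distribution `v / (τ - n)`. -/
def simplePole (n : ℤ) (v : V) : K →ₗ[ℂ] V :=
  LinearMap.toSpanSingleton ℂ V v ∘ₗ K.trₗ ∘ₗ LinearMap.mulLeft ℂ (K.u n 0)

theorem simplePole_pol (n : ℤ) (v : V) (G : Polynomial ℂ) :
    simplePole n v (pol G) = G.eval (n : ℂ) • v := by
  obtain ⟨G', h⟩ := K.u_zero_mul_pol n G
  change K.trₗ (K.u n 0 * pol G) • v = _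
  rw [h, map_add, map_smul, K.trₗ_apply, K.trₗ_apply, K.tr_u, K.tr_pol, if_pos rfl, add_zero,
    smul_eq_mul, mul_one]

theorem isRat_simplePole (n : ℤ) (v : V) : IsRat (simplePole n v) :=
  ⟨⟨_, X_sub_C_mem_poleSet n⟩, fun G => by rw [simplePole_pol]; simp⟩

theorem conv_simplePole (a : K →ₗ[ℂ] Module.End ℂ V) (n : ℤ) (v : V) (q : K) :
    conv a (simplePole n v) q = a (K.shift (-n) q) v := by
  have h := conv_sub_mem (isRat_simplePole n v) (a := a) (S := ⊥) n
    (fun k G => by rw [simplePole_pol]; simp) q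
  rw [Submodule.mem_bot, sub_eq_zero] at h
  rw [h, ← map_one pol, simplePole_pol, Polynomial.eval_one, one_smul]

theorem IsRat.sub {ξ η : K →ₗ[ℂ] V} (h : IsRat ξ) (h' : IsRat η) : IsRat (ξ - η) := by
  rw [sub_eq_add_neg, ← neg_one_smul ℂ η]
  exact h.add (h'.smul _)

/-- A distribution with simple poles modulo `S'` is expanded modulo `S`. -/
theorem conv_smodEq_sum {S S' : Submodule ℂ V} {ξ : K →ₗ[ℂ] V} (h : IsRat ξ)
    {a : K →ₗ[ℂ] Module.End ℂ V} (ha : ∀ k, ∀ v ∈ S', a k v ∈ S) (s : Finset ℤ) (η : ℤ → V)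
    (hξ : ∀ G, ξ (pol G) ≡ ∑ n ∈ s, G.eval (n : ℂ) • η n [SMOD S']) (q : K) :
    conv a ξ q ≡ ∑ n ∈ s, a (K.shift (-n) q) (η n) [SMOD S] := by
  induction s using Finset.induction_on generalizing ξ with
  | empty =>
    rw [Finset.sum_empty, SModEq.zero]
    refine conv_mem h (fun k G => ha k _ ?_) q
    have := hξ G
    rwa [Finset.sum_empty, SModEq.zero] at this
  | insert n s hn ih =>
    -- Subtract the simple pole at n from ξ. The contribution of that pole is known exactly by
    -- `conv_simplePole`.
    have h2 := ih (h.sub (isRat_simplePole n (η n))) (fun G => by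
      have := (hξ G).sub (SModEq.refl (simplePole n (η n) (pol G)))
      rwa [Finset.sum_insert hn, simplePole_pol, add_sub_cancel_left, ← simplePole_pol] at this)
    have h3 := h2.add (SModEq.refl (conv a (simplePole n (η n)) q))
    rwa [← conv_add (h.sub (isRat_simplePole n (η n))) (isRat_simplePole n (η n)),
      sub_add_cancel, conv_simplePole, add_comm, ← Finset.sum_insert
        (f := fun n => a (K.shift (-n) q) (η n)) hn] at h3

end

namespace PToda

open MvPolynomial

/-- The sum `∑ₙ G(n) a n`. -/
def evalSum {M : Type*} [AddCommGroup M] [Module ℂ M] (G : Polynomial ℂ) : (ℤ →₀ M) →ₗ[ℂ] M :=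
  Finsupp.lsum ℂ fun n => G.eval (n : ℂ) • LinearMap.id

theorem evalSum_apply {M : Type*} [AddCommGroup M] [Module ℂ M] (G : Polynomial ℂ) (a : ℤ →₀ M) :
    evalSum G a = a.sum fun n v => G.eval (n : ℂ) • v := rfl

theorem evalSum_eq_sum {M : Type*} [AddCommGroup M] [Module ℂ M] (G : Polynomial ℂ) {a : ℤ →₀ M}
    {s : Finset ℤ} (hs : a.support ⊆ s) : evalSum G a = ∑ n ∈ s, G.eval (n : ℂ) • a n :=
  Finsupp.sum_of_support_subset _ hs _ fun _ _ => smul_zero _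

theorem evalSum_eq_add (G : Polynomial ℂ) {a b c : ℤ →₀ PToda} (p q : ℤ → PToda)
    (h : ∀ n, c n = p n * a n + q n * b n) :
    evalSum G c = ∑ n ∈ a.support, p n * (G.eval (n : ℂ) • a n) +
      ∑ n ∈ b.support, G.eval (n : ℂ) • (q n * b n) := by
  classical
  have hs : c.support ⊆ a.support ∪ b.support := by
    intro n hn
    rw [Finset.mem_union, Finsupp.mem_support_iff, Finsupp.mem_support_iff]
    rw [Finsupp.mem_support_iff, h] at hn
    by_contra! h
    exact hn (by rw [h.1, h.2, mul_zero, mul_zero, add_zero])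
  have h1 : ∑ n ∈ a.support, p n * (G.eval (n : ℂ) • a n) =
      ∑ n ∈ a.support ∪ b.support, p n * (G.eval (n : ℂ) • a n) :=
    Finset.sum_subset Finset.subset_union_left fun n _ hn => by
      rw [Finsupp.notMem_support_iff.mp hn, smul_zero, mul_zero]
  have h2 : ∑ n ∈ b.support, G.eval (n : ℂ) • (q n * b n) =
      ∑ n ∈ a.support ∪ b.support, G.eval (n : ℂ) • (q n * b n) :=
    Finset.sum_subset Finset.subset_union_right fun n _ hn => by
      rw [Finsupp.notMem_support_iff.mp hn, mul_zero, smul_zero]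
  rw [h1, h2, evalSum_eq_sum G hs, ← Finset.sum_add_distrib]
  exact Finset.sum_congr rfl fun n _ => by rw [h, smul_add, mul_smul_comm]

theorem lin_mem (f : CToda) : lin f ∈ filtration 1 := by
  refine (Submodule.Quotient.mk_eq_zero _).mp ?_
  refine LinearMap.congr_fun (f := (filtration 1).mkQ ∘ₗ lin) (g := 0)
    (CToda.hom_ext fun x => (Submodule.Quotient.mk_eq_zero _).mpr ?_) f
  rw [lin_e]; exact X_mem_degFil x

theorem T_zpow_mem (n : ℤ) {k : ℤ} {f : PToda} (hf : f ∈ filtration k) :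
    (T ^ n) f ∈ filtration k := by
  have h : ((T ^ n : PToda ≃ₐ[ℂ] PToda) : PToda →ₐ[ℂ] PToda) =
      MvPolynomial.aeval fun x => X (x.1, x.2 + n) :=
    MvPolynomial.algHom_ext fun x => by
      rw [MvPolynomial.aeval_X]; exact T_zpow_X n x
  have h2 : (T ^ n) f = MvPolynomial.aeval (fun x => X (x.1, x.2 + n)) f := DFunLike.congr_fun h f
  rw [h2]
  exact aeval_mem_degFil (fun _ => X_mem_degFil _) hf

theorem bracket_X_mem (x : TodaGen × ℤ) (n : ℤ) {k : ℤ} {f : PToda} (hf : f ∈ filtration k) :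
    bracket (X x) f n ∈ filtration k := by
  refine degFil_induction (p := fun k f => bracket (X x) f n ∈ filtration k) (fun k => ?_) ?_
    (fun k v f hf ih => ?_) (fun k k' f h ih => degFil_mono (by omega) ih) (fun k f f' h h' => ?_)
    (fun k c f h => ?_) hf
  · rw [map_zero]; exact Submodule.zero_mem _
  · rw [bracket_one]; exact Submodule.zero_mem _
  · rw [bracket_mul, X_bracket_X]
    exact Submodule.add_mem _ (X_mul_mem_degFil v ih) (mul_mem_degFil hf (lin_mem _))
  · rw [map_add]; exact Submodule.add_mem _ h h'
  · rw [map_smul]; exact Submodule.smul_mem _ _ h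

theorem bracket_mem {k l : ℤ} {f g : PToda} (hf : f ∈ filtration k) (hg : g ∈ filtration l)
    (n : ℤ) : bracket f g n ∈ filtration (k + l - 1) := by
  refine degFil_induction (p := fun k f => bracket f g n ∈ filtration (k + l - 1)) (fun k => ?_) ?_
    (fun k v f hf ih => ?_) (fun k k' f h ih => degFil_mono (by omega) ih) (fun k f f' h h' => ?_)
    (fun k c f h => ?_) hf
  · rw [map_zero]; exact Submodule.zero_mem _
  · rw [one_bracket]; exact Submodule.zero_mem _
  · rw [mul_bracket, T_zpow_X, show k + 1 + l - 1 = k + l - 1 + 1 by ring]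
    refine Submodule.add_mem _ (X_mul_mem_degFil _ ih) ?_
    rw [sub_add_cancel]
    exact mul_mem_degFil (T_zpow_mem n hf) (bracket_X_mem v n hg)
  · rw [map_add]; exact Submodule.add_mem _ h h'
  · rw [map_smul]; exact Submodule.smul_mem _ _ h

theorem evalSum_bracket_mem {k l : ℤ} {f g : PToda} (hf : f ∈ filtration k)
    (hg : g ∈ filtration l) (G : Polynomial ℂ) :
    evalSum G (bracket f g) ∈ filtration (k + l - 1) := by
  rw [evalSum_apply]
  exact Submodule.sum_mem _ fun n _ => Submodule.smul_mem _ _ (bracket_mem hf hg n)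

end PToda

namespace Toda

open MvPolynomial CToda TodaModel PToda

local notation "FV" => VacMod.filtration CToda

/-- The quantization map. -/
def quantize : PToda →ₗ[ℂ] VToda :=
  modelEquiv.toLinearMap ∘ₗ (MvPolynomial.aeval fun x : TodaGen × ℤ =>
    (X (x.1, x.2, 0) : TodaModel)).toLinearMap

theorem quantize_apply (f : PToda) : quantize f =
    modelEquiv (MvPolynomial.aeval (fun x : TodaGen × ℤ => (X (x.1, x.2, 0) : TodaModel)) f) := rfl

theorem quantize_one : quantize 1 = v0 CToda := by
  rw [quantize_apply, map_one, modelEquiv_one]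

theorem quantize_mem {k : ℤ} {f : PToda} (hf : f ∈ PToda.filtration k) : quantize f ∈ FV k :=
  modelEquiv_mem (aeval_mem_degFil (fun _ => X_mem_degFil _) hf)

/-- Forgetting the order of the pole in the variables of the model is a left inverse of the
substitution and does not raise the degree. -/
theorem quantize_injective_gr {k : ℤ} {f : PToda} (hf : quantize f ∈ FV k) :
    f ∈ PToda.filtration k := by
  have h := toModel_mem hf
  rw [quantize_apply, toModel_modelEquiv] at h
  let r : TodaModel →ₐ[ℂ] PToda := MvPolynomial.aeval fun v => X (v.1, v.2.1)
  have e : r.comp (MvPolynomial.aeval fun x : TodaGen × ℤ => (X (x.1, x.2, 0) : TodaModel)) =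
      AlgHom.id ℂ PToda := MvPolynomial.algHom_ext fun x => by
    rw [AlgHom.comp_apply, MvPolynomial.aeval_X]; exact MvPolynomial.aeval_X _ _
  have e2 : r _ = f := DFunLike.congr_fun e f
  rw [← e2]
  exact aeval_mem_degFil (fun _ => X_mem_degFil _) h

/-- The leading term of a product with a variable. -/
theorem quantize_X_mul (x : TodaGen × ℤ) {k : ℤ} {f : PToda} (hf : f ∈ PToda.filtration k) :
    quantize (X x * f) ≡ act (mode (e x) (K.u 0 0)) (quantize f) [SMOD FV k] := by
  rw [SModEq.sub_mem, quantize_apply, quantize_apply, map_mul (MvPolynomial.aeval _),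
    MvPolynomial.aeval_X, ← genMode_u, ← modelEquiv_rep, ← map_sub]
  exact modelEquiv_mem (rep_fn_sub_mem x.1 (x.2, 0)
    (aeval_mem_degFil (fun _ => X_mem_degFil _) hf))

theorem quantize_X (x : TodaGen × ℤ) :
    quantize (X x) = act (mode (e x) (K.u 0 0)) (v0 CToda) := by
  rw [quantize_apply, MvPolynomial.aeval_X, ← genMode_u, ← modelEquiv_one, ← modelEquiv_rep]
  congr 1
  obtain ⟨x | x, n⟩ := x
  · rw [rep_B, opB_sing (K.u_mem _ _), hat_u, mul_one]
  · rw [rep_C, opC_one, hat_u]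

theorem quantize_lin_mul (a : CToda) {k : ℤ} {f : PToda} (hf : f ∈ PToda.filtration k) :
    quantize (lin a * f) ≡ act (mode a (K.u 0 0)) (quantize f) [SMOD FV k] := by
  refine LinearMap.congr_fun (f := (FV k).mkQ ∘ₗ quantize ∘ₗ LinearMap.mulRight ℂ f ∘ₗ lin)
    (g := (FV k).mkQ ∘ₗ LinearMap.applyₗ (quantize f) ∘ₗ actₗ ∘ₗ mode.flip (K.u 0 0))
    (CToda.hom_ext fun x => ?_) a
  change (FV k).mkQ (quantize (lin (e x) * f)) =
    (FV k).mkQ (act (mode (e x) (K.u 0 0)) (quantize f))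
  rw [lin_e]
  exact quantize_X_mul x hf

theorem smodEq_of_le {k l : ℤ} (h : k ≤ l) {a b : VToda} (hab : a ≡ b [SMOD FV k]) :
    a ≡ b [SMOD FV l] := hab.mono (VacMod.filtration_mono h)

theorem act_smodEq {k : ℤ} {a b : VToda} (h : a ≡ b [SMOD FV k]) (z : LieOf CToda) :
    act z a ≡ act z b [SMOD FV (k + 1)] := by
  rw [SModEq.sub_mem] at h ⊢
  rw [← act_sub_right]
  exact VacMod.act_mem_filtration z h

theorem act_ann_smodEq {k : ℤ} {a b : VToda} (h : a ≡ b [SMOD FV k]) {z : LieOf CToda}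
    (hz : z ∈ ann CToda) : act z a ≡ act z b [SMOD FV k] := by
  rw [SModEq.sub_mem] at h ⊢
  rw [← act_sub_right]
  exact VacMod.act_ann_mem_filtration hz h

theorem vop_smodEq_left {k l : ℤ} {a b c : VToda} (h : a ≡ b [SMOD FV k]) (hc : c ∈ FV l) (F : K) :
    vop CToda a F c ≡ vop CToda b F c [SMOD FV (k + l)] := by
  rw [SModEq.sub_mem] at h ⊢
  rw [← LinearMap.sub_apply, ← LinearMap.sub_apply, ← map_sub]
  exact VacMod.vop_mem_filtration h hc F

/-- Multiplication by a variable and the normally ordered product with a mode both become the action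
of that mode modulo lower order, so a variable can be peeled off f. -/
theorem quantize_mul {k l : ℤ} {f g : PToda} (hf : f ∈ PToda.filtration k)
    (hg : g ∈ PToda.filtration l) :
    quantize (f * g) ≡ vop CToda (quantize f) (K.u 0 0) (quantize g) [SMOD FV (k + l - 1)] := by
  refine degFil_induction (p := fun k f => quantize (f * g) ≡
    vop CToda (quantize f) (K.u 0 0) (quantize g) [SMOD FV (k + l - 1)]) (fun k => ?_) ?_
    (fun k x f hf ih => ?_) (fun k k' f h ih => smodEq_of_le (by omega) ih) (fun k f f' h h' => ?_)
    (fun k c f h => ?_) hf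
  · simp
  · rw [one_mul, quantize_one, vop_v0, K.tr_u, if_pos rfl, one_smul]
  · rw [mul_assoc]
    have hq := quantize_mem hf
    have hg' := quantize_mem hg
    have h1 := smodEq_of_le (l := k + 1 + l - 1) (by omega) (quantize_X_mul x (mul_mem_degFil hf hg))
    have h2 := smodEq_of_le (l := k + 1 + l - 1) (by omega) (act_smodEq ih (mode (e x) (K.u 0 0)))
    have h3 := smodEq_of_le (l := k + 1 + l - 1) (by omega)
      (SModEq.sub_mem.mpr (VacMod.vop_act_u_zero_sub_mem (e x) (K.u 0 0) hq hg'))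
    have h4 := smodEq_of_le (l := k + 1 + l - 1) (by omega)
      (vop_smodEq_left (quantize_X_mul x hf) hg' (K.u 0 0))
    exact h1.trans (h2.trans (h3.symm.trans h4.symm))
  · rw [add_mul, map_add, map_add, map_add, LinearMap.add_apply]; exact h.add h'
  · rw [smul_mul_assoc, map_smul, map_smul, map_smul, LinearMap.smul_apply, LinearMap.smul_apply]
    exact h.smul c

theorem tPow_smodEq (n : ℤ) {k : ℤ} {a b : VToda} (h : a ≡ b [SMOD FV k]) :
    tPow CToda n a ≡ tPow CToda n b [SMOD FV k] := by
  have := vop_smodEq_left h VacMod.v0_mem_filtration (K.u n 0)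
  rwa [add_zero] at this

theorem mode_e_shift (x : TodaGen × ℤ) (n : ℤ) :
    mode (e x) (K.u n 0) = mode (e (x.1, x.2 + n)) (K.u 0 0) := by
  rw [← genMode_u, mode_e, K.shift_u, sub_neg_eq_add, add_comm]

theorem quantize_T {k : ℤ} {f : PToda} (hf : f ∈ PToda.filtration k) (n : ℤ) :
    quantize ((PToda.T ^ n) f) ≡ tPow CToda n (quantize f) [SMOD FV (k - 1)] := by
  refine degFil_induction (p := fun k f => quantize ((PToda.T ^ n) f) ≡
    tPow CToda n (quantize f) [SMOD FV (k - 1)]) (fun k => ?_) ?_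
    (fun k x f hf ih => ?_) (fun k k' f h ih => smodEq_of_le (by omega) ih) (fun k f f' h h' => ?_)
    (fun k c f h => ?_) hf
  · simp
  · rw [map_one (PToda.T ^ n), quantize_one, tPow_v0]
  · rw [T_zpow_mul, T_zpow_X, add_sub_cancel_right]
    have h1 := quantize_X_mul (x.1, x.2 + n) (T_zpow_mem n hf)
    have h2 := smodEq_of_le (l := k) (by omega) (act_smodEq ih (mode (e (x.1, x.2 + n)) (K.u 0 0)))
    have h3 := tPow_smodEq n (quantize_X_mul x hf)
    rw [tPow_act, K.shift_u, zero_sub, neg_neg, mode_e_shift] at h3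
    exact h1.trans (h2.trans h3.symm)
  · simp only [map_add]; exact h.add h'
  · simp only [map_smul]; exact h.smul c

theorem shift_pol_mul_u (n : ℤ) (G : Polynomial ℂ) :
    ∃ G', K.shift n (pol G) * K.u 0 0 = G.eval (n : ℂ) • K.u 0 0 + pol G' := by
  obtain ⟨G₁, h⟩ := K.u_zero_mul_pol n G
  obtain ⟨G', h'⟩ := K.shift_pol n G₁
  refine ⟨G', ?_⟩
  have := congrArg (K.shift n) h
  rw [map_mul, K.shift_u, sub_self, map_add, map_smul, K.shift_u, sub_self, ← h'] at this
  rw [mul_comm, this]; rfl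

/-- The function G(τ+n)/τ is G(n)/τ plus a polynomial, and the polynomial part gives a mode in the
annihilation subalgebra. -/
theorem lie_mode_pol (x y : TodaGen × ℤ) (G : Polynomial ℂ) :
    ⁅mode (e x) (pol G), mode (e y) (K.u 0 0)⁆ -
      mode (evalSum G (CToda.prod (e x) (e y))) (K.u 0 0) ∈ ann CToda := by
  have hl : ⁅mode (e x) (pol G), mode (e y) (K.u 0 0)⁆ =
      ∑ n ∈ (CToda.prod (e x) (e y)).support,
        mode (CToda.prod (e x) (e y) n) (K.shift n (pol G) * K.u 0 0) := lie_mode_sum ..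
  rw [hl, evalSum_apply, Finsupp.sum, map_sum, LinearMap.sum_apply, ← Finset.sum_sub_distrib]
  refine Submodule.sum_mem (ann CToda).toSubmodule fun n _ => ?_
  obtain ⟨G', h⟩ := shift_pol_mul_u n G
  rw [h, map_add, map_smul, map_smul, LinearMap.smul_apply]
  have e1 (a b : LieOf CToda) : a + b - a = b := add_sub_cancel_left a b
  refine (e1 _ _).symm.subst (motive := (· ∈ ann CToda)) (mode_mem_ann _ G')

theorem lin_evalSum (a : ℤ →₀ CToda) (b : ℤ →₀ PToda) (h : ∀ n, b n = lin (a n)) (G : Polynomial ℂ) :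
    lin (evalSum G a) = evalSum G b := by
  rw [evalSum_eq_sum G subset_rfl, evalSum_eq_sum G (s := a.support), map_sum]
  · exact Finset.sum_congr rfl fun n _ => by rw [map_smul, h]
  · intro n hn
    rw [Finsupp.mem_support_iff, h] at hn
    rw [Finsupp.mem_support_iff]
    exact fun h0 => hn (by rw [h0, map_zero])

/-- The leading term of the singular part of the field of a variable. -/
theorem act_mode_pol_quantize (x : TodaGen × ℤ) (G : Polynomial ℂ) {l : ℤ} {g : PToda}
    (hg : g ∈ PToda.filtration l) : act (mode (e x) (pol G)) (quantize g) ≡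
      quantize (evalSum G (PToda.bracket (X x) g)) [SMOD FV (l - 1)] := by
  refine degFil_induction (p := fun l g => act (mode (e x) (pol G)) (quantize g) ≡
      quantize (evalSum G (PToda.bracket (X x) g)) [SMOD FV (l - 1)]) (fun k => ?_) ?_
    (fun k y g hg ih => ?_) (fun k k' f h ih => smodEq_of_le (by omega) ih) (fun k f f' h h' => ?_)
    (fun k c f h => ?_) hg
  · simp [act_zero_right]
  · rw [quantize_one, act_pol_v0, bracket_one, map_zero, map_zero]
  · rw [add_sub_cancel_right]
    set z := evalSum G (CToda.prod (e x) (e y)) with hz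
    have e1 : evalSum G (PToda.bracket (X x) (X y * g)) =
        X y * evalSum G (PToda.bracket (X x) g) + lin z * g := by
      rw [hz, lin_evalSum _ (PToda.bracket (X x) (X y)) (X_bracket_X x y),
        evalSum_eq_add G (fun _ => X y) (fun _ => g) (bracket_mul (X x) (X y) g),
        evalSum_eq_sum G subset_rfl, evalSum_eq_sum G subset_rfl, Finset.mul_sum, Finset.sum_mul]
      congr 1
      exact Finset.sum_congr rfl fun n _ => by rw [smul_mul_assoc, mul_comm]
    have h1 := act_ann_smodEq (quantize_X_mul y hg) (mode_mem_ann (e x) G)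
    have h2 := act_smodEq ih (mode (e y) (K.u 0 0))
    have hm := evalSum_bracket_mem (X_mem_degFil x) hg G
    rw [add_sub_cancel_left] at hm
    have h3 := quantize_X_mul y hm
    rw [sub_add_cancel] at h2
    have h4 : act ⁅mode (e x) (pol G), mode (e y) (K.u 0 0)⁆ (quantize g) ≡
        act (mode z (K.u 0 0)) (quantize g) [SMOD FV k] := by
      rw [SModEq.sub_mem, ← actₗ_apply, ← actₗ_apply, ← LinearMap.sub_apply, ← map_sub]
      exact VacMod.act_ann_mem_filtration (lie_mode_pol x y G) (quantize_mem hg)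
    rw [e1, map_add]
    refine h1.trans ?_
    -- The two terms of this exchange match the two terms of the Leibniz rule for the action of the
    -- variable on a product.
    have e2 : act (mode (e x) (pol G)) (act (mode (e y) (K.u 0 0)) (quantize g)) =
        act (mode (e y) (K.u 0 0)) (act (mode (e x) (pol G)) (quantize g)) +
        act ⁅mode (e x) (pol G), mode (e y) (K.u 0 0)⁆ (quantize g) := by
      rw [act_lie]; abel
    rw [e2]
    exact (h2.trans h3.symm).add (h4.trans (quantize_lin_mul z hg).symm)
  · simp only [map_add, act_add_right]; exact h.add h'
  · simp only [map_smul, act_smul_right]; exact h.smul c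

/-- Modulo lower order both halves of the product have simple poles. The left half has residues f_n
g and evaluates the variable x at Tⁿx; the right half has residues x_n g and evaluates f at Tⁿf. The
sum is the twisted Leibniz rule `mul_bracket`. -/
theorem quantize_bracket {k l : ℤ} {f g : PToda} (hf : f ∈ PToda.filtration k)
    (hg : g ∈ PToda.filtration l) (G : Polynomial ℂ) :
    vop CToda (quantize f) (pol G) (quantize g) ≡ quantize (evalSum G (PToda.bracket f g))
      [SMOD FV (k + l - 2)] := by
  refine degFil_induction (p := fun k f => ∀ G, vop CToda (quantize f) (pol G) (quantize g) ≡
    quantize (evalSum G (PToda.bracket f g)) [SMOD FV (k + l - 2)]) (fun k G => ?_) (fun G => ?_)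
    (fun k x f hf ih G => ?_) (fun k k' f h ih G => smodEq_of_le (by omega) (ih G))
    (fun k f f' h h' G => ?_) (fun k c f h G => ?_) hf G
  · simp
  · rw [quantize_one, vop_v0, K.tr_pol, zero_smul, one_bracket, map_zero, map_zero]
  · have hq := quantize_mem hf
    have hg' := quantize_mem hg
    have lvl : k + 1 + l - 2 = k + l - 1 := by ring
    rw [lvl]
    have h0 : vop CToda (quantize (X x * f)) (pol G) (quantize g) ≡
        vop CToda (act (mode (e x) (K.u 0 0)) (quantize f)) (pol G) (quantize g)
        [SMOD FV (k + l - 1)] := by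
      have := quantize_X_mul x hf
      rw [SModEq.sub_mem] at this ⊢
      rw [← LinearMap.sub_apply, ← LinearMap.sub_apply, ← map_sub]
      exact VacMod.vop_pol_mem_filtration this hg' G
    refine h0.trans ?_
    rw [vop_act]
    have h1 := conv_smodEq_sum (S := FV (k + l - 1)) (S' := FV (k + l - 2))
      ((isRat_vop (quantize f) (quantize g)).tw (pol G)) (a := (gen (e x)).1)
      (fun k' v hv => VacMod.filtration_mem_of_le (by omega) (VacMod.act_mem_filtration _ hv))
      (PToda.bracket f g).support (fun n => quantize (G.eval (n : ℂ) • PToda.bracket f g n)) (fun G' => by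
        have := ih (G * G')
        rw [map_mul, evalSum_eq_sum _ subset_rfl, map_sum] at this
        refine this.trans (Eq.subst (motive := fun t => _ ≡ t [SMOD FV (k + l - 2)])
          (Finset.sum_congr rfl fun n _ => ?_) SModEq.rfl)
        rw [Polynomial.eval_mul, mul_comm, mul_smul, map_smul]) (K.u 0 0)
    have h2 := conv_smodEq_sum (S := FV (k + l - 1)) (S' := FV (l - 1))
      ((gen (e x)).isRat (quantize g)) (a := tw (pol G) (vop CToda (quantize f)))
      (fun k' v hv => VacMod.filtration_mem_of_le (by omega) (VacMod.vop_mem_filtration hq hv _))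
      (PToda.bracket (X x) g).support (fun n => quantize (PToda.bracket (X x) g n)) (fun G' => by
        have := act_mode_pol_quantize x G' hg
        rw [evalSum_eq_sum _ subset_rfl, map_sum] at this
        rw [Fields.app_apply, gen_apply]
        simpa only [map_smul] using this) (K.antipode (K.u 0 0))
    have e1 : evalSum G (PToda.bracket (X x * f) g) =
        ∑ n ∈ (PToda.bracket f g).support, X (x.1, x.2 + n) * (G.eval (n : ℂ) • PToda.bracket f g n) +
        ∑ n ∈ (PToda.bracket (X x) g).support, G.eval (n : ℂ) •
          ((PToda.T ^ n) f * PToda.bracket (X x) g n) := by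
      refine evalSum_eq_add G _ _ fun n => ?_
      rw [mul_bracket, T_zpow_X]
    rw [e1, map_add, map_sum, map_sum]
    have h5 := h1.trans (SModEq.sum (y := fun n : ℤ =>
      quantize (X (x.1, x.2 + n) * (G.eval (n : ℂ) • PToda.bracket f g n))) fun n _ => ?_)
    have h6 := h2.trans (SModEq.sum (y := fun n : ℤ =>
      -quantize (G.eval (n : ℂ) • ((PToda.T ^ n) f * PToda.bracket (X x) g n))) fun n _ => ?_)
    · have h7 := h5.sub h6
      rwa [Finset.sum_neg_distrib, sub_neg_eq_add] at h7
    · have hb : PToda.bracket (X x) g n ∈ PToda.filtration l := bracket_X_mem x n hg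
      have hb' := quantize_mem hb
      obtain ⟨G', hG'⟩ := K.u_zero_mul_pol n G
      -- Only the pole G(n)/(τ−n) matters: the polynomial remainder gives a polynomial mode, which
      -- is of lower order. The sign of the antipode of 1/τ compensates the sign of the right half.
      have e2 : pol G * K.shift (-n) (K.antipode (K.u 0 0)) =
          -(G.eval (n : ℂ) • K.u n 0 + pol G') := by
        rw [← hG', K.antipode_u, neg_zero, zero_add, pow_one, neg_one_mul, map_neg, K.shift_u,
          zero_sub, neg_neg, mul_neg, mul_comm]
      have e3 : vop CToda (quantize f) (K.u n 0) = vop CToda (tPow CToda n (quantize f)) (K.u 0 0) := by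
        rw [vop_tPow, K.shift_u, zero_sub, neg_neg]
      rw [tw_apply, e2, map_neg, LinearMap.neg_apply, map_add, map_smul, LinearMap.add_apply,
        LinearMap.smul_apply, e3, map_smul, ← add_zero (G.eval (n : ℂ) • quantize _)]
      refine (SModEq.add (SModEq.smul ?_ _)
        (SModEq.zero.mpr (VacMod.vop_pol_mem_filtration hq hb' G'))).neg
      have h3 := smodEq_of_le (l := k + l - 1) (by omega)
        (vop_smodEq_left (quantize_T hf n) hb' (K.u 0 0))
      exact h3.symm.trans (quantize_mul (T_zpow_mem n hf) hb).symm
    · rw [K.shift_u, zero_sub, neg_neg, gen_apply, mode_e_shift]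
      exact (smodEq_of_le (by omega) (quantize_X_mul _
        (Submodule.smul_mem _ _ (bracket_mem hf hg n)))).symm
  · simp only [map_add, LinearMap.add_apply]; exact (h G).add (h' G)
  · simp only [map_smul, LinearMap.smul_apply]; exact (h G).smul c

theorem isQuantizationMap : IsQuantizationMap PToda.T PToda.bracket PToda.filtration (v0 CToda)
    (vop CToda) (VacMod.filtration CToda) quantize where
  mem k f hf := quantize_mem hf
  inj k f hf h := quantize_injective_gr h
  one := quantize_one
  mul k l f g hf hg := by
    have h := quantize_mul hf hg
    rwa [SModEq.sub_mem] at h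
  shift k f hf n := by
    have h := quantize_T hf n
    rwa [SModEq.sub_mem, ← hAct_vop] at h
  poisson k l f g hf hg G := by
    have h := quantize_bracket hf hg G
    rwa [SModEq.sub_mem, evalSum_apply] at h

theorem quantize_X_eq (x : TodaGen) (n : ℤ) :
    quantize (X (x, n)) = act (mode (e (x, 0)) (K.u n 0)) (v0 CToda) := by
  rw [quantize_X, ← genMode_u]; rfl

/-! ### Noncommutativity. -/

theorem toModel_genMode (x : TodaGen) (n : ℤ) (j : ℕ) :
    toModel (act (genMode x (K.u n j)) (v0 CToda)) = X (x, n, j) := by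
  rw [toModel_act, toModel_v0]
  cases x
  · rw [rep_B, opB_sing (K.u_mem _ _), hat_u, mul_one]
  · rw [rep_C, opC_one, hat_u]

/-- The products by the mode at `1` do not commute. -/
theorem exists_vop_one_ne : ∃ f g : VToda, vop CToda f 1 g ≠ vop CToda g 1 f := by
  -- For the states C and B: the mode of B at 1 kills C because `dif 1 = 0`, whereas the mode of C
  -- at 1 maps B to C − TC.
  refine ⟨act (genMode .C (K.u 0 0)) (v0 CToda), act (genMode .B (K.u 0 0)) (v0 CToda), fun h => ?_⟩
  have h := congrArg toModel h
  rw [genMode, genMode, vop_gen, vop_gen, ← genMode, ← genMode, toModel_act (genMode .C 1), toModel_genMode,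
    toModel_act (genMode .B 1), toModel_genMode, rep_B, rep_C, ← mul_one (X (TodaGen.B, 0, 0)), opC_B_mul,
    opC_one, mul_one, opC_one, ← map_one pol, hat_pol, opB_pol, ← hat_u .C, derB_hat_C, fn, dif_apply,
    dif_apply, map_one, map_one, sub_self, zero_mul, map_zero, mul_zero, zero_sub, K.shift_u,
    map_sub, hat_u, hat_u, neg_eq_zero, sub_eq_zero] at h
  simpa using MvPolynomial.X_injective h

/-- The normally ordered product is not commutative. -/
theorem exists_vop_u_zero_ne :
    ∃ f g : VToda, vop CToda f (K.u 0 0) g ≠ vop CToda g (K.u 0 0) f := by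
  refine ⟨act (genMode .C (K.u 0 0)) (v0 CToda), act (genMode .B (K.u 0 0)) (v0 CToda), fun h => ?_⟩
  have h := congrArg toModel h
  -- The commutator of the modes of B and C at 1/τ is the mode of C at this function. Its double
  -- pole at 0 is detected below by the coefficient of the variable `(.C, 0, 1)`.
  have hu : dif (K.u 0 0) * K.u 0 0 = K.u 1 0 - K.u 0 0 - K.u 0 1 := by
    have h0 := K.u_spec 0 0
    have h1 := K.u_spec 1 0
    have h2 := K.u_mul_same 0 0 0
    rw [dif_apply, K.shift_u]
    push_cast at h0 h1
    norm_num at h0 h1 h2 ⊢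
    linear_combination K.u 1 0 * h0 - K.u 0 0 * h1 - h2
  rw [genMode, genMode, vop_gen, vop_gen, ← genMode, ← genMode, toModel_act (genMode .C (K.u 0 0)),
    toModel_genMode, toModel_act (genMode .B (K.u 0 0)), toModel_genMode, rep_B, rep_C, ← mul_one (X (TodaGen.B, 0, 0)), opC_B_mul,
    opC_one, opC_one, fn, hu, opB_sing (K.u_mem _ _), map_sub, map_sub, hat_u, hat_u, hat_u,
    hat_u, sub_eq_self] at h
  have := congrArg (MvPolynomial.aeval fun v : TodaGen × ℤ × ℕ =>
    if v = (.C, 0, 1) then (1 : ℂ) else 0) h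
  simp at this

end Toda

end HTVertex
end

theorem mainTheorem3 :
    IsCompl (cr CToda).toSubmodule (ann CToda).toSubmodule ∧
    Function.Bijective (crMap CToda) ∧
    IsHTVertexPoisson PToda.T PToda.bracket ∧
    ∃ Y : VToda →ₗ[ℂ] K →ₗ[ℂ] Module.End ℂ VToda,
      IsHTVertexAlgebra (v0 CToda) Y ∧
      (∀ (f : CToda) (F : K) (w : VToda),
        Y (act (mode f (K.u 0 0)) (v0 CToda)) F w = act (mode f F) w) ∧
      (∀ (n : ℤ) (f : CToda) (p : K) (w : VToda),
        hAct (v0 CToda) Y n (act (mode f p) w) =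
          act (mode f (K.shift (-n) p)) (hAct (v0 CToda) Y n w)) ∧
      IsFilteredVertexAlgebra (v0 CToda) Y (VacMod.filtration CToda) ∧
      (∃ Q : PToda →ₗ[ℂ] VToda,
        IsQuantizationMap PToda.T PToda.bracket PToda.filtration (v0 CToda) Y
          (VacMod.filtration CToda) Q ∧
        ∀ (x : TodaGen) (n : ℤ), Q (MvPolynomial.X (x, n)) =
          act (mode (CToda.e (x, 0)) (K.u n 0)) (v0 CToda)) ∧
      (∃ f g : VToda, Y f 1 g ≠ Y g 1 f) ∧
      (∃ f g : VToda, Y f (K.u 0 0) g ≠ Y g (K.u 0 0) f) :=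
  ⟨CToda.isCompl_cr_ann, TodaModel.crMap_bijective, PToda.isHTVertexPoisson, vop CToda,
    isHTVertexAlgebra_vop, vop_gen, fun n f p w => by rw [hAct_vop, hAct_vop, tPow_act],
    VacMod.isFilteredVertexAlgebra, ⟨Toda.quantize, Toda.isQuantizationMap, Toda.quantize_X_eq⟩,
    Toda.exists_vop_one_ne, Toda.exists_vop_u_zero_ne⟩
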